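/- Let $k$ be a field of characteristic zero, $d\in\mathbb Z$, and let $V$ be a $d$-algebra over $k$: a complex of $k$-vector spaces with a dg commutative associative product and a bracket making $V[d-1]$ a dg Lie algebra, such that $\{ab,c\}=a\{b,c\}+(-1)^{|b|(|c|+d-1)}\{a,c\}b$. Dually, a $d$-coalgebra (with counit) has a dg cocommutative coassociative coproduct $\Delta$ and a cobracket $\delta$; it is *coproartinian* if it has an exhaustive increasing filtration $F^0\subset F^1\subset\dots$ by sub-$d$-coalgebras with $F^0=k\cdot 1$, $\epsilon(1)=1$, with $\delta=0$ on $F^1$ and $\Delta x=1\otimes x+x\otimes 1$ for $x\in F^1\cap\ker\epsilon$, and with $\Delta x-1\otimes x-x\otimes 1$ and $\delta x$ in $F^{i-1}\otimes F^{i-1}$ for $x\in F^i$, $i\ge 2$. Let $(V^\vee,p)$ be the cofree coproartinian $d$-coalgebra cogenerated by the graded space $V[d]$, $p:V^\vee\to V[d]$ the projection, with the quadratic differential $Q$ determined by the differential, the bracket and the product of $V$. Let $\mathrm{def}(V)$ be the dg Lie algebra of graded coderivations of $V^\vee$, with differential $[Q,-]$. Let $H=\underline{\mathrm{Hom}}^{Id}(V,V)$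 be the coproartinian $d$-coalgebra representing the functor which sends a coproartinian $d$-coalgebra $S$ to the set of morphisms of $d$-coalgebras $V^\vee\otimes S\to V^\vee$ whose restriction to $V^\vee\otimes 1$ is the identity; let $\mu:V^\vee\otimes H\to V^\vee$ be the universal morphism and let $m:H\otimes H\to H$ be the composition product, $\mu(v\otimes m(x\otimes y))=\mu(\mu(v\otimes x)\otimes y)$. Let $C(H)$ be the largest (cocommutative) subcoalgebra of $H$ contained in $\ker\delta$. Finally let $a'[d]$ be the graded space of graded linear maps $V^\vee\to V[d]$, with the differential $f\mapsto df+\{p,f\}$, where $\{\,,\}$ is the convolution bracket. Then: 1. $V^\vee$ and $H$ exist, $m$ exists and is unique, and $C(H)$, with the restrictions of the structure of $H$ and of $m$, is a cocommutative dg Hopf algebra. 2. There is a canonical isomorphism of dg Hopf algebras $\Phi:C(H)\to U(\mathrm{def}(V))$; it is given by $\mu(v\otimes\Phi^{-1}(D))=-(-1)^{|D||v|}D(v)$ for homogeneous $D\in\mathrm{def}(V)$ and $v\in V^\vee$. 3. $a'[d]$ is a complex, and there is an isomorphism of complexes $\theta:a'[d]\to\mathrm{def}(V)$ with $p\circ\theta(f)=-f$.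 4. There is an isomorphism of graded coalgebras $\kappa:S(a'[d])\to C(H)$, where $S(a'[d])$ is the graded symmetric (cofree cocommutative) coalgebra, given by cofreeness: $p\mu(v\otimes\kappa(f))=(-1)^{|f||v|}f(v)$ for $f\in a'[d]$, and $p\mu(v\otimes\kappa(f_1\cdots f_n))=0$ for $n\ge 2$. One has $\Phi\kappa(f)=\theta(f)$ for $f\in a'[d]$, and $\Phi\kappa(f_1\cdots f_n)-\theta(f_1)\cdots\theta(f_n)$ is a linear combination of products of fewer than $n$ elements of $\mathrm{def}(V)$ for all $n$; that is, $\Phi\kappa$ induces the Poincaré–Birkhoff–Witt isomorphism $S(\mathrm{def}(V))\cong\mathrm{gr}\,U(\mathrm{def}(V))$ up to the identification $\theta$. 5. There is also an isomorphism of dg coalgebras $\sigma:S(a'[d])\to C(H)$ whose composite with $\Phi$ is exactly the Poincaré–Birkhoff–Witt symmetrization isomorphism: for homogeneous $f_i$, $\Phi\sigma(f_1\cdots f_n)=\frac1{n!}\sum_{s\in S_n}\pm\,\theta(f_{s(1)})\cdots\theta(f_{s(n)})$ with the Koszul signs $\pm$. -/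

import Mathlib

open scoped TensorProduct DirectSum

universe u v w

noncomputable section

namespace DefHopf

/-- The sign `(-1)^n` in the ground field. -/
def ksign (k : Type u) [Field k] (n : ℤ) : k := ((n.negOnePow : ℤ) : k)

section signs
variable (k : Type u) [Field k]

theorem ksign_add (m n : ℤ) : ksign k (m + n) = ksign k m * ksign k n := by
  simp [ksign, Int.negOnePow_add]

theorem ksign_mul_self (m : ℤ) : ksign k m * ksign k m = 1 := by
  rw [← ksign_add, ksign, Int.negOnePow_even _ ⟨m, rfl⟩]; simp

@[simp] theorem ksign_zero : ksign k 0 = 1 := by simp [ksign]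

@[simp] theorem ksign_one : ksign k 1 = -1 := by simp [ksign]

end signs

/-- A `ℤ`-graded vector space with an endomorphism `diff` of degree one.
It is a complex when moreover `diff ∘ diff = 0`, see `IsComplex`. -/
structure DiffMod (k : Type u) [Field k] (V : Type v) [AddCommGroup V] [Module k V] where
  gr : ℤ → Submodule k V
  internal : DirectSum.IsInternal gr
  diff : V →ₗ[k] V
  diff_mem : ∀ {i : ℤ} {x : V}, x ∈ gr i → diff x ∈ gr (i + 1)

namespace DiffMod

section basics
variable {k : Type u} [Field k] {V : Type v} [AddCommGroup V] [Module k V]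
  {W : Type w} [AddCommGroup W] [Module k W]

def IsComplex (c : DiffMod k V) : Prop := ∀ x, c.diff (c.diff x) = 0

/-- The linear map out of a graded space given by its restrictions to the homogeneous parts. -/
def glue {M : Type*} [AddCommMonoid M] [Module k M] (c : DiffMod k V)
    (f : ∀ i, c.gr i →ₗ[k] M) : V →ₗ[k] M :=
  letI := c.internal.chooseDecomposition
  DirectSum.toModule k ℤ M f ∘ₗ (DirectSum.decomposeLinearEquiv c.gr).toLinearMap

theorem glue_apply {M : Type*} [AddCommMonoid M] [Module k M] (c : DiffMod k V)
    (f : ∀ i, c.gr i →ₗ[k] M) {i : ℤ} {x : V} (hx : x ∈ c.gr i) :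
    c.glue f x = f i ⟨x, hx⟩ := by
  let := c.internal.chooseDecomposition
  simp only [glue, LinearMap.comp_apply, LinearEquiv.coe_coe,
    DirectSum.decomposeLinearEquiv_apply]
  rw [DirectSum.decompose_of_mem _ hx, ← DirectSum.lof_eq_of k, DirectSum.toModule_lof]

theorem induction (c : DiffMod k V) {P : V → Prop} (x : V)
    (hom : ∀ i x, x ∈ c.gr i → P x) (add : ∀ x y, P x → P y → P (x + y)) : P x := by
  have hx : x ∈ iSup c.gr := by rw [c.internal.submodule_iSup_eq_top]; trivial
  induction hx using Submodule.iSup_induction' with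
  | mem i x hx => exact hom i x hx
  | zero => exact hom 0 0 (Submodule.zero_mem _)
  | add x y _ _ h1 h2 => exact add x y h1 h2

theorem hom_ext {M : Type*} [AddCommMonoid M] [Module k M] (c : DiffMod k V)
    {f g : V →ₗ[k] M}
    (h : ∀ i x, x ∈ c.gr i → f x = g x) : f = g := by
  ext x
  induction x using c.induction with
  | hom i x hx => exact h i x hx
  | add x y h1 h2 => rw [map_add, map_add, h1, h2]

/-- `x ↦ (-1)^(n|x|) x`. -/
def sgn (c : DiffMod k V) (n : ℤ) : V →ₗ[k] V :=
  c.glue fun i => ksign k (n * i) • (c.gr i).subtype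

theorem sgn_apply (c : DiffMod k V) (n : ℤ) {i : ℤ} {x : V} (hx : x ∈ c.gr i) :
    c.sgn n x = ksign k (n * i) • x := by
  rw [sgn, glue_apply c _ hx]; rfl

/-- The Koszul interchange `x ⊗ y ↦ (-1)^(|x||y|) y ⊗ x`. -/
def twist (c : DiffMod k V) (c' : DiffMod k W) : V ⊗[k] W →ₗ[k] W ⊗[k] V :=
  TensorProduct.lift (c.glue fun i =>
    LinearMap.lcomp k _ (c'.sgn i) ∘ₗ (TensorProduct.mk k W V).flip ∘ₗ (c.gr i).subtype)

theorem twist_apply (c : DiffMod k V) (c' : DiffMod k W) {i j : ℤ} {x : V} {y : W}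
    (hx : x ∈ c.gr i) (hy : y ∈ c'.gr j) :
    c.twist c' (x ⊗ₜ y) = ksign k (i * j) • (y ⊗ₜ[k] x) := by
  rw [twist, TensorProduct.lift.tmul, glue_apply c _ hx]
  simp [sgn_apply c' i hy, TensorProduct.smul_tmul']

/-- The interchange of the two middle factors, with the Koszul sign. -/
def mid (c : DiffMod k V) (c' : DiffMod k W) :
    (V ⊗[k] V) ⊗[k] (W ⊗[k] W) →ₗ[k] (V ⊗[k] W) ⊗[k] (V ⊗[k] W) :=
  (TensorProduct.assoc k V W (V ⊗[k] W)).symm.toLinearMap ∘ₗ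
  TensorProduct.map LinearMap.id
    ((TensorProduct.assoc k W V W).toLinearMap ∘ₗ
      TensorProduct.map (c.twist c') LinearMap.id ∘ₗ
      (TensorProduct.assoc k V W W).symm.toLinearMap) ∘ₗ
  (TensorProduct.assoc k V V (W ⊗[k] W)).toLinearMap

/-- Linear maps that are homogeneous of degree `n`. -/
def homDeg (c : DiffMod k V) (c' : DiffMod k W) (n : ℤ) : Submodule k (V →ₗ[k] W) where
  carrier := {f | ∀ i x, x ∈ c.gr i → f x ∈ c'.gr (i + n)}
  add_mem' hf hg i x hx := Submodule.add_mem _ (hf i x hx) (hg i x hx)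
  zero_mem' _ _ _ := Submodule.zero_mem _
  smul_mem' a _ hf i x hx := Submodule.smul_mem _ a (hf i x hx)

/-- Tensor product of two subspaces, as a subspace of the tensor product. -/
def _root_.DefHopf.tensorSub (S : Submodule k V) (T : Submodule k W) : Submodule k (V ⊗[k] W) :=
  LinearMap.range (TensorProduct.map S.subtype T.subtype)

theorem _root_.DefHopf.tmul_mem_tensorSub {S : Submodule k V} {T : Submodule k W} {x : V} {y : W}
    (hx : x ∈ S) (hy : y ∈ T) : x ⊗ₜ[k] y ∈ tensorSub S T :=
  ⟨(⟨x, hx⟩ : S) ⊗ₜ (⟨y, hy⟩ : T), by simp⟩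

/-- The total grading on a tensor product. -/
def tensorGr (c : DiffMod k V) (c' : DiffMod k W) (n : ℤ) : Submodule k (V ⊗[k] W) :=
  ⨆ i : ℤ, tensorSub (c.gr i) (c'.gr (n - i))

theorem tmul_mem_tensorGr (c : DiffMod k V) (c' : DiffMod k W) {i j n : ℤ} {x : V} {y : W}
    (hx : x ∈ c.gr i) (hy : y ∈ c'.gr j) (h : i + j = n) : x ⊗ₜ[k] y ∈ c.tensorGr c' n := by
  subst h
  refine Submodule.mem_iSup_of_mem i (tmul_mem_tensorSub hx ?_)
  simpa using hy

theorem tensorGr_induction (c : DiffMod k V) (c' : DiffMod k W) {n : ℤ}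
    {P : V ⊗[k] W → Prop} (z : V ⊗[k] W) (hz : z ∈ c.tensorGr c' n)
    (tmul : ∀ i j x y, x ∈ c.gr i → y ∈ c'.gr j → i + j = n → P (x ⊗ₜ y))
    (zero : P 0) (add : ∀ x y, P x → P y → P (x + y)) : P z := by
  induction hz using Submodule.iSup_induction' with
  | mem i z hz =>
    obtain ⟨t, rfl⟩ := hz
    induction t using TensorProduct.induction_on with
    | zero => simpa using zero
    | tmul x y => exact tmul i (n - i) x y x.2 y.2 (by ring)
    | add a b h1 h2 => rw [map_add]; exact add _ _ h1 h2
  | zero => exact zero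
  | add x y _ _ h1 h2 => exact add x y h1 h2

theorem lof_congr {M : Type w} [AddCommGroup M] [Module k M] (S : ℤ → Submodule k M)
    {i j : ℤ} (h : i = j) {x : M} (hi : x ∈ S i) (hj : x ∈ S j) :
    DirectSum.lof k ℤ (fun n => S n) i ⟨x, hi⟩ = DirectSum.lof k ℤ (fun n => S n) j ⟨x, hj⟩ := by
  subst h; rfl

theorem tensorGr_internal (c : DiffMod k V) (c' : DiffMod k W) :
    DirectSum.IsInternal (c.tensorGr c') := by
  let D : V ⊗[k] W →ₗ[k] ⨁ n, c.tensorGr c' n :=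
    TensorProduct.lift (c.glue fun i =>
      LinearMap.flip (c'.glue fun j => LinearMap.flip
        (LinearMap.mk₂ k (fun (x : c.gr i) (y : c'.gr j) =>
          DirectSum.lof k ℤ (fun n => c.tensorGr c' n) (i + j)
            ⟨(x : V) ⊗ₜ[k] (y : W), tmul_mem_tensorGr c c' x.2 y.2 rfl⟩)
          (fun x x' y => by
            rw [← map_add]; congr 1; ext; simp [TensorProduct.add_tmul])
          (fun a x y => by rw [← map_smul]; congr 1)
          (fun x y y' => by
            rw [← map_add]; congr 1; ext; simp [TensorProduct.tmul_add])
          (fun a x y => by rw [← map_smul]; congr 1; ext; simp))))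
  have hD : ∀ {i j : ℤ} {x : V} {y : W} (hx : x ∈ c.gr i) (hy : y ∈ c'.gr j),
      D (x ⊗ₜ y) = DirectSum.lof k ℤ (fun n => c.tensorGr c' n) (i + j)
            ⟨x ⊗ₜ[k] y, tmul_mem_tensorGr c c' hx hy rfl⟩ := by
    intro i j x y hx hy
    simp only [D, TensorProduct.lift.tmul]
    rw [glue_apply c _ hx, LinearMap.flip_apply, glue_apply c' _ hy]
    rfl
  refine @DirectSum.Decomposition.isInternal _ _ _ _ _ _ _ _
    (DirectSum.Decomposition.ofLinearMap (c.tensorGr c') D ?_ ?_)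
  · apply TensorProduct.ext
    apply c.hom_ext
    intro i x hx
    apply c'.hom_ext
    intro j y hy
    simp [hD hx hy]
  · ext n ⟨z, hz⟩ : 2
    simp only [LinearMap.comp_apply, DirectSum.coeLinearMap_lof, LinearMap.id_apply]
    have key : ∃ hz', D z = DirectSum.lof k ℤ (fun n => c.tensorGr c' n) n ⟨z, hz'⟩ := by
      refine tensorGr_induction (P := fun z => ∃ hz', D z =
        DirectSum.lof k ℤ (fun n => c.tensorGr c' n) n ⟨z, hz'⟩) c c' z hz ?_ ?_ ?_
      · intro i j x y hx hy h
        exact ⟨tmul_mem_tensorGr c c' hx hy h, by rw [hD hx hy]; exact lof_congr _ h _ _⟩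
      · exact ⟨Submodule.zero_mem _, by rw [map_zero]; exact (map_zero _).symm⟩
      · rintro x y ⟨a, ha⟩ ⟨b, hb⟩
        refine ⟨Submodule.add_mem _ a b, ?_⟩
        rw [map_add, ha, hb, ← map_add]
        rfl
    exact key.2

theorem sgn_mem (c : DiffMod k V) (n : ℤ) {i : ℤ} {x : V} (hx : x ∈ c.gr i) :
    c.sgn n x ∈ c.gr i := by
  rw [sgn_apply c n hx]; exact Submodule.smul_mem _ _ hx

/-- The operator `D ⊗ 1 + 1 ⊗ D'` for `D`, `D'` of degree `n`, where
`(1 ⊗ D')(x ⊗ y) = (-1)^(n|x|) x ⊗ D' y`. -/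
def leib (c : DiffMod k V) (n : ℤ) (D : V →ₗ[k] V) (D' : W →ₗ[k] W) :
    V ⊗[k] W →ₗ[k] V ⊗[k] W :=
  TensorProduct.map D LinearMap.id + TensorProduct.map (c.sgn n) D'

/-- The tensor product, with differential `d ⊗ 1 + 1 ⊗ d`. -/
def tensor (c : DiffMod k V) (c' : DiffMod k W) : DiffMod k (V ⊗[k] W) where
  gr := c.tensorGr c'
  internal := tensorGr_internal c c'
  diff := c.leib 1 c.diff c'.diff
  diff_mem := by
    intro n z hz
    refine tensorGr_induction (P := fun z => c.leib 1 c.diff c'.diff z ∈ c.tensorGr c' (n + 1))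
      c c' z hz ?_ ?_ ?_
    · intro i j x y hx hy h
      simp only [leib, LinearMap.add_apply, TensorProduct.map_tmul, LinearMap.id_apply]
      exact Submodule.add_mem _
        (tmul_mem_tensorGr c c' (c.diff_mem hx) hy (by omega))
        (tmul_mem_tensorGr c c' (c.sgn_mem 1 hx) (c'.diff_mem hy) (by omega))
    · rw [map_zero]; exact Submodule.zero_mem _
    · intro x y hx hy
      rw [map_add]; exact Submodule.add_mem _ hx hy

/-- The shift `V[n]`: its part of degree `i` is the part of `V` of degree `i + n`, and its
differential is `(-1)^n d`. -/
def shift (c : DiffMod k V) (n : ℤ) : DiffMod k V where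
  gr i := c.gr (i + n)
  internal := by
    rw [DirectSum.isInternal_submodule_iff_iSupIndep_and_iSup_eq_top]
    refine ⟨c.internal.submodule_iSupIndep.comp (add_left_injective n), ?_⟩
    rw [← c.internal.submodule_iSup_eq_top]
    exact (Equiv.addRight n).iSup_comp (g := c.gr)
  diff := ksign k n • c.diff
  diff_mem := by
    intro i x hx
    have := Submodule.smul_mem _ (ksign k n) (c.diff_mem hx)
    rwa [add_right_comm] at this

/-- The direct sum of a family of spaces `A n` placed in degree `n`, with a differential given by
its components. -/
def ofFamily (A : ℤ → Type v) [∀ n, AddCommGroup (A n)] [∀ n, Module k (A n)]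
    (δ : ∀ n, A n →ₗ[k] A (n + 1)) : DiffMod k (⨁ n, A n) where
  gr n := LinearMap.range (DirectSum.lof k ℤ A n)
  internal := by
    let D : (⨁ n, A n) →ₗ[k] ⨁ n, LinearMap.range (DirectSum.lof k ℤ A n) :=
      DirectSum.toModule k ℤ _ fun n =>
        DirectSum.lof k ℤ (fun n => LinearMap.range (DirectSum.lof k ℤ A n)) n ∘ₗ
          (DirectSum.lof k ℤ A n).rangeRestrict
    refine @DirectSum.Decomposition.isInternal _ _ _ _ _ _ _ _
      (DirectSum.Decomposition.ofLinearMap _ D ?_ ?_)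
    · ext n x : 2
      simp [D]
    · ext n ⟨x, y, rfl⟩ : 2
      simp only [D, LinearMap.comp_apply, DirectSum.coeLinearMap_lof, LinearMap.id_apply,
        DirectSum.toModule_lof]
      rfl
  diff := DirectSum.toModule k ℤ _ fun n => DirectSum.lof k ℤ A (n + 1) ∘ₗ δ n
  diff_mem := by
    rintro n _ ⟨x, rfl⟩
    rw [DirectSum.toModule_lof]
    exact ⟨δ n x, rfl⟩

end basics
end DiffMod

section algebras
variable (k : Type u) [Field k]

/-- A `d`-algebra (without unit): a complex with a dg commutative associative product and a
bracket which makes `V[d-1]` a dg Lie algebra, subject to the Leibniz identity.  The degree of a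
homogeneous `x ∈ V` in `V[d-1]` is `|x| + 1 - d`. -/
structure DAlgebra (d : ℤ) (V : Type v) [AddCommGroup V] [Module k V] extends DiffMod k V where
  isComplex : toDiffMod.IsComplex
  mul : V →ₗ[k] V →ₗ[k] V
  mul_mem : ∀ {i j x y}, x ∈ gr i → y ∈ gr j → mul x y ∈ gr (i + j)
  mul_assoc : ∀ x y z, mul (mul x y) z = mul x (mul y z)
  mul_comm : ∀ {i j x y}, x ∈ gr i → y ∈ gr j → mul x y = ksign k (i * j) • mul y x
  diff_mul : ∀ {i x}, x ∈ gr i → ∀ y,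
    toDiffMod.diff (mul x y) = mul (toDiffMod.diff x) y + ksign k i • mul x (toDiffMod.diff y)
  brk : V →ₗ[k] V →ₗ[k] V
  brk_mem : ∀ {i j x y}, x ∈ gr i → y ∈ gr j → brk x y ∈ gr (i + j + 1 - d)
  brk_antisymm : ∀ {i j x y}, x ∈ gr i → y ∈ gr j →
    brk x y = -(ksign k ((i + 1 - d) * (j + 1 - d)) • brk y x)
  brk_jacobi : ∀ {i j x y}, x ∈ gr i → y ∈ gr j → ∀ z,
    brk x (brk y z) = brk (brk x y) z + ksign k ((i + 1 - d) * (j + 1 - d)) • brk y (brk x z)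
  diff_brk : ∀ {i x}, x ∈ gr i → ∀ y,
    toDiffMod.diff (brk x y) = brk (toDiffMod.diff x) y + ksign k (i + 1 - d) • brk x (toDiffMod.diff y)
  leibniz : ∀ {j l b c}, b ∈ gr j → c ∈ gr l → ∀ a,
    brk (mul a b) c = mul a (brk b c) + ksign k (j * (l + d - 1)) • mul (brk a c) b

/-- The data of a coaugmented `d`-coalgebra: coproduct `comul`, cobracket `cobr`, counit, and a
distinguished element `one`. -/
structure DCoalgData (W : Type v) [AddCommGroup W] [Module k W] extends DiffMod k W where
  comul : W →ₗ[k] W ⊗[k] W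
  cobr : W →ₗ[k] W ⊗[k] W
  counit : W →ₗ[k] k
  one : W

end algebras

namespace DCoalgData
variable {k : Type u} [Field k] {W : Type v} [AddCommGroup W] [Module k W]
  {W' : Type w} [AddCommGroup W'] [Module k W']

open DiffMod

/-- Exchange of the last two factors of `(W ⊗ W) ⊗ W`, with the Koszul sign. -/
def swap23 (c : DiffMod k W) : (W ⊗[k] W) ⊗[k] W →ₗ[k] (W ⊗[k] W) ⊗[k] W :=
  (TensorProduct.assoc k W W W).symm.toLinearMap ∘ₗ
    TensorProduct.map LinearMap.id (c.twist c) ∘ₗ (TensorProduct.assoc k W W W).toLinearMap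

/-- The cyclic permutation `a ⊗ b ⊗ c ↦ ± c ⊗ a ⊗ b`. -/
def cyc (c : DiffMod k W) : (W ⊗[k] W) ⊗[k] W →ₗ[k] (W ⊗[k] W) ⊗[k] W :=
  TensorProduct.map (c.twist c) LinearMap.id ∘ₗ swap23 c

/-- A coderivation of degree `n`, with respect to both the coproduct and the cobracket (which
has degree `1 - d`). -/
structure IsCoder (d : ℤ) (c : DCoalgData k W) (n : ℤ) (D : W →ₗ[k] W) : Prop where
  deg : D ∈ homDeg c.toDiffMod c.toDiffMod n
  comul : c.comul ∘ₗ D = c.leib n D D ∘ₗ c.comul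
  cobr : c.cobr ∘ₗ D = ksign k (n * (1 - d)) • (c.leib n D D ∘ₗ c.cobr)

/-- The axioms of a `d`-coalgebra with counit.  The cobracket is regarded as an operation
`W → W ⊗ W` of degree `1 - d`, so that it is (anti)symmetric up to `(-1)^d` (equivalently,
it is antisymmetric on `W[1-d]`); the co-Jacobi and co-Leibniz identities are the
duals of those of a `d`-algebra. -/
structure IsDCoalgebra (d : ℤ) (c : DCoalgData k W) : Prop where
  isComplex : c.IsComplex
  comul_mem : ∀ {i x}, x ∈ c.gr i → c.comul x ∈ c.tensorGr c.toDiffMod i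
  coassoc : (TensorProduct.assoc k W W W).toLinearMap ∘ₗ
    TensorProduct.map c.comul LinearMap.id ∘ₗ c.comul =
      TensorProduct.map LinearMap.id c.comul ∘ₗ c.comul
  cocomm : c.twist c.toDiffMod ∘ₗ c.comul = c.comul
  counit_deg : ∀ {i x}, x ∈ c.gr i → i ≠ 0 → c.counit x = 0
  counit_comul : (TensorProduct.lid k W).toLinearMap ∘ₗ
    TensorProduct.map c.counit LinearMap.id ∘ₗ c.comul = LinearMap.id
  cobr_mem : ∀ {i x}, x ∈ c.gr i → c.cobr x ∈ c.tensorGr c.toDiffMod (i + 1 - d)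
  cobr_symm : c.twist c.toDiffMod ∘ₗ c.cobr = ksign k d • c.cobr
  cojacobi : ∀ x, (fun t => t + cyc c.toDiffMod t + cyc c.toDiffMod (cyc c.toDiffMod t))
    (TensorProduct.map c.cobr LinearMap.id (c.cobr x)) = 0
  coleibniz : TensorProduct.map c.comul LinearMap.id ∘ₗ c.cobr =
    (TensorProduct.assoc k W W W).symm.toLinearMap ∘ₗ
      TensorProduct.map (c.sgn (1 - d)) c.cobr ∘ₗ c.comul +
    swap23 c.toDiffMod ∘ₗ TensorProduct.map c.cobr LinearMap.id ∘ₗ c.comul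
  counit_cobr : (TensorProduct.lid k W).toLinearMap ∘ₗ
    TensorProduct.map c.counit LinearMap.id ∘ₗ c.cobr = 0
  diff_coder : IsCoder d c 1 c.diff

/-- A graded subspace which is a subcomplex and a sub-`d`-coalgebra. -/
structure IsSubcoalgebra (c : DCoalgData k W) (S : Submodule k W) : Prop where
  homogeneous : S ≤ ⨆ i, S ⊓ c.gr i
  diff_mem : ∀ x ∈ S, c.diff x ∈ S
  comul_mem : ∀ x ∈ S, c.comul x ∈ tensorSub S S
  cobr_mem : ∀ x ∈ S, c.cobr x ∈ tensorSub S S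

/-- Coproartinian: there is an exhaustive increasing filtration by sub-coalgebras, with
`F 0` spanned by the unit, whose first step is primitive and such that the reduced coproduct
and the cobracket lower it. -/
def IsCoproartinian (c : DCoalgData k W) : Prop :=
  ∃ F : ℕ → Submodule k W, Monotone F ∧ (⨆ i, F i) = ⊤ ∧ (∀ i, IsSubcoalgebra c (F i)) ∧
    F 0 = Submodule.span k {c.one} ∧ c.counit c.one = 1 ∧
    (∀ x ∈ F 1, c.counit x = 0 → c.comul x = c.one ⊗ₜ x + x ⊗ₜ c.one) ∧
    (∀ x ∈ F 1, c.cobr x = 0) ∧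
    (∀ i, 2 ≤ i → ∀ x ∈ F i,
      c.comul x - c.one ⊗ₜ x - x ⊗ₜ c.one ∈ tensorSub (F (i - 1)) (F (i - 1)) ∧
      c.cobr x ∈ tensorSub (F (i - 1)) (F (i - 1)))

/-- Morphisms of graded `d`-coalgebras with counit (the differentials are ignored). -/
structure IsGradedHom (c : DCoalgData k W) (c' : DCoalgData k W') (f : W →ₗ[k] W') : Prop where
  deg : f ∈ homDeg c.toDiffMod c'.toDiffMod 0
  comul : c'.comul ∘ₗ f = TensorProduct.map f f ∘ₗ c.comul
  cobr : c'.cobr ∘ₗ f = TensorProduct.map f f ∘ₗ c.cobr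
  counit : c'.counit ∘ₗ f = c.counit

/-- Morphisms of `d`-coalgebras with counit. -/
structure IsHom (c : DCoalgData k W) (c' : DCoalgData k W') (f : W →ₗ[k] W') : Prop
    extends IsGradedHom c c' f where
  diff : c'.diff ∘ₗ f = f ∘ₗ c.diff

/-- The tensor product of `d`-coalgebras. -/
def tensor (d : ℤ) (c : DCoalgData k W) (c' : DCoalgData k W') : DCoalgData k (W ⊗[k] W') where
  toDiffMod := c.toDiffMod.tensor c'.toDiffMod
  comul := mid c.toDiffMod c'.toDiffMod ∘ₗ TensorProduct.map c.comul c'.comul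
  cobr := mid c.toDiffMod c'.toDiffMod ∘ₗ
    (TensorProduct.map c.cobr c'.comul + TensorProduct.map (c.comul ∘ₗ c.sgn (d - 1)) c'.cobr)
  counit := LinearMap.mul' k k ∘ₗ TensorProduct.map c.counit c'.counit
  one := c.one ⊗ₜ c'.one

/-- `(W, p)` is the cofree coproartinian `d`-coalgebra cogenerated by the graded space `X`
(the differentials are ignored). -/
structure IsCofree {k : Type u} [Field k] (d : ℤ) {X : Type u} [AddCommGroup X] [Module k X]
    (X' : DiffMod k X) {W : Type u} [AddCommGroup W] [Module k W] (c : DCoalgData k W)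
    (p : W →ₗ[k] X) : Prop where
  deg : p ∈ homDeg c.toDiffMod X' 0
  one : p c.one = 0
  universal : ∀ (A : Type u) [AddCommGroup A] [Module k A] (a : DCoalgData k A),
    IsDCoalgebra d a → IsCoproartinian a → ∀ f ∈ homDeg a.toDiffMod X' 0, f a.one = 0 →
      ∃! g : A →ₗ[k] W, IsGradedHom a c g ∧ p ∘ₗ g = f

end DCoalgData

section bar
open DiffMod DCoalgData
variable {k : Type u} [Field k] {d : ℤ} {V : Type v} [AddCommGroup V] [Module k V]

/-- The bracket of a `d`-algebra `V` as a graded symmetric operation of degree one on `V[d]`. -/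
def DAlgebra.shBrk (A : DAlgebra k d V) : V ⊗[k] V →ₗ[k] V :=
  TensorProduct.lift A.brk ∘ₗ TensorProduct.map ((A.shift d).sgn 1) LinearMap.id

/-- The product of a `d`-algebra `V` as an operation of degree `d` on `V[d]`. -/
def DAlgebra.shMul (A : DAlgebra k d V) : V ⊗[k] V →ₗ[k] V :=
  TensorProduct.lift A.mul ∘ₗ TensorProduct.map ((A.shift d).sgn d) LinearMap.id

/-- `(W, p)` is the `d`-coalgebra `V^∨`: the cofree coproartinian `d`-coalgebra cogenerated by
`V[d]`, with the quadratic differential whose corestriction to `V[d]` is given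
by the differential, the bracket and the product of `V`. -/
structure IsBar {k : Type u} [Field k] {d : ℤ} {V : Type u} [AddCommGroup V] [Module k V]
    (A : DAlgebra k d V) {W : Type u} [AddCommGroup W] [Module k W] (c : DCoalgData k W)
    (p : W →ₗ[k] V) : Prop where
  isDCoalgebra : IsDCoalgebra d c
  isCoproartinian : IsCoproartinian c
  isCofree : IsCofree d (A.shift d) c p
  differential : p ∘ₗ c.diff = (A.shift d).diff ∘ₗ p +
    (2⁻¹ : k) • (A.shBrk ∘ₗ TensorProduct.map p p ∘ₗ c.comul) +
    (2⁻¹ : k) • (A.shMul ∘ₗ TensorProduct.map p p ∘ₗ c.cobr)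

/-- The set of morphisms `W ⊗ S → W` which restrict to the identity along `k → S`. -/
def FId {W : Type v} [AddCommGroup W] [Module k W] {S : Type w} [AddCommGroup S] [Module k S]
    (d : ℤ) (c : DCoalgData k W) (s : DCoalgData k S) : Set (W ⊗[k] S →ₗ[k] W) :=
  {f | IsHom (c.tensor d s) c f ∧ ∀ w, f (w ⊗ₜ s.one) = w}

/-- `(H, μ)` is the coproartinian `d`-coalgebra that represents the functor `S ↦ FId d c S` on
coproartinian `d`-coalgebras; `μ` is the universal element. -/
structure IsHomId {k : Type u} [Field k] (d : ℤ) {W : Type u} [AddCommGroup W] [Module k W]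
    (c : DCoalgData k W) {H : Type u} [AddCommGroup H] [Module k H] (h : DCoalgData k H)
    (μ : W ⊗[k] H →ₗ[k] W) : Prop where
  isDCoalgebra : IsDCoalgebra d h
  isCoproartinian : IsCoproartinian h
  mem : μ ∈ FId d c h
  universal : ∀ (S : Type u) [AddCommGroup S] [Module k S] (s : DCoalgData k S),
    IsDCoalgebra d s → IsCoproartinian s → ∀ f ∈ FId d c s,
      ∃! g : S →ₗ[k] H, IsHom s h g ∧ μ ∘ₗ TensorProduct.map LinearMap.id g = f

/-- The composition product on `H = Hom^Id(V,V)`: it classifies the composite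
`W ⊗ H ⊗ H → W ⊗ H → W`. -/
structure IsComposition {W : Type v} [AddCommGroup W] [Module k W] {H : Type w} [AddCommGroup H]
    [Module k H] (d : ℤ) (h : DCoalgData k H) (μ : W ⊗[k] H →ₗ[k] W)
    (m : H ⊗[k] H →ₗ[k] H) : Prop where
  isHom : IsHom (h.tensor d h) h m
  comp : μ ∘ₗ TensorProduct.map LinearMap.id m ∘ₗ (TensorProduct.assoc k W H H).toLinearMap =
    μ ∘ₗ TensorProduct.map μ LinearMap.id

/-- The biggest (cocommutative) subcoalgebra contained in the kernel of the cobracket. -/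
def coreC {H : Type w} [AddCommGroup H] [Module k H] (h : DCoalgData k H) : Submodule k H :=
  sSup {S | IsSubcoalgebra h S ∧ S ≤ LinearMap.ker h.cobr}

end bar
section lie
open DiffMod

/-- A graded Lie algebra with a derivation of degree one (a dg Lie algebra if moreover
`diff ∘ diff = 0`). -/
structure GLie (k : Type u) [Field k] (g : Type v) [AddCommGroup g] [Module k g]
    extends DiffMod k g where
  brk : g →ₗ[k] g →ₗ[k] g
  brk_mem : ∀ {i j x y}, x ∈ gr i → y ∈ gr j → brk x y ∈ gr (i + j)
  brk_antisymm : ∀ {i j x y}, x ∈ gr i → y ∈ gr j → brk x y = -(ksign k (i * j) • brk y x)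
  brk_jacobi : ∀ {i j x y}, x ∈ gr i → y ∈ gr j → ∀ z,
    brk x (brk y z) = brk (brk x y) z + ksign k (i * j) • brk y (brk x z)
  diff_brk : ∀ {i x}, x ∈ gr i → ∀ y,
    toDiffMod.diff (brk x y) = brk (toDiffMod.diff x) y + ksign k i • brk x (toDiffMod.diff y)

/-- The abelian Lie algebra on a graded space. -/
def DiffMod.abelian {k : Type u} [Field k] {X : Type v} [AddCommGroup X] [Module k X]
    (c : DiffMod k X) : GLie k X where
  toDiffMod := c
  brk := 0
  brk_mem _ _ := Submodule.zero_mem _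
  brk_antisymm _ _ := by simp
  brk_jacobi _ _ _ := by simp
  diff_brk _ _ := by simp

variable {k : Type u} [Field k] {W : Type v} [AddCommGroup W] [Module k W]
  {V : Type w} [AddCommGroup V] [Module k V]

/-- The graded commutator of endomorphisms of degrees `n` and `m`. -/
def gcomm (n m : ℤ) : (W →ₗ[k] W) →ₗ[k] (W →ₗ[k] W) →ₗ[k] (W →ₗ[k] W) :=
  LinearMap.mk₂ k (fun D E => D ∘ₗ E - ksign k (n * m) • (E ∘ₗ D))
    (fun D D' E => by ext x; simp [smul_add]; abel)
    (fun a D E => by ext x; simp [smul_sub, smul_comm a])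
    (fun D E E' => by ext x; simp [smul_add]; abel)
    (fun a D E => by ext x; simp [smul_sub, smul_comm a])

theorem gcomm_apply (n m : ℤ) (D E : W →ₗ[k] W) (x : W) :
    gcomm n m D E x = D (E x) - ksign k (n * m) • E (D x) := rfl

theorem leib_gcomm (c : DiffMod k W) {n m : ℤ} {D E : W →ₗ[k] W} (hD : D ∈ homDeg c c n)
    (hE : E ∈ homDeg c c m) :
    gcomm n m (c.leib n D D) (c.leib m E E) =
      c.leib (n + m) (gcomm n m D E) (gcomm n m D E) := by
  apply TensorProduct.ext
  apply c.hom_ext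
  intro i x hx
  refine LinearMap.ext fun y => ?_
  change gcomm n m (c.leib n D D) (c.leib m E E) (x ⊗ₜ y) =
    c.leib (n + m) (gcomm n m D E) (gcomm n m D E) (x ⊗ₜ y)
  simp only [gcomm_apply, leib,
    LinearMap.add_apply, TensorProduct.map_tmul, LinearMap.id_apply, map_add,
    c.sgn_apply _ hx, c.sgn_apply _ (hD _ _ hx), c.sgn_apply _ (hE _ _ hx), map_smul,
    TensorProduct.sub_tmul, TensorProduct.tmul_sub, ← TensorProduct.smul_tmul',
    TensorProduct.tmul_smul, smul_smul]
  have e1 : ksign k (n * (i + m)) = ksign k (n * m) * ksign k (n * i) := by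
    rw [← ksign_add]; congr 1; ring
  have e2 : ksign k (m * (i + n)) = ksign k (n * m) * ksign k (m * i) := by
    rw [← ksign_add]; congr 1; ring
  have e3 : ksign k ((n + m) * i) = ksign k (n * i) * ksign k (m * i) := by
    rw [← ksign_add]; congr 1; ring
  have e4 := ksign_mul_self k (n * m)
  simp only [e1, e2, e3, ← mul_assoc, e4, one_mul]
  have e5 : ksign k (n * i) * ksign k (m * i) * ksign k (n * m) =
    ksign k (n * m) * ksign k (n * i) * ksign k (m * i) := by ring
  have e6 : ksign k (m * i) * ksign k (n * i) = ksign k (n * i) * ksign k (m * i) := by ring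
  simp only [e6]
  abel

theorem gcomm_antisymm (n m : ℤ) (D E : W →ₗ[k] W) :
    gcomm n m D E = -(ksign k (n * m) • gcomm m n E D) := by
  ext x
  simp only [gcomm_apply, LinearMap.neg_apply, LinearMap.smul_apply, smul_sub, smul_smul,
    mul_comm m n, ksign_mul_self, one_smul]
  abel

theorem gcomm_jacobi (n m l : ℤ) (D E F : W →ₗ[k] W) :
    gcomm n (m + l) D (gcomm m l E F) = gcomm (n + m) l (gcomm n m D E) F +
      ksign k (n * m) • gcomm m (n + l) E (gcomm n l D F) := by
  ext x
  have e1 : ksign k (n * (m + l)) = ksign k (n * m) * ksign k (n * l) := by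
    rw [← ksign_add]; congr 1; ring
  have e2 : ksign k (m * (n + l)) = ksign k (n * m) * ksign k (m * l) := by
    rw [← ksign_add]; congr 1; ring
  have e3 : ksign k ((n + m) * l) = ksign k (n * l) * ksign k (m * l) := by
    rw [← ksign_add]; congr 1; ring
  have e4 := ksign_mul_self k (n * m)
  simp only [gcomm_apply, LinearMap.add_apply, LinearMap.smul_apply, smul_sub, smul_smul,
    map_sub, map_smul, e1, e2, e3, ← mul_assoc, e4, one_mul]
  have e5 : ksign k (n * l) * ksign k (m * l) * ksign k (n * m) =
    ksign k (n * m) * ksign k (n * l) * ksign k (m * l) := by ring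
  have e6 : ksign k (m * l) * ksign k (n * l) = ksign k (n * l) * ksign k (m * l) := by ring
  simp only [e5, e6]
  abel

variable (d : ℤ) (c : DCoalgData k W)

/-- The space of coderivations of degree `n`. -/
def coder (n : ℤ) : Submodule k (W →ₗ[k] W) where
  carrier := {D | c.IsCoder d n D}
  add_mem' {D E} hD hE := by
    refine ⟨Submodule.add_mem _ hD.deg hE.deg, ?_, ?_⟩
    · rw [LinearMap.comp_add, hD.comul, hE.comul]
      ext x
      simp [leib, TensorProduct.map_add_left, TensorProduct.map_add_right]
      abel
    · rw [LinearMap.comp_add, hD.cobr, hE.cobr]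
      ext x
      simp [leib, TensorProduct.map_add_left, TensorProduct.map_add_right]
      abel
  zero_mem' := by
    refine ⟨Submodule.zero_mem _, ?_, ?_⟩ <;>
    simp [leib]
  smul_mem' a D hD := by
    refine ⟨Submodule.smul_mem _ a hD.deg, ?_, ?_⟩
    · rw [LinearMap.comp_smul, hD.comul]
      ext x
      simp [leib, TensorProduct.map_smul_left, TensorProduct.map_smul_right]
    · rw [LinearMap.comp_smul, hD.cobr]
      ext x
      simp [leib, TensorProduct.map_smul_left, TensorProduct.map_smul_right, smul_comm a]

theorem gcomm_homDeg {c : DiffMod k W} {n m : ℤ} {D E : W →ₗ[k] W} (hD : D ∈ homDeg c c n)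
    (hE : E ∈ homDeg c c m) : gcomm n m D E ∈ homDeg c c (n + m) := by
  intro i x hx
  refine Submodule.sub_mem _ ?_ (Submodule.smul_mem _ _ ?_)
  · have := hD _ _ (hE _ _ hx)
    rwa [add_assoc, add_comm m] at this
  · have := hE _ _ (hD _ _ hx)
    rwa [add_assoc] at this

theorem gcomm_coder {n m : ℤ} {D E : W →ₗ[k] W} (hD : D ∈ coder d c n) (hE : E ∈ coder d c m) :
    gcomm n m D E ∈ coder d c (n + m) := by
  have aux : ∀ (Δ : W →ₗ[k] W ⊗[k] W) (a b : k),
      Δ ∘ₗ D = a • (c.leib n D D ∘ₗ Δ) → Δ ∘ₗ E = b • (c.leib m E E ∘ₗ Δ) →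
      Δ ∘ₗ gcomm n m D E =
        (a * b) • (c.leib (n + m) (gcomm n m D E) (gcomm n m D E) ∘ₗ Δ) := by
    intro Δ a b h1 h2
    rw [← leib_gcomm c.toDiffMod hD.deg hE.deg]
    ext x
    have h1' := fun y => LinearMap.congr_fun h1 y
    have h2' := fun y => LinearMap.congr_fun h2 y
    simp only [LinearMap.comp_apply, LinearMap.smul_apply] at h1' h2'
    simp only [LinearMap.comp_apply, LinearMap.smul_apply, gcomm_apply, map_sub, map_smul, h1', h2',
      smul_sub, smul_smul]
    congr 2
    ring
  refine ⟨gcomm_homDeg hD.deg hE.deg, ?_, ?_⟩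
  · have := aux c.comul 1 1 (by rw [hD.comul, one_smul]) (by rw [hE.comul, one_smul])
    rwa [one_mul, one_smul] at this
  · have := aux c.cobr _ _ hD.cobr hE.cobr
    rwa [← ksign_add, ← add_mul] at this

/-- The graded commutator as a bilinear map between spaces of coderivations. -/
def coderBrk (n m : ℤ) : coder d c n →ₗ[k] coder d c m →ₗ[k] coder d c (n + m) :=
  LinearMap.mk₂ k (fun D E => ⟨gcomm n m D.1 E.1, gcomm_coder d c D.2 E.2⟩)
    (fun D D' E => by ext1; simp) (fun a D E => by ext1; simp)
    (fun D E E' => by ext1; simp) (fun a D E => by ext1; simp)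

variable {d c}

/-- The differential `x ↦ [∂, x]` on coderivations. -/
def coderDiff (hc : c.IsDCoalgebra d) (n : ℤ) : coder d c n →ₗ[k] coder d c (n + 1) where
  toFun D := ⟨gcomm 1 n c.diff D.1, by
    rw [add_comm]; exact gcomm_coder d c hc.diff_coder D.2⟩
  map_add' D E := by ext1; simp
  map_smul' a D := by ext1; simp

/-- A coderivation of degree `n`, as an element of the graded space of all coderivations. -/
def coderEl (n : ℤ) {D : W →ₗ[k] W} (hD : D ∈ coder d c n) : ⨁ n, coder d c n :=
  DirectSum.lof k ℤ (fun n => coder d c n) n ⟨D, hD⟩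

theorem coderEl_congr {n m : ℤ} (h : n = m) {D E : W →ₗ[k] W} (hD : D ∈ coder d c n)
    (hE : E ∈ coder d c m) (hDE : D = E) : coderEl n hD = coderEl m hE := by
  subst h hDE; rfl

theorem coderEl_add {n : ℤ} {D E : W →ₗ[k] W} (hD : D ∈ coder d c n) (hE : E ∈ coder d c n) :
    coderEl n hD + coderEl n hE = coderEl n (Submodule.add_mem _ hD hE) := by
  rw [coderEl, coderEl, ← map_add]; rfl

theorem coderEl_smul {n : ℤ} (a : k) {D : W →ₗ[k] W} (hD : D ∈ coder d c n) :
    a • coderEl n hD = coderEl n (Submodule.smul_mem _ a hD) := by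
  rw [coderEl, ← map_smul]; rfl

theorem coderEl_neg {n : ℤ} {D : W →ₗ[k] W} (hD : D ∈ coder d c n) :
    -coderEl n hD = coderEl n (Submodule.neg_mem _ hD) := by
  rw [coderEl, ← map_neg]; rfl

theorem coder_induction {P : (⨁ n, coder d c n) → Prop} (z : ⨁ n, coder d c n)
    (el : ∀ n D (hD : D ∈ coder d c n), P (coderEl n hD)) (add : ∀ x y, P x → P y → P (x + y)) :
    P z := by
  induction z using DirectSum.induction_on with
  | zero =>
    have h : coderEl 0 (Submodule.zero_mem (coder d c 0)) = 0 :=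
      map_zero (DirectSum.lof k ℤ (fun n => coder d c n) 0)
    rw [← h]
    exact el _ _ _
  | of i x => exact el i x.1 x.2
  | add x y h1 h2 => exact add x y h1 h2

variable (d c) in
/-- The graded commutator bracket on the graded space of all coderivations. -/
def coderBracket : (⨁ n, coder d c n) →ₗ[k] (⨁ n, coder d c n) →ₗ[k] ⨁ n, coder d c n :=
  DirectSum.toModule k ℤ _ fun n => LinearMap.flip (DirectSum.toModule k ℤ _ fun m =>
    LinearMap.flip ((coderBrk d c n m).compr₂ (DirectSum.lof k ℤ (fun n => coder d c n) (n + m))))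

theorem coderBracket_el {n m : ℤ} {D E : W →ₗ[k] W} (hD : D ∈ coder d c n)
    (hE : E ∈ coder d c m) :
    coderBracket d c (coderEl n hD) (coderEl m hE) = coderEl (n + m) (gcomm_coder d c hD hE) := by
  simp only [coderBracket, coderEl, DirectSum.toModule_lof, LinearMap.flip_apply,
    LinearMap.compr₂_apply]
  rfl

theorem coderDiff_el (hc : c.IsDCoalgebra d) {n : ℤ} {D : W →ₗ[k] W} (hD : D ∈ coder d c n) :
    (DiffMod.ofFamily (fun n => coder d c n) (coderDiff hc)).diff (coderEl n hD) =
      coderEl (1 + n) (gcomm_coder d c hc.diff_coder hD) := by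
  simp only [DiffMod.ofFamily, coderEl, DirectSum.toModule_lof, LinearMap.comp_apply]
  exact coderEl_congr (add_comm _ _) _ _ rfl

/-- The deformation Lie algebra: the graded Lie algebra of coderivations of `c`, with
differential the bracket with the differential of `c`. -/
def defLie (hc : c.IsDCoalgebra d) : GLie k (⨁ n, coder d c n) where
  toDiffMod := DiffMod.ofFamily (fun n => coder d c n) (coderDiff hc)
  brk := coderBracket d c
  brk_mem := by
    rintro i j _ _ ⟨D, rfl⟩ ⟨E, rfl⟩
    exact ⟨_, (coderBracket_el D.2 E.2).symm⟩
  brk_antisymm := by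
    rintro i j _ _ ⟨⟨D, hD⟩, rfl⟩ ⟨⟨E, hE⟩, rfl⟩
    change coderBracket d c (coderEl i hD) (coderEl j hE) =
      -(ksign k (i * j) • coderBracket d c (coderEl j hE) (coderEl i hD))
    rw [coderBracket_el, coderBracket_el, coderEl_smul, coderEl_neg]
    exact coderEl_congr (add_comm _ _) _ _ (gcomm_antisymm _ _ _ _)
  brk_jacobi := by
    rintro i j _ _ ⟨⟨D, hD⟩, rfl⟩ ⟨⟨E, hE⟩, rfl⟩ z
    change coderBracket d c (coderEl i hD) (coderBracket d c (coderEl j hE) z) =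
      coderBracket d c (coderBracket d c (coderEl i hD) (coderEl j hE)) z +
      ksign k (i * j) • coderBracket d c (coderEl j hE) (coderBracket d c (coderEl i hD) z)
    induction z using coder_induction with
    | el l F hF =>
      rw [coderBracket_el, coderBracket_el, coderBracket_el, coderBracket_el, coderBracket_el,
        coderBracket_el, coderEl_smul]
      have h1 := coderEl_congr (d := d) (c := c) (add_assoc i j l)
        (gcomm_coder d c (gcomm_coder d c hD hE) hF)
        (by rw [← add_assoc]; exact gcomm_coder d c (gcomm_coder d c hD hE) hF) rfl
      have h2 := coderEl_congr (d := d) (c := c) (add_left_comm j i l)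
        (Submodule.smul_mem _ (ksign k (i * j)) (gcomm_coder d c hE (gcomm_coder d c hD hF)))
        (by rw [← add_left_comm]; exact Submodule.smul_mem _ (ksign k (i * j))
              (gcomm_coder d c hE (gcomm_coder d c hD hF))) rfl
      rw [h1, h2, coderEl_add]
      exact coderEl_congr rfl _ _ (gcomm_jacobi _ _ _ _ _ _)
    | add x y h1 h2 =>
      simp only [map_add, h1, h2, smul_add]
      abel
  diff_brk := by
    rintro i _ ⟨⟨D, hD⟩, rfl⟩ z
    change (DiffMod.ofFamily (fun n => coder d c n) (coderDiff hc)).diff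
        (coderBracket d c (coderEl i hD) z) =
      coderBracket d c ((DiffMod.ofFamily (fun n => coder d c n) (coderDiff hc)).diff
        (coderEl i hD)) z +
      ksign k i • coderBracket d c (coderEl i hD)
        ((DiffMod.ofFamily (fun n => coder d c n) (coderDiff hc)).diff z)
    induction z using coder_induction with
    | el l F hF =>
      have hQ := hc.diff_coder
      rw [coderBracket_el, coderDiff_el, coderDiff_el, coderDiff_el, coderBracket_el,
        coderBracket_el, coderEl_smul]
      have h1 := coderEl_congr (d := d) (c := c) (add_assoc 1 i l)
        (gcomm_coder d c (gcomm_coder d c hQ hD) hF)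
        (by rw [← add_assoc]; exact gcomm_coder d c (gcomm_coder d c hQ hD) hF) rfl
      have h2 := coderEl_congr (d := d) (c := c) (add_left_comm i 1 l)
        (Submodule.smul_mem _ (ksign k i) (gcomm_coder d c hD (gcomm_coder d c hQ hF)))
        (by rw [← add_left_comm]; exact Submodule.smul_mem _ (ksign k i)
              (gcomm_coder d c hD (gcomm_coder d c hQ hF))) rfl
      rw [h1, h2, coderEl_add]
      refine coderEl_congr rfl _ _ ?_
      have := gcomm_jacobi 1 i l c.diff D F
      rwa [one_mul] at this
    | add x y h1 h2 =>
      simp only [map_add, h1, h2, smul_add]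
      abel

end lie
section twisted
open DiffMod DCoalgData
variable {k : Type u} [Field k] {d : ℤ}

theorem map_mem_tensorGr {W W' V V' : Type*} [AddCommGroup W] [Module k W]
    [AddCommGroup W'] [Module k W'] [AddCommGroup V] [Module k V] [AddCommGroup V'] [Module k V']
    {a : DiffMod k W} {a' : DiffMod k W'} {b : DiffMod k V} {b' : DiffMod k V'} {n m i : ℤ}
    {f : W →ₗ[k] V} {g : W' →ₗ[k] V'} (hf : f ∈ homDeg a b n) (hg : g ∈ homDeg a' b' m)
    {z : W ⊗[k] W'} (hz : z ∈ a.tensorGr a' i) :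
    TensorProduct.map f g z ∈ b.tensorGr b' (i + (n + m)) := by
  refine tensorGr_induction (P := fun z => TensorProduct.map f g z ∈ b.tensorGr b' (i + (n + m)))
    a a' z hz ?_ ?_ ?_
  · intro p q x y hx hy h
    rw [TensorProduct.map_tmul]
    exact tmul_mem_tensorGr b b' (hf _ _ hx) (hg _ _ hy) (by omega)
  · rw [map_zero]; exact Submodule.zero_mem _
  · intro x y hx hy
    rw [map_add]; exact Submodule.add_mem _ hx hy

variable {V : Type v} [AddCommGroup V] [Module k V]

theorem shBrk_mem (A : DAlgebra k d V) {i : ℤ} {z : V ⊗[k] V}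
    (hz : z ∈ (A.shift d).tensorGr (A.shift d) i) : A.shBrk z ∈ (A.shift d).gr (i + 1) := by
  refine tensorGr_induction (P := fun z => A.shBrk z ∈ (A.shift d).gr (i + 1)) _ _ z hz ?_ ?_ ?_
  · intro p q x y hx hy h
    have := A.brk_mem ((A.shift d).sgn_mem 1 hx) hy
    rw [show p + d + (q + d) + 1 - d = i + 1 + d by omega] at this
    exact this
  · rw [map_zero]; exact Submodule.zero_mem _
  · intro x y hx hy
    rw [map_add]; exact Submodule.add_mem _ hx hy

theorem shMul_mem (A : DAlgebra k d V) {i : ℤ} {z : V ⊗[k] V}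
    (hz : z ∈ (A.shift d).tensorGr (A.shift d) i) : A.shMul z ∈ (A.shift d).gr (i + d) := by
  refine tensorGr_induction (P := fun z => A.shMul z ∈ (A.shift d).gr (i + d)) _ _ z hz ?_ ?_ ?_
  · intro p q x y hx hy h
    have := A.mul_mem ((A.shift d).sgn_mem d hx) hy
    rw [show p + d + (q + d) = i + d + d by omega] at this
    exact this
  · rw [map_zero]; exact Submodule.zero_mem _
  · intro x y hx hy
    rw [map_add]; exact Submodule.add_mem _ hx hy

variable {W : Type w} [AddCommGroup W] [Module k W]

/-- The twisted differential `f ↦ d f + {p, f}` on maps `f : W → V[d]` of degree `n`.  Here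
`d f = d_V ∘ f - (-1)^n f ∘ d_W`, and `{p, f}` is the convolution bracket, the sum of
a term with the bracket of `V` and the coproduct of `W` and of a term with the product of `V` and
the cobracket of `W`. -/
def twistedDiff (A : DAlgebra k d V) (c : DCoalgData k W) (p : W →ₗ[k] V) (n : ℤ) :
    (W →ₗ[k] V) →ₗ[k] (W →ₗ[k] V) where
  toFun f := (A.shift d).diff ∘ₗ f - ksign k n • (f ∘ₗ c.diff) +
    A.shBrk ∘ₗ TensorProduct.map f p ∘ₗ c.comul +
    ksign k (n * (1 - d)) • (A.shMul ∘ₗ TensorProduct.map f p ∘ₗ c.cobr)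
  map_add' f g := by
    ext x
    simp only [LinearMap.add_apply, LinearMap.sub_apply, LinearMap.smul_apply,
      LinearMap.comp_apply, TensorProduct.map_add_left, map_add, smul_add]
    abel
  map_smul' a f := by
    ext x
    simp only [LinearMap.add_apply, LinearMap.sub_apply, LinearMap.smul_apply,
      LinearMap.comp_apply, TensorProduct.map_smul_left, map_smul, smul_add, smul_sub,
      RingHom.id_apply, smul_comm a]

theorem twistedDiff_mem (A : DAlgebra k d V) {c : DCoalgData k W} (hc : c.IsDCoalgebra d)
    {p : W →ₗ[k] V} (hp : p ∈ homDeg c.toDiffMod (A.shift d) 0) {n : ℤ} {f : W →ₗ[k] V}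
    (hf : f ∈ homDeg c.toDiffMod (A.shift d) n) :
    twistedDiff A c p n f ∈ homDeg c.toDiffMod (A.shift d) (n + 1) := by
  intro i x hx
  refine Submodule.add_mem _ (Submodule.add_mem _ (Submodule.sub_mem _ ?_ ?_) ?_) ?_
  · have := (A.shift d).diff_mem (hf i x hx)
    rwa [add_assoc] at this
  · have := hf _ _ (c.diff_mem hx)
    rw [show i + 1 + n = i + (n + 1) by ring] at this
    exact Submodule.smul_mem _ _ this
  · have := shBrk_mem A (map_mem_tensorGr hf hp (hc.comul_mem hx))
    rwa [show i + (n + 0) + 1 = i + (n + 1) by ring] at this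
  · have := shMul_mem A (map_mem_tensorGr hf hp (hc.cobr_mem hx))
    rw [show i + 1 - d + (n + 0) + d = i + (n + 1) by ring] at this
    exact Submodule.smul_mem _ _ this

/-- The graded space `a'[d]`, where `a'` is the space of graded maps `Hom(W, V)` with its
differential twisted by `p`. In degree `n` it consists of the maps `W → V[d]` of degree `n`. -/
def twistedHom (A : DAlgebra k d V) {c : DCoalgData k W} (hc : c.IsDCoalgebra d)
    {p : W →ₗ[k] V} (hp : p ∈ homDeg c.toDiffMod (A.shift d) 0) :
    DiffMod k (⨁ n, homDeg c.toDiffMod (A.shift d) n) :=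
  DiffMod.ofFamily (fun n => homDeg c.toDiffMod (A.shift d) n) fun n =>
    ((twistedDiff A c p n).domRestrict _).codRestrict _ fun f => twistedDiff_mem A hc hp f.2

/-- A graded map `W → V[d]` of degree `n`, as an element of `a'[d]`. -/
def homEl {b : DiffMod k W} {b' : DiffMod k V} (n : ℤ) {f : W →ₗ[k] V} (hf : f ∈ homDeg b b' n) :
    ⨁ n, homDeg b b' n :=
  DirectSum.lof k ℤ (fun n => homDeg b b' n) n ⟨f, hf⟩

/-- The graded space of all graded maps from `W` to `V[d]`. -/
abbrev HomSpace (A : DAlgebra k d V) (c : DCoalgData k W) : Type (max v w) :=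
  ⨁ n, homDeg c.toDiffMod (A.shift d) n

variable (d) in
/-- The graded space of all coderivations. -/
abbrev CoderSpace (c : DCoalgData k W) : Type w := ⨁ n, coder d c n

end twisted

section
variable {k : Type u} [Field k] {d : ℤ} {V : Type u} [AddCommGroup V] [Module k V]
  {A : DAlgebra k d V} {W : Type u} [AddCommGroup W] [Module k W] {c : DCoalgData k W}
  {p : W →ₗ[k] V}

/-- The deformation Lie algebra `def(V)` of a `d`-algebra: coderivations of `V^∨`. -/
def IsBar.lie (hW : IsBar A c p) : GLie k (CoderSpace d c) := defLie hW.isDCoalgebra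

/-- The graded space `a'[d]` with its differential, for `V^∨`. -/
def IsBar.twisted (hW : IsBar A c p) : DiffMod k (HomSpace A c) :=
  twistedHom A hW.isDCoalgebra hW.isCofree.deg

end

section bialgebras
open DiffMod
variable {k : Type u} [Field k]

/-- The data of an augmented dg bialgebra. -/
structure BialgData (k : Type u) [Field k] (A : Type v) [AddCommGroup A] [Module k A]
    extends DiffMod k A where
  mul : A ⊗[k] A →ₗ[k] A
  one : A
  comul : A →ₗ[k] A ⊗[k] A
  counit : A →ₗ[k] k

variable {A : Type v} [AddCommGroup A] [Module k A] {B : Type w} [AddCommGroup B] [Module k B]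

namespace BialgData

/-- The axioms of a cocommutative dg Hopf algebra. -/
structure IsCocommHopf (a : BialgData k A) : Prop where
  isComplex : a.IsComplex
  mul_mem : ∀ {i j x y}, x ∈ a.gr i → y ∈ a.gr j → a.mul (x ⊗ₜ y) ∈ a.gr (i + j)
  mul_assoc : ∀ x y z, a.mul (a.mul (x ⊗ₜ y) ⊗ₜ z) = a.mul (x ⊗ₜ a.mul (y ⊗ₜ z))
  one_mem : a.one ∈ a.gr 0
  one_mul : ∀ x, a.mul (a.one ⊗ₜ x) = x
  mul_one : ∀ x, a.mul (x ⊗ₜ a.one) = x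
  diff_mul : a.diff ∘ₗ a.mul = a.mul ∘ₗ a.leib 1 a.diff a.diff
  comul_mem : ∀ {i x}, x ∈ a.gr i → a.comul x ∈ a.tensorGr a.toDiffMod i
  coassoc : (TensorProduct.assoc k A A A).toLinearMap ∘ₗ
    TensorProduct.map a.comul LinearMap.id ∘ₗ a.comul =
      TensorProduct.map LinearMap.id a.comul ∘ₗ a.comul
  cocomm : a.twist a.toDiffMod ∘ₗ a.comul = a.comul
  counit_deg : ∀ {i x}, x ∈ a.gr i → i ≠ 0 → a.counit x = 0
  counit_comul : (TensorProduct.lid k A).toLinearMap ∘ₗ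
    TensorProduct.map a.counit LinearMap.id ∘ₗ a.comul = LinearMap.id
  comul_diff : a.comul ∘ₗ a.diff = a.leib 1 a.diff a.diff ∘ₗ a.comul
  counit_diff : a.counit ∘ₗ a.diff = 0
  comul_mul : a.comul ∘ₗ a.mul = TensorProduct.map a.mul a.mul ∘ₗ
    mid a.toDiffMod a.toDiffMod ∘ₗ TensorProduct.map a.comul a.comul
  comul_one : a.comul a.one = a.one ⊗ₜ a.one
  counit_mul : ∀ x y, a.counit (a.mul (x ⊗ₜ y)) = a.counit x * a.counit y
  counit_one : a.counit a.one = 1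
  antipode : ∃ S ∈ homDeg a.toDiffMod a.toDiffMod 0,
    (∀ x, a.mul (TensorProduct.map S LinearMap.id (a.comul x)) = a.counit x • a.one) ∧
    (∀ x, a.mul (TensorProduct.map LinearMap.id S (a.comul x)) = a.counit x • a.one)

/-- `f` is a morphism of graded coaugmented coalgebras (the differentials and the products are
ignored). -/
structure IsGradedCoalgHom (a : BialgData k A) (b : BialgData k B) (f : A →ₗ[k] B) : Prop where
  deg : f ∈ homDeg a.toDiffMod b.toDiffMod 0
  comul : b.comul ∘ₗ f = TensorProduct.map f f ∘ₗ a.comul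
  counit : b.counit ∘ₗ f = a.counit
  one : f a.one = b.one

/-- `f` is a morphism of coaugmented dg coalgebras (the products are ignored). -/
structure IsCoalgHom (a : BialgData k A) (b : BialgData k B) (f : A →ₗ[k] B) : Prop
    extends IsGradedCoalgHom a b f where
  diff : b.diff ∘ₗ f = f ∘ₗ a.diff

/-- `f` is a morphism of dg bialgebras. -/
structure IsBialgHom (a : BialgData k A) (b : BialgData k B) (f : A →ₗ[k] B) : Prop
    extends IsCoalgHom a b f where
  mul : f ∘ₗ a.mul = b.mul ∘ₗ TensorProduct.map f f

/-- `a` is the bialgebra structure on the subspace `S` of the coalgebra `h` which is obtained by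
restricting the structure of `h` and the product `m`. -/
structure IsRestriction {H : Type w} [AddCommGroup H] [Module k H] (h : DCoalgData k H)
    (m : H ⊗[k] H →ₗ[k] H) (S : Submodule k H) (a : BialgData k S) : Prop where
  gr : ∀ i, a.gr i = (h.gr i).comap S.subtype
  diff : S.subtype ∘ₗ a.diff = h.diff ∘ₗ S.subtype
  mul : S.subtype ∘ₗ a.mul = m ∘ₗ TensorProduct.map S.subtype S.subtype
  one : (a.one : H) = h.one
  comul : TensorProduct.map S.subtype S.subtype ∘ₗ a.comul = h.comul ∘ₗ S.subtype
  counit : a.counit = h.counit ∘ₗ S.subtype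

end BialgData
end bialgebras

section env
open DiffMod
variable {k : Type u} [Field k] {g : Type v} [AddCommGroup g] [Module k g] (L : GLie k g)

namespace GLie

/-- The relations `x y = (-1)^(|x||y|) y x + [x, y]`. -/
inductive Rel : TensorAlgebra k g → TensorAlgebra k g → Prop
  | comm {i j : ℤ} {x y : g} (hx : x ∈ L.gr i) (hy : y ∈ L.gr j) :
    Rel (TensorAlgebra.ι k x * TensorAlgebra.ι k y)
      (ksign k (i * j) • (TensorAlgebra.ι k y * TensorAlgebra.ι k x) +
        TensorAlgebra.ι k (L.brk x y))

/-- The universal enveloping algebra of a graded Lie algebra. -/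
abbrev Env : Type (max u v) := RingQuot (Rel L)

/-- The canonical map to the enveloping algebra. -/
def ι : g →ₗ[k] Env L := (RingQuot.mkAlgHom k (Rel L)).toLinearMap ∘ₗ TensorAlgebra.ι k

theorem ι_mul_ι {i j : ℤ} {x y : g} (hx : x ∈ L.gr i) (hy : y ∈ L.gr j) :
    ι L x * ι L y = ksign k (i * j) • (ι L y * ι L x) + ι L (L.brk x y) := by
  have := RingQuot.mkAlgHom_rel k (Rel.comm (L := L) hx hy)
  simpa [ι] using this

/-- The universal property of the enveloping algebra. -/
def lift {B : Type*} [Semiring B] [Algebra k B] (f : g →ₗ[k] B)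
    (hf : ∀ i j x y, x ∈ L.gr i → y ∈ L.gr j →
      f x * f y = ksign k (i * j) • (f y * f x) + f (L.brk x y)) : Env L →ₐ[k] B :=
  RingQuot.liftAlgHom k ⟨TensorAlgebra.lift k f, by
    rintro _ _ ⟨hx, hy⟩
    simpa using hf _ _ _ _ hx hy⟩

theorem lift_ι {B : Type*} [Semiring B] [Algebra k B] (f : g →ₗ[k] B)
    (hf : ∀ i j x y, x ∈ L.gr i → y ∈ L.gr j →
      f x * f y = ksign k (i * j) • (f y * f x) + f (L.brk x y)) (x : g) :
    lift L f hf (ι L x) = f x := by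
  simp [lift, ι]

theorem env_hom_ext {B : Type*} [Semiring B] [Algebra k B] {f f' : Env L →ₐ[k] B}
    (h : ∀ x, f (ι L x) = f' (ι L x)) : f = f' := by
  apply RingQuot.ringQuot_ext'
  apply TensorAlgebra.hom_ext
  ext x
  exact h x

/-- Products of homogeneous generators, with their total degree. -/
inductive Mono : ℤ → Env L → Prop
  | one : Mono 0 1
  | cons {i n : ℤ} {x : g} {z : Env L} (hx : x ∈ L.gr i) (hz : Mono n z) :
    Mono (i + n) (ι L x * z)

theorem Mono.mul {i j : ℤ} {y z : Env L} (hy : Mono L i y) (hz : Mono L j z) :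
    Mono L (i + j) (y * z) := by
  induction hy with
  | one => simpa using hz
  | cons hx _ ih => rw [add_assoc, mul_assoc]; exact Mono.cons hx ih

/-- The grading of the enveloping algebra. -/
def envGr (n : ℤ) : Submodule k (Env L) := Submodule.span k {z | Mono L n z}

theorem ι_mem {i : ℤ} {x : g} (hx : x ∈ L.gr i) : ι L x ∈ envGr L i := by
  have := Mono.cons hx (Mono.one (L := L))
  rw [add_zero, mul_one] at this
  exact Submodule.subset_span this

instance envGr_gradedMonoid : SetLike.GradedMonoid (envGr L) where
  one_mem := Submodule.subset_span Mono.one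
  mul_mem i j y z hy hz := by
    have h : envGr L i * envGr L j ≤ envGr L (i + j) := by
      rw [envGr, envGr, Submodule.span_mul_span]
      refine Submodule.span_mono ?_
      rintro _ ⟨y, hy, z, hz, rfl⟩
      exact Mono.mul L hy hz
    exact h (Submodule.mul_mem_mul hy hz)

/-- The canonical map to the enveloping algebra, as a map to the direct sum of its homogeneous
parts. -/
def gι : g →ₗ[k] ⨁ n, envGr L n :=
  L.glue fun i => DirectSum.lof k ℤ (fun n => envGr L n) i ∘ₗ
    ((ι L).domRestrict (L.gr i)).codRestrict (envGr L i) fun x => ι_mem L x.2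

theorem gι_apply {i : ℤ} {x : g} (hx : x ∈ L.gr i) :
    gι L x = DirectSum.of (fun n => envGr L n) i ⟨ι L x, ι_mem L hx⟩ := by
  rw [gι, glue_apply _ _ hx]; rfl

theorem env_of_congr {i j : ℤ} (h : i = j) {y z : Env L} (hy : y ∈ envGr L i)
    (hz : z ∈ envGr L j) (hyz : y = z) :
    DirectSum.of (fun n => envGr L n) i ⟨y, hy⟩ = DirectSum.of (fun n => envGr L n) j ⟨z, hz⟩ := by
  subst h hyz; rfl

theorem gι_rel (i j : ℤ) (x y : g) (hx : x ∈ L.gr i) (hy : y ∈ L.gr j) :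
    gι L x * gι L y = ksign k (i * j) • (gι L y * gι L x) + gι L (L.brk x y) := by
  have hyx : ι L y * ι L x ∈ envGr L (i + j) := by
    rw [add_comm]; exact SetLike.GradedMonoid.toGradedMul.mul_mem (ι_mem L hy) (ι_mem L hx)
  have h2 : gι L y * gι L x = DirectSum.lof k ℤ (fun n => envGr L n) (i + j) ⟨_, hyx⟩ := by
    rw [gι_apply L hx, gι_apply L hy, DirectSum.of_mul_of]
    exact env_of_congr L (add_comm _ _) _ _ rfl
  rw [h2, gι_apply L hx, gι_apply L hy, gι_apply L (L.brk_mem hx hy), DirectSum.of_mul_of,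
    ← DirectSum.lof_eq_of k, ← DirectSum.lof_eq_of k, ← map_smul, ← map_add]
  congr 1
  exact Subtype.ext (ι_mul_ι L hx hy)

/-- The decomposition of the enveloping algebra into its homogeneous parts. -/
def decomp : Env L →ₐ[k] ⨁ n, envGr L n := lift L (gι L) (gι_rel L)

instance envGradedAlgebra : GradedAlgebra (envGr L) :=
  GradedAlgebra.ofAlgHom (envGr L) (decomp L)
    (by
      apply env_hom_ext
      intro x
      induction x using L.toDiffMod.induction with
      | hom i x hx =>
        rw [AlgHom.comp_apply, decomp, lift_ι, gι_apply L hx, DirectSum.coeAlgHom_of]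
        rfl
      | add x y h1 h2 => simp only [map_add, h1, h2])
    (by
      rintro i ⟨z, hz⟩
      have key : ∃ hz', decomp L z = DirectSum.of (fun n => envGr L n) i ⟨z, hz'⟩ := by
        induction hz using Submodule.span_induction with
        | mem z hz =>
          refine ⟨Submodule.subset_span hz, ?_⟩
          induction hz with
          | one => rw [map_one]; rfl
          | cons hx hz ih =>
            rw [map_mul, ih, decomp, lift_ι, gι_apply L hx, DirectSum.of_mul_of]
            rfl
        | zero => exact ⟨Submodule.zero_mem _, by rw [map_zero]; exact (map_zero _).symm⟩
        | add y z _ _ h1 h2 =>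
          obtain ⟨a, ha⟩ := h1
          obtain ⟨b, hb⟩ := h2
          refine ⟨Submodule.add_mem _ a b, ?_⟩
          rw [map_add, ha, hb, ← map_add]
          rfl
        | smul r z _ h1 =>
          obtain ⟨a, ha⟩ := h1
          refine ⟨Submodule.smul_mem _ r a, ?_⟩
          rw [map_smul, ha, ← DirectSum.lof_eq_of k, ← map_smul]
          rfl
      exact key.2)

/-- The matrix `(γ x, d x; 0, x)`, where `γ x = (-1)^|x| x`. -/
def diffMatι : g →ₗ[k] Matrix (Fin 2) (Fin 2) (Env L) where
  toFun x := !![ι L (L.sgn 1 x), ι L (L.diff x); 0, ι L x]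
  map_add' x y := by ext i j; fin_cases i <;> fin_cases j <;> simp
  map_smul' a x := by ext i j; fin_cases i <;> fin_cases j <;> simp

theorem diffMatι_rel (i j : ℤ) (x y : g) (hx : x ∈ L.gr i) (hy : y ∈ L.gr j) :
    diffMatι L x * diffMatι L y =
      ksign k (i * j) • (diffMatι L y * diffMatι L x) + diffMatι L (L.brk x y) := by
  have h1 := ι_mul_ι L hx hy
  have h2 := ι_mul_ι L (L.diff_mem hx) hy
  have h3 := ι_mul_ι L hx (L.diff_mem hy)
  have h4 := L.diff_brk hx y
  have e1 : ksign k ((i + 1) * j) = ksign k (i * j) * ksign k j := by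
    rw [← ksign_add]; congr 1; ring
  have e2 : ksign k (i * (j + 1)) = ksign k (i * j) * ksign k i := by
    rw [← ksign_add]; congr 1; ring
  have e3 := ksign_mul_self k i
  ext p q
  fin_cases p <;> fin_cases q <;>
    simp [diffMatι, L.sgn_apply _ hx, L.sgn_apply _ hy, L.sgn_apply _ (L.brk_mem hx hy)]
  · rw [h1, ksign_add]
    simp only [smul_add, smul_smul]
    congr 2
    ring
  · rw [h2, h3, h4, e1, e2]
    simp only [smul_add, smul_smul, map_add, map_smul]
    have e4 : ksign k i * (ksign k (i * j) * ksign k i) = ksign k (i * j) := by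
      linear_combination ksign k (i * j) * e3
    rw [e4]
    abel
  · exact h1

/-- The algebra map `x ↦ (γ x, d x; 0, x)`, used to extend the differential to a derivation of the
enveloping algebra. -/
def diffMat : Env L →ₐ[k] Matrix (Fin 2) (Fin 2) (Env L) := lift L (diffMatι L) (diffMatι_rel L)

theorem diffMat_mono {n : ℤ} {z : Env L} (hz : Mono L n z) :
    diffMat L z 0 0 = ksign k n • z ∧ diffMat L z 1 0 = 0 ∧ diffMat L z 1 1 = z ∧
      diffMat L z 0 1 ∈ envGr L (n + 1) := by
  induction hz with
  | one => simp [map_one]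
  | @cons i n x z hx hz ih =>
    obtain ⟨h1, h2, h3, h4⟩ := ih
    have hz' : z ∈ envGr L n := Submodule.subset_span hz
    have e : diffMat L (ι L x * z) = diffMatι L x * diffMat L z := by
      rw [map_mul, diffMat, lift_ι]
    rw [e]
    simp only [diffMatι, LinearMap.coe_mk, AddHom.coe_mk, Matrix.mul_apply, Fin.sum_univ_two,
      Matrix.of_apply, Matrix.cons_val', Matrix.cons_val_zero, Matrix.cons_val_one,
      Matrix.cons_val_fin_one, h1, h2, h3, L.sgn_apply _ hx, ksign_add, one_mul, map_smul,
      mul_zero, zero_mul, add_zero, zero_add, smul_mul_assoc, true_and]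
    refine ⟨by rw [mul_smul_comm, smul_smul],
      Submodule.add_mem (envGr L _) (Submodule.smul_mem (envGr L _) _ ?_) ?_⟩
    · have := SetLike.GradedMonoid.toGradedMul.mul_mem (ι_mem L hx) h4
      rwa [← add_assoc] at this
    · have := SetLike.GradedMonoid.toGradedMul.mul_mem (ι_mem L (L.diff_mem hx)) hz'
      rwa [add_right_comm] at this

/-- The derivation of the enveloping algebra which extends the differential. -/
def envDiff : Env L →ₗ[k] Env L :=
  (LinearMap.proj 1 ∘ₗ LinearMap.proj 0) ∘ₗ (diffMat L).toLinearMap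

/-- The map `x ↦ x ⊗ 1 + 1 ⊗ x` to the graded tensor product. -/
def comulι : g →ₗ[k] GradedTensorProduct k (envGr L) (envGr L) :=
  ((GradedTensorProduct.includeLeft (envGr L) (envGr L)).toLinearMap +
    (GradedTensorProduct.includeRight (envGr L) (envGr L)).toLinearMap) ∘ₗ ι L

theorem comulι_rel (i j : ℤ) (x y : g) (hx : x ∈ L.gr i) (hy : y ∈ L.gr j) :
    comulι L x * comulι L y =
      ksign k (i * j) • (comulι L y * comulι L x) + comulι L (L.brk x y) := by
  have cross : ∀ (i j : ℤ) (x y : g), x ∈ L.gr i → y ∈ L.gr j →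
      GradedTensorProduct.includeRight (envGr L) (envGr L) (ι L x) *
        GradedTensorProduct.includeLeft (envGr L) (envGr L) (ι L y) =
      ksign k (i * j) • (GradedTensorProduct.includeLeft (envGr L) (envGr L) (ι L y) *
        GradedTensorProduct.includeRight (envGr L) (envGr L) (ι L x)) := by
    intro i j x y hx hy
    have h := GradedTensorProduct.tmul_coe_mul_coe_tmul (R := k) (envGr L) (envGr L)
      1 (⟨ι L x, ι_mem L hx⟩ : envGr L i) (⟨ι L y, ι_mem L hy⟩ : envGr L j) 1
    have h' := GradedTensorProduct.tmul_one_mul_one_tmul (R := k) (envGr L) (envGr L)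
      (ι L y) (ι L x)
    rw [one_mul, mul_one] at h
    refine h.trans ?_
    refine Eq.trans ?_ (congrArg (fun t => ksign k (i * j) • t) h'.symm)
    rw [Units.smul_def, ksign, Int.cast_smul_eq_zsmul]
    rfl
  have e := ksign_mul_self k (i * j)
  have hl := congrArg (GradedTensorProduct.includeLeft (envGr L) (envGr L)) (ι_mul_ι L hx hy)
  have hr := congrArg (GradedTensorProduct.includeRight (envGr L) (envGr L)) (ι_mul_ι L hx hy)
  simp only [map_mul, map_add, map_smul] at hl hr
  simp only [comulι, LinearMap.comp_apply, LinearMap.add_apply, AlgHom.toLinearMap_apply,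
    mul_add, add_mul]
  rw [hl, hr, cross i j x y hx hy, cross j i y x hy hx, mul_comm j i]
  simp only [smul_add, smul_smul, e, one_smul]
  abel

/-- The coproduct of the enveloping algebra, as an algebra map to the graded tensor product. -/
def envComul : Env L →ₐ[k] GradedTensorProduct k (envGr L) (envGr L) :=
  lift L (comulι L) (comulι_rel L)

/-- The enveloping algebra as a dg bialgebra: the generators are primitive. -/
def envBialg : BialgData k (Env L) where
  gr := envGr L
  internal := DirectSum.Decomposition.isInternal _
  diff := envDiff L
  diff_mem := by
    intro n z hz
    induction hz using Submodule.span_induction with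
    | mem z hz => exact (diffMat_mono L hz).2.2.2
    | zero => rw [map_zero]; exact Submodule.zero_mem _
    | add y z _ _ h1 h2 => rw [map_add]; exact Submodule.add_mem _ h1 h2
    | smul r z _ h1 => rw [map_smul]; exact Submodule.smul_mem _ _ h1
  mul := LinearMap.mul' k (Env L)
  one := 1
  comul := (GradedTensorProduct.of k (envGr L) (envGr L)).symm.toLinearMap ∘ₗ
    (envComul L).toLinearMap
  counit := (lift L (0 : g →ₗ[k] k) (fun _ _ _ _ _ _ => by simp)).toLinearMap

/-- The product `x 0 * x 1 * ... * x (n - 1)` in the enveloping algebra. -/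
def mono {n : ℕ} (x : Fin n → g) : Env L := (List.ofFn fun i => ι L (x i)).prod

/-- The span of the products of fewer than `n` generators. -/
def filtLT (n : ℕ) : Submodule k (Env L) :=
  Submodule.span k {z | ∃ m < n, ∃ x : Fin m → g, z = mono L x}

/-- The Koszul sign of the reordering `x 0, x 1, ... ↦ x (s 0), x (s 1), ...` of homogeneous
elements of degrees `e 0, e 1, ...`. -/
def permSign (k : Type u) [Field k] {n : ℕ} (e : Fin n → ℤ) (s : Equiv.Perm (Fin n)) : k :=
  ∏ q : Fin n × Fin n with q.1 < q.2 ∧ s q.2 < s q.1, ksign k (e (s q.1) * e (s q.2))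

/-- The graded symmetrization of the product of elements `x i` of degrees `e i`: the value at
`x 0 ⋯ x (n - 1)` of the Poincaré–Birkhoff–Witt isomorphism `S(g) → U(g)`. -/
def pbw {n : ℕ} (e : Fin n → ℤ) (x : Fin n → g) : Env L :=
  (n.factorial : k)⁻¹ • ∑ s : Equiv.Perm (Fin n), permSign k e s • mono L (x ∘ s)

end GLie

/-- The graded symmetric algebra `S(X)`, i.e. the enveloping algebra of the abelian Lie
algebra `X`. As a coalgebra (with the elements of `X` primitive) it is the cofree coproartinian
cocommutative coalgebra cogenerated by `X`, in characteristic zero. -/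
abbrev DiffMod.Sym (c : DiffMod k g) : Type (max u v) := c.abelian.Env

/-- The dg bialgebra structure of `S(X)`. -/
abbrev DiffMod.symBialg (c : DiffMod k g) : BialgData k c.Sym := c.abelian.envBialg

end env
end DefHopf

end

open DefHopf

open scoped TensorProduct DirectSum

noncomputable section

namespace DefHopf
open DiffMod DCoalgData
open LinearMap (comp_apply comp_assoc comp_id id_comp comp_add add_comp smul_comp comp_smul
  comp_sub sub_comp comp_zero id_apply toSpanSingleton)
open TensorProduct (map_tmul tmul_add add_tmul tmul_smul smul_tmul' map_map map_comp map_id lid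
  rid assoc assoc_tmul tmul_zero zero_tmul induction_on ext')

section signs
variable {k : Type u} [Field k]

theorem ksign_congr {m n : ℤ} (h : (m : ZMod 2) = n) : ksign k m = ksign k n := by
  have h2 : Even (m - n) := by
    rw [← ZMod.intCast_eq_zero_iff_even]
    push_cast
    rw [h, sub_self]
  have : m = n + (m - n) := by ring
  rw [this, ksign_add]
  nth_rewrite 2 [ksign]
  rw [Int.negOnePow_even _ h2]
  simp

theorem zmod_two_mul_self (a : ZMod 2) : a * a = a := by
  revert a; decide

theorem ksign_add_eq_zero {m n : ℤ} (h : (m : ZMod 2) = n + 1) : ksign k m + ksign k n = 0 := by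
  rw [show ksign k m = ksign k (n + 1) from ksign_congr (by rw [h]; push_cast; rfl), ksign_add]
  simp

theorem ksign_neg (m : ℤ) : -ksign k m = ksign k (m + 1) := by simp [ksign_add]

theorem ksign_smul_smul {M : Type*} [AddCommGroup M] [Module k M] (m : ℤ) (x : M) :
    ksign k m • ksign k m • x = x := by
  rw [smul_smul, ksign_mul_self, one_smul]

end signs

section ext
variable {k : Type u} [Field k] {V : Type*} [AddCommGroup V] [Module k V]
  {W : Type*} [AddCommGroup W] [Module k W] {M : Type*} [AddCommGroup M] [Module k M]

theorem DiffMod.tensor_hom_ext (c : DiffMod k V) (c' : DiffMod k W) {f g : V ⊗[k] W →ₗ[k] M}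
    (h : ∀ i j x y, x ∈ c.gr i → y ∈ c'.gr j → f (x ⊗ₜ y) = g (x ⊗ₜ y)) : f = g := by
  apply TensorProduct.ext
  refine c.hom_ext fun i x hx => c'.hom_ext fun j y hy => h i j x y hx hy

/-- Induction on homogeneous pure tensors. -/
theorem DiffMod.tensor_induction (c : DiffMod k V) (c' : DiffMod k W) {P : V ⊗[k] W → Prop}
    (z : V ⊗[k] W) (tmul : ∀ i j x y, x ∈ c.gr i → y ∈ c'.gr j → P (x ⊗ₜ y))
    (add : ∀ x y, P x → P y → P (x + y)) : P z := by
  induction z using induction_on with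
  | zero => simpa using tmul 0 0 0 0 (Submodule.zero_mem _) (Submodule.zero_mem _)
  | tmul x y =>
    induction x using c.induction with
    | hom i x hx =>
      induction y using c'.induction with
      | hom j y hy => exact tmul i j x y hx hy
      | add y y' h1 h2 => rw [tmul_add]; exact add _ _ h1 h2
    | add x x' h1 h2 => rw [add_tmul]; exact add _ _ h1 h2
  | add x y h1 h2 => exact add x y h1 h2

theorem DiffMod.mem_unique (c : DiffMod k V) {i j : ℤ} {x : V} (hi : x ∈ c.gr i)
    (hj : x ∈ c.gr j) (hij : i ≠ j) : x = 0 :=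
  Submodule.disjoint_def.1 (c.internal.submodule_iSupIndep.pairwiseDisjoint hij) x hi hj

/-- The projection to the part of degree `a`. -/
def DiffMod.proj (c : DiffMod k V) (a : ℤ) : V →ₗ[k] V :=
  c.glue fun i => if i = a then (c.gr i).subtype else 0

theorem DiffMod.proj_of_mem (c : DiffMod k V) {a : ℤ} {x : V} (hx : x ∈ c.gr a) :
    c.proj a x = x := by
  rw [proj, glue_apply c _ hx]; simp

theorem DiffMod.proj_of_ne (c : DiffMod k V) {a i : ℤ} {x : V} (hx : x ∈ c.gr i) (h : i ≠ a) :
    c.proj a x = 0 := by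
  rw [proj, glue_apply c _ hx]; simp [h]

theorem DiffMod.proj_mem (c : DiffMod k V) (a : ℤ) (x : V) : c.proj a x ∈ c.gr a := by
  induction x using c.induction with
  | hom i x hx =>
    by_cases h : i = a
    · subst h; rwa [c.proj_of_mem hx]
    · rw [c.proj_of_ne hx h]; exact Submodule.zero_mem _
  | add x y h1 h2 => rw [map_add]; exact Submodule.add_mem _ h1 h2

theorem DiffMod.exists_sum_proj (c : DiffMod k V) (x : V) :
    ∃ s : Finset ℤ, x = ∑ a ∈ s, c.proj a x := by
  classical
  let := c.internal.chooseDecomposition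
  have key : ∀ a y, c.proj a y = (DirectSum.decompose c.gr y a : V) := by
    intro a y
    induction y using c.induction with
    | hom i y hy =>
      by_cases hi : i = a
      · subst hi; rw [c.proj_of_mem hy, DirectSum.decompose_of_mem_same _ hy]
      · rw [c.proj_of_ne hy hi, DirectSum.decompose_of_mem_ne _ hy hi]
    | add y z h1 h2 => rw [map_add, h1, h2]; simp
  refine ⟨(DirectSum.decompose c.gr x).support, ?_⟩
  simp only [key]
  exact (DirectSum.sum_support_decompose c.gr x).symm

theorem DiffMod.proj_ext (c : DiffMod k V) {x : V} (h : ∀ a, c.proj a x = 0) : x = 0 := by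
  obtain ⟨s, hs⟩ := c.exists_sum_proj x
  rw [hs]
  exact Finset.sum_eq_zero fun a _ => h a

/-- A family of functionals separates the points. -/
def Separating (P : Set (Module.Dual k V)) : Prop := ∀ x, (∀ φ ∈ P, φ x = 0) → x = 0

theorem Separating.ext {P : Set (Module.Dual k V)} (hP : Separating P) {f g : M →ₗ[k] V}
    (h : ∀ φ ∈ P, φ ∘ₗ f = φ ∘ₗ g) : f = g := by
  ext x
  rw [← sub_eq_zero]
  refine hP _ fun φ hφ => ?_
  rw [map_sub, sub_eq_zero]
  exact LinearMap.congr_fun (h φ hφ) x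

/-- The exterior product of functionals. -/
def dtmul (φ : Module.Dual k V) (ψ : Module.Dual k W) : Module.Dual k (V ⊗[k] W) :=
  LinearMap.mul' k k ∘ₗ TensorProduct.map φ ψ

infixl:75 " ⊠ " => dtmul

@[simp] theorem dtmul_tmul (φ : Module.Dual k V) (ψ : Module.Dual k W) (x : V) (y : W) :
    (φ ⊠ ψ) (x ⊗ₜ y) = φ x * ψ y := by simp [dtmul]

theorem dtmul_add_left (φ φ' : Module.Dual k V) (ψ : Module.Dual k W) :
    (φ + φ') ⊠ ψ = φ ⊠ ψ + φ' ⊠ ψ := by ext; simp [add_mul]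

theorem dtmul_add_right (φ : Module.Dual k V) (ψ ψ' : Module.Dual k W) :
    φ ⊠ (ψ + ψ') = φ ⊠ ψ + φ ⊠ ψ' := by ext; simp [mul_add]

theorem dtmul_smul_left (a : k) (φ : Module.Dual k V) (ψ : Module.Dual k W) :
    (a • φ) ⊠ ψ = a • (φ ⊠ ψ) := by ext; simp [mul_assoc]

theorem dtmul_smul_right (a : k) (φ : Module.Dual k V) (ψ : Module.Dual k W) :
    φ ⊠ (a • ψ) = a • (φ ⊠ ψ) := by ext; simp [mul_left_comm]

theorem dtmul_zero_left (ψ : Module.Dual k W) : (0 : Module.Dual k V) ⊠ ψ = 0 := by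
  ext; simp

theorem dtmul_zero_right (φ : Module.Dual k V) : φ ⊠ (0 : Module.Dual k W) = 0 := by
  ext; simp

theorem dtmul_comp_map {V' W' : Type*} [AddCommGroup V'] [Module k V'] [AddCommGroup W']
    [Module k W'] (φ : Module.Dual k V) (ψ : Module.Dual k W) (f : V' →ₗ[k] V) (g : W' →ₗ[k] W) :
    (φ ⊠ ψ) ∘ₗ TensorProduct.map f g = (φ ∘ₗ f) ⊠ (ψ ∘ₗ g) := by ext; simp

theorem Separating.dtmul {P : Set (Module.Dual k V)} {P' : Set (Module.Dual k W)}
    (hP : Separating P) (hP' : Separating P') : Separating (Set.image2 dtmul P P') := by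
  intro z hz
  have h1 : ∀ φ ∈ P, (lid k W) (TensorProduct.map φ LinearMap.id z) = 0 := by
    intro φ hφ
    refine hP' _ fun ψ hψ => ?_
    rw [← hz _ (Set.mem_image2_of_mem hφ hψ)]
    induction z using induction_on with
    | zero => simp
    | tmul x y => simp
    | add x y h1 h2 =>
      clear h1 h2 hz
      have : ψ ∘ₗ (lid k W).toLinearMap ∘ₗ TensorProduct.map φ LinearMap.id =
          φ ⊠ ψ := by ext; simp
      exact LinearMap.congr_fun this (x + y)
  classical
  let b := Module.Basis.ofVectorSpace k W
  let e := TensorProduct.equivFinsuppOfBasisRight (M := V) b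
  rw [← e.map_eq_zero_iff]
  ext i
  refine hP _ fun φ hφ => ?_
  have : (b.coord i) ((lid k W) (TensorProduct.map φ LinearMap.id z)) =
      φ (e z i) := by
    clear h1 hz
    induction z using induction_on with
    | zero => simp
    | tmul x y =>
      simp [e, mul_comm]
    | add x y h1 h2 => simp only [map_add, h1, h2, Finsupp.add_apply]
  rw [← this, h1 φ hφ, map_zero]

/-- Functionals which vanish outside degree `a`. -/
def DiffMod.dualDeg (c : DiffMod k V) (a : ℤ) : Submodule k (Module.Dual k V) where
  carrier := {φ | ∀ i x, x ∈ c.gr i → i ≠ a → φ x = 0}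
  add_mem' h1 h2 i x hx hi := by simp [h1 i x hx hi, h2 i x hx hi]
  zero_mem' _ _ _ _ := rfl
  smul_mem' r _ h1 i x hx hi := by simp [h1 i x hx hi]

theorem DiffMod.separating_dualDeg (c : DiffMod k V) :
    Separating {φ : Module.Dual k V | ∃ a, φ ∈ c.dualDeg a} := by
  intro x hx
  refine c.proj_ext fun a => ?_
  rw [← Module.forall_dual_apply_eq_zero_iff k]
  intro φ
  refine hx (φ ∘ₗ c.proj a) ⟨a, fun i y hy hi => ?_⟩
  rw [comp_apply, c.proj_of_ne hy hi, map_zero]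

theorem DiffMod.dtmul_mem_dualDeg (c : DiffMod k V) (c' : DiffMod k W) {a b : ℤ}
    {φ : Module.Dual k V} {ψ : Module.Dual k W} (hφ : φ ∈ c.dualDeg a) (hψ : ψ ∈ c'.dualDeg b) :
    φ ⊠ ψ ∈ (c.tensor c').dualDeg (a + b) := by
  intro n z hz hn
  refine tensorGr_induction (P := fun z => (φ ⊠ ψ) z = 0) c c' z hz ?_ (map_zero _) ?_
  · intro i j x y hx hy h
    rw [dtmul_tmul]
    by_cases hi : i = a
    · rw [hψ j y hy (by omega), mul_zero]
    · rw [hφ i x hx hi, zero_mul]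
  · intro x y h1 h2
    rw [map_add, h1, h2, add_zero]

theorem DiffMod.dtmul_twist (c : DiffMod k V) (c' : DiffMod k W) {a b : ℤ}
    {φ : Module.Dual k W} {ψ : Module.Dual k V} (hφ : φ ∈ c'.dualDeg a) (hψ : ψ ∈ c.dualDeg b) :
    (φ ⊠ ψ) ∘ₗ c.twist c' = ksign k (a * b) • (ψ ⊠ φ) := by
  refine DiffMod.tensor_hom_ext c c' fun i j x y hx hy => ?_
  rw [comp_apply, twist_apply c c' hx hy, map_smul, dtmul_tmul, LinearMap.smul_apply,
    dtmul_tmul]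
  by_cases hj : j = a
  · by_cases hi : i = b
    · subst hi hj; simp only [smul_eq_mul]; rw [mul_comm i j, mul_comm (φ y)]
    · simp [hψ i x hx hi]
  · simp [hφ j y hy hj]

theorem DiffMod.dualDeg_comp_sgn (c : DiffMod k V) (n : ℤ) {a : ℤ} {φ : Module.Dual k V}
    (hφ : φ ∈ c.dualDeg a) : φ ∘ₗ c.sgn n = ksign k (n * a) • φ := by
  refine c.hom_ext fun i x hx => ?_
  rw [comp_apply, c.sgn_apply n hx, map_smul, LinearMap.smul_apply]
  by_cases hi : i = a
  · rw [hi]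
  · simp [hφ i x hx hi]

theorem DiffMod.dualDeg_comp (c : DiffMod k V) (c' : DiffMod k W) {n a b : ℤ} {f : V →ₗ[k] W}
    (hf : f ∈ homDeg c c' n) {φ : Module.Dual k W} (hφ : φ ∈ c'.dualDeg a) (h : b + n = a) :
    φ ∘ₗ f ∈ c.dualDeg b := by
  intro i x hx hi
  exact hφ _ _ (hf i x hx) (by omega)

theorem DiffMod.mid_tmul (c : DiffMod k V) (c' : DiffMod k W) {i j : ℤ} (x : V) {x' : V} {y : W}
    (y' : W) (hx : x' ∈ c.gr i) (hy : y ∈ c'.gr j) :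
    mid c c' ((x ⊗ₜ x') ⊗ₜ (y ⊗ₜ y')) = ksign k (i * j) • ((x ⊗ₜ[k] y) ⊗ₜ[k] (x' ⊗ₜ[k] y')) := by
  simp only [mid, comp_apply, LinearEquiv.coe_coe, assoc_tmul,
    map_tmul, id_apply, TensorProduct.assoc_symm_tmul,
    twist_apply c c' hx hy, map_smul, tmul_smul, ← smul_tmul']

theorem DiffMod.dtmul_mid (c : DiffMod k V) (c' : DiffMod k W) {a b : ℤ}
    (φ : Module.Dual k V) {φ' : Module.Dual k W} {ψ : Module.Dual k V} (ψ' : Module.Dual k W)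
    (hφ' : φ' ∈ c'.dualDeg a) (hψ : ψ ∈ c.dualDeg b) :
    ((φ ⊠ φ') ⊠ (ψ ⊠ ψ')) ∘ₗ mid c c' = ksign k (a * b) • ((φ ⊠ ψ) ⊠ (φ' ⊠ ψ')) := by
  apply ext'
  intro s t
  induction s using c.tensor_induction c with
  | add s s' h1 h2 => rw [add_tmul, map_add, map_add, h1, h2]
  | tmul i j x x' hx hx' =>
    induction t using c'.tensor_induction c' with
    | add s s' h1 h2 => rw [tmul_add, map_add, map_add, h1, h2]
    | tmul i' j' y y' hy hy' =>
      rw [comp_apply, mid_tmul c c' x y' hx' hy, map_smul]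
      simp only [dtmul_tmul, LinearMap.smul_apply, smul_eq_mul]
      by_cases hj : j = b
      · by_cases hi : i' = a
        · subst hi hj; rw [mul_comm i' j]; ring
        · simp [hφ' i' y hy hi]
      · simp [hψ j x' hx' hj]

theorem DiffMod.dtmul_leib (c : DiffMod k V) (n : ℤ) (D : V →ₗ[k] V)
    (D' : W →ₗ[k] W) {a : ℤ} {φ : Module.Dual k V} (hφ : φ ∈ c.dualDeg a) (ψ : Module.Dual k W) :
    (φ ⊠ ψ) ∘ₗ c.leib n D D' = (φ ∘ₗ D) ⊠ ψ + ksign k (n * a) • (φ ⊠ (ψ ∘ₗ D')) := by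
  rw [leib, comp_add, dtmul_comp_map, dtmul_comp_map, dualDeg_comp_sgn c n hφ,
    dtmul_smul_left, comp_id]

end ext

section dual
variable {k : Type u} [Field k] {W : Type v} [AddCommGroup W] [Module k W]
  {W' : Type w} [AddCommGroup W'] [Module k W']

theorem dtmul_assoc_symm {U : Type*} [AddCommGroup U] [Module k U] (φ : Module.Dual k W)
    (ψ : Module.Dual k W') (χ : Module.Dual k U) :
    (φ ⊠ ψ ⊠ χ) ∘ₗ (assoc k W W' U).symm.toLinearMap = φ ⊠ (ψ ⊠ χ) := by
  ext; simp [mul_assoc]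

theorem dtmul_assoc {U : Type*} [AddCommGroup U] [Module k U] (φ : Module.Dual k W)
    (ψ : Module.Dual k W') (χ : Module.Dual k U) :
    (φ ⊠ (ψ ⊠ χ)) ∘ₗ (assoc k W W' U).toLinearMap = φ ⊠ ψ ⊠ χ := by
  ext; simp [mul_assoc]

theorem dtmul_swap23 (c : DiffMod k W) {b e : ℤ} (φ : Module.Dual k W) {ψ χ : Module.Dual k W}
    (hψ : ψ ∈ c.dualDeg b) (hχ : χ ∈ c.dualDeg e) :
    (φ ⊠ ψ ⊠ χ) ∘ₗ swap23 c = ksign k (b * e) • (φ ⊠ χ ⊠ ψ) := by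
  rw [swap23, ← comp_assoc, dtmul_assoc_symm, ← comp_assoc, dtmul_comp_map,
    dtmul_twist c c hψ hχ, comp_id, dtmul_smul_right, smul_comp, dtmul_assoc]

theorem dtmul_cyc (c : DiffMod k W) {a b e : ℤ} {φ ψ χ : Module.Dual k W}
    (hφ : φ ∈ c.dualDeg a) (hψ : ψ ∈ c.dualDeg b) (hχ : χ ∈ c.dualDeg e) :
    (φ ⊠ ψ ⊠ χ) ∘ₗ cyc c = ksign k (a * (b + e)) • (ψ ⊠ χ ⊠ φ) := by
  rw [cyc, ← comp_assoc, dtmul_comp_map, dtmul_twist c c hφ hψ, comp_id,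
    dtmul_smul_left, smul_comp, dtmul_swap23 c _ hφ hχ, smul_smul, ← ksign_add, mul_add]

theorem dtmul_cyc_sum (c : DiffMod k W) {a b e : ℤ} {φ ψ χ : Module.Dual k W}
    (hφ : φ ∈ c.dualDeg a) (hψ : ψ ∈ c.dualDeg b) (hχ : χ ∈ c.dualDeg e) :
    (φ ⊠ ψ ⊠ χ) ∘ₗ (LinearMap.id + cyc c + cyc c ∘ₗ cyc c) =
      φ ⊠ ψ ⊠ χ + ksign k (a * (b + e)) • (ψ ⊠ χ ⊠ φ) + ksign k (e * (a + b)) • (χ ⊠ φ ⊠ ψ) := by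
  rw [comp_add, comp_add, comp_id, ← comp_assoc,
    dtmul_cyc c hφ hψ hχ, smul_comp, dtmul_cyc c hψ hχ hφ, smul_smul, ← ksign_add]
  congr 2
  exact ksign_congr (by push_cast; grind)

namespace DCoalgData
variable (c : DCoalgData k W)

/-- The product of functionals dual to the coproduct. -/
def dmul (φ ψ : Module.Dual k W) : Module.Dual k W := (φ ⊠ ψ) ∘ₗ c.comul

/-- The bracket of functionals dual to the cobracket. -/
def dbr (φ ψ : Module.Dual k W) : Module.Dual k W := (φ ⊠ ψ) ∘ₗ c.cobr

theorem dmul_smul_left (a : k) (φ ψ : Module.Dual k W) :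
    c.dmul (a • φ) ψ = a • c.dmul φ ψ := by
  rw [dmul, dtmul_smul_left, smul_comp, dmul]

theorem dmul_smul_right (a : k) (φ ψ : Module.Dual k W) :
    c.dmul φ (a • ψ) = a • c.dmul φ ψ := by
  rw [dmul, dtmul_smul_right, smul_comp, dmul]

theorem dmul_add_left (φ φ' ψ : Module.Dual k W) :
    c.dmul (φ + φ') ψ = c.dmul φ ψ + c.dmul φ' ψ := by
  rw [dmul, dtmul_add_left, add_comp, dmul, dmul]

theorem dmul_add_right (φ ψ ψ' : Module.Dual k W) :
    c.dmul φ (ψ + ψ') = c.dmul φ ψ + c.dmul φ ψ' := by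
  rw [dmul, dtmul_add_right, add_comp, dmul, dmul]

theorem dbr_smul_left (a : k) (φ ψ : Module.Dual k W) :
    c.dbr (a • φ) ψ = a • c.dbr φ ψ := by
  rw [dbr, dtmul_smul_left, smul_comp, dbr]

theorem dbr_smul_right (a : k) (φ ψ : Module.Dual k W) :
    c.dbr φ (a • ψ) = a • c.dbr φ ψ := by
  rw [dbr, dtmul_smul_right, smul_comp, dbr]

theorem dbr_add_left (φ φ' ψ : Module.Dual k W) :
    c.dbr (φ + φ') ψ = c.dbr φ ψ + c.dbr φ' ψ := by
  rw [dbr, dtmul_add_left, add_comp, dbr, dbr]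

theorem dbr_add_right (φ ψ ψ' : Module.Dual k W) :
    c.dbr φ (ψ + ψ') = c.dbr φ ψ + c.dbr φ ψ' := by
  rw [dbr, dtmul_add_right, add_comp, dbr, dbr]

section translate
variable (φ ψ χ : Module.Dual k W)

theorem dtmul_comul_left : (φ ⊠ ψ ⊠ χ) ∘ₗ TensorProduct.map c.comul LinearMap.id ∘ₗ c.comul =
    c.dmul (c.dmul φ ψ) χ := by
  rw [← comp_assoc, dtmul_comp_map]; rfl

theorem dtmul_comul_right :
    (φ ⊠ (ψ ⊠ χ)) ∘ₗ TensorProduct.map LinearMap.id c.comul ∘ₗ c.comul =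
      c.dmul φ (c.dmul ψ χ) := by
  rw [← comp_assoc, dtmul_comp_map]; rfl

theorem dtmul_cobr_left : (φ ⊠ ψ ⊠ χ) ∘ₗ TensorProduct.map c.cobr LinearMap.id ∘ₗ c.cobr =
    c.dbr (c.dbr φ ψ) χ := by
  rw [← comp_assoc, dtmul_comp_map]; rfl

theorem dtmul_comul_cobr : (φ ⊠ ψ ⊠ χ) ∘ₗ TensorProduct.map c.comul LinearMap.id ∘ₗ c.cobr =
    c.dbr (c.dmul φ ψ) χ := by
  rw [← comp_assoc, dtmul_comp_map]; rfl

theorem dtmul_cobr_comul : (φ ⊠ ψ ⊠ χ) ∘ₗ TensorProduct.map c.cobr LinearMap.id ∘ₗ c.comul =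
    c.dmul (c.dbr φ ψ) χ := by
  rw [← comp_assoc, dtmul_comp_map]; rfl

theorem dtmul_sgn_cobr {a : ℤ} (n : ℤ) (hφ : φ ∈ c.dualDeg a) :
    (φ ⊠ (ψ ⊠ χ)) ∘ₗ TensorProduct.map (c.sgn n) c.cobr ∘ₗ c.comul =
      ksign k (n * a) • c.dmul φ (c.dbr ψ χ) := by
  rw [← comp_assoc, dtmul_comp_map, dualDeg_comp_sgn c.toDiffMod n hφ, ← dmul_smul_left]
  rfl

theorem dtmul_leib_comul {a : ℤ} (n : ℤ) (D D' : W →ₗ[k] W) (hφ : φ ∈ c.dualDeg a) :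
    (φ ⊠ ψ) ∘ₗ c.leib n D D' ∘ₗ c.comul =
      c.dmul (φ ∘ₗ D) ψ + ksign k (n * a) • c.dmul φ (ψ ∘ₗ D') := by
  rw [← comp_assoc, dtmul_leib c.toDiffMod n D D' hφ, add_comp,
    smul_comp]
  rfl

theorem dtmul_leib_cobr {a : ℤ} (n : ℤ) (D D' : W →ₗ[k] W) (hφ : φ ∈ c.dualDeg a) :
    (φ ⊠ ψ) ∘ₗ c.leib n D D' ∘ₗ c.cobr =
      c.dbr (φ ∘ₗ D) ψ + ksign k (n * a) • c.dbr φ (ψ ∘ₗ D') := by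
  rw [← comp_assoc, dtmul_leib c.toDiffMod n D D' hφ, add_comp,
    smul_comp]
  rfl


theorem dtmul_counit (T : W →ₗ[k] W ⊗[k] W) :
    ψ ∘ₗ (lid k W).toLinearMap ∘ₗ TensorProduct.map c.counit LinearMap.id ∘ₗ T =
      (c.counit ⊠ ψ) ∘ₗ T := by
  have : ψ ∘ₗ (lid k W).toLinearMap ∘ₗ
      TensorProduct.map c.counit LinearMap.id = c.counit ⊠ ψ := by ext; simp
  rw [← this]; rfl

end translate

namespace IsDCoalgebra
variable {c} {d : ℤ} (hc : c.IsDCoalgebra d) {a b e : ℤ} {φ ψ χ : Module.Dual k W}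
include hc

theorem counit_mem_dualDeg : c.counit ∈ c.dualDeg 0 := fun _ _ hx hi => hc.counit_deg hx hi

theorem dmul_mem (hφ : φ ∈ c.dualDeg a) (hψ : ψ ∈ c.dualDeg b) :
    c.dmul φ ψ ∈ c.dualDeg (a + b) := fun i _ hx hi =>
  dtmul_mem_dualDeg c.toDiffMod c.toDiffMod hφ hψ i _ (hc.comul_mem hx) hi

theorem dbr_mem (hφ : φ ∈ c.dualDeg a) (hψ : ψ ∈ c.dualDeg b) :
    c.dbr φ ψ ∈ c.dualDeg (a + b + d - 1) := fun i _ hx hi =>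
  dtmul_mem_dualDeg c.toDiffMod c.toDiffMod hφ hψ _ _ (hc.cobr_mem hx) (by omega)

theorem dmul_assoc (φ ψ χ : Module.Dual k W) :
    c.dmul (c.dmul φ ψ) χ = c.dmul φ (c.dmul ψ χ) := by
  rw [← dtmul_comul_left, ← dtmul_comul_right, ← hc.coassoc, ← dtmul_assoc]
  rfl

theorem dmul_comm (hφ : φ ∈ c.dualDeg a) (hψ : ψ ∈ c.dualDeg b) :
    c.dmul φ ψ = ksign k (a * b) • c.dmul ψ φ := by
  rw [dmul, ← hc.cocomm, ← comp_assoc, dtmul_twist c.toDiffMod c.toDiffMod hφ hψ]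
  rfl

theorem dbr_comm (hφ : φ ∈ c.dualDeg a) (hψ : ψ ∈ c.dualDeg b) :
    c.dbr φ ψ = ksign k (a * b + d) • c.dbr ψ φ := by
  have h : c.cobr = ksign k d • (c.twist c.toDiffMod ∘ₗ c.cobr) := by
    rw [hc.cobr_symm, smul_smul, ksign_mul_self, one_smul]
  rw [dbr, h, comp_smul, ← comp_assoc,
    dtmul_twist c.toDiffMod c.toDiffMod hφ hψ, smul_comp, smul_smul, add_comm, ksign_add]
  rfl

theorem dbr_jacobi (hφ : φ ∈ c.dualDeg a) (hψ : ψ ∈ c.dualDeg b) (hχ : χ ∈ c.dualDeg e) :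
    c.dbr (c.dbr φ ψ) χ + ksign k (a * (b + e)) • c.dbr (c.dbr ψ χ) φ +
      ksign k (e * (a + b)) • c.dbr (c.dbr χ φ) ψ = 0 := by
  have h : (LinearMap.id + cyc c.toDiffMod + cyc c.toDiffMod ∘ₗ cyc c.toDiffMod) ∘ₗ
      TensorProduct.map c.cobr LinearMap.id ∘ₗ c.cobr = 0 := LinearMap.ext hc.cojacobi
  have h3 := congrArg (fun T => (φ ⊠ ψ ⊠ χ) ∘ₗ T) h
  simp only [comp_zero] at h3
  rwa [← comp_assoc, dtmul_cyc_sum c.toDiffMod hφ hψ hχ, add_comp, add_comp, smul_comp,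
    smul_comp, dtmul_cobr_left, dtmul_cobr_left, dtmul_cobr_left] at h3

theorem dbr_leibniz (hφ : φ ∈ c.dualDeg a) (hψ : ψ ∈ c.dualDeg b) (hχ : χ ∈ c.dualDeg e) :
    c.dbr (c.dmul φ ψ) χ = ksign k ((1 - d) * a) • c.dmul φ (c.dbr ψ χ) +
      ksign k (b * e) • c.dmul (c.dbr φ χ) ψ := by
  rw [← dtmul_comul_cobr, hc.coleibniz, comp_add, ← comp_assoc,
    dtmul_assoc_symm, dtmul_sgn_cobr c φ ψ χ _ hφ, ← comp_assoc,
    dtmul_swap23 c.toDiffMod φ hψ hχ, smul_comp, dtmul_cobr_comul]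

theorem counit_dmul (φ : Module.Dual k W) : c.dmul c.counit φ = φ := by
  rw [dmul, ← dtmul_counit, hc.counit_comul, comp_id]

theorem dmul_counit (φ : Module.Dual k W) : c.dmul φ c.counit = φ := by
  refine c.hom_ext fun i x hx => ?_
  have h : ∀ φ : Module.Dual k W, φ x = (φ ∘ₗ c.proj i) x := fun φ => by
    rw [comp_apply, c.proj_of_mem hx]
  have h1 : φ ∘ₗ c.proj i ∈ c.dualDeg i := fun j y hy hj => by
    rw [comp_apply, c.proj_of_ne hy hj, map_zero]
  have h2 : c.dmul φ c.counit x = c.dmul (φ ∘ₗ c.proj i) c.counit x := by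
    refine tensorGr_induction (P := fun z => (φ ⊠ c.counit) z = ((φ ∘ₗ c.proj i) ⊠ c.counit) z)
      _ _ _ (hc.comul_mem hx) ?_ (by simp) ?_
    · intro p q x y hx hy hpq
      simp only [dtmul_tmul]
      by_cases hq : q = 0
      · rw [comp_apply, c.proj_of_mem (by convert hx; omega)]
      · rw [hc.counit_deg hy hq, mul_zero, mul_zero]
    · intro y z hy hz; rw [map_add, map_add, hy, hz]
  rw [h2, hc.dmul_comm h1 hc.counit_mem_dualDeg, counit_dmul hc, mul_zero, ksign_zero, one_smul,
    ← h]

theorem counit_dbr (φ : Module.Dual k W) : c.dbr c.counit φ = 0 := by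
  rw [dbr, ← dtmul_counit, hc.counit_cobr, comp_zero]

theorem dmul_diff (hφ : φ ∈ c.dualDeg a) (ψ : Module.Dual k W) :
    c.dmul φ ψ ∘ₗ c.diff = c.dmul (φ ∘ₗ c.diff) ψ + ksign k a • c.dmul φ (ψ ∘ₗ c.diff) := by
  rw [dmul, comp_assoc, hc.diff_coder.comul, dtmul_leib_comul c φ ψ 1 _ _ hφ, one_mul]

theorem dbr_diff (hφ : φ ∈ c.dualDeg a) (ψ : Module.Dual k W) :
    c.dbr φ ψ ∘ₗ c.diff = ksign k (1 - d) • (c.dbr (φ ∘ₗ c.diff) ψ +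
      ksign k a • c.dbr φ (ψ ∘ₗ c.diff)) := by
  rw [dbr, comp_assoc, hc.diff_coder.cobr, comp_smul,
    dtmul_leib_cobr c φ ψ 1 _ _ hφ, one_mul, one_mul]

omit hc in
theorem comp_diff_mem (hφ : φ ∈ c.dualDeg a) : φ ∘ₗ c.diff ∈ c.dualDeg (a - 1) :=
  dualDeg_comp c.toDiffMod c.toDiffMod (n := 1) (fun _ _ hx => c.diff_mem hx) hφ (by ring)

omit hc in
/-- The axioms of a `d`-coalgebra can be checked on a separating family of homogeneous
functionals. -/
theorem of_dual (P : ℤ → Set (Module.Dual k W)) (hP : Separating {φ | ∃ a, φ ∈ P a})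
    (hdeg : ∀ a, ∀ φ ∈ P a, φ ∈ c.dualDeg a) (isComplex : c.IsComplex)
    (comul_mem : ∀ {i x}, x ∈ c.gr i → c.comul x ∈ c.tensorGr c.toDiffMod i)
    (cobr_mem : ∀ {i x}, x ∈ c.gr i → c.cobr x ∈ c.tensorGr c.toDiffMod (i + 1 - d))
    (counit_deg : ∀ {i x}, x ∈ c.gr i → i ≠ 0 → c.counit x = 0)
    (counit_dmul : ∀ a, ∀ φ ∈ P a, c.dmul c.counit φ = φ)
    (counit_dbr : ∀ a, ∀ φ ∈ P a, c.dbr c.counit φ = 0)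
    (comm : ∀ a, ∀ φ ∈ P a, ∀ b, ∀ ψ ∈ P b, c.dmul φ ψ = ksign k (a * b) • c.dmul ψ φ)
    (br_comm : ∀ a, ∀ φ ∈ P a, ∀ b, ∀ ψ ∈ P b, c.dbr φ ψ = ksign k (a * b + d) • c.dbr ψ φ)
    (mul_diff : ∀ a, ∀ φ ∈ P a, ∀ b, ∀ ψ ∈ P b, c.dmul φ ψ ∘ₗ c.diff =
      c.dmul (φ ∘ₗ c.diff) ψ + ksign k a • c.dmul φ (ψ ∘ₗ c.diff))
    (br_diff : ∀ a, ∀ φ ∈ P a, ∀ b, ∀ ψ ∈ P b, c.dbr φ ψ ∘ₗ c.diff =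
      ksign k (1 - d) • (c.dbr (φ ∘ₗ c.diff) ψ + ksign k a • c.dbr φ (ψ ∘ₗ c.diff)))
    (assoc : ∀ a, ∀ φ ∈ P a, ∀ b, ∀ ψ ∈ P b, ∀ e, ∀ χ ∈ P e,
      c.dmul (c.dmul φ ψ) χ = c.dmul φ (c.dmul ψ χ))
    (jacobi : ∀ a, ∀ φ ∈ P a, ∀ b, ∀ ψ ∈ P b, ∀ e, ∀ χ ∈ P e,
      c.dbr (c.dbr φ ψ) χ + ksign k (a * (b + e)) • c.dbr (c.dbr ψ χ) φ +
        ksign k (e * (a + b)) • c.dbr (c.dbr χ φ) ψ = 0)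
    (leibniz : ∀ a, ∀ φ ∈ P a, ∀ b, ∀ ψ ∈ P b, ∀ e, ∀ χ ∈ P e,
      c.dbr (c.dmul φ ψ) χ = ksign k ((1 - d) * a) • c.dmul φ (c.dbr ψ χ) +
      ksign k (b * e) • c.dmul (c.dbr φ χ) ψ) : c.IsDCoalgebra d := by
  have hP2 := hP.dtmul hP
  have hP3 := hP2.dtmul hP
  have hP3' := hP.dtmul hP2
  refine ⟨isComplex, comul_mem, ?_, ?_, counit_deg, ?_, cobr_mem, ?_, ?_, ?_, ?_, ?_⟩
  · refine hP3'.ext ?_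
    rintro _ ⟨φ, ⟨a, hφ⟩, _, ⟨ψ, ⟨b, hψ⟩, χ, ⟨e, hχ⟩, rfl⟩, rfl⟩
    rw [← comp_assoc, dtmul_assoc, dtmul_comul_left, dtmul_comul_right,
      assoc a φ hφ b ψ hψ e χ hχ]
  · refine hP2.ext ?_
    rintro _ ⟨φ, ⟨a, hφ⟩, ψ, ⟨b, hψ⟩, rfl⟩
    rw [← comp_assoc, dtmul_twist c.toDiffMod c.toDiffMod (hdeg a φ hφ) (hdeg b ψ hψ)]
    exact (comm a φ hφ b ψ hψ).symm
  · refine hP.ext ?_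
    rintro φ ⟨a, hφ⟩
    rw [dtmul_counit, comp_id]
    exact counit_dmul a φ hφ
  · refine hP2.ext ?_
    rintro _ ⟨φ, ⟨a, hφ⟩, ψ, ⟨b, hψ⟩, rfl⟩
    rw [← comp_assoc, dtmul_twist c.toDiffMod c.toDiffMod (hdeg a φ hφ) (hdeg b ψ hψ),
      comp_smul]
    have := br_comm a φ hφ b ψ hψ
    rw [dbr] at this
    rw [this, smul_smul, ← ksign_add,
      show ksign k (d + (a * b + d)) = ksign k (a * b) from ksign_congr (by push_cast; grind)]
    rfl
  · intro x
    have : (LinearMap.id + cyc c.toDiffMod + cyc c.toDiffMod ∘ₗ cyc c.toDiffMod) ∘ₗ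
        TensorProduct.map c.cobr LinearMap.id ∘ₗ c.cobr = 0 := by
      refine hP3.ext ?_
      rintro _ ⟨_, ⟨φ, ⟨a, hφ⟩, ψ, ⟨b, hψ⟩, rfl⟩, χ, ⟨e, hχ⟩, rfl⟩
      have h1 := hdeg a φ hφ
      have h2 := hdeg b ψ hψ
      have h3 := hdeg e χ hχ
      rw [← comp_assoc, dtmul_cyc_sum c.toDiffMod h1 h2 h3, add_comp,
        add_comp, smul_comp, smul_comp, dtmul_cobr_left,
        dtmul_cobr_left, dtmul_cobr_left, comp_zero, ← jacobi a φ hφ b ψ hψ e χ hχ]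
    exact LinearMap.congr_fun this x
  · refine hP3.ext ?_
    rintro _ ⟨_, ⟨φ, ⟨a, hφ⟩, ψ, ⟨b, hψ⟩, rfl⟩, χ, ⟨e, hχ⟩, rfl⟩
    rw [dtmul_comul_cobr, comp_add, ← comp_assoc _ _ (φ ⊠ ψ ⊠ χ),
      dtmul_assoc_symm, dtmul_sgn_cobr c φ ψ χ _ (hdeg a φ hφ), ← comp_assoc,
      dtmul_swap23 c.toDiffMod φ (hdeg b ψ hψ) (hdeg e χ hχ), smul_comp,
      dtmul_cobr_comul, leibniz a φ hφ b ψ hψ e χ hχ]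
  · refine hP.ext ?_
    rintro φ ⟨a, hφ⟩
    rw [dtmul_counit, comp_zero]
    exact counit_dbr a φ hφ
  · refine ⟨fun _ _ hx => c.diff_mem hx, hP2.ext ?_, hP2.ext ?_⟩
    · rintro _ ⟨φ, ⟨a, hφ⟩, ψ, ⟨b, hψ⟩, rfl⟩
      rw [dtmul_leib_comul c φ ψ 1 _ _ (hdeg a φ hφ), one_mul]
      exact mul_diff a φ hφ b ψ hψ
    · rintro _ ⟨φ, ⟨a, hφ⟩, ψ, ⟨b, hψ⟩, rfl⟩
      rw [comp_smul, dtmul_leib_cobr c φ ψ 1 _ _ (hdeg a φ hφ), one_mul, one_mul]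
      exact br_diff a φ hφ b ψ hψ

end IsDCoalgebra
end DCoalgData
end dual

section tensor
variable {k : Type u} [Field k] {W : Type v} [AddCommGroup W] [Module k W]
  {W' : Type w} [AddCommGroup W'] [Module k W']

theorem DiffMod.mid_mem (c : DiffMod k W) (c' : DiffMod k W') {n : ℤ}
    {z : (W ⊗[k] W) ⊗[k] (W' ⊗[k] W')} (hz : z ∈ (c.tensor c).tensorGr (c'.tensor c') n) :
    mid c c' z ∈ (c.tensor c').tensorGr (c.tensor c') n := by
  refine tensorGr_induction (P := fun z => mid c c' z ∈ (c.tensor c').tensorGr (c.tensor c') n)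
    _ _ z hz ?_ ?_ ?_
  · intro i j s t hs ht hij
    refine tensorGr_induction
      (P := fun s => mid c c' (s ⊗ₜ t) ∈ (c.tensor c').tensorGr (c.tensor c') n) c c s hs ?_ ?_ ?_
    · intro p q x x' hx hx' hpq
      refine tensorGr_induction (P := fun t => mid c c' ((x ⊗ₜ x') ⊗ₜ t) ∈
        (c.tensor c').tensorGr (c.tensor c') n) c' c' t ht ?_ ?_ ?_
      · intro p' q' y y' hy hy' hpq'
        rw [mid_tmul c c' x y' hx' hy]
        exact Submodule.smul_mem _ _ (tmul_mem_tensorGr _ _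
          (tmul_mem_tensorGr c c' hx hy rfl) (tmul_mem_tensorGr c c' hx' hy' rfl) (by omega))
      · simp
      · intro a b ha hb
        rw [tmul_add, map_add]; exact Submodule.add_mem _ ha hb
    · simp
    · intro a b ha hb
      rw [add_tmul, map_add]; exact Submodule.add_mem _ ha hb
  · simp
  · intro a b ha hb
    rw [map_add]; exact Submodule.add_mem _ ha hb

theorem DiffMod.sgn_homDeg (c : DiffMod k W) (n : ℤ) : c.sgn n ∈ homDeg c c 0 := fun i x hx => by
  rw [add_zero]; exact c.sgn_mem n hx

namespace DCoalgData
variable {c : DCoalgData k W} {c' : DCoalgData k W'} {d : ℤ}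

namespace IsDCoalgebra
variable (hc : c.IsDCoalgebra d) (hc' : c'.IsDCoalgebra d)
include hc

theorem comul_homDeg : c.comul ∈ homDeg c.toDiffMod (c.toDiffMod.tensor c.toDiffMod) 0 :=
  fun i x hx => by rw [add_zero]; exact hc.comul_mem hx

theorem cobr_homDeg : c.cobr ∈ homDeg c.toDiffMod (c.toDiffMod.tensor c.toDiffMod) (1 - d) :=
  fun i x hx => by have := hc.cobr_mem hx; rwa [add_sub_assoc] at this

variable {a a' b b' e e' : ℤ} {φ ψ χ : Module.Dual k W} {φ' ψ' χ' : Module.Dual k W'}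

omit hc in
theorem tensor_dmul (hφ' : φ' ∈ c'.dualDeg a') (hψ : ψ ∈ c.dualDeg b) :
    (c.tensor d c').dmul (φ ⊠ φ') (ψ ⊠ ψ') =
      ksign k (a' * b) • (c.dmul φ ψ ⊠ c'.dmul φ' ψ') := by
  rw [dmul, tensor, ← comp_assoc, dtmul_mid c.toDiffMod c'.toDiffMod φ ψ' hφ' hψ,
    smul_comp, dtmul_comp_map]
  rfl

theorem tensor_dbr (hφ : φ ∈ c.dualDeg a) (hφ' : φ' ∈ c'.dualDeg a') (hψ : ψ ∈ c.dualDeg b) :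
    (c.tensor d c').dbr (φ ⊠ φ') (ψ ⊠ ψ') =
      ksign k (a' * b) • (c.dbr φ ψ ⊠ c'.dmul φ' ψ') +
        ksign k (a' * b + (d - 1) * (a + b)) • (c.dmul φ ψ ⊠ c'.dbr φ' ψ') := by
  have h := dualDeg_comp_sgn c.toDiffMod (d - 1) (hc.dmul_mem hφ hψ)
  rw [dmul, comp_assoc] at h
  rw [dbr, tensor, ← comp_assoc, dtmul_mid c.toDiffMod c'.toDiffMod φ ψ' hφ' hψ,
    smul_comp, comp_add, dtmul_comp_map, dtmul_comp_map, h, dtmul_smul_left,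
    smul_add, smul_smul, ← ksign_add]
  rfl

theorem dmul_cyc (hφ : φ ∈ c.dualDeg a) (hψ : ψ ∈ c.dualDeg b) (hχ : χ ∈ c.dualDeg e) :
    c.dmul (c.dmul ψ χ) φ = ksign k (a * (b + e)) • c.dmul (c.dmul φ ψ) χ := by
  rw [hc.dmul_comm (hc.dmul_mem hψ hχ) hφ, hc.dmul_assoc φ ψ χ, mul_comm]

theorem dbr_dmul (hφ : φ ∈ c.dualDeg a) (hψ : ψ ∈ c.dualDeg b) (hχ : χ ∈ c.dualDeg e) :
    c.dbr (c.dmul φ ψ) χ = ksign k (a * (b + e)) • c.dmul (c.dbr ψ χ) φ +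
      ksign k (b * e + a * e + d) • c.dmul (c.dbr χ φ) ψ := by
  rw [hc.dbr_leibniz hφ hψ hχ, hc.dmul_comm hφ (hc.dbr_mem hψ hχ), hc.dbr_comm hφ hχ,
    dmul_smul_left, smul_smul, smul_smul, ← ksign_add, ← ksign_add]
  congr 2 <;> exact ksign_congr (by push_cast; grind)

theorem dbr_jacobi' (hφ : φ ∈ c.dualDeg a) (hψ : ψ ∈ c.dualDeg b) (hχ : χ ∈ c.dualDeg e) :
    c.dbr (c.dbr φ ψ) χ = ksign k (a * (b + e) + 1) • c.dbr (c.dbr ψ χ) φ +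
      ksign k (e * (a + b) + 1) • c.dbr (c.dbr χ φ) ψ := by
  rw [ksign_add, ksign_add _ (e * (a + b)), ksign_one]
  have h := hc.dbr_jacobi hφ hψ hχ
  rw [add_assoc, add_eq_zero_iff_eq_neg] at h
  rw [h]
  module

include hc'

theorem tensor_dbr_dbr (hφ : φ ∈ c.dualDeg a) (hφ' : φ' ∈ c'.dualDeg a') (hψ : ψ ∈ c.dualDeg b)
    (hψ' : ψ' ∈ c'.dualDeg b') (hχ : χ ∈ c.dualDeg e) :
    (c.tensor d c').dbr ((c.tensor d c').dbr (φ ⊠ φ') (ψ ⊠ ψ')) (χ ⊠ χ') =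
      ksign k (a' * b + (a' + b') * e) •
        (c.dbr (c.dbr φ ψ) χ ⊠ c'.dmul (c'.dmul φ' ψ') χ') +
      ksign k (a' * b + (a' + b') * e + (d - 1) * (a + b + d - 1 + e)) •
        (c.dmul (c.dbr φ ψ) χ ⊠ c'.dbr (c'.dmul φ' ψ') χ') +
      ksign k (a' * b + (d - 1) * (a + b) + (a' + b' + d - 1) * e) •
        (c.dbr (c.dmul φ ψ) χ ⊠ c'.dmul (c'.dbr φ' ψ') χ') +
      ksign k (a' * b + (d - 1) * (a + b) + (a' + b' + d - 1) * e + (d - 1) * (a + b + e)) •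
        (c.dmul (c.dmul φ ψ) χ ⊠ c'.dbr (c'.dbr φ' ψ') χ') := by
  rw [hc.tensor_dbr hφ hφ' hψ, dbr_add_left, dbr_smul_left, dbr_smul_left,
    hc.tensor_dbr (hc.dbr_mem hφ hψ) (hc'.dmul_mem hφ' hψ') hχ,
    hc.tensor_dbr (hc.dmul_mem hφ hψ) (hc'.dbr_mem hφ' hψ') hχ]
  simp only [smul_add, smul_smul, ← ksign_add, add_assoc]

theorem tensor_jacobi (hφ : φ ∈ c.dualDeg a) (hφ' : φ' ∈ c'.dualDeg a') (hψ : ψ ∈ c.dualDeg b)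
    (hψ' : ψ' ∈ c'.dualDeg b') (hχ : χ ∈ c.dualDeg e) (hχ' : χ' ∈ c'.dualDeg e') :
    (c.tensor d c').dbr ((c.tensor d c').dbr (φ ⊠ φ') (ψ ⊠ ψ')) (χ ⊠ χ') +
      ksign k ((a + a') * (b + b' + (e + e'))) •
        (c.tensor d c').dbr ((c.tensor d c').dbr (ψ ⊠ ψ') (χ ⊠ χ')) (φ ⊠ φ') +
      ksign k ((e + e') * (a + a' + (b + b'))) •
        (c.tensor d c').dbr ((c.tensor d c').dbr (χ ⊠ χ') (φ ⊠ φ')) (ψ ⊠ ψ') = 0 := by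
  have hJ := hc.dbr_jacobi' hφ hψ hχ
  have hJ' := hc'.dbr_jacobi' hφ' hψ' hχ'
  have e1 := hc.dmul_cyc hφ hψ hχ
  have e2 := hc.dmul_cyc hψ hχ hφ
  have e1' := hc'.dmul_cyc hφ' hψ' hχ'
  have e2' := hc'.dmul_cyc hψ' hχ' hφ'
  rw [e1, smul_smul, ← ksign_add] at e2
  rw [e1', smul_smul, ← ksign_add] at e2'
  rw [hc.tensor_dbr_dbr hc' hφ hφ' hψ hψ' hχ, hc.tensor_dbr_dbr hc' hψ hψ' hχ hχ' hφ,
    hc.tensor_dbr_dbr hc' hχ hχ' hφ hφ' hψ,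
    hc.dbr_dmul hφ hψ hχ, hc.dbr_dmul hψ hχ hφ, hc.dbr_dmul hχ hφ hψ,
    hc'.dbr_dmul hφ' hψ' hχ', hc'.dbr_dmul hψ' hχ' hφ', hc'.dbr_dmul hχ' hφ' hψ',
    e1, e1', e2, e2', hJ, hJ']
  generalize c.dmul (c.dbr φ ψ) χ = A1
  generalize c.dmul (c.dbr ψ χ) φ = A2
  generalize c.dmul (c.dbr χ φ) ψ = A3
  generalize c'.dmul (c'.dbr φ' ψ') χ' = A1'
  generalize c'.dmul (c'.dbr ψ' χ') φ' = A2'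
  generalize c'.dmul (c'.dbr χ' φ') ψ' = A3'
  generalize c.dmul (c.dmul φ ψ) χ = M
  generalize c'.dmul (c'.dmul φ' ψ') χ' = M'
  generalize c.dbr (c.dbr ψ χ) φ = B2
  generalize c.dbr (c.dbr χ φ) ψ = B3
  generalize c'.dbr (c'.dbr ψ' χ') φ' = B2'
  generalize c'.dbr (c'.dbr χ' φ') ψ' = B3'
  have hd := zmod_two_mul_self (d : ZMod 2)
  simp only [dtmul_add_left, dtmul_add_right, dtmul_smul_left, dtmul_smul_right, smul_add,
    smul_smul, ← ksign_add]
  match_scalars <;> simp only [mul_one] <;> apply ksign_add_eq_zero <;> push_cast <;> grind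

theorem tensor_leibniz (hφ : φ ∈ c.dualDeg a) (hφ' : φ' ∈ c'.dualDeg a') (hψ : ψ ∈ c.dualDeg b)
    (hψ' : ψ' ∈ c'.dualDeg b') (hχ : χ ∈ c.dualDeg e) (hχ' : χ' ∈ c'.dualDeg e') :
    (c.tensor d c').dbr ((c.tensor d c').dmul (φ ⊠ φ') (ψ ⊠ ψ')) (χ ⊠ χ') =
      ksign k ((1 - d) * (a + a')) •
        (c.tensor d c').dmul (φ ⊠ φ') ((c.tensor d c').dbr (ψ ⊠ ψ') (χ ⊠ χ')) +
      ksign k ((b + b') * (e + e')) •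
        (c.tensor d c').dmul ((c.tensor d c').dbr (φ ⊠ φ') (χ ⊠ χ')) (ψ ⊠ ψ') := by
  have e1 : c'.dmul (c'.dmul φ' χ') ψ' = ksign k (b' * e') • c'.dmul (c'.dmul φ' ψ') χ' := by
    rw [hc'.dmul_assoc, hc'.dmul_comm hχ' hψ', dmul_smul_right, hc'.dmul_assoc, mul_comm]
  have e2 : c.dmul (c.dmul φ χ) ψ = ksign k (b * e) • c.dmul (c.dmul φ ψ) χ := by
    rw [hc.dmul_assoc, hc.dmul_comm hχ hψ, dmul_smul_right, hc.dmul_assoc, mul_comm]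
  rw [tensor_dmul hφ' hψ, dbr_smul_left,
    hc.tensor_dbr (hc.dmul_mem hφ hψ) (hc'.dmul_mem hφ' hψ') hχ, hc.tensor_dbr hψ hψ' hχ,
    hc.tensor_dbr hφ hφ' hχ]
  simp only [dmul_add_left, dmul_add_right, dmul_smul_left, dmul_smul_right]
  rw [tensor_dmul hφ' (hc.dbr_mem hψ hχ), tensor_dmul hφ' (hc.dmul_mem hψ hχ),
    tensor_dmul (hc'.dmul_mem hφ' hχ') hψ, tensor_dmul (hc'.dbr_mem hφ' hχ') hψ,
    hc.dbr_leibniz hφ hψ hχ, hc'.dbr_leibniz hφ' hψ' hχ', e1, e2, ← hc.dmul_assoc φ ψ χ,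
    ← hc'.dmul_assoc φ' ψ' χ']
  have hd := zmod_two_mul_self (d : ZMod 2)
  simp only [dtmul_add_left, dtmul_add_right, dtmul_smul_left, dtmul_smul_right, smul_add,
    smul_smul, ← ksign_add]
  match_scalars <;> simp only [mul_one] <;> apply ksign_congr <;> push_cast <;> grind

omit hc hc' in
theorem dtmul_tensor_diff (hφ : φ ∈ c.dualDeg a) :
    (φ ⊠ φ') ∘ₗ (c.tensor d c').diff =
      (φ ∘ₗ c.diff) ⊠ φ' + ksign k a • (φ ⊠ (φ' ∘ₗ c'.diff)) := by
  have := dtmul_leib c.toDiffMod 1 c.diff c'.diff hφ φ'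
  rwa [one_mul] at this

theorem tensor_dmul_diff (hφ : φ ∈ c.dualDeg a) (hφ' : φ' ∈ c'.dualDeg a') (hψ : ψ ∈ c.dualDeg b) :
    (c.tensor d c').dmul (φ ⊠ φ') (ψ ⊠ ψ') ∘ₗ (c.tensor d c').diff =
      (c.tensor d c').dmul ((φ ⊠ φ') ∘ₗ (c.tensor d c').diff) (ψ ⊠ ψ') +
      ksign k (a + a') •
        (c.tensor d c').dmul (φ ⊠ φ') ((ψ ⊠ ψ') ∘ₗ (c.tensor d c').diff) := by
  rw [tensor_dmul hφ' hψ, smul_comp, dtmul_tensor_diff (hc.dmul_mem hφ hψ),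
    dtmul_tensor_diff hφ, dtmul_tensor_diff hψ, hc.dmul_diff hφ, hc'.dmul_diff hφ']
  simp only [dmul_add_left, dmul_add_right, dmul_smul_left, dmul_smul_right]
  rw [tensor_dmul hφ' hψ, tensor_dmul (comp_diff_mem hφ') hψ, tensor_dmul hφ' (comp_diff_mem hψ),
    tensor_dmul hφ' hψ]
  simp only [dtmul_add_left, dtmul_add_right, dtmul_smul_left, dtmul_smul_right, smul_add,
    smul_smul, ← ksign_add]
  match_scalars <;> simp only [mul_one] <;> apply ksign_congr <;> push_cast <;> grind

theorem tensor_dbr_diff (hφ : φ ∈ c.dualDeg a) (hφ' : φ' ∈ c'.dualDeg a') (hψ : ψ ∈ c.dualDeg b) :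
    (c.tensor d c').dbr (φ ⊠ φ') (ψ ⊠ ψ') ∘ₗ (c.tensor d c').diff =
      ksign k (1 - d) • ((c.tensor d c').dbr ((φ ⊠ φ') ∘ₗ (c.tensor d c').diff) (ψ ⊠ ψ') +
      ksign k (a + a') •
        (c.tensor d c').dbr (φ ⊠ φ') ((ψ ⊠ ψ') ∘ₗ (c.tensor d c').diff)) := by
  rw [hc.tensor_dbr hφ hφ' hψ, add_comp, smul_comp, smul_comp,
    dtmul_tensor_diff (hc.dmul_mem hφ hψ), dtmul_tensor_diff (hc.dbr_mem hφ hψ),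
    dtmul_tensor_diff hφ, dtmul_tensor_diff hψ, hc.dmul_diff hφ, hc'.dmul_diff hφ',
    hc.dbr_diff hφ, hc'.dbr_diff hφ']
  simp only [dbr_add_left, dbr_add_right, dbr_smul_left, dbr_smul_right]
  rw [hc.tensor_dbr (comp_diff_mem hφ) hφ' hψ, hc.tensor_dbr hφ (comp_diff_mem hφ') hψ,
    hc.tensor_dbr hφ hφ' (comp_diff_mem hψ), hc.tensor_dbr hφ hφ' hψ]
  have hd := zmod_two_mul_self (d : ZMod 2)
  simp only [dtmul_add_left, dtmul_add_right, dtmul_smul_left, dtmul_smul_right, smul_add,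
    smul_smul, ← ksign_add]
  match_scalars <;> simp only [mul_one] <;> apply ksign_congr <;> push_cast <;> grind

/-- The tensor product of `d`-coalgebras is a `d`-coalgebra. -/
theorem tensor : (c.tensor d c').IsDCoalgebra d := by
  refine IsDCoalgebra.of_dual
    (fun n => {Φ | ∃ a a' φ φ', φ ∈ c.dualDeg a ∧ φ' ∈ c'.dualDeg a' ∧ a + a' = n ∧ φ ⊠ φ' = Φ})
    ?_ ?_ ?_ ?_ ?_ ?_ ?_ ?_ ?_ ?_ ?_ ?_ ?_ ?_ ?_
  · convert c.separating_dualDeg.dtmul c'.separating_dualDeg using 1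
    ext Φ
    constructor
    · rintro ⟨_, a, a', φ, φ', h1, h2, rfl, rfl⟩
      exact ⟨φ, ⟨a, h1⟩, φ', ⟨a', h2⟩, rfl⟩
    · rintro ⟨φ, ⟨a, h1⟩, φ', ⟨a', h2⟩, rfl⟩
      exact ⟨_, a, a', φ, φ', h1, h2, rfl, rfl⟩
  · rintro _ _ ⟨a, a', φ, φ', h1, h2, rfl, rfl⟩
    exact dtmul_mem_dualDeg _ _ h1 h2
  · intro z
    induction z using c.toDiffMod.tensor_induction c'.toDiffMod with
    | tmul i j x y hx hy =>
      have h1 := hc.isComplex x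
      have h2 := hc'.isComplex y
      simp [DCoalgData.tensor, DiffMod.tensor, leib, c.sgn_apply 1 hx,
        c.sgn_apply 1 (c.diff_mem hx), h1, h2, ksign_add, ← add_tmul]
    | add x y h1 h2 => rw [map_add, map_add, h1, h2, add_zero]
  · intro i z hz
    refine mid_mem _ _ ?_
    have := map_mem_tensorGr hc.comul_homDeg hc'.comul_homDeg hz
    rwa [add_zero, add_zero] at this
  · intro i z hz
    refine mid_mem _ _ (Submodule.add_mem _ ?_ ?_)
    · have := map_mem_tensorGr hc.cobr_homDeg hc'.comul_homDeg hz
      rwa [add_zero, ← add_sub_assoc] at this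
    · have h : c.comul ∘ₗ c.sgn (d - 1) ∈ homDeg c.toDiffMod (c.toDiffMod.tensor c.toDiffMod) 0 :=
        fun i x hx => hc.comul_homDeg _ _ (c.sgn_mem _ hx)
      have := map_mem_tensorGr h hc'.cobr_homDeg hz
      rwa [zero_add, ← add_sub_assoc] at this
  · intro i z hz hi
    exact dtmul_mem_dualDeg _ _ hc.counit_mem_dualDeg hc'.counit_mem_dualDeg i z hz (by simpa)
  · rintro _ _ ⟨a, a', φ, φ', h1, h2, rfl, rfl⟩
    have := tensor_dmul (d := d) (φ := c.counit) (ψ' := φ') hc'.counit_mem_dualDeg h1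
    rw [hc.counit_dmul, hc'.counit_dmul, zero_mul, ksign_zero, one_smul] at this
    exact this
  · rintro _ _ ⟨a, a', φ, φ', h1, h2, rfl, rfl⟩
    have := hc.tensor_dbr (ψ' := φ') hc.counit_mem_dualDeg hc'.counit_mem_dualDeg h1
    rw [hc.counit_dbr, hc'.counit_dbr, dtmul_zero_left, dtmul_zero_right, smul_zero, smul_zero,
      add_zero] at this
    exact this
  · rintro _ _ ⟨a, a', φ, φ', h1, h2, rfl, rfl⟩ _ _ ⟨b, b', ψ, ψ', h3, h4, rfl, rfl⟩
    rw [tensor_dmul h2 h3, tensor_dmul h4 h1, hc.dmul_comm h1 h3, hc'.dmul_comm h2 h4,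
      dtmul_smul_left, dtmul_smul_right]
    simp only [smul_smul, ← ksign_add]
    congr 1
    exact ksign_congr (by push_cast; grind)
  · rintro _ _ ⟨a, a', φ, φ', h1, h2, rfl, rfl⟩ _ _ ⟨b, b', ψ, ψ', h3, h4, rfl, rfl⟩
    rw [hc.tensor_dbr h1 h2 h3, hc.tensor_dbr h3 h4 h1, hc.dmul_comm h1 h3, hc'.dmul_comm h2 h4,
      hc.dbr_comm h1 h3, hc'.dbr_comm h2 h4]
    simp only [dtmul_smul_left, dtmul_smul_right, smul_add, smul_smul, ← ksign_add]
    match_scalars <;> simp only [mul_one] <;> apply ksign_congr <;> push_cast <;> grind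
  · rintro _ _ ⟨a, a', φ, φ', h1, h2, rfl, rfl⟩ _ _ ⟨b, b', ψ, ψ', h3, h4, rfl, rfl⟩
    exact hc.tensor_dmul_diff hc' h1 h2 h3
  · rintro _ _ ⟨a, a', φ, φ', h1, h2, rfl, rfl⟩ _ _ ⟨b, b', ψ, ψ', h3, h4, rfl, rfl⟩
    exact hc.tensor_dbr_diff hc' h1 h2 h3
  · rintro _ _ ⟨a, a', φ, φ', h1, h2, rfl, rfl⟩ _ _ ⟨b, b', ψ, ψ', h3, h4, rfl, rfl⟩
      _ _ ⟨e, e', χ, χ', h5, h6, rfl, rfl⟩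
    rw [tensor_dmul h2 h3, tensor_dmul h4 h5, dmul_smul_left, dmul_smul_right,
      tensor_dmul (hc'.dmul_mem h2 h4) h5, tensor_dmul h2 (hc.dmul_mem h3 h5), hc.dmul_assoc,
      hc'.dmul_assoc, smul_smul, smul_smul, ← ksign_add, ← ksign_add]
    congr 1
    exact ksign_congr (by push_cast; grind)
  · rintro _ _ ⟨a, a', φ, φ', h1, h2, rfl, rfl⟩ _ _ ⟨b, b', ψ, ψ', h3, h4, rfl, rfl⟩
      _ _ ⟨e, e', χ, χ', h5, h6, rfl, rfl⟩
    exact hc.tensor_jacobi hc' h1 h2 h3 h4 h5 h6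
  · rintro _ _ ⟨a, a', φ, φ', h1, h2, rfl, rfl⟩ _ _ ⟨b, b', ψ, ψ', h3, h4, rfl, rfl⟩
      _ _ ⟨e, e', χ, χ', h5, h6, rfl, rfl⟩
    exact hc.tensor_leibniz hc' h1 h2 h3 h4 h5 h6

end IsDCoalgebra
end DCoalgData
end tensor

section tensorSub
variable {k : Type u} [Field k] {V V' W W' : Type*} [AddCommGroup V] [Module k V]
  [AddCommGroup W] [Module k W] [AddCommGroup V'] [Module k V'] [AddCommGroup W'] [Module k W']

theorem tensorSub_induction {S : Submodule k V} {T : Submodule k W} {P : V ⊗[k] W → Prop}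
    {z : V ⊗[k] W} (hz : z ∈ tensorSub S T) (tmul : ∀ x ∈ S, ∀ y ∈ T, P (x ⊗ₜ y)) (zero : P 0)
    (add : ∀ x y, P x → P y → P (x + y)) : P z := by
  obtain ⟨t, rfl⟩ := hz
  induction t using induction_on with
  | zero => simpa using zero
  | tmul x y => exact tmul x x.2 y y.2
  | add a b h1 h2 => rw [map_add]; exact add _ _ h1 h2

theorem tensorSub_le {S : Submodule k V} {T : Submodule k W} {U : Submodule k (V ⊗[k] W)}
    (h : ∀ x ∈ S, ∀ y ∈ T, x ⊗ₜ y ∈ U) : tensorSub S T ≤ U := fun _ hz =>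
  tensorSub_induction hz h (Submodule.zero_mem _) fun _ _ => Submodule.add_mem _

theorem tensorSub_mono {S S' : Submodule k V} {T T' : Submodule k W} (h : S ≤ S') (h' : T ≤ T') :
    tensorSub S T ≤ tensorSub S' T' :=
  tensorSub_le fun _ hx _ hy => tmul_mem_tensorSub (h hx) (h' hy)

theorem map_mem_tensorSub {S : Submodule k V} {T : Submodule k W} {S' : Submodule k V'}
    {T' : Submodule k W'} {f : V →ₗ[k] V'} {g : W →ₗ[k] W'} (hf : ∀ x ∈ S, f x ∈ S')
    (hg : ∀ x ∈ T, g x ∈ T') {z : V ⊗[k] W} (hz : z ∈ tensorSub S T) :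
    TensorProduct.map f g z ∈ tensorSub S' T' := by
  have : tensorSub S T ≤ (tensorSub S' T').comap (TensorProduct.map f g) :=
    tensorSub_le fun x hx y hy => by
      rw [Submodule.mem_comap, map_tmul]
      exact tmul_mem_tensorSub (hf x hx) (hg y hy)
  exact this hz

theorem mem_tensorSub_span {x : V} {y : W} {z : V ⊗[k] W}
    (hz : z ∈ tensorSub (Submodule.span k {x}) (Submodule.span k {y})) :
    ∃ a : k, z = a • (x ⊗ₜ y) := by
  have : tensorSub (Submodule.span k {x}) (Submodule.span k {y}) ≤
      Submodule.span k {x ⊗ₜ[k] y} := tensorSub_le fun x' hx y' hy => by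
    obtain ⟨a, rfl⟩ := Submodule.mem_span_singleton.1 hx
    obtain ⟨b, rfl⟩ := Submodule.mem_span_singleton.1 hy
    rw [TensorProduct.smul_tmul_smul]
    exact Submodule.smul_mem _ _ (Submodule.mem_span_singleton_self _)
  obtain ⟨a, ha⟩ := Submodule.mem_span_singleton.1 (this hz)
  exact ⟨a, ha.symm⟩

theorem map_injective {f : V →ₗ[k] V'} {g : W →ₗ[k] W'} (hf : Function.Injective f)
    (hg : Function.Injective g) : Function.Injective (TensorProduct.map f g) := by
  have : TensorProduct.map f g = LinearMap.lTensor V' g ∘ₗ LinearMap.rTensor W f := by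
    ext; simp
  rw [this]
  exact (Module.Flat.lTensor_preserves_injective_linearMap g hg).comp
    (Module.Flat.rTensor_preserves_injective_linearMap f hf)

end tensorSub

section homog
variable {k : Type u} [Field k] {V : Type*} [AddCommGroup V] [Module k V]
  {W : Type*} [AddCommGroup W] [Module k W]

/-- A subspace is homogeneous. -/
def DiffMod.IsHomog (c : DiffMod k V) (S : Submodule k V) : Prop := ∀ a, ∀ x ∈ S, c.proj a x ∈ S

theorem DiffMod.isHomog_of_le (c : DiffMod k V) {S : Submodule k V} (h : S ≤ ⨆ i, S ⊓ c.gr i) :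
    c.IsHomog S := by
  intro a x hx
  have : (⨆ i, S ⊓ c.gr i) ≤ S.comap (c.proj a) := by
    refine iSup_le fun i y hy => ?_
    rw [Submodule.mem_comap]
    by_cases hi : i = a
    · subst hi; rw [c.proj_of_mem hy.2]; exact hy.1
    · rw [c.proj_of_ne hy.2 hi]; exact Submodule.zero_mem _
  exact this (h hx)

theorem DiffMod.mem_iSup_of_proj (c : DiffMod k V) {S : ℤ → Submodule k V} {x : V}
    (h : ∀ a, c.proj a x ∈ S a) : x ∈ ⨆ a, S a := by
  obtain ⟨s, hs⟩ := c.exists_sum_proj x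
  rw [hs]
  exact Submodule.sum_mem _ fun a _ => Submodule.mem_iSup_of_mem a (h a)

theorem DiffMod.IsHomog.le {c : DiffMod k V} {S : Submodule k V} (h : c.IsHomog S) :
    S ≤ ⨆ i, S ⊓ c.gr i := fun x hx =>
  c.mem_iSup_of_proj fun a => ⟨h a x hx, c.proj_mem a x⟩

/-- Induction on homogeneous elements of a homogeneous subspace. -/
theorem DiffMod.IsHomog.induction {c : DiffMod k V} {S : Submodule k V} (h : c.IsHomog S)
    {P : V → Prop} {x : V} (hx : x ∈ S) (hom : ∀ i y, y ∈ S → y ∈ c.gr i → P y)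
    (add : ∀ x y, P x → P y → P (x + y)) : P x := by
  have h2 := h.le hx
  clear hx
  induction h2 using Submodule.iSup_induction' with
  | mem i x hx => exact hom i x hx.1 hx.2
  | zero => exact hom 0 0 (Submodule.zero_mem _) (Submodule.zero_mem _)
  | add x y _ _ h1 h2 => exact add x y h1 h2

theorem DiffMod.proj_comp {c : DiffMod k V} {c' : DiffMod k W} {n : ℤ} {f : V →ₗ[k] W}
    (hf : f ∈ homDeg c c' n) (a : ℤ) (x : V) : c'.proj (a + n) (f x) = f (c.proj a x) := by
  induction x using c.induction with
  | hom i x hx =>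
    by_cases hi : i = a
    · subst hi; rw [c.proj_of_mem hx, c'.proj_of_mem (hf _ _ hx)]
    · rw [c.proj_of_ne hx hi, c'.proj_of_ne (hf _ _ hx) (by omega), map_zero]
  | add x y h1 h2 => simp only [map_add, h1, h2]

theorem DiffMod.sgn_comp {c : DiffMod k V} {c' : DiffMod k W} {f : V →ₗ[k] W}
    (hf : f ∈ homDeg c c' 0) (n : ℤ) : c'.sgn n ∘ₗ f = f ∘ₗ c.sgn n := by
  refine c.hom_ext fun i x hx => ?_
  have := hf _ _ hx
  rw [add_zero] at this
  rw [comp_apply, comp_apply, c'.sgn_apply n this, c.sgn_apply n hx, map_smul]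

theorem DiffMod.IsHomog.comap {c : DiffMod k V} {c' : DiffMod k W} {n : ℤ} {f : V →ₗ[k] W}
    (hf : f ∈ homDeg c c' n) {S : Submodule k W} (hS : c'.IsHomog S) :
    c.IsHomog (S.comap f) := fun a x hx => by
  rw [Submodule.mem_comap, ← proj_comp hf]
  exact hS _ _ hx

theorem DiffMod.IsHomog.sgn_mem {c : DiffMod k V} {S : Submodule k V} (h : c.IsHomog S) (n : ℤ)
    {x : V} (hx : x ∈ S) : c.sgn n x ∈ S :=
  h.induction (P := fun x => c.sgn n x ∈ S) hx
    (fun i y hy hi => by rw [c.sgn_apply n hi]; exact Submodule.smul_mem _ _ hy)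
    fun x y h1 h2 => by rw [map_add]; exact Submodule.add_mem _ h1 h2

theorem DiffMod.IsHomog.tensorSub {c : DiffMod k V} {c' : DiffMod k W} {S : Submodule k V}
    {T : Submodule k W} (hS : c.IsHomog S) (hT : c'.IsHomog T) :
    (c.tensor c').IsHomog (tensorSub S T) := by
  intro a z hz
  refine tensorSub_induction (P := fun z => (c.tensor c').proj a z ∈ DefHopf.tensorSub S T) hz
    (fun x hx y hy => ?_) (by simp) fun x y h1 h2 => by
      rw [map_add]; exact Submodule.add_mem _ h1 h2
  refine hS.induction (P := fun x => (c.tensor c').proj a (x ⊗ₜ y) ∈ DefHopf.tensorSub S T) hx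
    (fun i x hx hi => ?_) fun x y h1 h2 => by
      rw [add_tmul, map_add]; exact Submodule.add_mem _ h1 h2
  refine hT.induction (P := fun y => (c.tensor c').proj a (x ⊗ₜ y) ∈ DefHopf.tensorSub S T) hy
    (fun j y hy hj => ?_) fun x y h1 h2 => by
      rw [tmul_add, map_add]; exact Submodule.add_mem _ h1 h2
  have hxy : x ⊗ₜ[k] y ∈ (c.tensor c').gr (i + j) := tmul_mem_tensorGr c c' hi hj rfl
  by_cases h : i + j = a
  · subst h; rw [(c.tensor c').proj_of_mem hxy]; exact tmul_mem_tensorSub hx hy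
  · rw [(c.tensor c').proj_of_ne hxy h]; exact Submodule.zero_mem _

theorem DiffMod.mid_mem_tensorSub {c : DiffMod k V} {c' : DiffMod k W} {S S' : Submodule k V}
    {T T' : Submodule k W} (hS' : c.IsHomog S') (hT : c'.IsHomog T) {s : V ⊗[k] V}
    {t : W ⊗[k] W} (hs : s ∈ DefHopf.tensorSub S S') (ht : t ∈ DefHopf.tensorSub T T') :
    mid c c' (s ⊗ₜ t) ∈
      DefHopf.tensorSub (DefHopf.tensorSub S T) (DefHopf.tensorSub S' T') := by
  refine tensorSub_induction (P := fun s => mid c c' (s ⊗ₜ t) ∈ _) hs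
    (fun x hx x' hx' => ?_) (by simp) fun x y h1 h2 => by
      rw [add_tmul, map_add]; exact Submodule.add_mem _ h1 h2
  refine tensorSub_induction (P := fun t => mid c c' ((x ⊗ₜ x') ⊗ₜ t) ∈ _) ht
    (fun y hy y' hy' => ?_) (by simp) fun x y h1 h2 => by
      rw [tmul_add, map_add]; exact Submodule.add_mem _ h1 h2
  refine hS'.induction (P := fun x' => mid c c' ((x ⊗ₜ x') ⊗ₜ (y ⊗ₜ y')) ∈ _) hx'
    (fun i x' hx' hi => ?_) fun x y h1 h2 => by
      rw [tmul_add, add_tmul, map_add]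
      exact Submodule.add_mem _ h1 h2
  refine hT.induction (P := fun y => mid c c' ((x ⊗ₜ x') ⊗ₜ (y ⊗ₜ y')) ∈ _) hy
    (fun j y hy hj => ?_) fun x y h1 h2 => by
      rw [add_tmul, tmul_add, map_add]
      exact Submodule.add_mem _ h1 h2
  rw [mid_tmul c c' x y' hi hj]
  exact Submodule.smul_mem _ _ (tmul_mem_tensorSub (tmul_mem_tensorSub hx hy)
    (tmul_mem_tensorSub hx' hy'))

theorem DiffMod.leib_mem_tensorSub {c : DiffMod k V} (n : ℤ) {D : V →ₗ[k] V} {D' : W →ₗ[k] W}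
    {S : Submodule k V} {T : Submodule k W} (hS : c.IsHomog S) (hD : ∀ x ∈ S, D x ∈ S)
    (hD' : ∀ x ∈ T, D' x ∈ T) {z : V ⊗[k] W} (hz : z ∈ DefHopf.tensorSub S T) :
    c.leib n D D' z ∈ DefHopf.tensorSub S T :=
  Submodule.add_mem _ (map_mem_tensorSub hD (fun _ h => h) hz)
    (map_mem_tensorSub (fun _ h => hS.sgn_mem n h) hD' hz)

end homog

namespace DCoalgData
variable {k : Type u} [Field k] {W : Type v} [AddCommGroup W] [Module k W]
  {W' : Type w} [AddCommGroup W'] [Module k W'] {d : ℤ}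

/-- The distinguished element is a group-like cycle on which the cobracket vanishes. -/
structure IsCoaugmented (c : DCoalgData k W) : Prop where
  one_mem : c.one ∈ c.gr 0
  counit_one : c.counit c.one = 1
  comul_one : c.comul c.one = c.one ⊗ₜ c.one
  cobr_one : c.cobr c.one = 0
  diff_one : c.diff c.one = 0

/-- The reduced coproduct. -/
def red (c : DCoalgData k W) : W →ₗ[k] W ⊗[k] W :=
  c.comul - TensorProduct.mk k W W c.one - (TensorProduct.mk k W W).flip c.one

theorem red_apply (c : DCoalgData k W) (x : W) :
    c.red x = c.comul x - c.one ⊗ₜ x - x ⊗ₜ c.one := rfl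

theorem comul_eq (c : DCoalgData k W) (x : W) :
    c.comul x = c.red x + c.one ⊗ₜ x + x ⊗ₜ c.one := by rw [red_apply]; abel

/-- The coradical filtration. -/
def corad (c : DCoalgData k W) : ℕ → Submodule k W
  | 0 => Submodule.span k {c.one}
  | n + 1 => (tensorSub (corad c n) (corad c n)).comap c.red ⊓
      (tensorSub (corad c n) (corad c n)).comap c.cobr

theorem mem_corad_succ {c : DCoalgData k W} {n : ℕ} {x : W} : x ∈ c.corad (n + 1) ↔
    c.red x ∈ tensorSub (c.corad n) (c.corad n) ∧ c.cobr x ∈ tensorSub (c.corad n) (c.corad n) :=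
  Iff.rfl

theorem le_corad {c : DCoalgData k W} {G : ℕ → Submodule k W}
    (h0 : G 0 ≤ Submodule.span k {c.one})
    (h : ∀ n, ∀ x ∈ G (n + 1), c.red x ∈ tensorSub (G n) (G n) ∧ c.cobr x ∈ tensorSub (G n) (G n))
    (n : ℕ) : G n ≤ c.corad n := by
  induction n with
  | zero => exact h0
  | succ n ih => exact fun x hx => ⟨tensorSub_mono ih ih (h n x hx).1,
      tensorSub_mono ih ih (h n x hx).2⟩

namespace IsCoaugmented
variable {c : DCoalgData k W} (h1 : c.IsCoaugmented)
include h1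

theorem one_ne_zero : c.one ≠ 0 := fun h => by
  have := h1.counit_one
  rw [h, map_zero] at this
  exact zero_ne_one this

theorem red_one : c.red c.one = -(c.one ⊗ₜ c.one) := by
  rw [red_apply, h1.comul_one]; abel

theorem corad_mono : Monotone c.corad := by
  refine monotone_nat_of_le_succ fun n => ?_
  induction n with
  | zero =>
    refine (Submodule.span_singleton_le_iff_mem _ _).2 (mem_corad_succ.2 ⟨?_, ?_⟩)
    · rw [h1.red_one]
      exact Submodule.neg_mem _ (tmul_mem_tensorSub (Submodule.mem_span_singleton_self _)
        (Submodule.mem_span_singleton_self _))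
    · rw [h1.cobr_one]; exact Submodule.zero_mem _
  | succ n ih =>
    exact fun x hx => ⟨tensorSub_mono ih ih hx.1, tensorSub_mono ih ih hx.2⟩

theorem one_mem_corad (n : ℕ) : c.one ∈ c.corad n :=
  h1.corad_mono (Nat.zero_le n) (Submodule.mem_span_singleton_self _)

theorem comul_mem_corad {n : ℕ} {x : W} (hx : x ∈ c.corad n) :
    c.comul x ∈ tensorSub (c.corad n) (c.corad n) := by
  rw [comul_eq]
  refine Submodule.add_mem _ (Submodule.add_mem _ ?_ (tmul_mem_tensorSub (h1.one_mem_corad n) hx))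
    (tmul_mem_tensorSub hx (h1.one_mem_corad n))
  have := h1.corad_mono (Nat.le_succ n)
  exact tensorSub_mono le_rfl le_rfl (this hx).1

variable (hc : c.IsDCoalgebra d)
include hc

theorem red_homDeg : c.red ∈ homDeg c.toDiffMod (c.toDiffMod.tensor c.toDiffMod) 0 := by
  intro i x hx
  rw [add_zero]
  exact Submodule.sub_mem _ (Submodule.sub_mem _ (hc.comul_mem hx)
    (tmul_mem_tensorGr _ _ h1.one_mem hx (zero_add _)))
    (tmul_mem_tensorGr _ _ hx h1.one_mem (add_zero _))

theorem isHomog_corad (n : ℕ) : c.IsHomog (c.corad n) := by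
  induction n with
  | zero =>
    intro a x hx
    obtain ⟨r, rfl⟩ := Submodule.mem_span_singleton.1 hx
    rw [map_smul]
    refine Submodule.smul_mem _ _ ?_
    by_cases ha : 0 = a
    · subst ha; rw [c.proj_of_mem h1.one_mem]; exact Submodule.mem_span_singleton_self _
    · rw [c.proj_of_ne h1.one_mem ha]; exact Submodule.zero_mem _
  | succ n ih =>
    intro a x hx
    exact ⟨(ih.tensorSub ih).comap (h1.red_homDeg hc) a x hx.1,
      (ih.tensorSub ih).comap hc.cobr_homDeg a x hx.2⟩

theorem red_diff (x : W) : c.red (c.diff x) = c.leib 1 c.diff c.diff (c.red x) := by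
  have := LinearMap.congr_fun hc.diff_coder.comul x
  simp only [comp_apply] at this
  rw [red_apply, red_apply, this, map_sub, map_sub]
  congr 1
  · congr 1
    simp [leib, h1.diff_one, c.sgn_apply 1 h1.one_mem]
  · simp [leib, h1.diff_one]

theorem isSubcoalgebra_corad (n : ℕ) : IsSubcoalgebra c (c.corad n) := by
  refine ⟨(h1.isHomog_corad hc n).le, ?_, fun x hx => h1.comul_mem_corad hx, ?_⟩
  · induction n with
    | zero =>
      intro x hx
      obtain ⟨r, rfl⟩ := Submodule.mem_span_singleton.1 hx
      rw [map_smul, h1.diff_one, smul_zero]; exact Submodule.zero_mem _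
    | succ n ih =>
      refine fun x hx => mem_corad_succ.2 ⟨?_, ?_⟩
      · rw [h1.red_diff hc]
        exact leib_mem_tensorSub 1 (h1.isHomog_corad hc n) ih ih hx.1
      · rw [← comp_apply, hc.diff_coder.cobr]
        exact Submodule.smul_mem _ _ (leib_mem_tensorSub 1 (h1.isHomog_corad hc n) ih ih hx.2)
  · intro x hx
    have := h1.corad_mono (Nat.le_succ n)
    exact (this hx).2

theorem isCoproartinian (h : ⨆ n, c.corad n = ⊤) : c.IsCoproartinian := by
  refine ⟨c.corad, h1.corad_mono, h, h1.isSubcoalgebra_corad hc, rfl, h1.counit_one, ?_, ?_, ?_⟩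
  · intro x hx hx0
    obtain ⟨a, ha⟩ := mem_tensorSub_span hx.1
    have h2 := LinearMap.congr_fun hc.counit_comul x
    simp only [comp_apply, LinearEquiv.coe_coe, id_apply] at h2
    rw [comul_eq, ha] at h2
    simp only [map_add, map_tmul, h1.counit_one, id_apply,
      TensorProduct.lid_tmul, one_smul, hx0, map_smul, zero_smul, add_zero, add_eq_right] at h2
    have ha0 : a = 0 := by simpa [h1.one_ne_zero] using h2
    rw [comul_eq, ha, ha0, zero_smul, zero_add]
  · intro x hx
    obtain ⟨a, ha⟩ := mem_tensorSub_span hx.2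
    have h2 := LinearMap.congr_fun hc.counit_cobr x
    simp only [comp_apply, LinearEquiv.coe_coe, LinearMap.zero_apply] at h2
    rw [ha] at h2 ⊢
    have ha0 : a = 0 := by simpa [h1.one_ne_zero, h1.counit_one] using h2
    rw [ha0, zero_smul]
  · intro i hi x hx
    obtain ⟨j, rfl⟩ : ∃ j, i = j + 1 := ⟨i - 1, by omega⟩
    exact hx

end IsCoaugmented

namespace IsCoproartinian
variable {c : DCoalgData k W} (h : c.IsCoproartinian) (hc : c.IsDCoalgebra d)
include h hc

theorem isCoaugmented : c.IsCoaugmented := by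
  obtain ⟨F, -, -, hsub, h0, h1, -⟩ := h
  have hone : c.one ∈ F 0 := by rw [h0]; exact Submodule.mem_span_singleton_self _
  have hne : c.one ≠ 0 := fun h => by
    rw [h, map_zero] at h1
    exact zero_ne_one h1
  have hmem : c.one ∈ c.gr 0 := by
    have h2 := c.isHomog_of_le (hsub 0).homogeneous 0 _ hone
    rw [h0] at h2
    obtain ⟨a, ha⟩ := Submodule.mem_span_singleton.1 h2
    have h3 : c.counit ∘ₗ c.proj 0 = c.counit := c.hom_ext fun i x hx => by
      rw [comp_apply]
      by_cases hi : i = 0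
      · subst hi; rw [c.proj_of_mem hx]
      · rw [c.proj_of_ne hx hi, map_zero, hc.counit_deg hx hi]
    have h4 := LinearMap.congr_fun h3 c.one
    rw [comp_apply, ← ha, map_smul, h1, smul_eq_mul, mul_one] at h4
    rw [h4, one_smul] at ha
    rw [ha]
    exact c.proj_mem 0 _
  refine ⟨hmem, h1, ?_, ?_, ?_⟩
  · have h2 := (hsub 0).comul_mem _ hone
    rw [h0] at h2
    obtain ⟨a, ha⟩ := mem_tensorSub_span h2
    have h3 := LinearMap.congr_fun hc.counit_comul c.one
    simp only [comp_apply, LinearEquiv.coe_coe, id_apply] at h3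
    rw [ha] at h3 ⊢
    simp only [map_smul, map_tmul, h1, id_apply, TensorProduct.lid_tmul,
      one_smul] at h3
    have h4 : (a - 1) • c.one = 0 := by rw [sub_smul, h3, one_smul, sub_self]
    rw [smul_eq_zero, sub_eq_zero] at h4
    rw [h4.resolve_right hne, one_smul]
  · have h2 := (hsub 0).cobr_mem _ hone
    rw [h0] at h2
    obtain ⟨a, ha⟩ := mem_tensorSub_span h2
    have h3 := LinearMap.congr_fun hc.counit_cobr c.one
    simp only [comp_apply, LinearEquiv.coe_coe, LinearMap.zero_apply] at h3
    rw [ha] at h3 ⊢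
    have ha0 : a = 0 := by simpa [h1, hne] using h3
    rw [ha0, zero_smul]
  · have h2 := (hsub 0).diff_mem _ hone
    rw [h0] at h2
    obtain ⟨a, ha⟩ := Submodule.mem_span_singleton.1 h2
    refine c.mem_unique (i := 0) (j := 1) ?_ (c.diff_mem hmem) (by norm_num)
    rw [← ha]
    exact Submodule.smul_mem _ _ hmem

theorem iSup_corad : ⨆ n, c.corad n = ⊤ := by
  have h1 := h.isCoaugmented hc
  obtain ⟨F, hmono, htop, hsub, h0, -, hprim, hcobr, hF⟩ := h
  rw [eq_top_iff, ← htop]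
  refine iSup_mono (le_corad h0.le fun n x hx => ?_)
  cases n with
  | zero =>
    rw [hcobr x hx]
    refine ⟨?_, Submodule.zero_mem _⟩
    have h2 := hmono zero_le_one (show c.one ∈ F 0 by
      rw [h0]; exact Submodule.mem_span_singleton_self _)
    have h3 := hprim (x - c.counit x • c.one) (Submodule.sub_mem _ hx (Submodule.smul_mem _ _ h2))
      (by simp [h1.counit_one])
    have h4 : c.red (x - c.counit x • c.one) = 0 := by
      rw [red_apply, h3, add_sub_cancel_left, sub_self]
    rw [map_sub, sub_eq_zero] at h4
    rw [h4, map_smul, h1.red_one, h0]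
    exact Submodule.smul_mem _ _ (Submodule.neg_mem _ (tmul_mem_tensorSub
      (Submodule.mem_span_singleton_self _) (Submodule.mem_span_singleton_self _)))
  | succ n => exact hF (n + 2) (by omega) x hx

theorem exists_mem_corad (x : W) : ∃ n, x ∈ c.corad n := by
  have : x ∈ ⨆ n, c.corad n := by rw [h.iSup_corad hc]; trivial
  exact (Submodule.mem_iSup_of_directed _
    (h.isCoaugmented hc).corad_mono.directed_le).1 this

end IsCoproartinian
end DCoalgData

section
variable {k : Type u} [Field k] {W : Type v} [AddCommGroup W] [Module k W]
  {W' : Type w} [AddCommGroup W'] [Module k W'] {d : ℤ}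

theorem DiffMod.mid_one_left (c : DiffMod k W) (c' : DiffMod k W') {o : W'} (ho : o ∈ c'.gr 0)
    (x x' : W) (y : W') :
    mid c c' ((x ⊗ₜ x') ⊗ₜ (o ⊗ₜ y)) = (x ⊗ₜ[k] o) ⊗ₜ[k] (x' ⊗ₜ[k] y) := by
  induction x' using c.induction with
  | hom i x' hx => rw [mid_tmul c c' x y hx ho, mul_zero, ksign_zero, one_smul]
  | add a b h1 h2 =>
    simp only [tmul_add, add_tmul, map_add, h1, h2]

theorem DiffMod.mid_one_right (c : DiffMod k W) (c' : DiffMod k W') {o : W} (ho : o ∈ c.gr 0)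
    (x : W) (y y' : W') :
    mid c c' ((x ⊗ₜ o) ⊗ₜ (y ⊗ₜ y')) = (x ⊗ₜ[k] y) ⊗ₜ[k] (o ⊗ₜ[k] y') := by
  induction y using c'.induction with
  | hom i y hy => rw [mid_tmul c c' x y' ho hy, zero_mul, ksign_zero, one_smul]
  | add a b h1 h2 =>
    simp only [tmul_add, add_tmul, map_add, h1, h2]

namespace DCoalgData
variable {c : DCoalgData k W} {c' : DCoalgData k W'}

theorem tensor_comul_tmul (x : W) (y : W') : (c.tensor d c').comul (x ⊗ₜ y) =
    mid c.toDiffMod c'.toDiffMod (c.comul x ⊗ₜ c'.comul y) := rfl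

theorem tensor_cobr_tmul (x : W) (y : W') : (c.tensor d c').cobr (x ⊗ₜ y) =
    mid c.toDiffMod c'.toDiffMod (c.cobr x ⊗ₜ c'.comul y) +
      mid c.toDiffMod c'.toDiffMod (c.comul (c.sgn (d - 1) x) ⊗ₜ c'.cobr y) := by
  simp [tensor]

theorem tensor_diff_tmul {i : ℤ} {x : W} (hx : x ∈ c.gr i) (y : W') :
    (c.tensor d c').diff (x ⊗ₜ y) = c.diff x ⊗ₜ y + ksign k i • (x ⊗ₜ c'.diff y) := by
  change c.leib 1 c.diff c'.diff (x ⊗ₜ y) = _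
  simp [leib, c.sgn_apply 1 hx, smul_tmul']

theorem tensor_counit_tmul (x : W) (y : W') :
    (c.tensor d c').counit (x ⊗ₜ y) = c.counit x * c'.counit y := by
  simp [tensor]

theorem IsCoaugmented.tensor (h : c.IsCoaugmented) (h' : c'.IsCoaugmented) :
    (c.tensor d c').IsCoaugmented := by
  refine ⟨tmul_mem_tensorGr _ _ h.one_mem h'.one_mem (zero_add _), ?_, ?_, ?_, ?_⟩
  · change (c.tensor d c').counit (c.one ⊗ₜ c'.one) = 1
    rw [tensor_counit_tmul, h.counit_one, h'.counit_one, one_mul]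
  · change (c.tensor d c').comul (c.one ⊗ₜ c'.one) = (c.one ⊗ₜ c'.one) ⊗ₜ (c.one ⊗ₜ c'.one)
    rw [tensor_comul_tmul, h.comul_one, h'.comul_one, mid_one_left _ _ h'.one_mem]
  · change (c.tensor d c').cobr (c.one ⊗ₜ c'.one) = 0
    rw [tensor_cobr_tmul, h.cobr_one, h'.cobr_one]
    simp
  · change (c.tensor d c').diff (c.one ⊗ₜ c'.one) = 0
    rw [tensor_diff_tmul h.one_mem, h.diff_one, h'.diff_one]
    simp

theorem IsCoproartinian.tensor (hc : c.IsDCoalgebra d) (hc' : c'.IsDCoalgebra d)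
    (h : c.IsCoproartinian) (h' : c'.IsCoproartinian) : (c.tensor d c').IsCoproartinian := by
  have h1 := h.isCoaugmented hc
  have h1' := h'.isCoaugmented hc'
  let G : ℕ → Submodule k (W ⊗[k] W') := fun n =>
    ⨆ p : {p : ℕ × ℕ // p.1 + p.2 = n}, tensorSub (c.corad p.1.1) (c'.corad p.1.2)
  have hle : ∀ i j n, i + j = n → tensorSub (c.corad i) (c'.corad j) ≤ G n := fun i j n hn =>
    le_iSup (fun p : {p : ℕ × ℕ // p.1 + p.2 = n} => tensorSub (c.corad p.1.1) (c'.corad p.1.2))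
      ⟨(i, j), hn⟩
  have hle' : ∀ i j n, i + j ≤ n → tensorSub (c.corad i) (c'.corad j) ≤ G n := fun i j n hn =>
    (tensorSub_mono (h1.corad_mono (show i ≤ n - j by omega)) le_rfl).trans
      (hle (n - j) j n (by omega))
  have hH := h1.isHomog_corad hc
  have hH' := h1'.isHomog_corad hc'
  have key : ∀ n, ∀ x ∈ G (n + 1), (c.tensor d c').red x ∈ tensorSub (G n) (G n) ∧
      (c.tensor d c').cobr x ∈ tensorSub (G n) (G n) := by
    intro n z hz
    have : G (n + 1) ≤ (tensorSub (G n) (G n)).comap (c.tensor d c').red ⊓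
        (tensorSub (G n) (G n)).comap (c.tensor d c').cobr := by
      refine iSup_le ?_
      rintro ⟨⟨i, j⟩, hij⟩
      refine tensorSub_le fun x hx y hy => ?_
      simp only at hij hx hy
      change (c.tensor d c').red (x ⊗ₜ y) ∈ tensorSub (G n) (G n) ∧
        (c.tensor d c').cobr (x ⊗ₜ y) ∈ tensorSub (G n) (G n)
      have hm : ∀ {p q r s : ℕ} {t : W ⊗[k] W} {t' : W' ⊗[k] W'},
          t ∈ tensorSub (c.corad p) (c.corad r) → t' ∈ tensorSub (c'.corad q) (c'.corad s) →
          p + q ≤ n → r + s ≤ n →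
          mid c.toDiffMod c'.toDiffMod (t ⊗ₜ t') ∈ tensorSub (G n) (G n) :=
        fun {p q r s} t t' ht ht' h1 h2 => tensorSub_mono (hle' p q n h1) (hle' r s n h2)
          (mid_mem_tensorSub (hH r) (hH' q) ht ht')
      rw [red_apply, tensor_comul_tmul, tensor_cobr_tmul]
      change mid c.toDiffMod c'.toDiffMod (c.comul x ⊗ₜ c'.comul y) -
        (c.one ⊗ₜ c'.one) ⊗ₜ (x ⊗ₜ y) - (x ⊗ₜ y) ⊗ₜ (c.one ⊗ₜ c'.one) ∈
          tensorSub (G n) (G n) ∧ _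
      obtain _ | i := i
      · obtain rfl : j = n + 1 := by omega
        obtain ⟨r, rfl⟩ := Submodule.mem_span_singleton.1 hx
        have hone := h1.one_mem_corad 0
        have hy' := mem_corad_succ.1 hy
        refine ⟨?_, Submodule.add_mem _ ?_ ?_⟩
        · have e : mid c.toDiffMod c'.toDiffMod (c.comul (r • c.one) ⊗ₜ c'.comul y) -
            (c.one ⊗ₜ c'.one) ⊗ₜ ((r • c.one) ⊗ₜ y) - ((r • c.one) ⊗ₜ y) ⊗ₜ (c.one ⊗ₜ c'.one) =
            r • mid c.toDiffMod c'.toDiffMod ((c.one ⊗ₜ c.one) ⊗ₜ c'.red y) := by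
            rw [map_smul, h1.comul_one, comul_eq c' y]
            simp only [tmul_add, map_add, mid_one_left _ _ h1'.one_mem,
              mid_one_right _ _ h1.one_mem, ← smul_tmul', tmul_smul,
              map_smul]
            abel
          rw [e]
          exact Submodule.smul_mem _ _ (hm (tmul_mem_tensorSub hone hone) hy'.1 (by omega)
            (by omega))
        · rw [map_smul, h1.cobr_one]; simp
        · rw [map_smul, map_smul, c.sgn_apply _ h1.one_mem, mul_zero, ksign_zero, one_smul,
            h1.comul_one, ← smul_tmul', map_smul]
          exact Submodule.smul_mem _ _ (hm (tmul_mem_tensorSub hone hone) hy'.2 (by omega)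
            (by omega))
      · obtain _ | j := j
        · obtain rfl : i = n := by omega
          obtain ⟨r, rfl⟩ := Submodule.mem_span_singleton.1 hy
          have hone := h1'.one_mem_corad 0
          have hx' := mem_corad_succ.1 hx
          refine ⟨?_, Submodule.add_mem _ ?_ ?_⟩
          · have e : mid c.toDiffMod c'.toDiffMod (c.comul x ⊗ₜ c'.comul (r • c'.one)) -
              (c.one ⊗ₜ c'.one) ⊗ₜ (x ⊗ₜ (r • c'.one)) - (x ⊗ₜ (r • c'.one)) ⊗ₜ (c.one ⊗ₜ c'.one) =
              r • mid c.toDiffMod c'.toDiffMod (c.red x ⊗ₜ (c'.one ⊗ₜ c'.one)) := by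
              rw [map_smul, h1'.comul_one, comul_eq c x]
              simp only [add_tmul, map_add, mid_one_left _ _ h1'.one_mem,
                ← smul_tmul', tmul_smul, map_smul, smul_add]
              abel
            rw [e]
            exact Submodule.smul_mem _ _ (hm hx'.1 (tmul_mem_tensorSub hone hone) (by omega)
              (by omega))
          · rw [map_smul, h1'.comul_one, tmul_smul, map_smul]
            exact Submodule.smul_mem _ _ (hm hx'.2 (tmul_mem_tensorSub hone hone) (by omega)
              (by omega))
          · rw [map_smul, h1'.cobr_one]; simp
        · have hone := h1.one_mem_corad 0
          have hone' := h1'.one_mem_corad 0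
          have hx' := mem_corad_succ.1 hx
          have hy' := mem_corad_succ.1 hy
          refine ⟨?_, Submodule.add_mem _ ?_ ?_⟩
          · have e : mid c.toDiffMod c'.toDiffMod (c.comul x ⊗ₜ c'.comul y) -
              (c.one ⊗ₜ c'.one) ⊗ₜ (x ⊗ₜ y) - (x ⊗ₜ y) ⊗ₜ (c.one ⊗ₜ c'.one) =
              mid c.toDiffMod c'.toDiffMod (c.red x ⊗ₜ c'.comul y) +
              mid c.toDiffMod c'.toDiffMod ((c.one ⊗ₜ x) ⊗ₜ c'.red y) +
              mid c.toDiffMod c'.toDiffMod ((x ⊗ₜ c.one) ⊗ₜ c'.red y) +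
              mid c.toDiffMod c'.toDiffMod ((c.one ⊗ₜ x) ⊗ₜ (y ⊗ₜ c'.one)) +
              mid c.toDiffMod c'.toDiffMod ((x ⊗ₜ c.one) ⊗ₜ (c'.one ⊗ₜ y)) := by
              nth_rewrite 1 [comul_eq c x, comul_eq c' y]
              rw [comul_eq c' y]
              simp only [tmul_add, add_tmul, map_add,
                mid_one_left _ _ h1'.one_mem, mid_one_right _ _ h1.one_mem]
              abel
            rw [e]
            refine Submodule.add_mem _ (Submodule.add_mem _ (Submodule.add_mem _
              (Submodule.add_mem _ ?_ ?_) ?_) ?_) ?_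
            · exact hm hx'.1 (h1'.comul_mem_corad hy) (by omega) (by omega)
            · exact hm (tmul_mem_tensorSub hone hx) hy'.1 (by omega) (by omega)
            · exact hm (tmul_mem_tensorSub hx hone) hy'.1 (by omega) (by omega)
            · exact hm (tmul_mem_tensorSub hone hx) (tmul_mem_tensorSub hy hone') (by omega)
                (by omega)
            · exact hm (tmul_mem_tensorSub hx hone) (tmul_mem_tensorSub hone' hy) (by omega)
                (by omega)
          · exact hm hx'.2 (h1'.comul_mem_corad hy) (by omega) (by omega)
          · exact hm (h1.comul_mem_corad ((hH (i + 1)).sgn_mem _ hx)) hy'.2 (by omega) (by omega)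
    exact this hz
  refine (h1.tensor h1').isCoproartinian (hc.tensor hc') ?_
  have hG : ∀ n, G n ≤ (c.tensor d c').corad n := le_corad (by
    refine iSup_le ?_
    rintro ⟨⟨i, j⟩, hij⟩
    obtain ⟨rfl, rfl⟩ : i = 0 ∧ j = 0 := by simpa using hij
    intro z hz
    obtain ⟨a, rfl⟩ := mem_tensorSub_span hz
    exact Submodule.smul_mem _ _ (Submodule.mem_span_singleton_self _)) key
  rw [eq_top_iff]
  rintro z -
  induction z using induction_on with
  | zero => exact Submodule.zero_mem _
  | tmul x y =>
    obtain ⟨i, hi⟩ := h.exists_mem_corad hc x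
    obtain ⟨j, hj⟩ := h'.exists_mem_corad hc' y
    exact Submodule.mem_iSup_of_mem (i + j) (hG _ (hle i j _ rfl (tmul_mem_tensorSub hi hj)))
  | add x y h1 h2 => exact Submodule.add_mem _ h1 h2

section hom
variable {A B C E : Type*} [AddCommGroup A] [Module k A] [AddCommGroup B] [Module k B]
  [AddCommGroup C] [Module k C] [AddCommGroup E] [Module k E] {a : DCoalgData k A}
  {b : DCoalgData k B} {e : DCoalgData k C} {e' : DCoalgData k E}

theorem _root_.DefHopf.DiffMod.homDeg_comp {a : DiffMod k A} {b : DiffMod k B} {e : DiffMod k C}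
    {n m : ℤ} {f : A →ₗ[k] B} {g : B →ₗ[k] C} (hg : g ∈ homDeg b e n) (hf : f ∈ homDeg a b m) :
    g ∘ₗ f ∈ homDeg a e (m + n) := fun i x hx => by
  have := hg _ _ (hf i x hx)
  rwa [add_assoc] at this

theorem _root_.DefHopf.DiffMod.homDeg_comp_zero {a : DiffMod k A} {b : DiffMod k B}
    {e : DiffMod k C} {n : ℤ} {f : A →ₗ[k] B} {g : B →ₗ[k] C} (hg : g ∈ homDeg b e n)
    (hf : f ∈ homDeg a b 0) : g ∘ₗ f ∈ homDeg a e n := by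
  simpa using homDeg_comp hg hf

theorem _root_.DefHopf.DiffMod.zero_homDeg_comp {a : DiffMod k A} {b : DiffMod k B}
    {e : DiffMod k C} {n : ℤ} {f : A →ₗ[k] B} {g : B →ₗ[k] C} (hg : g ∈ homDeg b e 0)
    (hf : f ∈ homDeg a b n) : g ∘ₗ f ∈ homDeg a e n := by
  simpa using homDeg_comp hg hf

theorem _root_.DefHopf.DiffMod.id_homDeg (a : DiffMod k A) : LinearMap.id ∈ homDeg a a 0 :=
  fun i x hx => by rwa [add_zero]

theorem _root_.DefHopf.DiffMod.map_homDeg {a : DiffMod k A} {b : DiffMod k B} {e : DiffMod k C}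
    {e' : DiffMod k E} {n m : ℤ} {f : A →ₗ[k] B} {g : C →ₗ[k] E} (hf : f ∈ homDeg a b n)
    (hg : g ∈ homDeg e e' m) :
    TensorProduct.map f g ∈ homDeg (a.tensor e) (b.tensor e') (n + m) :=
  fun _ _ hx => map_mem_tensorGr hf hg hx

theorem IsGradedHom.id (a : DCoalgData k A) : IsGradedHom a a LinearMap.id :=
  ⟨a.id_homDeg, by simp, by simp, rfl⟩

theorem IsHom.id (a : DCoalgData k A) : IsHom a a LinearMap.id :=
  ⟨IsGradedHom.id a, rfl⟩

theorem IsGradedHom.comp {f : A →ₗ[k] B} {g : B →ₗ[k] C} (hg : IsGradedHom b e g)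
    (hf : IsGradedHom a b f) : IsGradedHom a e (g ∘ₗ f) := by
  refine ⟨homDeg_comp_zero hg.deg hf.deg, ?_, ?_, ?_⟩
  · rw [← comp_assoc, hg.comul, comp_assoc, hf.comul, ← comp_assoc,
      map_comp]
  · rw [← comp_assoc, hg.cobr, comp_assoc, hf.cobr, ← comp_assoc,
      map_comp]
  · rw [← comp_assoc, hg.counit, hf.counit]

theorem IsHom.comp {f : A →ₗ[k] B} {g : B →ₗ[k] C} (hg : IsHom b e g)
    (hf : IsHom a b f) : IsHom a e (g ∘ₗ f) := by
  refine ⟨hg.toIsGradedHom.comp hf.toIsGradedHom, ?_⟩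
  rw [← comp_assoc, hg.diff, comp_assoc, hf.diff, comp_assoc]

theorem _root_.DefHopf.DiffMod.mid_comp_map {a : DiffMod k A} {b : DiffMod k B} {e : DiffMod k C}
    {e' : DiffMod k E} {f f' : A →ₗ[k] B} {g g' : C →ₗ[k] E} (hf' : f' ∈ homDeg a b 0)
    (hg : g ∈ homDeg e e' 0) :
    mid b e' ∘ₗ TensorProduct.map (TensorProduct.map f f') (TensorProduct.map g g') =
      TensorProduct.map (TensorProduct.map f g) (TensorProduct.map f' g') ∘ₗ mid a e := by
  apply ext'
  intro s t
  induction s using a.tensor_induction a with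
  | add s s' h1 h2 => rw [add_tmul, map_add, map_add, h1, h2]
  | tmul i j x x' hx hx' =>
    induction t using e.tensor_induction e with
    | add s s' h1 h2 => rw [tmul_add, map_add, map_add, h1, h2]
    | tmul i' j' y y' hy hy' =>
      have h1 := hf' _ _ hx'
      have h2 := hg _ _ hy
      rw [add_zero] at h1 h2
      simp only [comp_apply, map_tmul]
      rw [mid_tmul b e' _ _ h1 h2, mid_tmul a e _ _ hx' hy, map_smul]
      rfl

theorem IsGradedHom.tensorMap {f : A →ₗ[k] B} {g : C →ₗ[k] E} (hf : IsGradedHom a b f)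
    (hg : IsGradedHom e e' g) :
    IsGradedHom (a.tensor d e) (b.tensor d e') (TensorProduct.map f g) := by
  refine ⟨?_, ?_, ?_, ?_⟩
  · have := map_homDeg hf.deg hg.deg
    rwa [add_zero] at this
  · change (mid _ _ ∘ₗ TensorProduct.map _ _) ∘ₗ _ = _ ∘ₗ (mid _ _ ∘ₗ TensorProduct.map _ _)
    rw [comp_assoc, ← map_comp, hf.comul, hg.comul,
      map_comp, ← comp_assoc, mid_comp_map hf.deg hg.deg,
      comp_assoc]
  · change (mid _ _ ∘ₗ (TensorProduct.map _ _ + TensorProduct.map _ _)) ∘ₗ _ =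
      _ ∘ₗ (mid _ _ ∘ₗ (TensorProduct.map _ _ + TensorProduct.map _ _))
    rw [← comp_assoc _ _ (TensorProduct.map _ _), ← mid_comp_map hf.deg hg.deg,
      comp_assoc, comp_assoc, add_comp, comp_add,
      comp_add, comp_add,
      ← map_comp, ← map_comp, ← map_comp,
      ← map_comp, hf.cobr, hg.cobr, hg.comul, comp_assoc,
      sgn_comp hf.deg, ← comp_assoc, hf.comul, comp_assoc]
  · apply ext'
    intro x y
    have h1 := LinearMap.congr_fun hf.counit x
    have h2 := LinearMap.congr_fun hg.counit y
    rw [comp_apply] at h1 h2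
    rw [comp_apply, map_tmul, tensor_counit_tmul, tensor_counit_tmul,
      h1, h2]

theorem IsHom.tensorMap {f : A →ₗ[k] B} {g : C →ₗ[k] E} (hf : IsHom a b f)
    (hg : IsHom e e' g) :
    IsHom (a.tensor d e) (b.tensor d e') (TensorProduct.map f g) := by
  refine ⟨hf.toIsGradedHom.tensorMap hg.toIsGradedHom, ?_⟩
  refine tensor_hom_ext a.toDiffMod e.toDiffMod fun i j x y hx hy => ?_
  have h1 := LinearMap.congr_fun hf.diff x
  have h2 := LinearMap.congr_fun hg.diff y
  have h3 := hf.deg _ _ hx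
  rw [add_zero] at h3
  simp only [comp_apply] at h1 h2 ⊢
  rw [map_tmul, tensor_diff_tmul h3, h1, h2, tensor_diff_tmul hx, map_add, map_smul]
  rfl

theorem isHom_assoc_symm (ha : a.IsDCoalgebra d) (hb : b.IsDCoalgebra d) :
    IsHom (a.tensor d (b.tensor d e)) ((a.tensor d b).tensor d e)
      (assoc k A B C).symm.toLinearMap := by
  have hsep := (a.separating_dualDeg.dtmul b.separating_dualDeg).dtmul e.separating_dualDeg
  refine ⟨⟨?_, ?_, ?_, ?_⟩, ?_⟩
  · intro n z hz
    rw [add_zero]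
    refine tensorGr_induction (P := fun z => (assoc k A B C).symm.toLinearMap z ∈
      ((a.tensor d b).tensor d e).gr n) _ _ z hz (fun i j x t hx ht hij => ?_) (by simp)
      fun x y h1 h2 => by rw [map_add]; exact Submodule.add_mem _ h1 h2
    refine tensorGr_induction (P := fun t => (assoc k A B C).symm.toLinearMap
      (x ⊗ₜ t) ∈ ((a.tensor d b).tensor d e).gr n) _ _ t ht (fun p q y z hy hz hpq => ?_) (by simp)
      fun x y h1 h2 => by rw [tmul_add, map_add]; exact Submodule.add_mem _ h1 h2
    exact tmul_mem_tensorGr _ _ (tmul_mem_tensorGr _ _ hx hy rfl) hz (by omega)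
  · refine (hsep.dtmul hsep).ext ?_
    rintro _ ⟨_, ⟨_, ⟨φ, ⟨n, hφ⟩, φ', ⟨n', hφ'⟩, rfl⟩, φ'', ⟨n'', hφ''⟩, rfl⟩,
      _, ⟨_, ⟨ψ, ⟨m, hψ⟩, ψ', ⟨m', hψ'⟩, rfl⟩, ψ'', ⟨m'', hψ''⟩, rfl⟩, rfl⟩
    rw [← comp_assoc, ← comp_assoc, dtmul_comp_map, dtmul_assoc_symm,
      dtmul_assoc_symm]
    have e1 := IsDCoalgebra.tensor_dmul (d := d) (c := a.tensor d b) (c' := e) (φ := φ ⊠ φ')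
      (ψ' := ψ'') hφ'' (dtmul_mem_dualDeg a.toDiffMod b.toDiffMod hψ hψ')
    have e2 := IsDCoalgebra.tensor_dmul (d := d) (c := a) (c' := b.tensor d e) (φ := φ)
      (ψ' := ψ' ⊠ ψ'') (dtmul_mem_dualDeg b.toDiffMod e.toDiffMod hφ' hφ'') hψ
    rw [IsDCoalgebra.tensor_dmul hφ' hψ, dtmul_smul_left, smul_smul, ← ksign_add] at e1
    rw [IsDCoalgebra.tensor_dmul hφ'' hψ', dtmul_smul_right, smul_smul, ← ksign_add] at e2
    change ((a.tensor d b).tensor d e).dmul _ _ ∘ₗ _ = (a.tensor d (b.tensor d e)).dmul _ _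
    rw [e1, e2, smul_comp, dtmul_assoc_symm]
    congr 1
    exact ksign_congr (by push_cast; grind)
  · refine (hsep.dtmul hsep).ext ?_
    rintro _ ⟨_, ⟨_, ⟨φ, ⟨n, hφ⟩, φ', ⟨n', hφ'⟩, rfl⟩, φ'', ⟨n'', hφ''⟩, rfl⟩,
      _, ⟨_, ⟨ψ, ⟨m, hψ⟩, ψ', ⟨m', hψ'⟩, rfl⟩, ψ'', ⟨m'', hψ''⟩, rfl⟩, rfl⟩
    rw [← comp_assoc, ← comp_assoc, dtmul_comp_map, dtmul_assoc_symm,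
      dtmul_assoc_symm]
    have e1 := (ha.tensor hb).tensor_dbr (c' := e) (ψ' := ψ'')
      (dtmul_mem_dualDeg a.toDiffMod b.toDiffMod hφ hφ') hφ''
      (dtmul_mem_dualDeg a.toDiffMod b.toDiffMod hψ hψ')
    have e2 := ha.tensor_dbr (c' := b.tensor d e) (ψ' := ψ' ⊠ ψ'') hφ
      (dtmul_mem_dualDeg b.toDiffMod e.toDiffMod hφ' hφ'') hψ
    rw [IsDCoalgebra.tensor_dmul hφ' hψ, ha.tensor_dbr hφ hφ' hψ] at e1
    rw [IsDCoalgebra.tensor_dmul hφ'' hψ', hb.tensor_dbr hφ' hφ'' hψ'] at e2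
    change ((a.tensor d b).tensor d e).dbr _ _ ∘ₗ _ = (a.tensor d (b.tensor d e)).dbr _ _
    rw [e1, e2]
    simp only [add_comp, smul_comp, dtmul_add_left, dtmul_add_right,
      dtmul_smul_left, dtmul_smul_right, smul_add, smul_smul, ← ksign_add, dtmul_assoc_symm]
    match_scalars <;> simp only [mul_one] <;> apply ksign_congr <;> push_cast <;> grind
  · ext x y z
    simp [tensor_counit_tmul, mul_assoc]
  · refine tensor_hom_ext a.toDiffMod (b.toDiffMod.tensor e.toDiffMod) fun i j x t hx ht => ?_
    clear ht
    induction t using b.toDiffMod.tensor_induction e.toDiffMod with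
    | add s t h1 h2 => rw [tmul_add, map_add, map_add, h1, h2]
    | tmul p q y z hy hz =>
      have h1 : ((a.tensor d b).tensor d e).diff ((x ⊗ₜ y) ⊗ₜ z) = _ := tensor_diff_tmul
        (c := a.tensor d b) (c' := e) (d := d) (tmul_mem_tensorGr a.toDiffMod b.toDiffMod hx hy rfl) z
      have h2 : (a.tensor d (b.tensor d e)).diff (x ⊗ₜ (y ⊗ₜ z)) = _ :=
        tensor_diff_tmul (c := a) (c' := b.tensor d e) (d := d) hx (y ⊗ₜ z)
      rw [comp_apply, comp_apply, h2]
      refine h1.trans ?_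
      rw [tensor_diff_tmul hx, tensor_diff_tmul hy]
      simp only [map_add, map_smul, tmul_add, tmul_smul, smul_add,
        smul_smul, LinearEquiv.coe_coe, TensorProduct.assoc_symm_tmul, add_tmul,
        ← smul_tmul', ksign_add]
      abel

end hom
end DCoalgData
end

section dualNumbers
variable (k : Type u) [Field k] (n : ℤ)

/-- The graded space spanned by `1` in degree `0` and `ε` in degree `n`. -/
def dualNumbersGr (i : ℤ) : Submodule k (k × k) where
  carrier := {x | (i ≠ 0 → x.1 = 0) ∧ (i ≠ n → x.2 = 0)}
  add_mem' h1 h2 := ⟨fun h => by simp [h1.1 h, h2.1 h], fun h => by simp [h1.2 h, h2.2 h]⟩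
  zero_mem' := ⟨fun _ => rfl, fun _ => rfl⟩
  smul_mem' r _ h := ⟨fun hi => by simp [h.1 hi], fun hi => by simp [h.2 hi]⟩

theorem dualNumbersGr_internal : DirectSum.IsInternal (dualNumbersGr k n) := by
  let f0 : k →ₗ[k] dualNumbersGr k n 0 := (LinearMap.inl k k k).codRestrict _ fun _ =>
    ⟨fun h => absurd rfl h, fun _ => rfl⟩
  let fn : k →ₗ[k] dualNumbersGr k n n := (LinearMap.inr k k k).codRestrict _ fun _ =>
    ⟨fun _ => rfl, fun h => absurd rfl h⟩
  let D : k × k →ₗ[k] ⨁ i, dualNumbersGr k n i := LinearMap.coprod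
    (DirectSum.lof k ℤ (fun i => dualNumbersGr k n i) 0 ∘ₗ f0)
    (DirectSum.lof k ℤ (fun i => dualNumbersGr k n i) n ∘ₗ fn)
  refine @DirectSum.Decomposition.isInternal _ _ _ _ _ _ _ _
    (DirectSum.Decomposition.ofLinearMap (dualNumbersGr k n) D ?_ ?_)
  · ext <;> simp [D, f0, fn] <;> rfl
  · ext i ⟨⟨a, b⟩, ha, hb⟩ : 2
    simp only [comp_apply, DirectSum.coeLinearMap_lof, id_apply, D,
      LinearMap.coprod_apply]
    have ma : ((a, 0) : k × k) ∈ dualNumbersGr k n i := ⟨ha, fun _ => rfl⟩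
    have mb : ((0, b) : k × k) ∈ dualNumbersGr k n i := ⟨fun _ => rfl, hb⟩
    have e : (⟨(a, b), ⟨ha, hb⟩⟩ : dualNumbersGr k n i) = ⟨(a, 0), ma⟩ + ⟨(0, b), mb⟩ := by
      ext <;> simp
    rw [e, map_add]
    congr 1
    · by_cases h : i = 0
      · subst h; rfl
      · obtain rfl : a = 0 := ha h
        rw [map_zero, map_zero]
        exact (map_zero _).symm
    · by_cases h : i = n
      · subst h; rfl
      · obtain rfl : b = 0 := hb h
        rw [map_zero, map_zero]
        exact (map_zero _).symm

/-- The coalgebra of dual numbers, with `ε` primitive of degree `n`. -/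
def dualNumbers : DCoalgData k (k × k) where
  gr := dualNumbersGr k n
  internal := dualNumbersGr_internal k n
  diff := 0
  diff_mem _ := Submodule.zero_mem _
  comul := LinearMap.coprod (toSpanSingleton k _ ((1, 0) ⊗ₜ (1, 0)))
    (toSpanSingleton k _ ((1, 0) ⊗ₜ (0, 1) + (0, 1) ⊗ₜ (1, 0)))
  cobr := 0
  counit := LinearMap.fst k k k
  one := (1, 0)

theorem dualNumbers_one_mem : ((1, 0) : k × k) ∈ (dualNumbers k n).gr 0 :=
  ⟨fun h => absurd rfl h, fun _ => rfl⟩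

theorem dualNumbers_eps_mem : ((0, 1) : k × k) ∈ (dualNumbers k n).gr n :=
  ⟨fun _ => rfl, fun h => absurd rfl h⟩

theorem dualNumbers_comul_one :
    (dualNumbers k n).comul (1, 0) = (1, 0) ⊗ₜ[k] (1, 0) := by
  simp [dualNumbers]

theorem dualNumbers_comul_eps :
    (dualNumbers k n).comul (0, 1) = (1, 0) ⊗ₜ[k] (0, 1) + (0, 1) ⊗ₜ[k] (1, 0) := by
  simp [dualNumbers]

theorem prod_hom_ext {M : Type*} [AddCommMonoid M] [Module k M] {f g : k × k →ₗ[k] M}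
    (h1 : f (1, 0) = g (1, 0)) (h2 : f (0, 1) = g (0, 1)) : f = g := by
  apply LinearMap.prod_ext <;> ext <;> simpa

theorem prod_induction {P : k × k → Prop} (x : k × k) (smul1 : ∀ a : k, P (a • (1, 0)))
    (smul2 : ∀ a : k, P (a • (0, 1))) (add : ∀ x y, P x → P y → P (x + y)) : P x := by
  have : x = x.1 • ((1, 0) : k × k) + x.2 • ((0, 1) : k × k) := by ext <;> simp
  rw [this]
  exact add _ _ (smul1 _) (smul2 _)

theorem dualNumbers_isDCoalgebra (d : ℤ) : (dualNumbers k n).IsDCoalgebra d := by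
  have m1 := dualNumbers_one_mem k n
  have m2 := dualNumbers_eps_mem k n
  have c1 := dualNumbers_comul_one k n
  have c2 := dualNumbers_comul_eps k n
  refine ⟨fun _ => rfl, ?_, ?_, ?_, ?_, ?_, ?_, ?_, ?_, ?_, ?_, ?_⟩
  · rintro i ⟨a, b⟩ ⟨ha, hb⟩
    have : ((a, b) : k × k) = a • (1, 0) + b • (0, 1) := by ext <;> simp
    rw [this, map_add, map_smul, map_smul, c1, c2]
    refine Submodule.add_mem _ ?_ ?_
    · by_cases h : i = 0
      · exact Submodule.smul_mem _ _ (tmul_mem_tensorGr _ _ m1 m1 (by omega))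
      · rw [show a = 0 from ha h, zero_smul]; exact Submodule.zero_mem _
    · by_cases h : i = n
      · exact Submodule.smul_mem _ _ (Submodule.add_mem _
          (tmul_mem_tensorGr _ _ m1 m2 (by omega)) (tmul_mem_tensorGr _ _ m2 m1 (by omega)))
      · rw [show b = 0 from hb h, zero_smul]; exact Submodule.zero_mem _
  · apply prod_hom_ext
    · simp [c1]
    · simp [c1, c2, tmul_add, add_tmul]; abel
  · apply prod_hom_ext
    · simp [c1, twist_apply _ _ m1 m1]
    · simp [c2, twist_apply _ _ m1 m2, twist_apply _ _ m2 m1]; abel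
  · rintro i ⟨a, b⟩ ⟨ha, hb⟩ hi
    exact ha hi
  · apply prod_hom_ext
    · simp only [comp_apply, c1]; simp [dualNumbers]
    · simp only [comp_apply, c2]; simp [dualNumbers]
  · intro i x _; exact Submodule.zero_mem _
  · simp [dualNumbers]
  · simp [dualNumbers]
  · simp [dualNumbers]
  · simp [dualNumbers]
  · exact ⟨fun _ _ _ => Submodule.zero_mem _, by simp [dualNumbers, leib],
      by simp [dualNumbers, leib]⟩

theorem dualNumbers_isCoaugmented : (dualNumbers k n).IsCoaugmented :=
  ⟨dualNumbers_one_mem k n, rfl, dualNumbers_comul_one k n, rfl, rfl⟩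

theorem dualNumbers_isCoproartinian : (dualNumbers k n).IsCoproartinian := by
  have h1 := dualNumbers_isCoaugmented k n
  refine h1.isCoproartinian (dualNumbers_isDCoalgebra k n 0) ?_
  rw [eq_top_iff]
  rintro x -
  refine Submodule.mem_iSup_of_mem 1 ?_
  refine prod_induction k x (fun a => ?_) (fun a => ?_) fun x y => Submodule.add_mem _
  · exact Submodule.smul_mem _ _ (h1.one_mem_corad 1)
  · refine Submodule.smul_mem _ _ (mem_corad_succ.2 ⟨?_, Submodule.zero_mem _⟩)
    rw [red_apply, dualNumbers_comul_eps]
    simp [dualNumbers]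

end dualNumbers

section coderAlong
variable {k : Type u} [Field k] {A : Type*} [AddCommGroup A] [Module k A] {W : Type*}
  [AddCommGroup W] [Module k W] {d n : ℤ}

theorem DiffMod.sgn_sgn (c : DiffMod k W) (n : ℤ) (x : W) : c.sgn n (c.sgn n x) = x := by
  induction x using c.induction with
  | hom i x hx => rw [c.sgn_apply n hx, map_smul, c.sgn_apply n hx, ksign_smul_smul]
  | add x y h1 h2 => rw [map_add, map_add, h1, h2]

theorem DiffMod.map_sgn_sgn (c : DiffMod k A) (c' : DiffMod k W) (n : ℤ) :
    TensorProduct.map (c.sgn n) (c'.sgn n) = (c.tensor c').sgn n := by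
  refine tensor_hom_ext c c' fun i j x y hx hy => ?_
  have : x ⊗ₜ y ∈ (c.tensor c').gr (i + j) := tmul_mem_tensorGr c c' hx hy rfl
  rw [map_tmul, c.sgn_apply n hx, c'.sgn_apply n hy, (c.tensor c').sgn_apply n this,
    TensorProduct.smul_tmul_smul, mul_add, ksign_add]

theorem DiffMod.sgn_comp_homDeg {c : DiffMod k A} {c' : DiffMod k W} {f : A →ₗ[k] W} {m : ℤ}
    (hf : f ∈ homDeg c c' m) (n : ℤ) : c'.sgn n ∘ₗ f = ksign k (n * m) • (f ∘ₗ c.sgn n) := by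
  refine c.hom_ext fun i x hx => ?_
  simp only [comp_apply, LinearMap.smul_apply]
  rw [c'.sgn_apply n (hf _ _ hx), c.sgn_apply n hx, map_smul, smul_smul, ← ksign_add]
  congr 1
  exact ksign_congr (by push_cast; ring)

namespace DCoalgData

/-- A coderivation of degree `n` along a morphism `g`. -/
structure IsCoderAlong (d : ℤ) (a : DCoalgData k A) (c : DCoalgData k W) (n : ℤ)
    (g D : A →ₗ[k] W) : Prop where
  deg : D ∈ homDeg a.toDiffMod c.toDiffMod n
  comul : c.comul ∘ₗ D =
    (TensorProduct.map D g + TensorProduct.map (g ∘ₗ a.sgn n) D) ∘ₗ a.comul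
  cobr : c.cobr ∘ₗ D = ksign k (n * (1 - d)) •
    ((TensorProduct.map D g + TensorProduct.map (g ∘ₗ a.sgn n) D) ∘ₗ a.cobr)

theorem isCoderAlong_id {c : DCoalgData k W} {D : W →ₗ[k] W} :
    IsCoderAlong d c c n LinearMap.id D ↔ IsCoder d c n D :=
  ⟨fun h => ⟨h.deg, h.comul, h.cobr⟩, fun h => ⟨h.deg, h.comul, h.cobr⟩⟩

variable {a : DCoalgData k A} {c : DCoalgData k W}

theorem IsCoderAlong.counit (ha : a.IsDCoalgebra d) (hc : c.IsDCoalgebra d) {g D : A →ₗ[k] W}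
    (hg : IsGradedHom a c g) (h : IsCoderAlong d a c n g D) : c.counit ∘ₗ D = 0 := by
  have h1 : (c.counit ⊠ c.counit) ∘ₗ c.comul ∘ₗ D =
      (c.counit ⊠ c.counit) ∘ₗ
        (TensorProduct.map D g + TensorProduct.map (g ∘ₗ a.sgn n) D) ∘ₗ a.comul := by rw [h.comul]
  rw [← comp_assoc, ← comp_assoc, comp_add, dtmul_comp_map,
    dtmul_comp_map, hg.counit, ← comp_assoc, hg.counit,
    dualDeg_comp_sgn _ _ ha.counit_mem_dualDeg, mul_zero, ksign_zero, one_smul,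
    add_comp] at h1
  change c.dmul _ _ ∘ₗ D = a.dmul _ _ + a.dmul _ _ at h1
  rw [hc.counit_dmul, ha.counit_dmul, ha.dmul_counit] at h1
  exact left_eq_add.1 h1

/-- The map `A ⊗ k[ε] → W` with components `g` and `D`. -/
def epsMap (a : DCoalgData k A) (n : ℤ) (g D : A →ₗ[k] W) : A ⊗[k] (k × k) →ₗ[k] W :=
  TensorProduct.lift (LinearMap.flip (LinearMap.coprod (toSpanSingleton k _ g)
    (toSpanSingleton k _ (D ∘ₗ a.sgn n))))

theorem epsMap_one (g D : A →ₗ[k] W) (x : A) : epsMap a n g D (x ⊗ₜ (1, 0)) = g x := by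
  simp [epsMap]

theorem epsMap_eps (g D : A →ₗ[k] W) (x : A) :
    epsMap a n g D (x ⊗ₜ (0, 1)) = D (a.sgn n x) := by
  simp [epsMap]

theorem eps_hom_ext {M : Type*} [AddCommMonoid M] [Module k M] {f g : A ⊗[k] (k × k) →ₗ[k] M}
    (h1 : ∀ x, f (x ⊗ₜ (1, 0)) = g (x ⊗ₜ (1, 0))) (h2 : ∀ x, f (x ⊗ₜ (0, 1)) = g (x ⊗ₜ (0, 1))) :
    f = g := by
  apply TensorProduct.ext
  ext x : 1
  exact prod_hom_ext k (h1 x) (h2 x)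

theorem epsMap_surj (G : A ⊗[k] (k × k) →ₗ[k] W) :
    ∃ g D, G = epsMap a n g D := by
  refine ⟨G ∘ₗ (TensorProduct.mk k A (k × k)).flip (1, 0),
    G ∘ₗ (TensorProduct.mk k A (k × k)).flip (0, 1) ∘ₗ a.sgn n, eps_hom_ext ?_ ?_⟩
  · intro x; rw [epsMap_one]; rfl
  · intro x; rw [epsMap_eps]; simp [DiffMod.sgn_sgn]

section mid
variable (g D : A →ₗ[k] W) (T : A ⊗[k] A)

theorem map_epsMap_one : TensorProduct.map (epsMap a n g D) (epsMap a n g D)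
    (mid a.toDiffMod (dualNumbers k n).toDiffMod (T ⊗ₜ ((1, 0) ⊗ₜ (1, 0)))) =
      TensorProduct.map g g T := by
  induction T using induction_on with
  | zero => simp
  | tmul x y =>
    rw [mid_one_left _ _ (dualNumbers_one_mem k n)]
    simp [epsMap_one]
  | add s t h1 h2 => rw [add_tmul, map_add, map_add, h1, h2, map_add]

theorem map_epsMap_eps : TensorProduct.map (epsMap a n g D) (epsMap a n g D)
    (mid a.toDiffMod (dualNumbers k n).toDiffMod
      (T ⊗ₜ ((1, 0) ⊗ₜ (0, 1) + (0, 1) ⊗ₜ (1, 0)))) =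
      (TensorProduct.map D g + TensorProduct.map (g ∘ₗ a.sgn n) D)
        ((a.toDiffMod.tensor a.toDiffMod).sgn n T) := by
  rw [← map_sgn_sgn]
  induction T using a.tensor_induction a.toDiffMod with
  | tmul i j x y hx hy =>
    rw [tmul_add, map_add, map_add, mid_one_left _ _ (dualNumbers_one_mem k n),
      mid_tmul _ _ _ _ hy (dualNumbers_eps_mem k n), map_smul]
    simp only [map_tmul, epsMap_one, epsMap_eps, LinearMap.add_apply,
      comp_apply, DiffMod.sgn_sgn, a.sgn_apply n hy, map_smul, tmul_smul]
    rw [add_comm, mul_comm, smul_add]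
  | add s t h1 h2 => rw [add_tmul, map_add, map_add, h1, h2, map_add, map_add]

end mid

theorem isGradedHom_epsMap (ha : a.IsDCoalgebra d) (hc : c.IsDCoalgebra d) {g D : A →ₗ[k] W} :
    IsGradedHom (a.tensor d (dualNumbers k n)) c (epsMap a n g D) ↔
      IsGradedHom a c g ∧ IsCoderAlong d a c n g D := by
  have hs : ∀ x, D x = (D ∘ₗ a.sgn n) (a.sgn n x) := fun x => by
    rw [comp_apply, DiffMod.sgn_sgn]
  have t1 := LinearMap.congr_fun (sgn_comp ha.comul_homDeg n)
  have t2 := LinearMap.congr_fun (sgn_comp_homDeg ha.cobr_homDeg n)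
  simp only [comp_apply, LinearMap.smul_apply] at t1 t2
  have cb1 : ∀ x : A, (a.tensor d (dualNumbers k n)).cobr (x ⊗ₜ (1, 0)) =
      mid a.toDiffMod (dualNumbers k n).toDiffMod (a.cobr x ⊗ₜ ((1, 0) ⊗ₜ (1, 0))) := fun x => by
    rw [tensor_cobr_tmul, dualNumbers_comul_one]; simp [dualNumbers]
  have cb2 : ∀ x : A, (a.tensor d (dualNumbers k n)).cobr (x ⊗ₜ (0, 1)) =
      mid a.toDiffMod (dualNumbers k n).toDiffMod
        (a.cobr x ⊗ₜ ((1, 0) ⊗ₜ (0, 1) + (0, 1) ⊗ₜ (1, 0))) := fun x => by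
    rw [tensor_cobr_tmul, dualNumbers_comul_eps]; simp [dualNumbers]
  constructor
  · intro h
    have hg : IsGradedHom a c g := by
      refine ⟨?_, ?_, ?_, ?_⟩
      · intro i x hx
        have := h.deg _ _ (tmul_mem_tensorGr _ _ hx (dualNumbers_one_mem k n) (add_zero i))
        rwa [epsMap_one] at this
      · ext x
        have := LinearMap.congr_fun h.comul (x ⊗ₜ (1, 0))
        rwa [comp_apply, comp_apply, tensor_comul_tmul,
          dualNumbers_comul_one, map_epsMap_one, epsMap_one] at this
      · ext x
        have := LinearMap.congr_fun h.cobr (x ⊗ₜ (1, 0))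
        rwa [comp_apply, comp_apply, cb1, map_epsMap_one,
          epsMap_one] at this
      · ext x
        have := LinearMap.congr_fun h.counit (x ⊗ₜ (1, 0))
        rw [comp_apply, tensor_counit_tmul, epsMap_one] at this
        rw [comp_apply, this]
        simp [dualNumbers]
    refine ⟨hg, ?_, ?_, ?_⟩
    · intro i x hx
      have := h.deg _ _ (tmul_mem_tensorGr _ _ (a.sgn_mem n hx) (dualNumbers_eps_mem k n)
        (rfl : i + n = _))
      rwa [epsMap_eps, DiffMod.sgn_sgn, add_zero] at this
    · ext x
      have := LinearMap.congr_fun h.comul (a.sgn n x ⊗ₜ (0, 1))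
      rwa [comp_apply, comp_apply, tensor_comul_tmul,
        dualNumbers_comul_eps, map_epsMap_eps, epsMap_eps, DiffMod.sgn_sgn, t1,
        DiffMod.sgn_sgn] at this
    · ext x
      have := LinearMap.congr_fun h.cobr (a.sgn n x ⊗ₜ (0, 1))
      rwa [comp_apply, comp_apply, cb2, map_epsMap_eps, epsMap_eps,
        DiffMod.sgn_sgn, t2, DiffMod.sgn_sgn, map_smul] at this
  · rintro ⟨hg, hD⟩
    refine ⟨?_, ?_, ?_, ?_⟩
    · intro i z hz
      rw [add_zero]
      refine tensorGr_induction (P := fun z => epsMap a n g D z ∈ c.gr i) _ _ z hz ?_ (by simp)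
        fun x y h1 h2 => by rw [map_add]; exact Submodule.add_mem _ h1 h2
      rintro p q x ⟨y1, y2⟩ hx ⟨h1, h2⟩ hpq
      have : ((y1, y2) : k × k) = y1 • (1, 0) + y2 • (0, 1) := by ext <;> simp
      rw [this, tmul_add, map_add, tmul_smul, tmul_smul,
        map_smul, map_smul, epsMap_one, epsMap_eps]
      refine Submodule.add_mem _ ?_ ?_
      · by_cases h : q = 0
        · have := hg.deg _ _ hx
          rw [show p + 0 = i by omega] at this
          exact Submodule.smul_mem _ _ this
        · rw [show y1 = 0 from h1 h, zero_smul]; exact Submodule.zero_mem _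
      · by_cases h : q = n
        · have := hD.deg _ _ (a.sgn_mem n hx)
          rw [show p + n = i by omega] at this
          exact Submodule.smul_mem _ _ this
        · rw [show y2 = 0 from h2 h, zero_smul]; exact Submodule.zero_mem _
    · refine eps_hom_ext (fun x => ?_) fun x => ?_
      · have := LinearMap.congr_fun hg.comul x
        rw [comp_apply, comp_apply, tensor_comul_tmul,
          dualNumbers_comul_one, map_epsMap_one, epsMap_one]
        exact this
      · have := LinearMap.congr_fun hD.comul (a.sgn n x)
        rw [comp_apply, comp_apply, tensor_comul_tmul,
          dualNumbers_comul_eps, map_epsMap_eps, epsMap_eps, t1]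
        exact this
    · refine eps_hom_ext (fun x => ?_) fun x => ?_
      · have := LinearMap.congr_fun hg.cobr x
        rw [comp_apply, comp_apply, cb1, map_epsMap_one, epsMap_one]
        exact this
      · have := LinearMap.congr_fun hD.cobr (a.sgn n x)
        rw [comp_apply, comp_apply, cb2, map_epsMap_eps, epsMap_eps, t2,
          map_smul]
        exact this
    · refine eps_hom_ext (fun x => ?_) fun x => ?_
      · have := LinearMap.congr_fun hg.counit x
        rw [comp_apply] at this
        rw [comp_apply, tensor_counit_tmul, epsMap_one, this]
        simp [dualNumbers]
      · have := LinearMap.congr_fun (hD.counit ha hc hg) (a.sgn n x)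
        rw [comp_apply] at this
        rw [comp_apply, tensor_counit_tmul, epsMap_eps, this]
        simp [dualNumbers]

end DCoalgData
end coderAlong

section
variable {k : Type u} [Field k] {A W X : Type u} [AddCommGroup A] [Module k A]
  [AddCommGroup W] [Module k W] [AddCommGroup X] [Module k X] {d : ℤ} {n : ℤ}
  {X' : DiffMod k X} {a : DCoalgData k A} {c : DCoalgData k W} {p : W →ₗ[k] X}
namespace DCoalgData

/-- Coderivations along a morphism to a cofree coalgebra correspond to linear maps to the
cogenerators. -/
theorem IsCofree.existsUnique_coderAlong (h : IsCofree d X' c p) (hc : c.IsDCoalgebra d)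
    (ha : a.IsDCoalgebra d) (ha' : a.IsCoproartinian) {g : A →ₗ[k] W} (hg : IsGradedHom a c g)
    (hg1 : p (g a.one) = 0) {f : A →ₗ[k] X} (hf : f ∈ homDeg a.toDiffMod X' n) :
    ∃! D, IsCoderAlong d a c n g D ∧ p ∘ₗ D = f := by
  have hp : ∀ g D, p ∘ₗ epsMap a n g D = epsMap a n (p ∘ₗ g) (p ∘ₗ D) := fun g D =>
    eps_hom_ext (fun x => by simp [epsMap_one]) fun x => by simp [epsMap_eps]
  obtain ⟨G, ⟨hG, hG2⟩, huniq⟩ := h.universal (A ⊗[k] (k × k)) (a.tensor d (dualNumbers k n))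
    (ha.tensor (dualNumbers_isDCoalgebra k n d))
    (ha'.tensor ha (dualNumbers_isDCoalgebra k n d) (dualNumbers_isCoproartinian k n))
    (epsMap a n (p ∘ₗ g) f) (by
      intro i z hz
      rw [add_zero]
      refine tensorGr_induction (P := fun z => epsMap a n (p ∘ₗ g) f z ∈ X'.gr i) _ _ z hz ?_
        (by simp) fun x y h1 h2 => by rw [map_add]; exact Submodule.add_mem _ h1 h2
      rintro p' q x ⟨y1, y2⟩ hx ⟨h1, h2⟩ hpq
      have : ((y1, y2) : k × k) = y1 • (1, 0) + y2 • (0, 1) := by ext <;> simp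
      rw [this, tmul_add, map_add, tmul_smul, tmul_smul,
        map_smul, map_smul, epsMap_one, epsMap_eps]
      refine Submodule.add_mem _ ?_ ?_
      · by_cases hq : q = 0
        · have := h.deg _ _ (hg.deg _ _ hx)
          rw [show p' + 0 + 0 = i by omega] at this
          exact Submodule.smul_mem _ _ this
        · rw [show y1 = 0 from h1 hq, zero_smul]; exact Submodule.zero_mem _
      · by_cases hq : q = n
        · have := hf _ _ (a.sgn_mem n hx)
          rw [show p' + n = i by omega] at this
          exact Submodule.smul_mem _ _ this
        · rw [show y2 = 0 from h2 hq, zero_smul]; exact Submodule.zero_mem _) (by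
      change epsMap a n (p ∘ₗ g) f (a.one ⊗ₜ (1, 0)) = 0
      rw [epsMap_one]; exact hg1)
  obtain ⟨g', D, rfl⟩ := epsMap_surj (a := a) (n := n) G
  obtain ⟨h1, h2⟩ := (isGradedHom_epsMap ha hc).1 hG
  rw [hp] at hG2
  have e1 : p ∘ₗ g' = p ∘ₗ g := by
    ext x
    have := LinearMap.congr_fun hG2 (x ⊗ₜ (1, 0))
    rwa [epsMap_one, epsMap_one] at this
  have e2 : p ∘ₗ D = f := by
    ext x
    have := LinearMap.congr_fun hG2 (a.sgn n x ⊗ₜ (0, 1))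
    rwa [epsMap_eps, epsMap_eps, DiffMod.sgn_sgn] at this
  obtain rfl : g' = g := by
    refine (h.universal A a ha ha' (p ∘ₗ g) (homDeg_comp_zero h.deg hg.deg) hg1).unique
      ⟨h1, e1⟩ ⟨hg, rfl⟩
  refine ⟨D, ⟨h2, e2⟩, ?_⟩
  rintro D' ⟨hD', e'⟩
  have := huniq (epsMap a n g' D') ⟨(isGradedHom_epsMap ha hc).2 ⟨h1, hD'⟩, by rw [hp, e']⟩
  ext x
  have := LinearMap.congr_fun this (a.sgn n x ⊗ₜ (0, 1))
  rwa [epsMap_eps, epsMap_eps, DiffMod.sgn_sgn] at this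

end DCoalgData
end

section tensorSub
variable {k : Type u} [Field k] {V V' W W' : Type*} [AddCommGroup V] [Module k V]
  [AddCommGroup W] [Module k W] [AddCommGroup V'] [Module k V'] [AddCommGroup W'] [Module k W']

theorem separating_univ : Separating (Set.univ : Set (Module.Dual k V)) := fun x hx =>
  (Module.forall_dual_apply_eq_zero_iff k x).1 fun φ => hx φ trivial

/-- A tensor lies in `S ⊗ T` iff all its contractions lie in `S` and `T`. -/
theorem mem_tensorSub_iff {S : Submodule k V} {T : Submodule k W} {z : V ⊗[k] W} :
    z ∈ tensorSub S T ↔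
      (∀ φ : Module.Dual k W, rid k V (TensorProduct.map LinearMap.id φ z) ∈ S) ∧
      (∀ φ : Module.Dual k V, lid k W (TensorProduct.map φ LinearMap.id z) ∈ T) := by
  constructor
  · intro hz
    refine ⟨fun φ => ?_, fun φ => ?_⟩
    · refine tensorSub_induction (P := fun z => rid k V
        (TensorProduct.map LinearMap.id φ z) ∈ S) hz ?_ (by simp) fun x y h1 h2 => ?_
      · intro x hx y _
        simpa using S.smul_mem _ hx
      · rw [map_add, map_add]; exact S.add_mem h1 h2
    · refine tensorSub_induction (P := fun z => lid k W
        (TensorProduct.map φ LinearMap.id z) ∈ T) hz ?_ (by simp) fun x y h1 h2 => ?_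
      · intro x _ y hy
        simpa using T.smul_mem _ hy
      · rw [map_add, map_add]; exact T.add_mem h1 h2
  · rintro ⟨h1, h2⟩
    obtain ⟨p, hp⟩ := S.subtype.exists_leftInverse_of_injective S.ker_subtype
    obtain ⟨q, hq⟩ := T.subtype.exists_leftInverse_of_injective T.ker_subtype
    have hp' : ∀ x ∈ S, S.subtype (p x) = x := fun x hx =>
      congrArg S.subtype (LinearMap.congr_fun hp ⟨x, hx⟩)
    have hq' : ∀ x ∈ T, T.subtype (q x) = x := fun x hx =>
      congrArg T.subtype (LinearMap.congr_fun hq ⟨x, hx⟩)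
    have sep := (separating_univ (k := k) (V := V)).dtmul (separating_univ (k := k) (V := W))
    have e1 : ∀ (f : V →ₗ[k] V) (φ : Module.Dual k V) (ψ : Module.Dual k W) (z : V ⊗[k] W),
        (φ ⊠ ψ) (TensorProduct.map f LinearMap.id z) =
          φ (f (rid k V (TensorProduct.map LinearMap.id ψ z))) := by
      intro f φ ψ z
      induction z using induction_on with
      | zero => simp
      | tmul x y => simp [mul_comm]
      | add x y h1 h2 => simp only [map_add, h1, h2]
    have e2 : ∀ (f : W →ₗ[k] W) (φ : Module.Dual k V) (ψ : Module.Dual k W) (z : V ⊗[k] W),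
        (φ ⊠ ψ) (TensorProduct.map LinearMap.id f z) =
          ψ (f (lid k W (TensorProduct.map φ LinearMap.id z))) := by
      intro f φ ψ z
      induction z using induction_on with
      | zero => simp
      | tmul x y => simp
      | add x y h1 h2 => simp only [map_add, h1, h2]
    have k1 : TensorProduct.map (S.subtype ∘ₗ p) LinearMap.id z = z := by
      rw [← sub_eq_zero]
      refine sep _ ?_
      rintro _ ⟨φ, -, ψ, -, rfl⟩
      have := e1 LinearMap.id φ ψ z
      rw [map_id] at this
      rw [map_sub, e1, comp_apply, hp' _ (h1 ψ)]
      exact sub_eq_zero.2 this.symm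
    have k2 : TensorProduct.map LinearMap.id (T.subtype ∘ₗ q) z = z := by
      rw [← sub_eq_zero]
      refine sep _ ?_
      rintro _ ⟨φ, -, ψ, -, rfl⟩
      have := e2 LinearMap.id φ ψ z
      rw [map_id] at this
      rw [map_sub, e2, comp_apply, hq' _ (h2 φ)]
      exact sub_eq_zero.2 this.symm
    refine ⟨TensorProduct.map p q z, ?_⟩
    rw [← comp_apply, ← map_comp]
    nth_rw 2 [← k1]
    nth_rw 2 [← k2]
    rw [← comp_apply, ← map_comp, comp_id, id_comp]

theorem mem_tensorSub_comap {f : V →ₗ[k] V'} {g : W →ₗ[k] W'} (hf : Function.Injective f)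
    (hg : Function.Injective g) {S : Submodule k V'} {T : Submodule k W'} {z : V ⊗[k] W}
    (hz : TensorProduct.map f g z ∈ tensorSub S T) : z ∈ tensorSub (S.comap f) (T.comap g) := by
  rw [mem_tensorSub_iff] at hz ⊢
  obtain ⟨p, hp⟩ := f.exists_leftInverse_of_injective (LinearMap.ker_eq_bot.2 hf)
  obtain ⟨q, hq⟩ := g.exists_leftInverse_of_injective (LinearMap.ker_eq_bot.2 hg)
  have hp' : ∀ x, p (f x) = x := fun x => LinearMap.congr_fun hp x
  have hq' : ∀ x, q (g x) = x := fun x => LinearMap.congr_fun hq x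
  refine ⟨fun φ => ?_, fun φ => ?_⟩
  · have := hz.1 (φ ∘ₗ q)
    rw [Submodule.mem_comap]
    convert this using 1
    clear this hz
    induction z using induction_on with
    | zero => simp
    | tmul x y => simp [hq']
    | add x y h1 h2 => simp only [map_add, h1, h2]
  · have := hz.2 (φ ∘ₗ p)
    rw [Submodule.mem_comap]
    convert this using 1
    clear this hz
    induction z using induction_on with
    | zero => simp
    | tmul x y => simp [hp']
    | add x y h1 h2 => simp only [map_add, h1, h2]

end tensorSub

section restrict
variable {k : Type u} [Field k] {V : Type*} [AddCommGroup V] [Module k V]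
  {W : Type*} [AddCommGroup W] [Module k W]

theorem DiffMod.mem_of_map_mem {a : DiffMod k V} {b : DiffMod k W} {f : V →ₗ[k] W}
    (hf : f ∈ homDeg a b 0) (hi : Function.Injective f) {i : ℤ} {x : V} (hx : f x ∈ b.gr i) :
    x ∈ a.gr i := by
  have h := proj_comp hf i x
  rw [add_zero, b.proj_of_mem hx] at h
  rw [hi h]
  exact a.proj_mem i x

/-- A homogeneous subspace which is closed under the differential. -/
def DiffMod.restrict (c : DiffMod k V) {S : Submodule k V} (hS : c.IsHomog S)
    (hd : ∀ x ∈ S, c.diff x ∈ S) : DiffMod k S where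
  gr i := (c.gr i).comap S.subtype
  internal := by
    rw [DirectSum.isInternal_submodule_iff_iSupIndep_and_iSup_eq_top]
    constructor
    · rw [iSupIndep_def]
      intro i
      rw [Submodule.disjoint_def]
      intro x hx hx'
      have h := c.internal.submodule_iSupIndep i
      rw [Submodule.disjoint_def] at h
      refine Subtype.ext (h x hx ?_)
      have h2 : (⨆ j, ⨆ (_ : j ≠ i), (c.gr j).comap S.subtype) ≤
          (⨆ j, ⨆ (_ : j ≠ i), c.gr j).comap S.subtype :=
        iSup₂_le fun j hj => Submodule.comap_mono (le_iSup₂_of_le j hj le_rfl)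
      exact h2 hx'
    · rw [eq_top_iff]
      rintro ⟨x, hx⟩ -
      have h2 : S ≤ (⨆ i, (c.gr i).comap S.subtype).map S.subtype := by
        refine hS.le.trans (iSup_le fun i => ?_)
        rintro y ⟨hy, hy'⟩
        exact ⟨⟨y, hy⟩, Submodule.mem_iSup_of_mem i hy', rfl⟩
      obtain ⟨y, hy, hyx⟩ := h2 hx
      rwa [show y = ⟨x, hx⟩ from Subtype.ext hyx] at hy
  diff := c.diff.restrict hd
  diff_mem hx := c.diff_mem hx

/-- The corestriction of a map to `S ⊗ S`. -/
def tensorSubLift {S : Submodule k V} (f : W →ₗ[k] V ⊗[k] V)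
    (hf : ∀ x, f x ∈ tensorSub S S) : W →ₗ[k] S ⊗[k] S :=
  (LinearEquiv.ofInjective (TensorProduct.map S.subtype S.subtype)
    (map_injective S.subtype_injective S.subtype_injective)).symm.toLinearMap ∘ₗ
      f.codRestrict (tensorSub S S) hf

theorem map_tensorSubLift {S : Submodule k V} (f : W →ₗ[k] V ⊗[k] V)
    (hf : ∀ x, f x ∈ tensorSub S S) :
    TensorProduct.map S.subtype S.subtype ∘ₗ tensorSubLift f hf = f := by
  ext x
  simp only [comp_apply, tensorSubLift]
  exact congrArg Subtype.val (LinearEquiv.apply_symm_apply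
    (LinearEquiv.ofInjective (TensorProduct.map S.subtype S.subtype)
      (map_injective S.subtype_injective S.subtype_injective)) _)

/-- The structure on a subcoalgebra which contains the unit. -/
def DCoalgData.restrict (c : DCoalgData k V) {S : Submodule k V} (hS : IsSubcoalgebra c S)
    (h1 : c.one ∈ S) : DCoalgData k S where
  toDiffMod := c.toDiffMod.restrict (c.isHomog_of_le hS.homogeneous) hS.diff_mem
  comul := tensorSubLift (c.comul ∘ₗ S.subtype) fun x => hS.comul_mem x x.2
  cobr := tensorSubLift (c.cobr ∘ₗ S.subtype) fun x => hS.cobr_mem x x.2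
  counit := c.counit ∘ₗ S.subtype
  one := ⟨c.one, h1⟩

theorem DCoalgData.isHom_subtype (c : DCoalgData k V) {S : Submodule k V}
    (hS : IsSubcoalgebra c S) (h1 : c.one ∈ S) : IsHom (c.restrict hS h1) c S.subtype :=
  ⟨⟨fun i x hx => by rw [add_zero]; exact hx, (map_tensorSubLift _ _).symm,
    (map_tensorSubLift _ _).symm, rfl⟩, rfl⟩

end restrict

namespace DCoalgData
section axioms
variable {k : Type u} [Field k] {A : Type v} [AddCommGroup A] [Module k A]
  {B : Type w} [AddCommGroup B] [Module k B]

/-- The axioms of a `d`-coalgebra that only concern the grading, the differential and the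
counit. -/
structure IsGradedData (d : ℤ) (c : DCoalgData k A) : Prop where
  isComplex : c.IsComplex
  comul_mem : ∀ {i x}, x ∈ c.gr i → c.comul x ∈ c.tensorGr c.toDiffMod i
  counit_deg : ∀ {i x}, x ∈ c.gr i → i ≠ 0 → c.counit x = 0
  counit_comul : (lid k A).toLinearMap ∘ₗ
    TensorProduct.map c.counit LinearMap.id ∘ₗ c.comul = LinearMap.id
  cobr_mem : ∀ {i x}, x ∈ c.gr i → c.cobr x ∈ c.tensorGr c.toDiffMod (i + 1 - d)
  counit_cobr : (lid k A).toLinearMap ∘ₗ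
    TensorProduct.map c.counit LinearMap.id ∘ₗ c.cobr = 0
  diff_coder : IsCoder d c 1 c.diff

/-- The defects of the remaining axioms. -/
def defectAssoc (c : DCoalgData k A) : A →ₗ[k] A ⊗[k] (A ⊗[k] A) :=
  (assoc k A A A).toLinearMap ∘ₗ TensorProduct.map c.comul LinearMap.id ∘ₗ c.comul -
    TensorProduct.map LinearMap.id c.comul ∘ₗ c.comul

def defectComm (c : DCoalgData k A) : A →ₗ[k] A ⊗[k] A :=
  c.twist c.toDiffMod ∘ₗ c.comul - c.comul

def defectSymm (d : ℤ) (c : DCoalgData k A) : A →ₗ[k] A ⊗[k] A :=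
  c.twist c.toDiffMod ∘ₗ c.cobr - ksign k d • c.cobr

def defectJacobi (c : DCoalgData k A) : A →ₗ[k] (A ⊗[k] A) ⊗[k] A :=
  (LinearMap.id + cyc c.toDiffMod + cyc c.toDiffMod ∘ₗ cyc c.toDiffMod) ∘ₗ
    TensorProduct.map c.cobr LinearMap.id ∘ₗ c.cobr

def defectLeibniz (d : ℤ) (c : DCoalgData k A) : A →ₗ[k] (A ⊗[k] A) ⊗[k] A :=
  TensorProduct.map c.comul LinearMap.id ∘ₗ c.cobr -
    ((assoc k A A A).symm.toLinearMap ∘ₗ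
      TensorProduct.map (c.sgn (1 - d)) c.cobr ∘ₗ c.comul +
    swap23 c.toDiffMod ∘ₗ TensorProduct.map c.cobr LinearMap.id ∘ₗ c.comul)

/-- The subspace on which the axioms of a `d`-coalgebra hold. -/
def axiomKer (d : ℤ) (c : DCoalgData k A) : Submodule k A :=
  LinearMap.ker c.defectAssoc ⊓ LinearMap.ker c.defectComm ⊓ LinearMap.ker (c.defectSymm d) ⊓
    LinearMap.ker c.defectJacobi ⊓ LinearMap.ker (c.defectLeibniz d)

theorem isDCoalgebra_iff {d : ℤ} {c : DCoalgData k A} :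
    c.IsDCoalgebra d ↔ c.IsGradedData d ∧ ∀ x, x ∈ c.axiomKer d := by
  constructor
  · intro h
    refine ⟨⟨h.isComplex, h.comul_mem, h.counit_deg, h.counit_comul, h.cobr_mem, h.counit_cobr,
      h.diff_coder⟩, fun x => ⟨⟨⟨⟨?_, ?_⟩, ?_⟩, ?_⟩, ?_⟩⟩
    · rw [SetLike.mem_coe, LinearMap.mem_ker, defectAssoc, h.coassoc, sub_self,
        LinearMap.zero_apply]
    · rw [SetLike.mem_coe, LinearMap.mem_ker, defectComm, h.cocomm, sub_self,
        LinearMap.zero_apply]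
    · rw [SetLike.mem_coe, LinearMap.mem_ker, defectSymm, h.cobr_symm, sub_self,
        LinearMap.zero_apply]
    · exact h.cojacobi x
    · exact LinearMap.congr_fun (sub_eq_zero.2 h.coleibniz) x
  · rintro ⟨h, hx⟩
    have h5 : c.defectLeibniz d = 0 := LinearMap.ext fun x => (hx x).2
    exact ⟨h.isComplex, h.comul_mem, sub_eq_zero.1 (LinearMap.ext fun x => (hx x).1.1.1.1),
      sub_eq_zero.1 (LinearMap.ext fun x => (hx x).1.1.1.2), h.counit_deg, h.counit_comul,
      h.cobr_mem, sub_eq_zero.1 (LinearMap.ext fun x => (hx x).1.1.2), fun x => (hx x).1.2,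
      sub_eq_zero.1 h5, h.counit_cobr, h.diff_coder⟩

theorem _root_.DefHopf.DiffMod.twist_comp_map {V V' W W' : Type*} [AddCommGroup V] [Module k V]
    [AddCommGroup W] [Module k W] [AddCommGroup V'] [Module k V'] [AddCommGroup W'] [Module k W']
    {a : DiffMod k V} {a' : DiffMod k V'} {b : DiffMod k W} {b' : DiffMod k W'} {f : V →ₗ[k] V'}
    {g : W →ₗ[k] W'} (hf : f ∈ homDeg a a' 0) (hg : g ∈ homDeg b b' 0) :
    a'.twist b' ∘ₗ TensorProduct.map f g = TensorProduct.map g f ∘ₗ a.twist b := by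
  refine tensor_hom_ext a b fun i j x y hx hy => ?_
  have h1 := hf _ _ hx
  have h2 := hg _ _ hy
  rw [add_zero] at h1 h2
  simp [twist_apply _ _ hx hy, twist_apply _ _ h1 h2]

theorem _root_.DefHopf.map_assoc {V V' W W' U U' : Type*} [AddCommGroup V] [Module k V]
    [AddCommGroup W] [Module k W] [AddCommGroup V'] [Module k V'] [AddCommGroup W'] [Module k W']
    [AddCommGroup U] [Module k U] [AddCommGroup U'] [Module k U'] (f : V →ₗ[k] V') (g : W →ₗ[k] W')
    (h : U →ₗ[k] U') :
    (assoc k V' W' U').toLinearMap ∘ₗ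
      TensorProduct.map (TensorProduct.map f g) h =
    TensorProduct.map f (TensorProduct.map g h) ∘ₗ (assoc k V W U).toLinearMap := by
  ext; rfl

theorem _root_.DefHopf.map_assoc_symm {V V' W W' U U' : Type*} [AddCommGroup V] [Module k V]
    [AddCommGroup W] [Module k W] [AddCommGroup V'] [Module k V'] [AddCommGroup W'] [Module k W']
    [AddCommGroup U] [Module k U] [AddCommGroup U'] [Module k U'] (f : V →ₗ[k] V') (g : W →ₗ[k] W')
    (h : U →ₗ[k] U') :
    (assoc k V' W' U').symm.toLinearMap ∘ₗ
      TensorProduct.map f (TensorProduct.map g h) =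
    TensorProduct.map (TensorProduct.map f g) h ∘ₗ
      (assoc k V W U).symm.toLinearMap := by
  apply TensorProduct.ext_threefold'
  intro x y z
  rfl

theorem swap23_comp_map {a : DiffMod k A} {c : DiffMod k B} {f : A →ₗ[k] B}
    (hf : f ∈ homDeg a c 0) :
    swap23 c ∘ₗ TensorProduct.map (TensorProduct.map f f) f =
      TensorProduct.map (TensorProduct.map f f) f ∘ₗ swap23 a := by
  have e1 := fun z => LinearMap.congr_fun (map_assoc f f f) z
  have e2 := fun z => LinearMap.congr_fun (map_assoc_symm f f f) z
  have e3 : ∀ z, TensorProduct.map LinearMap.id (c.twist c)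
      (TensorProduct.map f (TensorProduct.map f f) z) =
      TensorProduct.map f (TensorProduct.map f f)
        (TensorProduct.map LinearMap.id (a.twist a) z) := fun z => by
    rw [← comp_apply, ← comp_apply, ← map_comp,
      ← map_comp, twist_comp_map hf hf, comp_id, id_comp]
  refine LinearMap.ext fun z => ?_
  simp only [comp_apply] at e1 e2
  simp only [swap23, comp_apply]
  rw [e1, e3, e2]

theorem cyc_comp_map {a : DiffMod k A} {c : DiffMod k B} {f : A →ₗ[k] B}
    (hf : f ∈ homDeg a c 0) :
    cyc c ∘ₗ TensorProduct.map (TensorProduct.map f f) f =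
      TensorProduct.map (TensorProduct.map f f) f ∘ₗ cyc a := by
  rw [cyc, comp_assoc, swap23_comp_map hf, ← comp_assoc,
    ← map_comp, twist_comp_map hf hf, cyc, ← comp_assoc,
    ← map_comp, comp_id, id_comp]

variable {a : DCoalgData k A} {c : DCoalgData k B} {f : A →ₗ[k] B}

namespace IsGradedHom
variable (h : IsGradedHom a c f)
include h

theorem map_comul : TensorProduct.map c.comul LinearMap.id ∘ₗ TensorProduct.map f f =
    TensorProduct.map (TensorProduct.map f f) f ∘ₗ TensorProduct.map a.comul LinearMap.id := by
  rw [← map_comp, h.comul, ← map_comp, id_comp,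
    comp_id]

theorem map_cobr : TensorProduct.map c.cobr LinearMap.id ∘ₗ TensorProduct.map f f =
    TensorProduct.map (TensorProduct.map f f) f ∘ₗ TensorProduct.map a.cobr LinearMap.id := by
  rw [← map_comp, h.cobr, ← map_comp, id_comp,
    comp_id]

theorem defectAssoc : c.defectAssoc ∘ₗ f =
    TensorProduct.map f (TensorProduct.map f f) ∘ₗ a.defectAssoc := by
  simp only [DCoalgData.defectAssoc, sub_comp, comp_sub, comp_assoc]
  rw [h.comul]
  congr 1
  · refine LinearMap.ext fun z => ?_
    have e1 := fun z => LinearMap.congr_fun (map_assoc f f f) z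
    have e2 := fun z => LinearMap.congr_fun h.map_comul z
    simp only [comp_apply] at e1 e2 ⊢
    rw [e2, e1]
  · rw [← comp_assoc, ← map_comp,
      ← comp_assoc _ _ (TensorProduct.map f (TensorProduct.map f f)),
      ← map_comp, h.comul, id_comp, comp_id]

theorem defectComm : c.defectComm ∘ₗ f = TensorProduct.map f f ∘ₗ a.defectComm := by
  simp only [DCoalgData.defectComm, sub_comp, comp_sub, comp_assoc]
  rw [h.comul, ← comp_assoc, twist_comp_map h.deg h.deg, comp_assoc]

theorem defectSymm (d : ℤ) : c.defectSymm d ∘ₗ f = TensorProduct.map f f ∘ₗ a.defectSymm d := by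
  simp only [DCoalgData.defectSymm, sub_comp, comp_sub, comp_assoc,
    smul_comp, comp_smul]
  rw [h.cobr, ← comp_assoc, twist_comp_map h.deg h.deg, comp_assoc]

theorem defectJacobi : c.defectJacobi ∘ₗ f =
    TensorProduct.map (TensorProduct.map f f) f ∘ₗ a.defectJacobi := by
  have h1 : TensorProduct.map c.cobr LinearMap.id ∘ₗ c.cobr ∘ₗ f =
      TensorProduct.map (TensorProduct.map f f) f ∘ₗ
        TensorProduct.map a.cobr LinearMap.id ∘ₗ a.cobr := by
    rw [h.cobr, ← comp_assoc, h.map_cobr, comp_assoc]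
  have h2 := cyc_comp_map h.deg
  simp only [DCoalgData.defectJacobi, comp_assoc]
  rw [h1]
  simp only [add_comp, comp_add, id_comp, comp_assoc]
  rw [← comp_assoc _ _ (cyc c.toDiffMod), h2]
  simp only [comp_assoc]
  rw [← comp_assoc _ _ (cyc c.toDiffMod), h2]
  simp only [comp_assoc]

theorem defectLeibniz (d : ℤ) : c.defectLeibniz d ∘ₗ f =
    TensorProduct.map (TensorProduct.map f f) f ∘ₗ a.defectLeibniz d := by
  simp only [DCoalgData.defectLeibniz, sub_comp, comp_sub,
    comp_assoc, add_comp, comp_add]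
  congr 2
  · rw [h.cobr, ← comp_assoc, h.map_comul, comp_assoc]
  · rw [h.comul, ← comp_assoc _ _ (TensorProduct.map (c.sgn (1 - d)) c.cobr),
      ← map_comp, sgn_comp h.deg, h.cobr,
      ← comp_assoc _ _ (TensorProduct.map (TensorProduct.map f f) f),
      ← map_assoc_symm, map_comp]
    simp only [comp_assoc]
  · rw [h.comul, ← comp_assoc _ _ (TensorProduct.map c.cobr LinearMap.id), h.map_cobr,
      ← comp_assoc _ _ (TensorProduct.map (TensorProduct.map f f) f),
      ← swap23_comp_map h.deg]
    simp only [comp_assoc]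

/-- Morphisms preserve the validity of the axioms. -/
theorem map_mem_axiomKer {d : ℤ} {x : A} (hx : x ∈ a.axiomKer d) : f x ∈ c.axiomKer d := by
  obtain ⟨⟨⟨⟨h1, h2⟩, h3⟩, h4⟩, h5⟩ := hx
  simp only [SetLike.mem_coe, LinearMap.mem_ker] at h1 h2 h3 h4 h5
  refine ⟨⟨⟨⟨?_, ?_⟩, ?_⟩, ?_⟩, ?_⟩ <;> rw [SetLike.mem_coe, LinearMap.mem_ker]
  · have := LinearMap.congr_fun h.defectAssoc x
    rwa [comp_apply, comp_apply, h1, map_zero] at this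
  · have := LinearMap.congr_fun h.defectComm x
    rwa [comp_apply, comp_apply, h2, map_zero] at this
  · have := LinearMap.congr_fun (h.defectSymm d) x
    rwa [comp_apply, comp_apply, h3, map_zero] at this
  · have := LinearMap.congr_fun h.defectJacobi x
    rwa [comp_apply, comp_apply, h4, map_zero] at this
  · have := LinearMap.congr_fun (h.defectLeibniz d) x
    rwa [comp_apply, comp_apply, h5, map_zero] at this

/-- Injective morphisms reflect the validity of the axioms. -/
theorem mem_axiomKer {d : ℤ} (hf : Function.Injective f) {x : A} (hx : f x ∈ c.axiomKer d) :
    x ∈ a.axiomKer d := by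
  obtain ⟨⟨⟨⟨h1, h2⟩, h3⟩, h4⟩, h5⟩ := hx
  simp only [SetLike.mem_coe, LinearMap.mem_ker] at h1 h2 h3 h4 h5
  have i2 := map_injective hf hf
  refine ⟨⟨⟨⟨?_, ?_⟩, ?_⟩, ?_⟩, ?_⟩ <;> rw [SetLike.mem_coe, LinearMap.mem_ker]
  · have := LinearMap.congr_fun h.defectAssoc x
    rw [comp_apply, comp_apply, h1] at this
    exact map_injective hf i2 (by rw [← this, map_zero])
  · have := LinearMap.congr_fun h.defectComm x
    rw [comp_apply, comp_apply, h2] at this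
    exact i2 (by rw [← this, map_zero])
  · have := LinearMap.congr_fun (h.defectSymm d) x
    rw [comp_apply, comp_apply, h3] at this
    exact i2 (by rw [← this, map_zero])
  · have := LinearMap.congr_fun h.defectJacobi x
    rw [comp_apply, comp_apply, h4] at this
    exact map_injective i2 hf (by rw [← this, map_zero])
  · have := LinearMap.congr_fun (h.defectLeibniz d) x
    rw [comp_apply, comp_apply, h5] at this
    exact map_injective i2 hf (by rw [← this, map_zero])

end IsGradedHom

theorem leib_comp_map {n : ℤ} {D : A →ₗ[k] A} {E : B →ₗ[k] B}
    (hf : f ∈ homDeg a.toDiffMod c.toDiffMod 0) (h : E ∘ₗ f = f ∘ₗ D) :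
    c.leib n E E ∘ₗ TensorProduct.map f f = TensorProduct.map f f ∘ₗ a.leib n D D := by
  rw [leib, leib, add_comp, comp_add, ← map_comp,
    ← map_comp, ← map_comp, ← map_comp, h,
    sgn_comp hf, id_comp, comp_id]

/-- A `d`-coalgebra structure is inherited along an injective morphism. -/
theorem IsHom.isDCoalgebra {d : ℤ} (h : IsHom a c f) (hf : Function.Injective f)
    (hc : c.IsGradedData d) (hx : ∀ x, f x ∈ c.axiomKer d) : a.IsDCoalgebra d := by
  have i2 := map_injective hf hf
  have hdeg : ∀ {i x}, x ∈ a.gr i → f x ∈ c.gr i := fun hx => by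
    simpa using h.deg _ _ hx
  have hm : TensorProduct.map f f ∈ homDeg (a.toDiffMod.tensor a.toDiffMod) (c.toDiffMod.tensor c.toDiffMod) 0 := by
    simpa using map_homDeg h.deg h.deg
  have hdiff := fun x => LinearMap.congr_fun h.diff x
  have hcomul := fun x => LinearMap.congr_fun h.comul x
  have hcobr := fun x => LinearMap.congr_fun h.cobr x
  have hcounit := fun x => LinearMap.congr_fun h.counit x
  simp only [comp_apply] at hdiff hcomul hcobr hcounit
  have hl : ∀ z, f (lid k A (TensorProduct.map a.counit LinearMap.id z)) =
      lid k B (TensorProduct.map c.counit LinearMap.id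
        (TensorProduct.map f f z)) := by
    intro z
    induction z using induction_on with
    | zero => simp
    | tmul x y => simp [hcounit]
    | add x y h1 h2 => simp only [map_add, h1, h2]
  refine isDCoalgebra_iff.2 ⟨⟨fun x => hf ?_, fun {i x} hx => ?_, fun {i x} hx hi => ?_, ?_,
    fun {i x} hx => ?_, ?_, ⟨fun i x hx => a.diff_mem hx, ?_, ?_⟩⟩,
    fun x => h.toIsGradedHom.mem_axiomKer hf (hx x)⟩
  · rw [← hdiff, ← hdiff, hc.isComplex, map_zero]
  · refine mem_of_map_mem (b := c.toDiffMod.tensor c.toDiffMod)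
      (a := a.toDiffMod.tensor a.toDiffMod) hm i2 ?_
    rw [← hcomul]
    exact hc.comul_mem (hdeg hx)
  · rw [← hcounit]; exact hc.counit_deg (hdeg hx) hi
  · ext x
    apply hf
    simp only [comp_apply, LinearEquiv.coe_coe]
    rw [hl, ← hcomul]
    exact LinearMap.congr_fun hc.counit_comul (f x)
  · refine mem_of_map_mem (b := c.toDiffMod.tensor c.toDiffMod)
      (a := a.toDiffMod.tensor a.toDiffMod) hm i2 ?_
    rw [← hcobr]
    exact hc.cobr_mem (hdeg hx)
  · ext x
    apply hf
    simp only [comp_apply, LinearEquiv.coe_coe]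
    rw [hl, ← hcobr]
    exact (LinearMap.congr_fun hc.counit_cobr (f x)).trans (map_zero f).symm
  · have e := leib_comp_map (n := 1) h.deg h.diff
    have h2 : TensorProduct.map f f ∘ₗ a.comul ∘ₗ a.diff =
        TensorProduct.map f f ∘ₗ a.leib 1 a.diff a.diff ∘ₗ a.comul := by
      rw [← comp_assoc, ← h.comul, comp_assoc, ← h.diff,
        ← comp_assoc, hc.diff_coder.comul, comp_assoc, h.comul,
        ← comp_assoc, e, comp_assoc]
    exact LinearMap.ext fun x => i2 (LinearMap.congr_fun h2 x)
  · have e := leib_comp_map (n := 1) h.deg h.diff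
    have h2 : TensorProduct.map f f ∘ₗ a.cobr ∘ₗ a.diff =
        TensorProduct.map f f ∘ₗ (ksign k (1 * (1 - d)) • (a.leib 1 a.diff a.diff ∘ₗ a.cobr)) := by
      rw [← comp_assoc, ← h.cobr, comp_assoc, ← h.diff,
        ← comp_assoc, hc.diff_coder.cobr, smul_comp, comp_smul,
        comp_assoc, h.cobr, ← comp_assoc, e, comp_assoc]
    exact LinearMap.ext fun x => i2 (LinearMap.congr_fun h2 x)

theorem IsDCoalgebra.isGradedData {d : ℤ} (hc : c.IsDCoalgebra d) : c.IsGradedData d :=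
  (isDCoalgebra_iff.1 hc).1

theorem IsDCoalgebra.mem_axiomKer {d : ℤ} (hc : c.IsDCoalgebra d) (x : B) :
    x ∈ c.axiomKer d := (isDCoalgebra_iff.1 hc).2 x

theorem IsDCoalgebra.restrict {d : ℤ} (hc : c.IsDCoalgebra d) {S : Submodule k B}
    (hS : IsSubcoalgebra c S) (h1 : c.one ∈ S) : (c.restrict hS h1).IsDCoalgebra d :=
  (c.isHom_subtype hS h1).isDCoalgebra S.subtype_injective hc.isGradedData
    fun _ => hc.mem_axiomKer _

theorem comap_corad_le (hcomul : c.comul ∘ₗ f = TensorProduct.map f f ∘ₗ a.comul)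
    (hcobr : c.cobr ∘ₗ f = TensorProduct.map f f ∘ₗ a.cobr) (hone : f a.one = c.one)
    (hf : Function.Injective f) (n : ℕ) : (c.corad n).comap f ≤ a.corad n := by
  refine le_corad (G := fun n => (c.corad n).comap f) ?_ ?_ n
  · intro x hx
    obtain ⟨r, hr⟩ := Submodule.mem_span_singleton.1 hx
    refine Submodule.mem_span_singleton.2 ⟨r, hf ?_⟩
    rw [map_smul, hone, hr]
  · intro n x hx
    have hx' : f x ∈ c.corad (n + 1) := hx
    obtain ⟨h1, h2⟩ := mem_corad_succ.1 hx'
    have key : ∀ z, TensorProduct.map f f z ∈ tensorSub (c.corad n) (c.corad n) →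
        z ∈ tensorSub ((c.corad n).comap f) ((c.corad n).comap f) := fun z hz =>
      mem_tensorSub_comap hf hf hz
    refine ⟨key _ ?_, key _ ?_⟩
    · rw [red_apply, map_sub, map_sub, map_tmul, map_tmul, hone,
        ← comp_apply (TensorProduct.map f f), ← hcomul]
      exact h1
    · rw [← comp_apply (TensorProduct.map f f), ← hcobr]
      exact h2

theorem IsCoaugmented.of_injective (hc : c.IsCoaugmented) (h : IsHom a c f)
    (hone : f a.one = c.one) (hf : Function.Injective f) : a.IsCoaugmented := by
  have i2 := map_injective hf hf
  refine ⟨mem_of_map_mem h.deg hf (by rw [hone]; exact hc.one_mem), ?_, i2 ?_, i2 ?_, hf ?_⟩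
  · rw [← h.counit, comp_apply, hone, hc.counit_one]
  · rw [← comp_apply, ← h.comul, comp_apply, hone, hc.comul_one,
      map_tmul, hone]
  · rw [← comp_apply, ← h.cobr, comp_apply, hone, hc.cobr_one, map_zero]
  · rw [← comp_apply, ← h.diff, comp_apply, hone, hc.diff_one, map_zero]

theorem IsCoaugmented.isCoproartinian_of_injective {d : ℤ} (hc : c.IsCoaugmented)
    (hc' : ⨆ n, c.corad n = ⊤) (h : IsHom a c f) (hone : f a.one = c.one)
    (hf : Function.Injective f) (ha : a.IsDCoalgebra d) : a.IsCoproartinian := by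
  refine (hc.of_injective h hone hf).isCoproartinian ha ?_
  rw [eq_top_iff]
  rintro x -
  have hx : f x ∈ ⨆ n, c.corad n := by rw [hc']; trivial
  obtain ⟨n, hn⟩ := (Submodule.mem_iSup_of_directed _ hc.corad_mono.directed_le).1 hx
  exact Submodule.mem_iSup_of_mem n (comap_corad_le h.comul h.cobr hone hf n hn)

end axioms

section largest
variable {k : Type u} [Field k] {A : Type v} [AddCommGroup A] [Module k A]
  {B : Type w} [AddCommGroup B] [Module k B]

/-- The largest subcoalgebra contained in a subspace. -/
def largestSub (c : DCoalgData k B) (K : Submodule k B) : Submodule k B :=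
  sSup {S | IsSubcoalgebra c S ∧ S ≤ K}

variable {c : DCoalgData k B} {K : Submodule k B}

theorem largestSub_le : c.largestSub K ≤ K := sSup_le fun _ h => h.2

theorem isSubcoalgebra_largestSub : IsSubcoalgebra c (c.largestSub K) := by
  have hle : ∀ S, IsSubcoalgebra c S ∧ S ≤ K → S ≤ c.largestSub K := fun S hS => le_sSup hS
  refine ⟨sSup_le fun S hS => hS.1.homogeneous.trans
    (iSup_mono fun i => inf_le_inf_right _ (hle S hS)), ?_, ?_, ?_⟩
  · change c.largestSub K ≤ (c.largestSub K).comap c.diff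
    exact sSup_le fun S hS x hx => hle S hS (hS.1.diff_mem x hx)
  · change c.largestSub K ≤ (tensorSub (c.largestSub K) (c.largestSub K)).comap c.comul
    exact sSup_le fun S hS x hx => tensorSub_mono (hle S hS) (hle S hS) (hS.1.comul_mem x hx)
  · change c.largestSub K ≤ (tensorSub (c.largestSub K) (c.largestSub K)).comap c.cobr
    exact sSup_le fun S hS x hx => tensorSub_mono (hle S hS) (hle S hS) (hS.1.cobr_mem x hx)

theorem IsCoaugmented.isSubcoalgebra_span_one (hc : c.IsCoaugmented) :
    IsSubcoalgebra c (Submodule.span k {c.one}) := by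
  have h1 := Submodule.mem_span_singleton_self (R := k) c.one
  refine ⟨?_, fun x hx => ?_, fun x hx => ?_, fun x hx => ?_⟩
  · rw [Submodule.span_le, Set.singleton_subset_iff]
    exact Submodule.mem_iSup_of_mem 0 ⟨h1, hc.one_mem⟩
  all_goals obtain ⟨r, rfl⟩ := Submodule.mem_span_singleton.1 hx
  · rw [map_smul, hc.diff_one, smul_zero]; exact Submodule.zero_mem _
  · rw [map_smul, hc.comul_one]; exact Submodule.smul_mem _ _ (tmul_mem_tensorSub h1 h1)
  · rw [map_smul, hc.cobr_one, smul_zero]; exact Submodule.zero_mem _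

theorem IsCoaugmented.one_mem_largestSub (hc : c.IsCoaugmented) (h1 : c.one ∈ K) :
    c.one ∈ c.largestSub K :=
  have h : Submodule.span k {c.one} ≤ c.largestSub K := le_sSup ⟨hc.isSubcoalgebra_span_one, by
    rwa [Submodule.span_le, Set.singleton_subset_iff]⟩
  h (Submodule.mem_span_singleton_self _)

end largest
end DCoalgData

section limits
variable {k : Type u} [Field k] {V W M N : Type*} [AddCommGroup V] [Module k V]
  [AddCommGroup W] [Module k W] [AddCommGroup M] [Module k M] [AddCommGroup N] [Module k N]

theorem map_congr_tensorSub {S : Submodule k V} {T : Submodule k W} {f f' : V →ₗ[k] M}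
    {g g' : W →ₗ[k] N} (hf : ∀ x ∈ S, f x = f' x) (hg : ∀ x ∈ T, g x = g' x) {z : V ⊗[k] W}
    (hz : z ∈ tensorSub S T) : TensorProduct.map f g z = TensorProduct.map f' g' z := by
  refine tensorSub_induction (P := fun z => TensorProduct.map f g z = TensorProduct.map f' g' z)
    hz (fun x hx y hy => ?_) (by simp) fun x y h1 h2 => by rw [map_add, map_add, h1, h2]
  rw [map_tmul, map_tmul, hf x hx, hg y hy]

/-- A sequence of linear maps which is eventually constant on each step of an exhaustive
filtration has a limit. -/
theorem exists_limit {F : ℕ → Submodule k V} (hF : Monotone F) (htop : ∀ x, ∃ n, x ∈ F n)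
    (g : ℕ → V →ₗ[k] M) (h : ∀ n m x, x ∈ F n → n ≤ m → g (m + 1) x = g m x) :
    ∃ G : V →ₗ[k] M, ∀ n m x, x ∈ F n → n ≤ m → G x = g m x := by
  choose N hN using htop
  have key : ∀ n m x, x ∈ F n → n ≤ m → g m x = g n x := by
    intro n m x hx hnm
    induction m, hnm using Nat.le_induction with
    | base => rfl
    | succ m hm ih => rw [h n m x hx hm, ih]
  have key2 : ∀ n m x, x ∈ F n → n ≤ m → g (N x) x = g m x := by
    intro n m x hx hnm
    rw [← key (N x) (max (N x) m) x (hN x) (le_max_left _ _),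
      key n (max (N x) m) x hx (hnm.trans (le_max_right _ _)), key n m x hx hnm]
  refine ⟨{ toFun := fun x => g (N x) x, map_add' := fun x y => ?_, map_smul' := fun r x => ?_ },
    key2⟩
  · have hx := hF (le_max_left (N x) (N y)) (hN x)
    have hy := hF (le_max_right (N x) (N y)) (hN y)
    rw [key2 _ _ _ hx le_rfl, key2 _ _ _ hy le_rfl,
      key2 _ _ _ (Submodule.add_mem _ hx hy) le_rfl, map_add]
  · rw [key2 _ _ _ (Submodule.smul_mem _ r (hN x)) le_rfl, map_smul]
    rfl

end limits

namespace DCoalgData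
section counit
variable {k : Type u} [Field k] {A : Type v} [AddCommGroup A] [Module k A] {d : ℤ}
  {M : Type*} [AddCommGroup M] [Module k M] {a : DCoalgData k A} (ha : a.IsDCoalgebra d)
  (f : A →ₗ[k] M) (w : M)
include ha

theorem IsDCoalgebra.map_counit_left (x : A) :
    TensorProduct.map (toSpanSingleton k M w ∘ₗ a.counit) f (a.comul x) =
      w ⊗ₜ f x := by
  have e : ∀ z, TensorProduct.map (toSpanSingleton k M w ∘ₗ a.counit) f z =
      w ⊗ₜ f (lid k A (TensorProduct.map a.counit LinearMap.id z)) := by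
    intro z
    induction z using induction_on with
    | zero => simp
    | tmul x y => simp [smul_tmul']
    | add x y h1 h2 => simp only [map_add, h1, h2, tmul_add]
  rw [e]
  congr 2
  exact LinearMap.congr_fun ha.counit_comul x

theorem IsDCoalgebra.map_counit_left_cobr (x : A) :
    TensorProduct.map (toSpanSingleton k M w ∘ₗ a.counit) f (a.cobr x) = 0 := by
  have e : ∀ z, TensorProduct.map (toSpanSingleton k M w ∘ₗ a.counit) f z =
      w ⊗ₜ f (lid k A (TensorProduct.map a.counit LinearMap.id z)) := by
    intro z
    induction z using induction_on with
    | zero => simp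
    | tmul x y => simp [smul_tmul']
    | add x y h1 h2 => simp only [map_add, h1, h2, tmul_add]
  rw [e, show lid k A (TensorProduct.map a.counit LinearMap.id (a.cobr x)) = 0 from
    LinearMap.congr_fun ha.counit_cobr x, map_zero, tmul_zero]

omit ha in
theorem map_counit_right_eq (z : A ⊗[k] A) :
    TensorProduct.map f (toSpanSingleton k M w ∘ₗ a.counit) z =
      f (rid k A (TensorProduct.map LinearMap.id a.counit z)) ⊗ₜ w := by
  induction z using induction_on with
  | zero => simp
  | tmul x y => simp [smul_tmul']
  | add x y h1 h2 => simp only [map_add, h1, h2, add_tmul]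

omit ha in
theorem dual_counit_right (φ : Module.Dual k A) (z : A ⊗[k] A) :
    φ (rid k A (TensorProduct.map LinearMap.id a.counit z)) =
      (φ ⊠ a.counit) z := by
  induction z using induction_on with
  | zero => simp
  | tmul x y => simp [mul_comm]
  | add x y h1 h2 => simp only [map_add, h1, h2]

theorem IsDCoalgebra.map_counit_right (x : A) :
    TensorProduct.map f (toSpanSingleton k M w ∘ₗ a.counit) (a.comul x) =
      f x ⊗ₜ w := by
  rw [map_counit_right_eq]
  congr 2
  rw [← sub_eq_zero]
  refine separating_univ (k := k) _ fun φ _ => ?_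
  rw [map_sub, dual_counit_right]
  exact sub_eq_zero.2 (LinearMap.congr_fun (ha.dmul_counit φ) x)

theorem IsDCoalgebra.map_counit_right_cobr (x : A) :
    TensorProduct.map f (toSpanSingleton k M w ∘ₗ a.counit) (a.cobr x) = 0 := by
  rw [map_counit_right_eq]
  suffices h : rid k A (TensorProduct.map LinearMap.id a.counit (a.cobr x)) = 0 by
    rw [h, map_zero, zero_tmul]
  refine a.separating_dualDeg _ ?_
  rintro φ ⟨b, hφ⟩
  rw [dual_counit_right]
  have := ha.dbr_comm hφ ha.counit_mem_dualDeg
  rw [ha.counit_dbr, smul_zero] at this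
  exact LinearMap.congr_fun this x

end counit

section trivial
variable {k : Type u} [Field k] {A : Type v} [AddCommGroup A] [Module k A] {d : ℤ}
  {B : Type w} [AddCommGroup B] [Module k B] {a : DCoalgData k A} {c : DCoalgData k B}

/-- The trivial morphism, through the ground field. -/
theorem IsCoaugmented.isGradedHom_trivial (hc : c.IsCoaugmented) (ha : a.IsDCoalgebra d) :
    IsGradedHom a c (toSpanSingleton k _ c.one ∘ₗ a.counit) := by
  refine ⟨fun i x hx => ?_, ?_, ?_, ?_⟩
  · rw [add_zero, comp_apply]
    by_cases hi : i = 0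
    · subst hi; exact Submodule.smul_mem _ _ hc.one_mem
    · rw [ha.counit_deg hx hi, map_zero]; exact Submodule.zero_mem _
  · refine LinearMap.ext fun x => ?_
    rw [comp_apply, comp_apply, comp_apply, ha.map_counit_left,
      LinearMap.toSpanSingleton_apply, map_smul, hc.comul_one, comp_apply,
      LinearMap.toSpanSingleton_apply, tmul_smul]
  · refine LinearMap.ext fun x => ?_
    rw [comp_apply, comp_apply, comp_apply,
      ha.map_counit_left_cobr, LinearMap.toSpanSingleton_apply, map_smul, hc.cobr_one, smul_zero]
  · ext x; simp [hc.counit_one]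

end trivial

section codRestrict
variable {k : Type u} [Field k] {A : Type v} [AddCommGroup A] [Module k A]
  {B : Type w} [AddCommGroup B] [Module k B] {a : DCoalgData k A} {c : DCoalgData k B}

theorem IsGradedHom.codRestrict {S : Submodule k B} (hS : IsSubcoalgebra c S) (h1 : c.one ∈ S)
    {g : A →ₗ[k] B} (hg : IsGradedHom a c g) (h : ∀ x, g x ∈ S) :
    IsGradedHom a (c.restrict hS h1) (g.codRestrict S h) := by
  have hsub := c.isHom_subtype hS h1
  have hg' : S.subtype ∘ₗ g.codRestrict S h = g := rfl
  have i2 := map_injective S.subtype_injective S.subtype_injective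
  refine ⟨fun i x hx => hg.deg i x hx, ?_, ?_, hg.counit⟩
  · have h : TensorProduct.map S.subtype S.subtype ∘ₗ (c.restrict hS h1).comul ∘ₗ
        g.codRestrict S h = TensorProduct.map S.subtype S.subtype ∘ₗ
          TensorProduct.map (g.codRestrict S h) (g.codRestrict S h) ∘ₗ a.comul := by
      rw [← comp_assoc, ← hsub.comul, comp_assoc, hg', hg.comul,
        ← comp_assoc, ← map_comp, hg']
    exact LinearMap.ext fun x => i2 (LinearMap.congr_fun h x)
  · have h : TensorProduct.map S.subtype S.subtype ∘ₗ (c.restrict hS h1).cobr ∘ₗ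
        g.codRestrict S h = TensorProduct.map S.subtype S.subtype ∘ₗ
          TensorProduct.map (g.codRestrict S h) (g.codRestrict S h) ∘ₗ a.cobr := by
      rw [← comp_assoc, ← hsub.cobr, comp_assoc, hg', hg.cobr,
        ← comp_assoc, ← map_comp, hg']
    exact LinearMap.ext fun x => i2 (LinearMap.congr_fun h x)

end codRestrict

section grouplike
variable {k : Type u} [Field k] {A : Type v} [AddCommGroup A] [Module k A]
  {c : DCoalgData k A}

theorem IsCoaugmented.grouplike_eq_one (hc : c.IsCoaugmented) {n : ℕ} {y : A}
    (hy : y ∈ c.corad n) (h1 : c.counit y = 1) (h2 : c.comul y = y ⊗ₜ y) : y = c.one := by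
  have hred : c.red (y - c.one) = (y - c.one) ⊗ₜ (y - c.one) := by
    rw [red_apply, map_sub, h2, hc.comul_one]
    simp only [TensorProduct.sub_tmul, TensorProduct.tmul_sub]
    abel
  have key : ∀ n, y - c.one ∈ c.corad n → y - c.one = 0 := by
    intro n
    induction n with
    | zero =>
      intro h
      obtain ⟨r, hr⟩ := Submodule.mem_span_singleton.1 h
      have := congrArg c.counit hr
      rw [map_smul, map_sub, h1, hc.counit_one, sub_self, smul_eq_mul, mul_one] at this
      rw [← hr, this, zero_smul]
    | succ n ih =>
      intro h
      by_contra hne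
      have h3 := (mem_corad_succ.1 h).1
      rw [hred] at h3
      obtain ⟨φ, hφ⟩ := Module.Projective.exists_dual_eq_one k hne
      have h4 := (mem_tensorSub_iff.1 h3).1 φ
      rw [map_tmul, TensorProduct.rid_tmul, hφ, one_smul] at h4
      exact hne (ih h4)
  exact sub_eq_zero.1 (key n (Submodule.sub_mem _ hy (hc.one_mem_corad n)))

end grouplike
end DCoalgData

section ofDeg
variable {k : Type u} [Field k] {J : Type v} (e : J → ℤ)

theorem ofDeg_internal : DirectSum.IsInternal fun n => Finsupp.supported k k {j | e j = n} := by
  let D : (J →₀ k) →ₗ[k] ⨁ n, Finsupp.supported k k {j | e j = n} :=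
    Finsupp.linearCombination k fun j =>
      DirectSum.lof k ℤ (fun n => Finsupp.supported k k {j | e j = n}) (e j)
        ⟨Finsupp.single j 1, Finsupp.single_mem_supported k 1 rfl⟩
  have hD : ∀ j, D (Finsupp.single j 1) =
      DirectSum.lof k ℤ (fun n => Finsupp.supported k k {j | e j = n}) (e j)
        ⟨Finsupp.single j 1, Finsupp.single_mem_supported k 1 rfl⟩ := fun j => by
    simp [D]
  refine @DirectSum.Decomposition.isInternal _ _ _ _ _ _ _ _
    (DirectSum.Decomposition.ofLinearMap _ D ?_ ?_)
  · ext j : 2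
    simp [hD]
  · ext n ⟨z, hz⟩ : 2
    simp only [comp_apply, DirectSum.coeLinearMap_lof, id_apply]
    have key : ∃ hz', D z =
        DirectSum.lof k ℤ (fun n => Finsupp.supported k k {j | e j = n}) n ⟨z, hz'⟩ := by
      have hz2 := hz
      rw [Finsupp.supported_eq_span_single] at hz2
      induction hz2 using Submodule.span_induction with
      | mem z h =>
        obtain ⟨j, hj, rfl⟩ := h
        exact ⟨hz, by rw [hD]; exact lof_congr _ hj _ _⟩
      | zero => exact ⟨Submodule.zero_mem _, by rw [map_zero]; exact (map_zero _).symm⟩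
      | add x y hx hy h1 h2 =>
        rw [← Finsupp.supported_eq_span_single] at hx hy
        obtain ⟨a, ha⟩ := h1 hx
        obtain ⟨b, hb⟩ := h2 hy
        refine ⟨Submodule.add_mem _ a b, ?_⟩
        rw [map_add, ha, hb, ← map_add]
        rfl
      | smul r x hx h1 =>
        rw [← Finsupp.supported_eq_span_single] at hx
        obtain ⟨a, ha⟩ := h1 hx
        refine ⟨Submodule.smul_mem _ r a, ?_⟩
        rw [map_smul, ha, ← map_smul]
        rfl
    exact key.2

/-- The graded space with a basis whose elements have given degrees. -/
def DiffMod.ofDeg : DiffMod k (J →₀ k) where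
  gr n := Finsupp.supported k k {j | e j = n}
  internal := ofDeg_internal e
  diff := 0
  diff_mem _ := Submodule.zero_mem _

variable {e}

theorem DiffMod.single_mem_ofDeg (j : J) :
    Finsupp.single j 1 ∈ (DiffMod.ofDeg (k := k) e).gr (e j) :=
  Finsupp.single_mem_supported k 1 rfl

theorem DiffMod.ofDeg_homDeg {M : Type*} [AddCommGroup M] [Module k M] {c : DiffMod k M} {n : ℤ}
    {f : (J →₀ k) →ₗ[k] M} (h : ∀ j, f (Finsupp.single j 1) ∈ c.gr (e j + n)) :
    f ∈ homDeg (DiffMod.ofDeg e) c n := by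
  intro i x hx
  change x ∈ Finsupp.supported k k {j | e j = i} at hx
  rw [Finsupp.supported_eq_span_single] at hx
  induction hx using Submodule.span_induction with
  | mem z h' =>
    obtain ⟨j, rfl, rfl⟩ := h'
    exact h j
  | zero => rw [map_zero]; exact Submodule.zero_mem _
  | add x y _ _ h1 h2 => rw [map_add]; exact Submodule.add_mem _ h1 h2
  | smul r x _ h1 => rw [map_smul]; exact Submodule.smul_mem _ _ h1

theorem DiffMod.exists_homogeneous_basis {X : Type v} [AddCommGroup X] [Module k X]
    (c : DiffMod k X) : ∃ (I : Type v) (b : Module.Basis I k X) (e : I → ℤ),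
      ∀ i, b i ∈ c.gr (e i) :=
  ⟨_, c.internal.collectedBasis fun n => Module.Basis.ofVectorSpace k (c.gr n), Sigma.fst,
    fun i => c.internal.collectedBasis_mem _ i⟩

end ofDeg

/-- Binary trees with labelled leaves and two kinds of nodes. -/
inductive CoTree (I : Type u) : Type u
  | leaf (i : I) : CoTree I
  | node (b : Bool) (l r : CoTree I) : CoTree I

namespace CoTree
variable (k : Type u) [Field k] (d : ℤ) {I : Type v} (e : I → ℤ)

/-- The degree of a tree; the nodes of the second kind have degree `d - 1`. -/
def deg : CoTree I → ℤ
  | leaf i => e i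
  | node b l r => deg l + deg r + bif b then d - 1 else 0

def optDeg : Option (CoTree I) → ℤ
  | none => 0
  | some t => deg d e t

/-- The space spanned by a unit and the trees. -/
abbrev Span (k : Type u) [Field k] (I : Type v) : Type (max u v) := Option (CoTree I) →₀ k

/-- The decomposition of a tree at a root of a given kind. -/
def split (b : Bool) : Option (CoTree I) → Span k I ⊗[k] Span k I
  | some (node b' l r) => if b = b' then
      Finsupp.single (some l) 1 ⊗ₜ Finsupp.single (some r) 1 else 0
  | _ => 0

/-- The primitive part of the coproduct. -/
def unitPart : Option (CoTree I) → Span k I ⊗[k] Span k I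
  | none => Finsupp.single none 1 ⊗ₜ Finsupp.single none 1
  | some t => Finsupp.single none 1 ⊗ₜ Finsupp.single (some t) 1 +
      Finsupp.single (some t) 1 ⊗ₜ Finsupp.single none 1

def counitFun : Option (CoTree I) → k
  | none => 1
  | some _ => 0

/-- The cofree (neither coassociative nor cocommutative) coalgebra with a coproduct and a
cobracket. -/
def coalg : DCoalgData k (Span k I) where
  toDiffMod := DiffMod.ofDeg (optDeg d e)
  comul := Finsupp.linearCombination k fun t => unitPart k t + split k false t
  cobr := Finsupp.linearCombination k (split k true)
  counit := Finsupp.linearCombination k (counitFun k)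
  one := Finsupp.single none 1

/-- The joining of two trees at a new root. -/
def joinFun (b : Bool) : Option (CoTree I) → Option (CoTree I) → Span k I
  | some l, some r => Finsupp.single (some (node b l r)) 1
  | _, _ => 0

def join (b : Bool) : Span k I ⊗[k] Span k I →ₗ[k] Span k I :=
  TensorProduct.lift (Finsupp.linearCombination k fun s =>
    Finsupp.linearCombination k (joinFun k b s))

/-- The projection which kills the unit. -/
def aug : Span k I →ₗ[k] Span k I :=
  Finsupp.linearCombination k fun t : Option (CoTree I) =>
    t.elim (0 : Span k I) fun t => Finsupp.single (some t) 1

variable {k} {X : Type v} [AddCommGroup X] [Module k X] (B : Module.Basis I k X)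

/-- The inclusion of the cogenerators. -/
def incl : X →ₗ[k] Span k I := B.constr k fun i => Finsupp.single (some (leaf i)) 1

def leafFun : Option (CoTree I) → X
  | some (leaf i) => B i
  | _ => 0

/-- The projection to the cogenerators. -/
def leaves : Span k I →ₗ[k] X := Finsupp.linearCombination k (leafFun B)

variable (b b' : Bool)

theorem join_single (s t : Option (CoTree I)) :
    join k b (Finsupp.single s 1 ⊗ₜ Finsupp.single t 1) = joinFun k b s t := by
  simp [join]

theorem comul_single (t : Option (CoTree I)) :
    (coalg k d e).comul (Finsupp.single t 1) = unitPart k t + split k false t := by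
  simp [coalg]

theorem cobr_single (t : Option (CoTree I)) :
    (coalg k d e).cobr (Finsupp.single t 1) = split k true t := by
  simp [coalg]

theorem counit_single (t : Option (CoTree I)) :
    (coalg k d e).counit (Finsupp.single t 1) = counitFun k t := by
  simp [coalg]

theorem leaves_single (t : Option (CoTree I)) :
    leaves B (Finsupp.single t 1) = leafFun B t := by
  simp [leaves]

theorem aug_single_none : aug k (Finsupp.single (none : Option (CoTree I)) 1) = 0 := by
  simp [aug]

theorem aug_single_some (t : CoTree I) :
    aug k (Finsupp.single (some t) 1) = Finsupp.single (some t) 1 := by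
  simp [aug]

theorem incl_basis (i : I) : incl B (B i) = Finsupp.single (some (leaf i)) 1 := by
  simp [incl]

theorem span_hom_ext {M : Type*} [AddCommMonoid M] [Module k M] {f g : Span k I →ₗ[k] M}
    (h : ∀ t, f (Finsupp.single t 1) = g (Finsupp.single t 1)) : f = g :=
  Finsupp.lhom_ext' fun t => LinearMap.ext_ring (h t)

theorem span_tensor_ext {M : Type*} [AddCommMonoid M] [Module k M]
    {f g : Span k I ⊗[k] Span k I →ₗ[k] M}
    (h : ∀ s t, f (Finsupp.single s 1 ⊗ₜ Finsupp.single t 1) =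
      g (Finsupp.single s 1 ⊗ₜ Finsupp.single t 1)) : f = g :=
  TensorProduct.ext (span_hom_ext fun s => span_hom_ext fun t => h s t)

theorem isCoaugmented_coalg : (coalg k d e).IsCoaugmented where
  one_mem := DiffMod.single_mem_ofDeg (e := optDeg d e) none
  counit_one := counit_single d e none
  comul_one := by
    change (coalg k d e).comul (Finsupp.single none 1) = _
    rw [comul_single]; simp [split, unitPart, coalg]
  cobr_one := cobr_single d e none
  diff_one := rfl

theorem aug_eq (x : Span k I) :
    aug k x = x - (coalg k d e).counit x • (coalg k d e).one := by
  have : aug k = LinearMap.id (R := k) (M := Span k I) -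
      toSpanSingleton k _ (coalg k d e).one ∘ₗ (coalg k d e).counit := by
    refine span_hom_ext fun t => ?_
    rw [LinearMap.sub_apply, comp_apply, counit_single]
    cases t with
    | none => simp [aug_single_none, counitFun, coalg]
    | some t => simp [aug_single_some, counitFun]
  rw [this]; simp

theorem join_one_left (x : Span k I) : join k b ((coalg k d e).one ⊗ₜ x) = 0 := by
  have : join k b ∘ₗ TensorProduct.mk k _ _ (coalg k d e).one = 0 := by
    refine span_hom_ext fun t => ?_
    rw [comp_apply, TensorProduct.mk_apply]
    exact join_single b none t
  exact LinearMap.congr_fun this x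

theorem join_one_right (x : Span k I) : join k b (x ⊗ₜ (coalg k d e).one) = 0 := by
  have : join k b ∘ₗ (TensorProduct.mk k _ _).flip (coalg k d e).one = 0 := by
    refine span_hom_ext fun t => ?_
    rw [comp_apply, LinearMap.flip_apply, TensorProduct.mk_apply]
    refine (join_single b t none).trans ?_
    cases t <;> rfl
  exact LinearMap.congr_fun this x

theorem counit_join (z : Span k I ⊗[k] Span k I) :
    (coalg k d e).counit (join k b z) = 0 := by
  have : (coalg k d e).counit ∘ₗ join k b = 0 := by
    refine span_tensor_ext fun s t => ?_
    rw [comp_apply, join_single]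
    cases s <;> cases t <;> simp [joinFun, counit_single, counitFun]
  exact LinearMap.congr_fun this z

theorem leaves_join (z : Span k I ⊗[k] Span k I) : leaves B (join k b z) = 0 := by
  have : leaves B ∘ₗ join k b = 0 := by
    refine span_tensor_ext fun s t => ?_
    rw [comp_apply, join_single]
    cases s <;> cases t <;> simp [joinFun, leaves_single, leafFun]
  exact LinearMap.congr_fun this z

theorem counit_incl (x : X) : (coalg k d e).counit (incl B x) = 0 := by
  have : (coalg k d e).counit ∘ₗ incl B = 0 := B.ext fun i => by
    rw [comp_apply, incl_basis, counit_single]; rfl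
  exact LinearMap.congr_fun this x

theorem leaves_incl (x : X) : leaves B (incl B x) = x := by
  have : leaves B ∘ₗ incl B = LinearMap.id := B.ext fun i => by
    rw [comp_apply, incl_basis, leaves_single]; rfl
  exact LinearMap.congr_fun this x

theorem leaves_one : leaves B (coalg k d e).one = 0 := leaves_single B none

theorem comul_incl (x : X) : (coalg k d e).comul (incl B x) =
    (coalg k d e).one ⊗ₜ incl B x + incl B x ⊗ₜ (coalg k d e).one := by
  have : (coalg k d e).comul ∘ₗ incl B =
      TensorProduct.mk k _ _ (coalg k d e).one ∘ₗ incl B +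
        (TensorProduct.mk k _ _).flip (coalg k d e).one ∘ₗ incl B := B.ext fun i => by
    rw [comp_apply, incl_basis, comul_single]
    simp [incl_basis, unitPart, split, coalg]
  exact LinearMap.congr_fun this x

theorem cobr_incl (x : X) : (coalg k d e).cobr (incl B x) = 0 := by
  have : (coalg k d e).cobr ∘ₗ incl B = 0 := B.ext fun i => by
    rw [comp_apply, incl_basis, cobr_single]; rfl
  exact LinearMap.congr_fun this x

theorem comul_join (z : Span k I ⊗[k] Span k I) : (coalg k d e).comul (join k b z) =
    (coalg k d e).one ⊗ₜ join k b z + join k b z ⊗ₜ (coalg k d e).one +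
      bif b then 0 else TensorProduct.map (aug k) (aug k) z := by
  have : (coalg k d e).comul ∘ₗ join k b =
      TensorProduct.mk k _ _ (coalg k d e).one ∘ₗ join k b +
        (TensorProduct.mk k _ _).flip (coalg k d e).one ∘ₗ join k b +
        bif b then 0 else TensorProduct.map (aug k) (aug k) := by
    refine span_tensor_ext fun s t => ?_
    rw [comp_apply, join_single]
    cases s <;> cases t <;> cases b <;>
      simp [joinFun, join_single, aug_single_none, aug_single_some, unitPart, split, coalg]
  refine (LinearMap.congr_fun this z).trans ?_
  cases b <;> rfl

theorem cobr_join (z : Span k I ⊗[k] Span k I) : (coalg k d e).cobr (join k b z) =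
      bif b then TensorProduct.map (aug k) (aug k) z else 0 := by
  have : (coalg k d e).cobr ∘ₗ join k b =
        bif b then TensorProduct.map (aug k) (aug k) else 0 := by
    refine span_tensor_ext fun s t => ?_
    rw [comp_apply, join_single]
    cases s <;> cases t <;> cases b <;>
      simp [joinFun, cobr_single, aug_single_none, aug_single_some, split]
  refine (LinearMap.congr_fun this z).trans ?_
  cases b <;> rfl

/-- An element is determined by its counit, its leaves, and its decompositions. -/
theorem eq_joins (x : Span k I) : x = (coalg k d e).counit x • (coalg k d e).one +
    incl B (leaves B x) + join k false ((coalg k d e).comul x) +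
      join k true ((coalg k d e).cobr x) := by
  have h1 := fun t => join_one_left d e false (k := k) (I := I) t
  have h2 := fun t => join_one_right d e false (k := k) (I := I) t
  have : LinearMap.id = toSpanSingleton k _ (coalg k d e).one ∘ₗ (coalg k d e).counit +
      incl B ∘ₗ leaves B + join k false ∘ₗ (coalg k d e).comul +
        join k true ∘ₗ (coalg k d e).cobr := by
    refine span_hom_ext fun t => ?_
    simp only [LinearMap.add_apply, comp_apply, counit_single, leaves_single,
      comul_single, cobr_single, map_add, id_apply]
    cases t with
    | none => simp [counitFun, leafFun, unitPart, split, join_single, joinFun, coalg]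
    | some t =>
      cases t with
      | leaf i =>
        simp [counitFun, leafFun, unitPart, split, join_single, joinFun, incl_basis]
      | node b l r =>
        cases b <;> simp [counitFun, leafFun, unitPart, split, join_single, joinFun]
  have := LinearMap.congr_fun this x
  simpa using this

theorem split_mem (t : Option (CoTree I)) :
    split k b t ∈ (DiffMod.ofDeg (k := k) (optDeg d e)).tensorGr (DiffMod.ofDeg (optDeg d e))
      (optDeg d e t + bif b then 1 - d else 0) := by
  have h := fun t : CoTree I => DiffMod.single_mem_ofDeg (k := k) (e := optDeg d e) (some t)
  unfold split
  split
  · split_ifs with hb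
    · subst hb
      refine tmul_mem_tensorGr _ _ (h _) (h _) ?_
      cases b <;> simp [optDeg, deg] <;> ring
    · exact Submodule.zero_mem _
  · exact Submodule.zero_mem _

theorem isGradedData_coalg : (coalg k d e).IsGradedData d := by
  have hs := fun t => DiffMod.single_mem_ofDeg (k := k) (e := optDeg d e) t
  have hc : (coalg k d e).comul ∈ homDeg (DiffMod.ofDeg (optDeg d e))
      ((DiffMod.ofDeg (optDeg d e)).tensor (DiffMod.ofDeg (optDeg d e))) 0 := by
    refine DiffMod.ofDeg_homDeg fun t => ?_
    rw [comul_single]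
    refine Submodule.add_mem _ ?_ (split_mem d e false t)
    cases t with
    | none => exact tmul_mem_tensorGr _ _ (hs _) (hs _) (by simp [optDeg])
    | some t =>
      exact Submodule.add_mem _ (tmul_mem_tensorGr _ _ (hs _) (hs _) (by simp [optDeg]))
        (tmul_mem_tensorGr _ _ (hs _) (hs _) (by simp [optDeg]))
  have hb : (coalg k d e).cobr ∈ homDeg (DiffMod.ofDeg (optDeg d e))
      ((DiffMod.ofDeg (optDeg d e)).tensor (DiffMod.ofDeg (optDeg d e))) (1 - d) := by
    refine DiffMod.ofDeg_homDeg fun t => ?_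
    rw [cobr_single]
    exact split_mem d e true t
  have hsplit : ∀ (b : Bool) (t : Option (CoTree I)), lid k (Span k I)
      (TensorProduct.map (coalg k d e).counit LinearMap.id (split k b t)) = 0 := by
    intro b t
    unfold split
    split
    · split_ifs
      · simp [counit_single, counitFun]
      · simp
    · simp
  refine ⟨fun x => rfl, fun {i x} hx => ?_, fun {i x} hx hi => ?_, ?_, fun {i x} hx => ?_, ?_,
    ⟨fun i x _ => Submodule.zero_mem _, ?_, ?_⟩⟩
  · have := hc i x hx
    rwa [add_zero] at this
  · change x ∈ Finsupp.supported k k {j | optDeg d e j = i} at hx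
    rw [Finsupp.supported_eq_span_single] at hx
    induction hx using Submodule.span_induction with
    | mem z h' =>
      obtain ⟨j, rfl, rfl⟩ := h'
      cases j with
      | none => exact absurd rfl hi
      | some j => exact counit_single d e (some j)
    | zero => rw [map_zero]
    | add x y _ _ h1 h2 => rw [map_add, h1, h2, add_zero]
    | smul r x _ h1 => rw [map_smul, h1, smul_zero]
  · refine span_hom_ext fun t => ?_
    simp only [comp_apply, LinearEquiv.coe_coe, comul_single, map_add, hsplit,
      id_apply, add_zero]
    cases t <;> simp [unitPart, counit_single, counitFun]
  · have := hb i x hx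
    rwa [← add_sub_assoc] at this
  · refine span_hom_ext fun t => ?_
    simp only [comp_apply, LinearEquiv.coe_coe, cobr_single, hsplit,
      LinearMap.zero_apply]
  · simp [coalg, DiffMod.ofDeg, leib]
  · simp [coalg, DiffMod.ofDeg, leib]

theorem iSup_corad_coalg : ⨆ n, (coalg k d e).corad n = ⊤ := by
  have h1 := isCoaugmented_coalg (k := k) d e
  have key : ∀ t : CoTree I, ∃ n, Finsupp.single (some t) 1 ∈ (coalg k d e).corad n := by
    intro t
    have hred : ∀ t : CoTree I, (coalg k d e).red (Finsupp.single (some t) 1) =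
        split k false (some t) := fun t => by
      rw [red_apply, comul_single]
      simp only [unitPart, coalg]
      abel
    induction t with
    | leaf i =>
      refine ⟨1, mem_corad_succ.2 ⟨?_, ?_⟩⟩
      · rw [hred]; exact Submodule.zero_mem _
      · rw [cobr_single]; exact Submodule.zero_mem _
    | node b l r hl hr =>
      obtain ⟨n, hl⟩ := hl
      obtain ⟨m, hr⟩ := hr
      have hmem : ∀ b', split k b' (some (node b l r)) ∈
          tensorSub ((coalg k d e).corad (max n m)) ((coalg k d e).corad (max n m)) := by
        intro b'
        simp only [split]
        split_ifs
        · exact tmul_mem_tensorSub (h1.corad_mono (le_max_left n m) hl)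
            (h1.corad_mono (le_max_right n m) hr)
        · exact Submodule.zero_mem _
      refine ⟨max n m + 1, mem_corad_succ.2 ⟨?_, ?_⟩⟩
      · rw [hred]; exact hmem false
      · rw [cobr_single]; exact hmem true
  rw [eq_top_iff]
  rintro x -
  induction x using Finsupp.induction_linear with
  | zero => exact Submodule.zero_mem _
  | add x y hx hy => exact Submodule.add_mem _ hx hy
  | single t r =>
    rw [← mul_one r, ← smul_eq_mul, ← Finsupp.smul_single]
    refine Submodule.smul_mem _ r ?_
    cases t with
    | none => exact Submodule.mem_iSup_of_mem 0 (h1.one_mem_corad 0)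
    | some t =>
      obtain ⟨n, hn⟩ := key t
      exact Submodule.mem_iSup_of_mem n hn

theorem join_homDeg : join k b ∈ homDeg ((DiffMod.ofDeg (optDeg d e)).tensor
    (DiffMod.ofDeg (optDeg d e))) (DiffMod.ofDeg (optDeg d e)) (bif b then d - 1 else 0) := by
  have h : ∀ s t : Option (CoTree I), joinFun k b s t ∈
      (DiffMod.ofDeg (k := k) (optDeg d e)).gr
        (optDeg d e s + optDeg d e t + bif b then d - 1 else 0) := by
    intro s t
    cases s with
    | none => exact Submodule.zero_mem _
    | some s =>
      cases t with
      | none => exact Submodule.zero_mem _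
      | some t => exact DiffMod.single_mem_ofDeg (e := optDeg d e) (some (node b s t))
  have h2 : ∀ s, TensorProduct.curry (join k b) (Finsupp.single s 1) ∈
      homDeg (DiffMod.ofDeg (k := k) (optDeg d e)) (DiffMod.ofDeg (optDeg d e))
        (optDeg d e s + bif b then d - 1 else 0) := by
    intro s
    refine DiffMod.ofDeg_homDeg fun t => ?_
    have := h s t
    rw [← join_single] at this
    rwa [← add_assoc, add_comm (optDeg d e t)]
  have h3 : ∀ i x, x ∈ (DiffMod.ofDeg (k := k) (optDeg d e)).gr i →
      TensorProduct.curry (join k b) x ∈ homDeg (DiffMod.ofDeg (k := k) (optDeg d e))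
        (DiffMod.ofDeg (optDeg d e)) (i + bif b then d - 1 else 0) := by
    intro i x hx
    change x ∈ Finsupp.supported k k {j | optDeg d e j = i} at hx
    rw [Finsupp.supported_eq_span_single] at hx
    induction hx using Submodule.span_induction with
    | mem z h' =>
      obtain ⟨j, rfl, rfl⟩ := h'
      exact h2 j
    | zero => rw [map_zero]; exact Submodule.zero_mem _
    | add x y _ _ h1 h2 => rw [map_add]; exact Submodule.add_mem _ h1 h2
    | smul r x _ h1 => rw [map_smul]; exact Submodule.smul_mem _ _ h1
  intro n z hz
  refine tensorGr_induction (P := fun z => join k b z ∈ _) _ _ z hz ?_ ?_ ?_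
  · intro i j x y hx hy hij
    have := h3 i x hx j y hy
    rwa [← add_assoc, add_comm j, hij] at this
  · rw [map_zero]; exact Submodule.zero_mem _
  · intro x y hx hy
    rw [map_add]; exact Submodule.add_mem _ hx hy

theorem leaves_homDeg {X' : DiffMod k X} (hB : ∀ i, B i ∈ X'.gr (e i)) :
    leaves B ∈ homDeg (coalg k d e).toDiffMod X' 0 := by
  refine DiffMod.ofDeg_homDeg fun t => ?_
  rw [leaves_single, add_zero]
  cases t with
  | none => exact Submodule.zero_mem _
  | some t =>
    cases t with
    | leaf i => exact hB i
    | node => exact Submodule.zero_mem _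

theorem incl_mem {X' : DiffMod k X} (hB : ∀ i, B i ∈ X'.gr (e i)) :
    incl B ∈ homDeg X' (coalg k d e).toDiffMod 0 := by
  have h1 : ∀ a x, incl B (X'.proj a x) = (coalg k d e).proj a (incl B x) := by
    intro a x
    have : incl B ∘ₗ X'.proj a = (coalg k d e).proj a ∘ₗ incl B := by
      refine B.ext fun i => ?_
      have h := DiffMod.single_mem_ofDeg (k := k) (e := optDeg d e) (some (leaf i))
      simp only [comp_apply, incl_basis]
      by_cases hi : e i = a
      · subst hi
        rw [X'.proj_of_mem (hB i), incl_basis]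
        exact ((coalg k d e).proj_of_mem h).symm
      · rw [X'.proj_of_ne (hB i) hi, map_zero]
        exact ((coalg k d e).proj_of_ne h hi).symm
    exact LinearMap.congr_fun this x
  intro i x hx
  rw [add_zero, ← X'.proj_of_mem hx, h1]
  exact DiffMod.proj_mem _ _ _

end CoTree

namespace CoTree
section universal
variable {k : Type u} [Field k] (d : ℤ) {I : Type v} (e : I → ℤ) {X : Type v} [AddCommGroup X]
  [Module k X] (B : Module.Basis I k X) {A : Type w} [AddCommGroup A] [Module k A]
  (a : DCoalgData k A) (f : A →ₗ[k] X)

/-- The operator whose fixed point is the morphism of coalgebras with corestriction `f`. -/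
def step (g : A →ₗ[k] Span k I) : A →ₗ[k] Span k I :=
  toSpanSingleton k _ (coalg k d e).one ∘ₗ a.counit + incl B ∘ₗ f +
    join k false ∘ₗ TensorProduct.map g g ∘ₗ a.comul +
    join k true ∘ₗ TensorProduct.map g g ∘ₗ a.cobr

def approx : ℕ → A →ₗ[k] Span k I
  | 0 => toSpanSingleton k _ (coalg k d e).one ∘ₗ a.counit
  | n + 1 => step d e B a f (approx n)

variable {d a f}

theorem approx_homDeg (ha : a.IsDCoalgebra d) {X' : DiffMod k X} (hB : ∀ i, B i ∈ X'.gr (e i))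
    (hf : f ∈ homDeg a.toDiffMod X' 0) (n : ℕ) :
    approx d e B a f n ∈ homDeg a.toDiffMod (coalg k d e).toDiffMod 0 := by
  have h0 : toSpanSingleton k _ (coalg k d e).one ∘ₗ a.counit ∈
      homDeg a.toDiffMod (coalg k d e).toDiffMod 0 := by
    intro i x hx
    rw [add_zero, comp_apply]
    by_cases hi : i = 0
    · subst hi; exact Submodule.smul_mem _ _ (isCoaugmented_coalg d e).one_mem
    · rw [ha.counit_deg hx hi, map_zero]; exact Submodule.zero_mem _
  induction n with
  | zero => exact h0
  | succ n ih =>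
    have hm : TensorProduct.map (approx d e B a f n) (approx d e B a f n) ∈
        homDeg (a.toDiffMod.tensor a.toDiffMod)
          ((coalg k d e).toDiffMod.tensor (coalg k d e).toDiffMod) 0 := by
      simpa using map_homDeg ih ih
    refine Submodule.add_mem _ (Submodule.add_mem _ (Submodule.add_mem _ h0
      (homDeg_comp_zero (incl_mem d e B hB) hf)) ?_) ?_
    · exact homDeg_comp_zero (join_homDeg d e false) (homDeg_comp_zero hm ha.comul_homDeg)
    · have := homDeg_comp (join_homDeg (k := k) d e true) (zero_homDeg_comp hm ha.cobr_homDeg)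
      rwa [show 1 - d + (bif true then d - 1 else 0) = 0 by simp] at this

theorem approx_one (h1 : a.IsCoaugmented) (hf : f a.one = 0) (n : ℕ) :
    approx d e B a f n a.one = (coalg k d e).one := by
  induction n with
  | zero => simp [approx, h1.counit_one]
  | succ n ih =>
    simp [approx, step, h1.counit_one, hf, h1.comul_one, h1.cobr_one, ih, join_one_left]

theorem approx_succ (h1 : a.IsCoaugmented) (hf : f a.one = 0) (n m : ℕ) (x : A)
    (hx : x ∈ a.corad n) (hnm : n ≤ m) :
    approx d e B a f (m + 1) x = approx d e B a f m x := by
  induction n generalizing m x with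
  | zero =>
    obtain ⟨r, rfl⟩ := Submodule.mem_span_singleton.1 hx
    rw [map_smul, map_smul, approx_one e B h1 hf, approx_one e B h1 hf]
  | succ n ih =>
    obtain ⟨m, rfl⟩ : ∃ m', m = m' + 1 := ⟨m - 1, by omega⟩
    have h := fun x hx => ih m x hx (by omega)
    obtain ⟨hr, hb⟩ := mem_corad_succ.1 hx
    have e1 := map_congr_tensorSub h h hr
    have e2 := map_congr_tensorSub h h hb
    have e3 : ∀ m, join k false (TensorProduct.map (approx d e B a f m) (approx d e B a f m)
        (a.comul x)) = join k false (TensorProduct.map (approx d e B a f m) (approx d e B a f m)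
        (a.red x)) := fun m => by
      rw [a.comul_eq x]
      simp [approx_one e B h1 hf, join_one_left, join_one_right]
    change step d e B a f (approx d e B a f (m + 1)) x = step d e B a f (approx d e B a f m) x
    simp only [step, LinearMap.add_apply, comp_apply]
    rw [e2, e3, e3, e1]

theorem exists_fixed (h1 : a.IsCoaugmented) (h2 : ∀ x, ∃ n, x ∈ a.corad n) (ha : a.IsDCoalgebra d)
    {X' : DiffMod k X} (hB : ∀ i, B i ∈ X'.gr (e i))
    (hf : f ∈ homDeg a.toDiffMod X' 0) (hf1 : f a.one = 0) :
    ∃ g ∈ homDeg a.toDiffMod (coalg k d e).toDiffMod 0, ∀ x, g x = step d e B a f g x := by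
  obtain ⟨g, hg⟩ := exists_limit h1.corad_mono h2 (approx d e B a f) fun n m x hx hnm =>
    approx_succ e B h1 hf1 n m x hx hnm
  refine ⟨g, fun i x hx => ?_, fun x => ?_⟩
  · obtain ⟨n, hn⟩ := h2 x
    rw [hg n n x hn le_rfl]
    exact approx_homDeg e B ha hB hf n i x hx
  · obtain ⟨n, hn⟩ := h2 x
    have h := fun x hx => hg n n x hx le_rfl
    have e1 := map_congr_tensorSub h h (h1.comul_mem_corad hn)
    have e2 := map_congr_tensorSub h h ((h1.isSubcoalgebra_corad ha n).cobr_mem x hn)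
    rw [hg n (n + 1) x hn (Nat.le_succ n)]
    change step d e B a f (approx d e B a f n) x = _
    simp only [step, LinearMap.add_apply, comp_apply]
    rw [e1, e2]

theorem isGradedHom_of_fixed (ha : a.IsDCoalgebra d) {g : A →ₗ[k] Span k I}
    (hg : g ∈ homDeg a.toDiffMod (coalg k d e).toDiffMod 0)
    (hfix : ∀ x, g x = step d e B a f g x) :
    IsGradedHom a (coalg k d e) g ∧ leaves B ∘ₗ g = f := by
  have hε : (coalg k d e).counit ∘ₗ g = a.counit := by
    ext x
    rw [comp_apply, hfix]
    simp [step, counit_incl, counit_join, (isCoaugmented_coalg d e).counit_one]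
  have haug : aug k ∘ₗ g =
      g - toSpanSingleton k _ (coalg k d e).one ∘ₗ a.counit := by
    ext1 x
    rw [comp_apply, aug_eq d e, ← comp_apply (coalg k d e).counit, hε]
    simp
  have hmap : ∀ z : A ⊗[k] A, TensorProduct.map (aug k) (aug k) (TensorProduct.map g g z) =
      TensorProduct.map g g z -
      TensorProduct.map g (toSpanSingleton k _ (coalg k d e).one ∘ₗ a.counit) z -
      (TensorProduct.map (toSpanSingleton k _ (coalg k d e).one ∘ₗ a.counit) g z -
        TensorProduct.map (toSpanSingleton k _ (coalg k d e).one ∘ₗ a.counit)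
          (toSpanSingleton k _ (coalg k d e).one ∘ₗ a.counit) z) := fun z => by
    rw [← comp_apply, ← map_comp, haug]
    induction z using induction_on with
    | zero => simp
    | tmul x y =>
      simp only [map_tmul, LinearMap.sub_apply, TensorProduct.sub_tmul,
        TensorProduct.tmul_sub]
      abel
    | add x y h1 h2 =>
      simp only [map_add, h1, h2]
      abel
  refine ⟨⟨hg, ?_, ?_, hε⟩, ?_⟩
  · refine LinearMap.ext fun x => ?_
    have h1 := hfix x
    simp only [step, LinearMap.add_apply, comp_apply,
      LinearMap.toSpanSingleton_apply] at h1
    have h2 := congrArg (coalg k d e).comul h1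
    simp only [map_add, map_smul, comul_incl, comul_join, (isCoaugmented_coalg d e).comul_one,
      cond_true, cond_false, add_zero] at h2
    rw [hmap, ha.map_counit_right, ha.map_counit_left, ha.map_counit_left] at h2
    rw [comp_apply, comp_apply, h2]
    have h3 := congrArg (fun y => (coalg k d e).one ⊗ₜ[k] y) h1
    have h4 := congrArg (fun y => y ⊗ₜ[k] (coalg k d e).one) h1
    simp only [add_tmul, tmul_add, tmul_smul,
      ← smul_tmul'] at h3 h4
    rw [h3, h4]
    simp only [comp_apply, LinearMap.toSpanSingleton_apply, tmul_smul]
    abel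
  · refine LinearMap.ext fun x => ?_
    have h1 := hfix x
    simp only [step, LinearMap.add_apply, comp_apply,
      LinearMap.toSpanSingleton_apply] at h1
    have h2 := congrArg (coalg k d e).cobr h1
    simp only [map_add, map_smul, cobr_incl, cobr_join, (isCoaugmented_coalg d e).cobr_one,
      cond_true, cond_false, add_zero, smul_zero, zero_add] at h2
    rw [hmap, ha.map_counit_right_cobr, ha.map_counit_left_cobr, ha.map_counit_left_cobr] at h2
    rw [comp_apply, comp_apply, h2]
    abel
  · ext x
    rw [comp_apply, hfix]
    simp [step, leaves_incl, leaves_join, leaves_one]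

/-- Morphisms to the cofree coalgebra are determined by their corestrictions. -/
theorem hom_unique (h1 : a.IsCoaugmented) (h2 : ∀ x, ∃ n, x ∈ a.corad n) {g g' : A →ₗ[k] Span k I}
    (hg : IsGradedHom a (coalg k d e) g) (hg' : IsGradedHom a (coalg k d e) g')
    (h : leaves B ∘ₗ g = leaves B ∘ₗ g') : g = g' := by
  have hc := isCoaugmented_coalg (k := k) d e
  have hone : ∀ {g : A →ₗ[k] Span k I}, IsGradedHom a (coalg k d e) g →
      g a.one = (coalg k d e).one := by
    intro g hg
    have hy : g a.one ∈ ⨆ n, (coalg k d e).corad n := by rw [iSup_corad_coalg]; trivial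
    obtain ⟨n, hn⟩ := (Submodule.mem_iSup_of_directed _ hc.corad_mono.directed_le).1 hy
    refine hc.grouplike_eq_one hn ?_ ?_
    · rw [← comp_apply, hg.counit, h1.counit_one]
    · rw [← comp_apply, hg.comul, comp_apply, h1.comul_one,
        map_tmul]
  have key : ∀ n, ∀ x ∈ a.corad n, g x = g' x := by
    intro n
    induction n with
    | zero =>
      intro x hx
      obtain ⟨r, rfl⟩ := Submodule.mem_span_singleton.1 hx
      rw [map_smul, map_smul, hone hg, hone hg']
    | succ n ih =>
      intro x hx
      obtain ⟨hr, hb⟩ := mem_corad_succ.1 hx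
      have e1 := map_congr_tensorSub ih ih hr
      have e2 := map_congr_tensorSub ih ih hb
      have e3 : ∀ {g : A →ₗ[k] Span k I}, IsGradedHom a (coalg k d e) g →
          join k false ((coalg k d e).comul (g x)) =
            join k false (TensorProduct.map g g (a.red x)) := fun {g} hg => by
        rw [← comp_apply (coalg k d e).comul, hg.comul, comp_apply,
          a.comul_eq x]
        simp [hone hg, join_one_left, join_one_right]
      rw [eq_joins d e B (g x), eq_joins d e B (g' x), e3 hg, e3 hg', e1,
        ← comp_apply, hg.counit, ← comp_apply (coalg k d e).counit g',
        hg'.counit, ← comp_apply (leaves B), h, comp_apply,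
        ← comp_apply (coalg k d e).cobr g, hg.cobr,
        ← comp_apply (coalg k d e).cobr g', hg'.cobr, comp_apply,
        comp_apply (TensorProduct.map g' g'), e2]
  ext1 x
  obtain ⟨n, hn⟩ := h2 x
  exact key n x hn

theorem range_isSubcoalgebra {g : A →ₗ[k] Span k I} (hg : IsGradedHom a (coalg k d e) g) :
    IsSubcoalgebra (coalg k d e) (LinearMap.range g) := by
  refine ⟨?_, ?_, ?_, ?_⟩
  · refine DiffMod.IsHomog.le ?_
    rintro i _ ⟨x, rfl⟩
    have := proj_comp hg.deg i x
    rw [add_zero] at this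
    exact ⟨_, this.symm⟩
  · rintro x -
    exact Submodule.zero_mem _
  · rintro _ ⟨x, rfl⟩
    rw [← comp_apply, hg.comul, comp_apply]
    exact map_mem_tensorSub (S := ⊤) (T := ⊤) (fun x _ => LinearMap.mem_range_self g x)
      (fun x _ => LinearMap.mem_range_self g x)
      (mem_tensorSub_iff.2 ⟨fun _ => trivial, fun _ => trivial⟩)
  · rintro _ ⟨x, rfl⟩
    rw [← comp_apply, hg.cobr, comp_apply]
    exact map_mem_tensorSub (S := ⊤) (T := ⊤) (fun x _ => LinearMap.mem_range_self g x)
      (fun x _ => LinearMap.mem_range_self g x)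
      (mem_tensorSub_iff.2 ⟨fun _ => trivial, fun _ => trivial⟩)

end universal
end CoTree

namespace DCoalgData
open CoTree

/-- Cofree coproartinian `d`-coalgebras exist. -/
theorem exists_isCofree {k : Type u} [Field k] (d : ℤ) {X : Type u} [AddCommGroup X] [Module k X]
    (X' : DiffMod k X) : ∃ (W : Type u) (_ : AddCommGroup W) (_ : Module k W) (c : DCoalgData k W)
      (p : W →ₗ[k] X), c.IsDCoalgebra d ∧ c.IsCoproartinian ∧ IsCofree d X' c p := by
  obtain ⟨I, B, e, hB⟩ := X'.exists_homogeneous_basis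
  let t := coalg k d e
  have ht : t.IsCoaugmented := isCoaugmented_coalg d e
  have htd : t.IsGradedData d := isGradedData_coalg d e
  let S := t.largestSub (t.axiomKer d)
  have hS : IsSubcoalgebra t S := isSubcoalgebra_largestSub
  have hSone : t.one ∈ S := by
    refine ht.one_mem_largestSub ?_
    have h := dualNumbers_isDCoalgebra k 0 d
    have hm := ht.isGradedHom_trivial h
    have := hm.map_mem_axiomKer (h.mem_axiomKer (1, 0))
    simpa [dualNumbers] using this
  let c := t.restrict hS hSone
  have hsub : IsHom c t S.subtype := t.isHom_subtype hS hSone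
  have hc : c.IsDCoalgebra d :=
    hsub.isDCoalgebra S.subtype_injective htd fun x => largestSub_le x.2
  refine ⟨S, inferInstance, inferInstance, c, leaves B ∘ₗ S.subtype, hc,
    ht.isCoproartinian_of_injective (iSup_corad_coalg d e) hsub rfl S.subtype_injective hc,
    homDeg_comp_zero (leaves_homDeg d e B hB) hsub.deg, leaves_one d e B, ?_⟩
  intro A _ _ a ha ha' f hf hf1
  have h1 := ha'.isCoaugmented ha
  have h2 := ha'.exists_mem_corad ha
  obtain ⟨g, hg, hfix⟩ := exists_fixed e B h1 h2 ha hB hf hf1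
  obtain ⟨hg2, hgf⟩ := isGradedHom_of_fixed e B ha hg hfix
  have hle : LinearMap.range g ≤ S := le_sSup ⟨range_isSubcoalgebra e hg2, by
    rintro _ ⟨x, rfl⟩
    exact hg2.map_mem_axiomKer (ha.mem_axiomKer x)⟩
  let g' : A →ₗ[k] S := g.codRestrict S fun x => hle ⟨x, rfl⟩
  have hg' : S.subtype ∘ₗ g' = g := rfl
  refine ⟨g', ⟨hg2.codRestrict hS hSone _, hgf⟩, ?_⟩
  · rintro g'' ⟨h3, h4⟩
    have h5 := hom_unique e B h1 h2 (hsub.toIsGradedHom.comp h3) hg2 (by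
      rw [← comp_assoc, h4, hgf])
    exact LinearMap.ext fun x => S.subtype_injective (LinearMap.congr_fun h5 x)

end DCoalgData

namespace DAlgebra
variable {k : Type u} [Field k] {d : ℤ} {V : Type v} [AddCommGroup V] [Module k V]
  (A : DAlgebra k d V)

theorem shBrk_tmul {i : ℤ} {x : V} (hx : x ∈ (A.shift d).gr i) (y : V) :
    A.shBrk (x ⊗ₜ y) = ksign k i • A.brk x y := by
  simp [shBrk, DiffMod.sgn_apply _ _ hx]

theorem shMul_tmul {i : ℤ} {x : V} (hx : x ∈ (A.shift d).gr i) (y : V) :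
    A.shMul (x ⊗ₜ y) = ksign k (d * i) • A.mul x y := by
  simp [shMul, DiffMod.sgn_apply _ _ hx]

theorem brk_mem_shift {i j : ℤ} {x y : V} (hx : x ∈ (A.shift d).gr i)
    (hy : y ∈ (A.shift d).gr j) : A.brk x y ∈ (A.shift d).gr (i + j + 1) := by
  have := A.brk_mem hx hy
  rwa [show i + d + (j + d) + 1 - d = i + j + 1 + d by ring] at this

theorem mul_mem_shift {i j : ℤ} {x y : V} (hx : x ∈ (A.shift d).gr i)
    (hy : y ∈ (A.shift d).gr j) : A.mul x y ∈ (A.shift d).gr (i + j + d) := by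
  have := A.mul_mem hx hy
  rwa [show i + d + (j + d) = i + j + d + d by ring] at this

theorem shBrk_twist : A.shBrk ∘ₗ (A.shift d).twist (A.shift d) = A.shBrk := by
  refine tensor_hom_ext (A.shift d) (A.shift d) fun i j x y hx hy => ?_
  rw [comp_apply, twist_apply _ _ hx hy, map_smul, A.shBrk_tmul hx, A.shBrk_tmul hy,
    A.brk_antisymm hx hy, smul_neg, smul_smul, smul_smul, ← ksign_add, ← ksign_add, ← neg_smul,
    ksign_neg]
  congr 1
  exact ksign_congr (by push_cast; grind)

theorem shMul_twist :
    A.shMul ∘ₗ (A.shift d).twist (A.shift d) = ksign k d • A.shMul := by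
  have hd := zmod_two_mul_self (d : ZMod 2)
  refine tensor_hom_ext (A.shift d) (A.shift d) fun i j x y hx hy => ?_
  rw [comp_apply, LinearMap.smul_apply, twist_apply _ _ hx hy, map_smul,
    A.shMul_tmul hx, A.shMul_tmul hy,
    A.mul_comm hx hy, smul_smul, smul_smul, smul_smul, ← ksign_add, ← ksign_add, ← ksign_add]
  congr 1
  exact ksign_congr (by push_cast; grind)

theorem diff_shBrk : (A.shift d).diff ∘ₗ A.shBrk =
    -(A.shBrk ∘ₗ (A.shift d).leib 1 (A.shift d).diff (A.shift d).diff) := by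
  have hd := zmod_two_mul_self (d : ZMod 2)
  refine tensor_hom_ext (A.shift d) (A.shift d) fun i j x y hx hy => ?_
  have hx' := (A.shift d).diff_mem hx
  simp only [comp_apply, LinearMap.neg_apply, leib, LinearMap.add_apply,
    map_tmul, id_apply, map_add, DiffMod.sgn_apply _ _ hx, map_smul,
    A.shBrk_tmul hx, A.shBrk_tmul hx', ← smul_tmul']
  simp only [DiffMod.shift, LinearMap.smul_apply, A.diff_brk hx, map_smul, smul_add, neg_add,
    smul_smul, ← ksign_add]
  match_scalars <;> simp only [mul_one, ksign_neg] <;> apply ksign_congr <;> push_cast <;>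
    grind

theorem diff_shMul : (A.shift d).diff ∘ₗ A.shMul =
    ksign k d • (A.shMul ∘ₗ (A.shift d).leib 1 (A.shift d).diff (A.shift d).diff) := by
  have hd := zmod_two_mul_self (d : ZMod 2)
  refine tensor_hom_ext (A.shift d) (A.shift d) fun i j x y hx hy => ?_
  have hx' := (A.shift d).diff_mem hx
  simp only [comp_apply, LinearMap.smul_apply, leib, LinearMap.add_apply,
    map_tmul, id_apply, map_add, DiffMod.sgn_apply _ _ hx, map_smul,
    A.shMul_tmul hx, A.shMul_tmul hx', ← smul_tmul']
  simp only [DiffMod.shift, LinearMap.smul_apply, A.diff_mul hx, map_smul, smul_add,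
    smul_smul, ← ksign_add]
  match_scalars <;> simp only [mul_one] <;> apply ksign_congr <;> push_cast <;> grind

theorem tensor3_ext {M : Type*} [AddCommGroup M] [Module k M] (c : DiffMod k V)
    {f g : (V ⊗[k] V) ⊗[k] V →ₗ[k] M}
    (h : ∀ i j l x y z, x ∈ c.gr i → y ∈ c.gr j → z ∈ c.gr l →
      f ((x ⊗ₜ y) ⊗ₜ z) = g ((x ⊗ₜ y) ⊗ₜ z)) : f = g := by
  apply TensorProduct.ext
  refine tensor_hom_ext c c fun i j x y hx hy => c.hom_ext fun l z hz => ?_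
  exact h i j l x y z hx hy hz

theorem swap23_tmul (c : DiffMod k V) {j l : ℤ} (x : V) {y z : V} (hy : y ∈ c.gr j)
    (hz : z ∈ c.gr l) : swap23 c ((x ⊗ₜ y) ⊗ₜ z) = ksign k (j * l) • ((x ⊗ₜ z) ⊗ₜ y) := by
  simp [swap23, twist_apply _ _ hy hz]

theorem cyc_tmul (c : DiffMod k V) {i j l : ℤ} {x y z : V} (hx : x ∈ c.gr i) (hy : y ∈ c.gr j)
    (hz : z ∈ c.gr l) :
    cyc c ((x ⊗ₜ y) ⊗ₜ z) = ksign k (l * (i + j)) • ((z ⊗ₜ x) ⊗ₜ y) := by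
  rw [cyc, comp_apply, swap23_tmul c x hy hz, map_smul, map_tmul,
    twist_apply _ _ hx hz, ← smul_tmul', smul_smul, ← ksign_add]
  congr 1
  exact ksign_congr (by push_cast; grind)

theorem shBrk_jacobi : A.shBrk ∘ₗ TensorProduct.map A.shBrk LinearMap.id ∘ₗ
    (LinearMap.id + cyc (A.shift d) + cyc (A.shift d) ∘ₗ cyc (A.shift d)) = 0 := by
  refine tensor3_ext (A.shift d) fun i j l x y z hx hy hz => ?_
  have e1 := A.brk_jacobi hx hy z
  have e2 := A.brk_antisymm (A.brk_mem hy hz) hx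
  have e3 := A.brk_antisymm (A.brk_mem hz hx) hy
  have e4 := congrArg (A.brk y) (A.brk_antisymm hz hx)
  rw [map_neg, map_smul] at e4
  rw [e4] at e3
  rw [e1] at e2
  simp only [comp_apply, LinearMap.add_apply, id_apply, cyc_tmul _ hx hy hz,
    map_smul, cyc_tmul _ hz hx hy, map_add, map_tmul, A.shBrk_tmul hx,
    A.shBrk_tmul hy, A.shBrk_tmul hz, ← smul_tmul',
    A.shBrk_tmul (A.brk_mem_shift hx hy), A.shBrk_tmul (A.brk_mem_shift hy hz),
    A.shBrk_tmul (A.brk_mem_shift hz hx), LinearMap.zero_apply]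
  rw [e2, e3]
  simp only [smul_add, smul_neg, neg_neg, smul_smul, ← ksign_add, neg_add]
  match_scalars <;> simp only [mul_one, ksign_neg] <;> apply ksign_add_eq_zero <;>
    push_cast <;> grind

theorem shMul_cyc : A.shMul ∘ₗ TensorProduct.map A.shMul LinearMap.id ∘ₗ cyc (A.shift d) =
    A.shMul ∘ₗ TensorProduct.map A.shMul LinearMap.id := by
  have hd := zmod_two_mul_self (d : ZMod 2)
  refine tensor3_ext (A.shift d) fun i j l x y z hx hy hz => ?_
  have e1 := A.mul_comm hz (A.mul_mem hx hy)
  rw [← A.mul_assoc] at e1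
  simp only [comp_apply, id_apply, cyc_tmul _ hx hy hz,
    map_smul, map_tmul, A.shMul_tmul hx,
    A.shMul_tmul hz, ← smul_tmul',
    A.shMul_tmul (A.mul_mem_shift hx hy), A.shMul_tmul (A.mul_mem_shift hz hx), e1]
  simp only [smul_smul, ← ksign_add]
  congr 1
  exact ksign_congr (by push_cast; grind)

theorem shBrk_leibniz : A.shBrk ∘ₗ TensorProduct.map A.shMul LinearMap.id +
    ksign k (1 - d) • (A.shMul ∘ₗ TensorProduct.map A.shBrk LinearMap.id ∘ₗ
      (ksign k d • (cyc (A.shift d) ∘ₗ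
        TensorProduct.map ((A.shift d).twist (A.shift d)) LinearMap.id) +
        swap23 (A.shift d))) = 0 := by
  have hd := zmod_two_mul_self (d : ZMod 2)
  refine tensor3_ext (A.shift d) fun i j l x y z hx hy hz => ?_
  have e1 := A.leibniz hy hz x
  have e2 := A.mul_comm (A.brk_mem hz hy) hx
  have e3 := A.brk_antisymm hz hy
  rw [e3, map_neg, map_smul, map_neg, map_smul] at e2
  simp only [comp_apply, LinearMap.add_apply, LinearMap.smul_apply, id_apply,
    map_tmul, twist_apply _ _ hx hy, ← smul_tmul', map_smul, map_add,
    cyc_tmul _ hy hx hz, swap23_tmul _ x hy hz, A.shMul_tmul hx, A.shBrk_tmul hz,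
    A.shBrk_tmul hx, A.shBrk_tmul (A.mul_mem_shift hx hy), LinearMap.zero_apply,
    A.shMul_tmul (A.brk_mem_shift hz hy), A.shMul_tmul (A.brk_mem_shift hx hz)]
  rw [e1, e3]
  rw [map_neg, map_smul, LinearMap.neg_apply, LinearMap.smul_apply] at *
  rw [e2]
  simp only [smul_add, smul_neg, smul_smul, ← ksign_add]
  match_scalars <;> simp only [mul_one, ksign_neg] <;> apply ksign_add_eq_zero <;> push_cast <;>
    grind

end DAlgebra

namespace DCoalgData.IsDCoalgebra
variable {k : Type u} [Field k] {d : ℤ} {W : Type w} [AddCommGroup W] [Module k W]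
  {c : DCoalgData k W} (hc : c.IsDCoalgebra d)
include hc

theorem swap23_comul_comul (x : W) :
    swap23 c.toDiffMod (TensorProduct.map c.comul LinearMap.id (c.comul x)) =
      TensorProduct.map c.comul LinearMap.id (c.comul x) := by
  have h1 : assoc k W W W (TensorProduct.map c.comul LinearMap.id (c.comul x)) =
      TensorProduct.map LinearMap.id c.comul (c.comul x) := LinearMap.congr_fun hc.coassoc x
  simp only [swap23, comp_apply, LinearEquiv.coe_coe]
  rw [h1, ← comp_apply (TensorProduct.map _ _), ← map_comp, hc.cocomm,
    comp_id, ← h1, LinearEquiv.symm_apply_apply]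

theorem cyc_comul_comul (x : W) :
    cyc c.toDiffMod (TensorProduct.map c.comul LinearMap.id (c.comul x)) =
      TensorProduct.map c.comul LinearMap.id (c.comul x) := by
  rw [cyc, comp_apply, hc.swap23_comul_comul, ← comp_apply,
    ← map_comp, hc.cocomm, comp_id]

theorem twist_cobr_comul (x : W) :
    TensorProduct.map (c.twist c.toDiffMod) LinearMap.id
      (TensorProduct.map c.cobr LinearMap.id (c.comul x)) =
      ksign k d • TensorProduct.map c.cobr LinearMap.id (c.comul x) := by
  rw [← comp_apply, ← map_comp, hc.cobr_symm,
    TensorProduct.map_smul_left, comp_id, LinearMap.smul_apply]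

theorem comul_cobr (x : W) :
    TensorProduct.map c.comul LinearMap.id (c.cobr x) =
      cyc c.toDiffMod (TensorProduct.map c.cobr LinearMap.id (c.comul x)) +
        swap23 c.toDiffMod (TensorProduct.map c.cobr LinearMap.id (c.comul x)) := by
  have h1 := LinearMap.congr_fun hc.coleibniz x
  simp only [comp_apply, LinearMap.add_apply, LinearEquiv.coe_coe] at h1
  rw [h1]
  congr 1
  have h2 : (assoc k W W W).symm.toLinearMap ∘ₗ
      TensorProduct.map (c.sgn (1 - d)) c.cobr ∘ₗ c.twist c.toDiffMod =
        cyc c.toDiffMod ∘ₗ TensorProduct.map c.cobr LinearMap.id := by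
    refine tensor_hom_ext c.toDiffMod c.toDiffMod fun i j x y hx hy => ?_
    simp only [comp_apply, twist_apply _ _ hx hy, map_smul, map_tmul,
      DiffMod.sgn_apply _ _ hy, id_apply, LinearEquiv.coe_coe]
    refine tensorGr_induction (P := fun z => ksign k (i * j) •
      (assoc k W W W).symm ((ksign k ((1 - d) * j) • y) ⊗ₜ z) =
        cyc c.toDiffMod (z ⊗ₜ y)) _ _ (c.cobr x) (hc.cobr_mem hx) ?_ ?_ ?_
    · intro a b x x' hx hx' h
      rw [DAlgebra.cyc_tmul _ hx hx' hy, ← smul_tmul', map_smul,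
        TensorProduct.assoc_symm_tmul, smul_smul, ← ksign_add, h]
      congr 1
      exact ksign_congr (by push_cast; grind)
    · simp
    · intro x y h1 h2
      rw [tmul_add, map_add, smul_add, h1, h2, add_tmul, map_add]
  have h3 := LinearMap.congr_fun h2 (c.comul x)
  simp only [comp_apply, LinearEquiv.coe_coe] at h3
  rw [← h3]
  congr 2
  exact (LinearMap.congr_fun hc.cocomm x).symm

end DCoalgData.IsDCoalgebra

namespace DCoalgData
section along
variable {k : Type u} [Field k] {d : ℤ} {A : Type v} [AddCommGroup A] [Module k A]
  {W : Type w} [AddCommGroup W] [Module k W] {a : DCoalgData k A} {c : DCoalgData k W} {n : ℤ}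
  {g : A →ₗ[k] W}

theorem IsCoder.comp_hom {D : W →ₗ[k] W} (hD : IsCoder d c n D) (hg : IsGradedHom a c g) :
    IsCoderAlong d a c n g (D ∘ₗ g) := by
  have e : c.leib n D D ∘ₗ TensorProduct.map g g =
      TensorProduct.map (D ∘ₗ g) g + TensorProduct.map (g ∘ₗ a.sgn n) (D ∘ₗ g) := by
    rw [leib, add_comp, ← map_comp, ← map_comp,
      id_comp, sgn_comp hg.deg]
  refine ⟨homDeg_comp_zero hD.deg hg.deg, ?_, ?_⟩
  · rw [← comp_assoc, hD.comul, comp_assoc, hg.comul, ← comp_assoc, e]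
  · rw [← comp_assoc, hD.cobr, smul_comp, comp_assoc, hg.cobr,
      ← comp_assoc, e]

theorem IsGradedHom.comp_coder {D : A →ₗ[k] A} (hg : IsGradedHom a c g) (hD : IsCoder d a n D) :
    IsCoderAlong d a c n g (g ∘ₗ D) := by
  have e : TensorProduct.map g g ∘ₗ a.leib n D D =
      TensorProduct.map (g ∘ₗ D) g + TensorProduct.map (g ∘ₗ a.sgn n) (g ∘ₗ D) := by
    rw [leib, comp_add, ← map_comp, ← map_comp,
      comp_id]
  refine ⟨zero_homDeg_comp hg.deg hD.deg, ?_, ?_⟩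
  · rw [← comp_assoc, hg.comul, comp_assoc, hD.comul, ← comp_assoc, e]
  · rw [← comp_assoc, hg.cobr, comp_assoc, hD.cobr, comp_smul,
      ← comp_assoc, e]

theorem IsCoderAlong.zero (g : A →ₗ[k] W) : IsCoderAlong d a c n g 0 :=
  ⟨Submodule.zero_mem _, by simp, by simp⟩

end along
end DCoalgData

section bar
variable {k : Type u} [Field k] {d : ℤ} {V : Type v} [AddCommGroup V] [Module k V]
  (A : DAlgebra k d V) {W : Type w} [AddCommGroup W] [Module k W] (c : DCoalgData k W)
  (p : W →ₗ[k] V)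

/-- The corestriction of the quadratic differential. -/
def barDiff : W →ₗ[k] V := (A.shift d).diff ∘ₗ p +
    (2⁻¹ : k) • (A.shBrk ∘ₗ TensorProduct.map p p ∘ₗ c.comul) +
    (2⁻¹ : k) • (A.shMul ∘ₗ TensorProduct.map p p ∘ₗ c.cobr)

variable {c p} (hc : c.IsDCoalgebra d) (hp : p ∈ homDeg c.toDiffMod (A.shift d) 0)
include hc hp

theorem barDiff_mem : barDiff A c p ∈ homDeg c.toDiffMod (A.shift d) 1 := by
  intro i x hx
  refine Submodule.add_mem _ (Submodule.add_mem _ ?_ (Submodule.smul_mem _ _ ?_))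
    (Submodule.smul_mem _ _ ?_)
  · have := (A.shift d).diff_mem (hp i x hx)
    rwa [add_zero] at this
  · have := shBrk_mem A (map_mem_tensorGr hp hp (hc.comul_mem hx))
    rwa [show i + (0 + 0) + 1 = i + 1 by ring] at this
  · have := shMul_mem A (map_mem_tensorGr hp hp (hc.cobr_mem hx))
    rwa [show i + 1 - d + (0 + 0) + d = i + 1 by ring] at this

omit hc in
theorem twist_map_sgn {n : ℤ} {g : W →ₗ[k] V} (hg : g ∈ homDeg c.toDiffMod (A.shift d) n)
    (z : W ⊗[k] W) : (A.shift d).twist (A.shift d)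
      (TensorProduct.map (p ∘ₗ c.sgn n) g z) =
        TensorProduct.map g p (c.twist c.toDiffMod z) := by
  refine LinearMap.congr_fun (f := (A.shift d).twist (A.shift d) ∘ₗ
    TensorProduct.map (p ∘ₗ c.sgn n) g) (g := TensorProduct.map g p ∘ₗ c.twist c.toDiffMod) ?_ z
  refine tensor_hom_ext c.toDiffMod c.toDiffMod fun i j x y hx hy => ?_
  have h1 := hp i x hx
  rw [add_zero] at h1
  simp only [comp_apply, map_tmul, DiffMod.sgn_apply _ _ hx, map_smul,
    twist_apply _ _ hx hy, ← smul_tmul', twist_apply _ _ h1 (hg j y hy), smul_smul,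
    ← ksign_add]
  congr 1
  exact ksign_congr (by push_cast; grind)

theorem shBrk_map_sgn {n : ℤ} {g : W →ₗ[k] V} (hg : g ∈ homDeg c.toDiffMod (A.shift d) n)
    (x : W) : A.shBrk (TensorProduct.map (p ∘ₗ c.sgn n) g (c.comul x)) =
      A.shBrk (TensorProduct.map g p (c.comul x)) := by
  have h1 : c.twist c.toDiffMod (c.comul x) = c.comul x := LinearMap.congr_fun hc.cocomm x
  have h2 := twist_map_sgn A hp hg (c.comul x)
  rw [h1] at h2
  rw [← h2]
  exact (LinearMap.congr_fun A.shBrk_twist _).symm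

theorem shMul_map_sgn {n : ℤ} {g : W →ₗ[k] V} (hg : g ∈ homDeg c.toDiffMod (A.shift d) n)
    (x : W) : A.shMul (TensorProduct.map (p ∘ₗ c.sgn n) g (c.cobr x)) =
      A.shMul (TensorProduct.map g p (c.cobr x)) := by
  have h1 : c.twist c.toDiffMod (c.cobr x) = ksign k d • c.cobr x :=
    LinearMap.congr_fun hc.cobr_symm x
  have h2 := congrArg A.shMul (twist_map_sgn A hp hg (c.cobr x))
  rw [h1, map_smul, map_smul, ← comp_apply, A.shMul_twist, LinearMap.smul_apply] at h2
  have h3 := congrArg (fun y => ksign k d • y) h2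
  simpa only [ksign_smul_smul] using h3

variable [CharZero k]

theorem barDiff_comp_coder {n : ℤ} {D : W →ₗ[k] W} (hD : IsCoder d c n D) :
    barDiff A c p ∘ₗ D = (A.shift d).diff ∘ₗ (p ∘ₗ D) +
      A.shBrk ∘ₗ TensorProduct.map (p ∘ₗ D) p ∘ₗ c.comul +
      ksign k (n * (1 - d)) • (A.shMul ∘ₗ TensorProduct.map (p ∘ₗ D) p ∘ₗ c.cobr) := by
  have hpD : p ∘ₗ D ∈ homDeg c.toDiffMod (A.shift d) n := zero_homDeg_comp hp hD.deg
  have e : ∀ z, TensorProduct.map p p (c.leib n D D z) = TensorProduct.map (p ∘ₗ D) p z +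
      TensorProduct.map (p ∘ₗ c.sgn n) (p ∘ₗ D) z := fun z => by
    rw [leib, LinearMap.add_apply, map_add, ← comp_apply, ← comp_apply,
      ← map_comp, ← map_comp, comp_id]
  refine LinearMap.ext fun x => ?_
  have e1 : c.comul (D x) = c.leib n D D (c.comul x) := LinearMap.congr_fun hD.comul x
  have e2 : c.cobr (D x) = ksign k (n * (1 - d)) • c.leib n D D (c.cobr x) :=
    LinearMap.congr_fun hD.cobr x
  simp only [barDiff, comp_apply, LinearMap.add_apply, LinearMap.smul_apply, e1, e2,
    map_smul, e, map_add, shBrk_map_sgn A hc hp hpD, shMul_map_sgn A hc hp hpD]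
  module

/-- The quadratic differential squares to zero. -/
theorem barDiff_comp_self {Q : W →ₗ[k] W} (hQ : IsCoder d c 1 Q) (hpQ : p ∘ₗ Q = barDiff A c p) :
    barDiff A c p ∘ₗ Q = 0 := by
  have hp3 : ∀ (T S : W →ₗ[k] W ⊗[k] W) (B : V ⊗[k] V →ₗ[k] V) (x : W),
      TensorProduct.map (B ∘ₗ TensorProduct.map p p ∘ₗ T) p (S x) =
        TensorProduct.map B LinearMap.id (TensorProduct.map (TensorProduct.map p p) p
          (TensorProduct.map T LinearMap.id (S x))) := fun T S B x => by
    change _ = (TensorProduct.map B LinearMap.id ∘ₗ TensorProduct.map (TensorProduct.map p p) p ∘ₗ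
      TensorProduct.map T LinearMap.id) (S x)
    rw [← map_comp, ← map_comp, comp_id, id_comp]
  have hcyc := fun z => LinearMap.congr_fun (cyc_comp_map hp) z
  have hswap := fun z => LinearMap.congr_fun (swap23_comp_map hp) z
  simp only [comp_apply] at hcyc hswap
  have hDp : (A.shift d).diff ∘ₗ p ∈ homDeg c.toDiffMod (A.shift d) 1 := by
    refine homDeg_comp_zero ?_ hp
    intro i x hx; exact (A.shift d).diff_mem hx
  have hleib : ∀ z : W ⊗[k] W, (A.shift d).leib 1 (A.shift d).diff (A.shift d).diff
      (TensorProduct.map p p z) = TensorProduct.map ((A.shift d).diff ∘ₗ p) p z +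
        TensorProduct.map (p ∘ₗ c.sgn 1) ((A.shift d).diff ∘ₗ p) z := fun z => by
    rw [leib, LinearMap.add_apply, ← comp_apply, ← comp_apply,
      ← map_comp, ← map_comp, id_comp, sgn_comp hp]
  rw [barDiff_comp_coder A hc hp hQ, hpQ]
  refine LinearMap.ext fun x => ?_
  -- the linear and the bilinear terms
  have a0 : (A.shift d).diff ((A.shift d).diff (p x)) = 0 := by
    simp [DiffMod.shift, A.isComplex (p x)]
  have a1 : (A.shift d).diff (A.shBrk (TensorProduct.map p p (c.comul x))) =
      -((2 : k) • A.shBrk (TensorProduct.map ((A.shift d).diff ∘ₗ p) p (c.comul x))) := by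
    rw [← comp_apply, A.diff_shBrk, LinearMap.neg_apply, comp_apply, hleib,
      map_add, shBrk_map_sgn A hc hp hDp, two_smul]
  have a2 : (A.shift d).diff (A.shMul (TensorProduct.map p p (c.cobr x))) =
      ksign k d • ((2 : k) • A.shMul (TensorProduct.map ((A.shift d).diff ∘ₗ p) p (c.cobr x))) := by
    rw [← comp_apply, A.diff_shMul, LinearMap.smul_apply, comp_apply, hleib,
      map_add, shMul_map_sgn A hc hp hDp, two_smul]
  -- the trilinear terms
  set T1 := TensorProduct.map (TensorProduct.map p p) p
    (TensorProduct.map c.comul LinearMap.id (c.comul x)) with hT1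
  set T2 := TensorProduct.map (TensorProduct.map p p) p
    (TensorProduct.map c.cobr LinearMap.id (c.cobr x)) with hT2
  set T3 := TensorProduct.map (TensorProduct.map p p) p
    (TensorProduct.map c.cobr LinearMap.id (c.comul x)) with hT3
  set T4 := TensorProduct.map (TensorProduct.map p p) p
    (TensorProduct.map c.comul LinearMap.id (c.cobr x)) with hT4
  have c1 : cyc (A.shift d) T1 = T1 := by rw [hT1, hcyc, hc.cyc_comul_comul]
  have c2 : T2 + cyc (A.shift d) T2 + cyc (A.shift d) (cyc (A.shift d) T2) = 0 := by
    rw [hT2, hcyc, hcyc, ← map_add, ← map_add]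
    have := hc.cojacobi x
    dsimp only at this
    rw [this, map_zero]
  have c3 : TensorProduct.map ((A.shift d).twist (A.shift d)) LinearMap.id T3 =
      ksign k d • T3 := by
    rw [hT3, ← map_smul, ← hc.twist_cobr_comul, ← comp_apply,
      ← comp_apply (TensorProduct.map (TensorProduct.map p p) p),
      ← map_comp, ← map_comp, twist_comp_map hp hp]
    rfl
  have c4 : T4 = cyc (A.shift d) T3 + swap23 (A.shift d) T3 := by
    rw [hT4, hc.comul_cobr, map_add, ← hcyc, ← hswap]
  have b1 : A.shBrk (TensorProduct.map A.shBrk LinearMap.id T1) = 0 := by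
    have := LinearMap.congr_fun A.shBrk_jacobi T1
    simp only [comp_apply, LinearMap.add_apply, id_apply, c1, map_add,
      LinearMap.zero_apply] at this
    have h3 : (3 : k) • A.shBrk (TensorProduct.map A.shBrk LinearMap.id T1) = 0 := by
      rw [← this]; module
    exact (smul_eq_zero.1 h3).resolve_left three_ne_zero
  have b2 : A.shMul (TensorProduct.map A.shMul LinearMap.id T2) = 0 := by
    have h := fun z => LinearMap.congr_fun A.shMul_cyc z
    simp only [comp_apply] at h
    have := congrArg (fun z => A.shMul (TensorProduct.map A.shMul LinearMap.id z)) c2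
    simp only [map_add, map_zero, h] at this
    have h3 : (3 : k) • A.shMul (TensorProduct.map A.shMul LinearMap.id T2) = 0 := by
      rw [← this]; module
    exact (smul_eq_zero.1 h3).resolve_left three_ne_zero
  have b3 : A.shBrk (TensorProduct.map A.shMul LinearMap.id T3) +
      ksign k (1 - d) • A.shMul (TensorProduct.map A.shBrk LinearMap.id T4) = 0 := by
    have := LinearMap.congr_fun A.shBrk_leibniz T3
    simp only [comp_apply, LinearMap.add_apply, LinearMap.smul_apply, c3,
      map_smul] at this
    rw [smul_smul (ksign k d), ksign_mul_self, one_smul, ← c4] at this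
    exact this
  have e1 : TensorProduct.map (barDiff A c p) p (c.comul x) =
      TensorProduct.map ((A.shift d).diff ∘ₗ p) p (c.comul x) +
        (2⁻¹ : k) • TensorProduct.map A.shBrk LinearMap.id T1 +
        (2⁻¹ : k) • TensorProduct.map A.shMul LinearMap.id T3 := by
    rw [barDiff, TensorProduct.map_add_left, TensorProduct.map_add_left,
      TensorProduct.map_smul_left, TensorProduct.map_smul_left, LinearMap.add_apply,
      LinearMap.add_apply, LinearMap.smul_apply, LinearMap.smul_apply, hp3, hp3]
  have e2 : TensorProduct.map (barDiff A c p) p (c.cobr x) =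
      TensorProduct.map ((A.shift d).diff ∘ₗ p) p (c.cobr x) +
        (2⁻¹ : k) • TensorProduct.map A.shBrk LinearMap.id T4 +
        (2⁻¹ : k) • TensorProduct.map A.shMul LinearMap.id T2 := by
    rw [barDiff, TensorProduct.map_add_left, TensorProduct.map_add_left,
      TensorProduct.map_smul_left, TensorProduct.map_smul_left, LinearMap.add_apply,
      LinearMap.add_apply, LinearMap.smul_apply, LinearMap.smul_apply, hp3, hp3]
  simp only [LinearMap.add_apply, comp_apply, LinearMap.smul_apply, e1, e2,
    LinearMap.zero_apply, map_add, map_smul, b1, b2]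
  simp only [barDiff, LinearMap.add_apply, comp_apply, LinearMap.smul_apply, map_add,
    map_smul, a0, a1, a2]
  have hs : ksign k d = -ksign k (1 - d) := by
    rw [ksign_neg]; exact ksign_congr (by push_cast; grind)
  rw [eq_neg_of_add_eq_zero_left b3, hs, one_mul]
  module

end bar

namespace DCoalgData
section withDiff
variable {k : Type u} [Field k] {d : ℤ} {W : Type v} [AddCommGroup W] [Module k W]
  {c : DCoalgData k W} {Q : W →ₗ[k] W}

/-- The same graded coalgebra with another differential. -/
def withDiff (c : DCoalgData k W) (Q : W →ₗ[k] W) (hQ : Q ∈ homDeg c.toDiffMod c.toDiffMod 1) :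
    DCoalgData k W :=
  { c with diff := Q, diff_mem := fun hx => hQ _ _ hx }

theorem IsCoder.comp_self [CharZero k] (hQ : IsCoder d c 1 Q) : IsCoder d c (1 + 1) (Q ∘ₗ Q) := by
  have h2 := Submodule.smul_mem _ (2⁻¹ : k) (gcomm_coder d c hQ hQ)
  have h3 : (2⁻¹ : k) • gcomm 1 1 Q Q = Q ∘ₗ Q := by
    ext x
    simp only [gcomm_apply, LinearMap.smul_apply, mul_one, ksign_one, comp_apply]
    module
  rwa [h3] at h2

theorem IsDCoalgebra.withDiff (hc : c.IsDCoalgebra d) (hQ : IsCoder d c 1 Q) (hQ2 : Q ∘ₗ Q = 0) :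
    (c.withDiff Q hQ.deg).IsDCoalgebra d :=
  ⟨fun x => LinearMap.congr_fun hQ2 x, hc.comul_mem, hc.coassoc, hc.cocomm, hc.counit_deg,
    hc.counit_comul, hc.cobr_mem, hc.cobr_symm, hc.cojacobi, hc.coleibniz, hc.counit_cobr,
    ⟨hQ.deg, hQ.comul, hQ.cobr⟩⟩

theorem IsCoproartinian.withDiff (hc' : c.IsCoproartinian) (hc : c.IsDCoalgebra d)
    (hQ : IsCoder d c 1 Q) (hQ2 : Q ∘ₗ Q = 0) (hQ1 : Q c.one = 0) :
    (c.withDiff Q hQ.deg).IsCoproartinian := by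
  have h1 := hc'.isCoaugmented hc
  have h2 : (c.withDiff Q hQ.deg).IsCoaugmented :=
    ⟨h1.one_mem, h1.counit_one, h1.comul_one, h1.cobr_one, hQ1⟩
  have hcor : ∀ n, (c.withDiff Q hQ.deg).corad n = c.corad n := by
    intro n
    induction n with
    | zero => rfl
    | succ n ih =>
      rw [corad, corad, ih]
      rfl
  refine h2.isCoproartinian (hc.withDiff hQ hQ2) ?_
  simp only [hcor]
  exact hc'.iSup_corad hc

end withDiff

variable {k : Type u} [Field k] {d : ℤ} {W : Type u} [AddCommGroup W] [Module k W]
  {c : DCoalgData k W} {Q : W →ₗ[k] W}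

theorem IsCofree.withDiff {X : Type u} [AddCommGroup X] [Module k X] {X' : DiffMod k X}
    {p : W →ₗ[k] X} (hp : IsCofree d X' c p) (hQ : Q ∈ homDeg c.toDiffMod c.toDiffMod 1) :
    IsCofree d X' (c.withDiff Q hQ) p := by
  refine ⟨hp.deg, hp.one, fun B _ _ b hb hb' f hf hf1 => ?_⟩
  obtain ⟨g, ⟨hg, hgf⟩, huniq⟩ := hp.universal B b hb hb' f hf hf1
  exact ⟨g, ⟨⟨hg.deg, hg.comul, hg.cobr, hg.counit⟩, hgf⟩, fun g' hg' => huniq g'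
    ⟨⟨hg'.1.deg, hg'.1.comul, hg'.1.cobr, hg'.1.counit⟩, hg'.2⟩⟩

/-- A coderivation of a cofree coalgebra kills the unit if its corestriction does. -/
theorem IsCofree.coder_one {X : Type u} [AddCommGroup X] [Module k X] {X' : DiffMod k X}
    {p : W →ₗ[k] X} (hp : IsCofree d X' c p) (hc : c.IsDCoalgebra d) (hc' : c.IsCoproartinian)
    {n : ℤ} (hQ : IsCoder d c n Q) (h : p (Q c.one) = 0) : Q c.one = 0 := by
  have h1 := hc'.isCoaugmented hc
  have hg := h1.isGradedHom_trivial hc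
  obtain ⟨_, -, huniq⟩ := hp.existsUnique_coderAlong (n := n) hc hc hc' hg (by simp [hp.one])
    (Submodule.zero_mem _)
  have h4 := (huniq _ ⟨hQ.comp_hom hg, by ext x; simp [h]⟩).trans
    (huniq 0 ⟨.zero _, by simp⟩).symm
  have := LinearMap.congr_fun h4 c.one
  simpa [h1.counit_one] using this

end DCoalgData

section exists_bar
variable {k : Type u} [Field k] [CharZero k] {d : ℤ} {V : Type u} [AddCommGroup V] [Module k V]

theorem exists_isBar (A : DAlgebra k d V) :
    ∃ (W : Type u) (_ : AddCommGroup W) (_ : Module k W) (c : DCoalgData k W) (p : W →ₗ[k] V),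
      IsBar A c p := by
  obtain ⟨W, _, _, c, p, hc, hc', hp⟩ := exists_isCofree d (A.shift d)
  have h1 := hc'.isCoaugmented hc
  have hid := IsGradedHom.id c
  obtain ⟨Q, ⟨hQ, hpQ⟩, -⟩ := hp.existsUnique_coderAlong hc hc hc' hid hp.one
    (barDiff_mem A hc hp.deg)
  rw [isCoderAlong_id] at hQ
  have hQ2 : Q ∘ₗ Q = 0 := by
    obtain ⟨_, -, huniq⟩ := hp.existsUnique_coderAlong (n := 1 + 1) hc hc hc' hid hp.one
      (Submodule.zero_mem _)
    refine (huniq _ ⟨isCoderAlong_id.2 hQ.comp_self, ?_⟩).trans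
      (huniq 0 ⟨isCoderAlong_id.2 (Submodule.zero_mem (coder d c (1 + 1))), by simp⟩).symm
    rw [← comp_assoc, hpQ, barDiff_comp_self A hc hp.deg hQ hpQ]
  have hQ1 : Q c.one = 0 := hp.coder_one hc hc' hQ (by
    rw [← comp_apply, hpQ]
    simp [barDiff, hp.one, h1.comul_one, h1.cobr_one])
  exact ⟨W, inferInstance, inferInstance, c.withDiff Q hQ.deg, p, hc.withDiff hQ hQ2,
    hc'.withDiff hc hQ hQ2 hQ1, hp.withDiff hQ.deg, hpQ⟩

end exists_bar

section theta
variable {k : Type u} [Field k] {d : ℤ} {V : Type u} [AddCommGroup V] [Module k V]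
  {A : DAlgebra k d V} {W : Type u} [AddCommGroup W] [Module k W] {c : DCoalgData k W}
  {p : W →ₗ[k] V}

theorem IsBar.existsUnique_coder (hW : IsBar A c p) {n : ℤ} {f : W →ₗ[k] V}
    (hf : f ∈ homDeg c.toDiffMod (A.shift d) n) :
    ∃! D : W →ₗ[k] W, D ∈ coder d c n ∧ p ∘ₗ D = f := by
  have := hW.isCofree.existsUnique_coderAlong hW.isDCoalgebra hW.isDCoalgebra hW.isCoproartinian
    (IsGradedHom.id c) hW.isCofree.one hf
  simp only [isCoderAlong_id] at this; exact this

/-- Coderivations of degree `n` correspond to maps to the cogenerators of degree `n`. -/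
def IsBar.coderEquiv (hW : IsBar A c p) (n : ℤ) :
    homDeg c.toDiffMod (A.shift d) n ≃ₗ[k] coder d c n :=
  (LinearEquiv.ofBijective
    ({ toFun := fun D => ⟨-(p ∘ₗ D.1), Submodule.neg_mem _
        (zero_homDeg_comp hW.isCofree.deg D.2.deg)⟩
       map_add' := fun D E => by ext x; simp [add_comm]
       map_smul' := fun r D => by ext x; simp } :
      coder d c n →ₗ[k] homDeg c.toDiffMod (A.shift d) n) (by
    constructor
    · intro D E h
      obtain ⟨_, -, huniq⟩ := hW.existsUnique_coder
        (zero_homDeg_comp hW.isCofree.deg D.2.deg)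
      have h2 : p ∘ₗ D.1 = p ∘ₗ E.1 := neg_injective (congrArg Subtype.val h)
      exact Subtype.ext ((huniq D.1 ⟨D.2, rfl⟩).trans (huniq E.1 ⟨E.2, h2.symm⟩).symm)
    · rintro ⟨f, hf⟩
      obtain ⟨D, ⟨hD, hpD⟩, -⟩ := hW.existsUnique_coder (Submodule.neg_mem _ hf)
      exact ⟨⟨D, hD⟩, Subtype.ext (by simp [hpD])⟩)).symm

theorem IsBar.comp_coderEquiv (hW : IsBar A c p) (n : ℤ)
    (f : homDeg c.toDiffMod (A.shift d) n) : p ∘ₗ (hW.coderEquiv n f : W →ₗ[k] W) = -f := by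
  have h := congrArg Subtype.val ((hW.coderEquiv n).symm_apply_apply f)
  rw [← h]
  change _ = - -(p ∘ₗ _)
  rw [neg_neg]

/-- The identification of `a'[d]` with the space of coderivations. -/
def IsBar.theta (hW : IsBar A c p) : HomSpace A c ≃ₗ[k] CoderSpace d c :=
  DFinsupp.mapRange.linearEquiv fun n => hW.coderEquiv n

theorem IsBar.theta_lof (hW : IsBar A c p) (n : ℤ) (f : homDeg c.toDiffMod (A.shift d) n) :
    hW.theta (DirectSum.lof k ℤ (fun n => homDeg c.toDiffMod (A.shift d) n) n f) =
      DirectSum.lof k ℤ (fun n => coder d c n) n (hW.coderEquiv n f) :=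
  DFinsupp.mapRange_single (hf := fun i => map_zero (hW.coderEquiv i))

theorem IsBar.theta_homEl (hW : IsBar A c p) {n : ℤ} {f : W →ₗ[k] V}
    (hf : f ∈ homDeg c.toDiffMod (A.shift d) n) :
    ∃ (D : W →ₗ[k] W) (hD : D ∈ coder d c n),
      hW.theta (homEl n hf) = coderEl n hD ∧ p ∘ₗ D = -f :=
  ⟨_, (hW.coderEquiv n ⟨f, hf⟩).2, hW.theta_lof n ⟨f, hf⟩, hW.comp_coderEquiv n ⟨f, hf⟩⟩

theorem IsBar.theta_mem (hW : IsBar A c p) :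
    hW.theta.toLinearMap ∈ homDeg hW.twisted hW.lie.toDiffMod 0 := by
  rintro n _ ⟨f, rfl⟩
  rw [add_zero]
  exact ⟨hW.coderEquiv n f, (hW.theta_lof n f).symm⟩

theorem homSpace_induction {P : HomSpace A c → Prop} (z : HomSpace A c)
    (el : ∀ n f (hf : f ∈ homDeg c.toDiffMod (A.shift d) n), P (homEl n hf))
    (add : ∀ x y, P x → P y → P (x + y)) : P z := by
  induction z using DirectSum.induction_on with
  | zero =>
    have h : homEl 0 (Submodule.zero_mem (homDeg c.toDiffMod (A.shift d) 0)) = 0 :=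
      map_zero (DirectSum.lof k ℤ (fun n => homDeg c.toDiffMod (A.shift d) n) 0)
    rw [← h]
    exact el _ _ _
  | of i x => exact el i x.1 x.2
  | add x y h1 h2 => exact add x y h1 h2

theorem IsBar.lie_isComplex (hW : IsBar A c p) : hW.lie.IsComplex := by
  intro z
  have hQ : ∀ x, c.diff (c.diff x) = 0 := hW.isDCoalgebra.isComplex
  induction z using coder_induction with
  | el n D hD =>
    have e1 : hW.lie.diff (coderEl n hD) = _ := coderDiff_el hW.isDCoalgebra hD
    rw [e1]
    refine (coderDiff_el hW.isDCoalgebra _).trans ?_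
    have h0 : coderEl (1 + (1 + n)) (Submodule.zero_mem (coder d c (1 + (1 + n)))) = 0 :=
      map_zero (DirectSum.lof k ℤ (fun n => coder d c n) (1 + (1 + n)))
    rw [← h0]
    refine coderEl_congr rfl _ _ ?_
    ext x
    simp only [gcomm_apply, map_sub, map_smul, hQ, map_zero, smul_zero, sub_zero, zero_sub,
      LinearMap.zero_apply]
    rw [← neg_add', ← neg_zero, neg_inj]
    simp only [one_mul]
    rw [← add_smul, ksign_add_eq_zero (by push_cast; grind), zero_smul]
  | add x y h1 h2 => rw [map_add, map_add, h1, h2, add_zero]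

variable [CharZero k]

omit [CharZero k] in
theorem IsBar.barDiff_eq (hW : IsBar A c p) : p ∘ₗ c.diff = barDiff A c p := hW.differential

theorem IsBar.theta_diff (hW : IsBar A c p) (x : HomSpace A c) :
    hW.theta (hW.twisted.diff x) = hW.lie.diff (hW.theta x) := by
  induction x using homSpace_induction with
  | el n f hf =>
    obtain ⟨D, hD, hθ, hpD⟩ := hW.theta_homEl hf
    have e1 : hW.twisted.diff (homEl n hf) = homEl (n + 1)
        (twistedDiff_mem A hW.isDCoalgebra hW.isCofree.deg hf) :=
      DirectSum.toModule_lof _ _ _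
    obtain ⟨E, hE, hθ', hpE⟩ := hW.theta_homEl
      (twistedDiff_mem A hW.isDCoalgebra hW.isCofree.deg hf)
    have e2 : hW.lie.diff (coderEl n hD) = _ := coderDiff_el hW.isDCoalgebra hD
    rw [e1, hθ, hθ', e2]
    have hG : gcomm 1 n c.diff D ∈ coder d c (n + 1) := by
      rw [add_comm]; exact gcomm_coder d c hW.isDCoalgebra.diff_coder hD
    refine (coderEl_congr rfl hE hG ?_).trans (coderEl_congr (add_comm _ _) _ _ rfl)
    obtain ⟨_, -, huniq⟩ := hW.existsUnique_coder
      (Submodule.neg_mem _ (twistedDiff_mem A hW.isDCoalgebra hW.isCofree.deg hf))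
    refine (huniq E ⟨hE, hpE⟩).trans (huniq _ ⟨hG, ?_⟩).symm
    have h1 := barDiff_comp_coder A hW.isDCoalgebra hW.isCofree.deg hD
    have h2 : p ∘ₗ gcomm 1 n c.diff D =
        barDiff A c p ∘ₗ D - ksign k n • ((p ∘ₗ D) ∘ₗ c.diff) := by
      rw [← hW.barDiff_eq]
      ext x
      simp [gcomm_apply]
    rw [h2, h1, hpD]
    ext x
    simp only [twistedDiff, LinearMap.coe_mk, AddHom.coe_mk, LinearMap.add_apply,
      LinearMap.sub_apply, LinearMap.neg_apply, LinearMap.smul_apply, comp_apply,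
      map_neg]
    have hm : TensorProduct.map (-f) p = -TensorProduct.map f p := by
      ext x y; simp [TensorProduct.neg_tmul]
    rw [hm]
    simp only [LinearMap.neg_apply, map_neg, smul_neg, neg_add, neg_sub]
    abel
  | add x y h1 h2 => simp only [map_add, h1, h2]

theorem IsBar.twisted_isComplex (hW : IsBar A c p) : hW.twisted.IsComplex := by
  intro x
  apply hW.theta.injective
  rw [hW.theta_diff, hW.theta_diff, hW.lie_isComplex, map_zero]

end theta

section homEv
variable {k : Type u} [Field k] {d : ℤ} {V : Type u} [AddCommGroup V] [Module k V]
  {A : DAlgebra k d V} {W : Type u} [AddCommGroup W] [Module k W] {c : DCoalgData k W}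
  {p : W →ₗ[k] V} {S : Type u} [AddCommGroup S] [Module k S]

variable (A c) in
/-- Evaluation of a graded map `f` at `w`, with the sign `(-1)^(|f||w|)`. -/
def homEv : HomSpace A c →ₗ[k] W →ₗ[k] V :=
  DirectSum.toModule k ℤ _ fun n => LinearMap.lcomp k V (c.sgn n) ∘ₗ
    (homDeg c.toDiffMod (A.shift d) n).subtype

theorem homEv_homEl {n : ℤ} {f : W →ₗ[k] V} (hf : f ∈ homDeg c.toDiffMod (A.shift d) n) :
    homEv A c (homEl n hf) = f ∘ₗ c.sgn n :=
  DirectSum.toModule_lof _ _ _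

namespace IsBar
variable (hW : IsBar A c p)

theorem homEl_mem {n : ℤ} {f : W →ₗ[k] V} (hf : f ∈ homDeg c.toDiffMod (A.shift d) n) :
    homEl n hf ∈ hW.twisted.gr n := ⟨⟨f, hf⟩, rfl⟩

theorem exists_homEl {n : ℤ} {x : HomSpace A c} (hx : x ∈ hW.twisted.gr n) :
    ∃ (f : W →ₗ[k] V) (hf : f ∈ homDeg c.toDiffMod (A.shift d) n), x = homEl n hf := by
  obtain ⟨f, rfl⟩ := hx
  exact ⟨f.1, f.2, rfl⟩

theorem homEv_mem {n : ℤ} {x : HomSpace A c} (hx : x ∈ hW.twisted.gr n) :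
    homEv A c x ∈ homDeg c.toDiffMod (A.shift d) n := by
  obtain ⟨f, hf, rfl⟩ := hW.exists_homEl hx
  rw [homEv_homEl]
  exact homDeg_comp_zero hf (sgn_homDeg _ _)

theorem homEv_ext {s : DiffMod k S} {n : ℤ} {g g' : S →ₗ[k] HomSpace A c}
    (hg : g ∈ homDeg s hW.twisted n) (hg' : g' ∈ homDeg s hW.twisted n)
    (h : ∀ x, homEv A c (g x) = homEv A c (g' x)) : g = g' := by
  refine s.hom_ext fun i x hx => ?_
  have hx' := h x
  obtain ⟨f, hf, e⟩ := hW.exists_homEl (hg i x hx)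
  obtain ⟨f', hf', e'⟩ := hW.exists_homEl (hg' i x hx)
  rw [e, e', homEv_homEl, homEv_homEl] at hx'
  have : f = f' := LinearMap.ext fun w => by
    have := LinearMap.congr_fun hx' (c.sgn (i + n) w)
    simpa [DiffMod.sgn_sgn] using this
  subst this
  rw [e, e']

theorem exists_curry {s : DiffMod k S} {f : W ⊗[k] S →ₗ[k] V}
    (hf : f ∈ homDeg (c.toDiffMod.tensor s) (A.shift d) 0) :
    ∃ g ∈ homDeg s hW.twisted 0, ∀ x w, homEv A c (g x) w = f (w ⊗ₜ x) := by
  have hmem : ∀ n (x : s.gr n), (LinearMap.lcomp k V (c.sgn n) ∘ₗ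
      (TensorProduct.mk k W S).flip.compr₂ f ∘ₗ (s.gr n).subtype) x ∈
        homDeg c.toDiffMod (A.shift d) n := by
    intro n x i w hw
    have := hf _ _ (tmul_mem_tensorGr c.toDiffMod s (c.sgn_mem n hw) x.2 rfl)
    rwa [add_zero] at this
  let g : S →ₗ[k] HomSpace A c := s.glue fun n => DirectSum.lof k ℤ
    (fun n => homDeg c.toDiffMod (A.shift d) n) n ∘ₗ LinearMap.codRestrict _ _ (hmem n)
  have hg : ∀ {n x} (hx : x ∈ s.gr n), g x = homEl n (hmem n ⟨x, hx⟩) := fun hx =>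
    s.glue_apply _ hx
  refine ⟨g, fun n x hx => ?_, fun x w => ?_⟩
  · rw [hg hx, add_zero]
    exact hW.homEl_mem _
  · induction x using s.induction with
    | hom n x hx =>
      rw [hg hx, homEv_homEl]
      simp [DiffMod.sgn_sgn]
    | add x y h1 h2 => rw [map_add, map_add, LinearMap.add_apply, h1, h2, tmul_add,
        map_add]

variable {s : DCoalgData k S}
include hW

theorem gradedHom_ext (hs : s.IsDCoalgebra d) (hs' : s.IsCoproartinian) {f f' : W ⊗[k] S →ₗ[k] W}
    (hf : IsGradedHom (c.tensor d s) c f) (hf' : IsGradedHom (c.tensor d s) c f')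
    (h1 : f (c.one ⊗ₜ s.one) = c.one) (h : p ∘ₗ f = p ∘ₗ f') : f = f' := by
  obtain ⟨_, -, huniq⟩ := hW.isCofree.universal _ _ (hW.isDCoalgebra.tensor hs)
    (hW.isCoproartinian.tensor hW.isDCoalgebra hs hs') (p ∘ₗ f)
    (homDeg_comp_zero hW.isCofree.deg hf.deg)
    (by change p (f (c.one ⊗ₜ s.one)) = 0; rw [h1, hW.isCofree.one])
  exact (huniq f ⟨hf, rfl⟩).trans (huniq f' ⟨hf', h.symm⟩).symm

theorem exists_gradedHom (hs : s.IsDCoalgebra d) (hs' : s.IsCoproartinian)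
    {g : S →ₗ[k] HomSpace A c} (hg : g ∈ homDeg s.toDiffMod hW.twisted 0) (h1 : g s.one = 0) :
    ∃ f : W ⊗[k] S →ₗ[k] W, IsGradedHom (c.tensor d s) c f ∧ (∀ w, f (w ⊗ₜ s.one) = w) ∧
      ∀ w x, p (f (w ⊗ₜ x)) = s.counit x • p w + homEv A c (g x) w := by
  have hc := hW.isDCoalgebra
  have hs1 := hs'.isCoaugmented hs
  have hc1 := hW.isCoproartinian.isCoaugmented hc
  let F : W ⊗[k] S →ₗ[k] V := TensorProduct.lift (LinearMap.flip
    (toSpanSingleton k (W →ₗ[k] V) p ∘ₗ s.counit + homEv A c ∘ₗ g))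
  have hF : ∀ w x, F (w ⊗ₜ x) = s.counit x • p w + homEv A c (g x) w := fun w x => by simp [F]
  have hFd : F ∈ homDeg (c.tensor d s).toDiffMod (A.shift d) 0 := by
    intro n z hz
    refine tensorGr_induction (P := fun z => F z ∈ (A.shift d).gr (n + 0)) _ _ z hz ?_ ?_ ?_
    · rintro i j w x hw hx rfl
      rw [hF]
      refine Submodule.add_mem _ ?_ ?_
      · by_cases hj : j = 0
        · have := hW.isCofree.deg _ _ hw
          rw [hj, add_zero]
          exact Submodule.smul_mem _ _ this
        · rw [hs.counit_deg hx hj, zero_smul]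
          exact Submodule.zero_mem _
      · have := hW.homEv_mem (hg _ _ hx) _ _ hw
        rwa [← add_assoc] at this
    · rw [map_zero]; exact Submodule.zero_mem _
    · intro x y hx hy
      rw [map_add]; exact Submodule.add_mem _ hx hy
  obtain ⟨f, ⟨hf, hpf⟩, -⟩ := hW.isCofree.universal _ _ (hc.tensor hs)
    (hW.isCoproartinian.tensor hc hs hs') F hFd (by
      change F (c.one ⊗ₜ s.one) = 0
      rw [hF, h1, hW.isCofree.one]; simp)
  have hpf' : ∀ w x, p (f (w ⊗ₜ x)) = s.counit x • p w + homEv A c (g x) w := fun w x =>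
    (LinearMap.congr_fun hpf _).trans (hF w x)
  refine ⟨f, hf, fun w => ?_, hpf'⟩
  let j : W →ₗ[k] W ⊗[k] S := (TensorProduct.mk k W S).flip s.one
  have hm : ∀ T : W ⊗[k] W, mid c.toDiffMod s.toDiffMod (T ⊗ₜ (s.one ⊗ₜ s.one)) =
      TensorProduct.map j j T := fun T => by
    induction T using induction_on with
    | zero => simp
    | tmul x y => rw [mid_one_left _ _ hs1.one_mem]; rfl
    | add x y h1 h2 => rw [add_tmul, map_add, map_add, h1, h2]
  have hj : IsGradedHom c (c.tensor d s) j := by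
    refine ⟨fun i w hw => tmul_mem_tensorGr _ _ hw hs1.one_mem rfl, ?_, ?_, ?_⟩ <;>
      refine LinearMap.ext fun w => ?_
    · change (c.tensor d s).comul (w ⊗ₜ s.one) = _
      rw [tensor_comul_tmul, hs1.comul_one, hm]
      rfl
    · change (c.tensor d s).cobr (w ⊗ₜ s.one) = _
      rw [tensor_cobr_tmul, hs1.comul_one, hs1.cobr_one, hm]
      simp
    · change (c.tensor d s).counit (w ⊗ₜ s.one) = _
      rw [tensor_counit_tmul, hs1.counit_one, mul_one]
  obtain ⟨_, -, huniq⟩ := hW.isCofree.universal _ _ hc hW.isCoproartinian p hW.isCofree.deg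
    hW.isCofree.one
  have e := (huniq (f ∘ₗ j) ⟨hf.comp hj, LinearMap.ext fun w => by
    change p (f (w ⊗ₜ s.one)) = _
    rw [hpf', h1, hs1.counit_one]; simp⟩).trans (huniq _ ⟨IsGradedHom.id c, rfl⟩).symm
  exact LinearMap.congr_fun e w

end IsBar
end homEv

/-- `(H, μ)` is, apart from the differentials, the coalgebra of unital maps `W ⊗ H → W`: it is
cofree, cogenerated by the components of `μ`. -/
structure IsBar.IsHomCofree {k : Type u} [Field k] {d : ℤ} {V : Type u} [AddCommGroup V]
    [Module k V] {A : DAlgebra k d V} {W : Type u} [AddCommGroup W] [Module k W]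
    {c : DCoalgData k W} {p : W →ₗ[k] V} (hW : IsBar A c p) {H : Type u} [AddCommGroup H]
    [Module k H] (h : DCoalgData k H) (q : H →ₗ[k] HomSpace A c) (μ : W ⊗[k] H →ₗ[k] W) :
    Prop where
  isCofree : IsCofree d hW.twisted h q
  isGradedHom : IsGradedHom (c.tensor d h) c μ
  unit : ∀ w, μ (w ⊗ₜ h.one) = w
  comp : ∀ w x, p (μ (w ⊗ₜ x)) = h.counit x • p w + homEv A c (q x) w

namespace IsBar.IsHomCofree
variable {k : Type u} [Field k] {d : ℤ} {V : Type u} [AddCommGroup V] [Module k V]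
  {A : DAlgebra k d V} {W : Type u} [AddCommGroup W] [Module k W] {c : DCoalgData k W}
  {p : W →ₗ[k] V} {hW : IsBar A c p} {S : Type u} [AddCommGroup S] [Module k S]
  {s : DCoalgData k S} {H : Type u} [AddCommGroup H] [Module k H] {h : DCoalgData k H}
  {q : H →ₗ[k] HomSpace A c} {μ : W ⊗[k] H →ₗ[k] W}
  (hq : hW.IsHomCofree h q μ)
include hq

theorem homEv_eq (x : H) (w : W) : homEv A c (q x) w = p (μ (w ⊗ₜ x)) - h.counit x • p w := by
  rw [hq.comp, add_sub_cancel_left]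

/-- Maps into `H` of the same degree and counit are determined by their composites with `μ`. -/
theorem comp_ext {n : ℤ} {g g' : S →ₗ[k] H}
    (hg : g ∈ homDeg s.toDiffMod h.toDiffMod n) (hg' : g' ∈ homDeg s.toDiffMod h.toDiffMod n)
    (hε : h.counit ∘ₗ g = h.counit ∘ₗ g')
    (e : ∀ w x, p (μ (w ⊗ₜ g x)) = p (μ (w ⊗ₜ g' x))) : q ∘ₗ g = q ∘ₗ g' := by
  refine hW.homEv_ext (zero_homDeg_comp hq.isCofree.deg hg) (zero_homDeg_comp hq.isCofree.deg hg')
    fun x => LinearMap.ext fun w => ?_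
  have hε' := LinearMap.congr_fun hε x
  simp only [comp_apply] at hε' ⊢
  rw [hq.homEv_eq, hq.homEv_eq, e, hε']

theorem existsUnique_gradedHom (hs : s.IsDCoalgebra d) (hs' : s.IsCoproartinian)
    {f : W ⊗[k] S →ₗ[k] W} (hf : IsGradedHom (c.tensor d s) c f) (hf1 : ∀ w, f (w ⊗ₜ s.one) = w) :
    ∃! g, IsGradedHom s h g ∧ μ ∘ₗ TensorProduct.map LinearMap.id g = f := by
  have hs1 := hs'.isCoaugmented hs
  obtain ⟨g0, hge, hg0⟩ := hW.exists_curry (s := s.toDiffMod)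
    (f := p ∘ₗ f - p ∘ₗ (rid k W).toLinearMap ∘ₗ
      TensorProduct.map LinearMap.id s.counit)
    (Submodule.sub_mem _ (homDeg_comp_zero hW.isCofree.deg hf.deg) (by
      intro n z hz
      refine tensorGr_induction (P := fun z => (p ∘ₗ (rid k W).toLinearMap ∘ₗ
        TensorProduct.map LinearMap.id s.counit) z ∈ (A.shift d).gr (n + 0)) _ _ z hz ?_ ?_ ?_
      · rintro i j w x hw hx rfl
        by_cases hj : j = 0
        · have := hW.isCofree.deg _ _ hw
          subst hj
          simpa using Submodule.smul_mem _ (s.counit x) this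
        · simp [hs.counit_deg hx hj]
      · rw [map_zero]; exact Submodule.zero_mem _
      · intro x y hx hy
        rw [map_add]; exact Submodule.add_mem _ hx hy))
  have hh : ∀ x w, homEv A c (g0 x) w = p (f (w ⊗ₜ x)) - s.counit x • p w := fun x w => by
    rw [hg0]
    simp
  have hge1 : g0 s.one = 0 := by
    have e : g0 ∘ₗ toSpanSingleton k S s.one ∘ₗ s.counit = 0 := by
      refine hW.homEv_ext (s := s.toDiffMod) (n := 0) (homDeg_comp_zero hge ?_)
        (Submodule.zero_mem _) fun x => LinearMap.ext fun w => ?_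
      · exact (hs1.isGradedHom_trivial hs).deg
      · simp only [comp_apply, LinearMap.toSpanSingleton_apply, map_smul,
          LinearMap.smul_apply, hh, hf1, hs1.counit_one]
        simp
    have := LinearMap.congr_fun e s.one
    simpa [hs1.counit_one] using this
  obtain ⟨g, ⟨hg, hqg⟩, huniq⟩ := hq.isCofree.universal _ _ hs hs' _ hge hge1
  refine ⟨g, ⟨hg, ?_⟩, ?_⟩
  · refine (hW.gradedHom_ext hs hs' hf (hq.isGradedHom.comp ((IsGradedHom.id c).tensorMap hg))
      (hf1 _) (ext' fun w x => ?_)).symm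
    have hε := LinearMap.congr_fun hg.counit x
    have hq' := LinearMap.congr_fun hqg x
    simp only [comp_apply, map_tmul, id_apply] at hε hq' ⊢
    rw [hq.comp, hε, hq', hh, add_sub_cancel]
  · rintro g' ⟨hg', e⟩
    refine huniq g' ⟨hg', hW.homEv_ext (zero_homDeg_comp hq.isCofree.deg hg'.deg) hge
      fun x => LinearMap.ext fun w => ?_⟩
    have hε := LinearMap.congr_fun hg'.counit x
    have e' := LinearMap.congr_fun e (w ⊗ₜ x)
    simp only [comp_apply, map_tmul, id_apply] at hε e' ⊢
    rw [hq.homEv_eq, e', hε, hh]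

/-- A derivation of `μ` is induced by a coderivation of `H`. -/
theorem existsUnique_coder (hh : h.IsDCoalgebra d) (hh' : h.IsCoproartinian) {n : ℤ}
    {E : W ⊗[k] H →ₗ[k] W} (hE : IsCoderAlong d (c.tensor d h) c n μ E) :
    ∃! D : H →ₗ[k] H, IsCoder d h n D ∧
      μ ∘ₗ TensorProduct.map (c.sgn n) D = E := by
  have hc := hW.isDCoalgebra
  have hn := dualNumbers_isDCoalgebra k n d
  have hn' := dualNumbers_isCoproartinian k n
  let F : W ⊗[k] (H ⊗[k] (k × k)) →ₗ[k] W :=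
    epsMap (c.tensor d h) n μ E ∘ₗ (assoc k W H (k × k)).symm.toLinearMap
  have hF : ∀ g D, μ ∘ₗ TensorProduct.map LinearMap.id (epsMap h n g D) = F ↔
      μ ∘ₗ TensorProduct.map LinearMap.id g = μ ∧ μ ∘ₗ TensorProduct.map (c.sgn n) D = E := by
    intro g D
    have e1 : ∀ w x, F (w ⊗ₜ (x ⊗ₜ (1, 0))) = μ (w ⊗ₜ x) := fun w x => by
      simp only [F, comp_apply, LinearEquiv.coe_coe, TensorProduct.assoc_symm_tmul]
      exact epsMap_one _ _ _
    have e2 : ∀ w x, F (w ⊗ₜ (x ⊗ₜ (0, 1))) = E (c.sgn n w ⊗ₜ h.sgn n x) := fun w x => by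
      simp only [F, comp_apply, LinearEquiv.coe_coe, TensorProduct.assoc_symm_tmul]
      refine (epsMap_eps _ _ _).trans (congrArg E ?_)
      exact (LinearMap.congr_fun (map_sgn_sgn c.toDiffMod h.toDiffMod n) (w ⊗ₜ x)).symm
    constructor
    · intro e
      constructor <;> refine ext' fun w x => ?_
      · have := LinearMap.congr_fun e (w ⊗ₜ (x ⊗ₜ (1, 0)))
        rw [e1] at this
        simpa [epsMap_one] using this
      · have := LinearMap.congr_fun e (c.sgn n w ⊗ₜ (h.sgn n x ⊗ₜ (0, 1)))
        rw [e2] at this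
        simpa [epsMap_eps, DiffMod.sgn_sgn] using this
    · rintro ⟨h1, h2⟩
      refine TensorProduct.ext (LinearMap.ext fun w => eps_hom_ext (fun x => ?_) fun x => ?_)
      · have := LinearMap.congr_fun h1 (w ⊗ₜ x)
        refine Eq.trans ?_ (e1 w x).symm
        simpa [epsMap_one] using this
      · have := LinearMap.congr_fun h2 (c.sgn n w ⊗ₜ h.sgn n x)
        refine Eq.trans ?_ (e2 w x).symm
        simpa [epsMap_eps, DiffMod.sgn_sgn] using this
  have hFg : IsGradedHom (c.tensor d (h.tensor d (dualNumbers k n))) c F :=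
    ((isGradedHom_epsMap (hc.tensor hh) hc).2 ⟨hq.isGradedHom, hE⟩).comp
      (isHom_assoc_symm hc hh).toIsGradedHom
  have hF1 : ∀ w, F (w ⊗ₜ (h.tensor d (dualNumbers k n)).one) = w := fun w =>
    (epsMap_one (a := c.tensor d h) μ E (w ⊗ₜ h.one)).trans (hq.unit w)
  obtain ⟨G, ⟨hG, hG'⟩, huniq⟩ := hq.existsUnique_gradedHom (hh.tensor hn) (hh'.tensor hh hn hn')
    hFg hF1
  have hid : ∀ g, IsGradedHom h h g → μ ∘ₗ TensorProduct.map LinearMap.id g = μ →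
      g = LinearMap.id := by
    intro g hg e
    obtain ⟨_, -, hu⟩ := hq.existsUnique_gradedHom hh hh' hq.isGradedHom hq.unit
    refine (hu g ⟨hg, e⟩).trans (hu _ ⟨IsGradedHom.id h, ?_⟩).symm
    rw [map_id, comp_id]
  obtain ⟨g, D, rfl⟩ := epsMap_surj (a := h) (n := n) G
  obtain ⟨hg, hD⟩ := (isGradedHom_epsMap hh hh).1 hG
  obtain ⟨e1, e2⟩ := (hF g D).1 hG'
  obtain rfl := hid g hg e1
  refine ⟨D, ⟨isCoderAlong_id.1 hD, e2⟩, fun D' ⟨hD', e'⟩ => ?_⟩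
  have := huniq (epsMap h n LinearMap.id D') ⟨(isGradedHom_epsMap hh hh).2
    ⟨hg, isCoderAlong_id.2 hD'⟩, (hF _ _).2 ⟨e1, e'⟩⟩
  refine LinearMap.ext fun x => ?_
  have := LinearMap.congr_fun this (h.sgn n x ⊗ₜ (0, 1))
  simpa [epsMap_eps, DiffMod.sgn_sgn] using this

end IsBar.IsHomCofree

namespace IsBar
variable {k : Type u} [Field k] {d : ℤ} {V : Type u} [AddCommGroup V] [Module k V]
  {A : DAlgebra k d V} {W : Type u} [AddCommGroup W] [Module k W] {c : DCoalgData k W}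
  {p : W →ₗ[k] V}

/-- The existence of the coalgebra `Hom^Id(V, V)`. -/
theorem exists_isHomId [CharZero k] (hW : IsBar A c p) :
    ∃ (H : Type u) (_ : AddCommGroup H) (_ : Module k H) (h : DCoalgData k H)
      (q : H →ₗ[k] HomSpace A c) (μ : W ⊗[k] H →ₗ[k] W),
      IsHomId d c h μ ∧ hW.IsHomCofree h q μ := by
  have hc := hW.isDCoalgebra
  have hc1 := hW.isCoproartinian.isCoaugmented hc
  obtain ⟨H, _, _, h, q, hh, hh', hcof⟩ := exists_isCofree d hW.twisted
  obtain ⟨μ, hμ, hμ1, hμp⟩ := hW.exists_gradedHom hh hh' hcof.deg hcof.one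
  have hq : hW.IsHomCofree h q μ := ⟨hcof, hμ, hμ1, hμp⟩
  have a1 := hc.diff_coder.comp_hom hμ
  have a2 := hμ.comp_coder (hc.tensor hh).diff_coder
  obtain ⟨D', ⟨hD', e'⟩, -⟩ := hq.existsUnique_coder hh hh' (n := 1)
    (E := c.diff ∘ₗ μ - μ ∘ₗ (c.tensor d h).diff) (by
      refine ⟨Submodule.sub_mem _ a1.deg a2.deg, ?_, ?_⟩
      · rw [comp_sub, a1.comul, a2.comul, ← sub_comp]
        congr 1
        ext; simp [TensorProduct.sub_tmul, TensorProduct.tmul_sub]; abel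
      · rw [comp_sub, a1.cobr, a2.cobr]
        refine (smul_sub _ _ _).symm.trans ?_
        rw [← sub_comp]
        congr 2
        ext; simp [TensorProduct.sub_tmul, TensorProduct.tmul_sub]; abel)
  obtain ⟨D, hDdef⟩ : ∃ D, D = h.diff + D' := ⟨_, rfl⟩
  have hD : IsCoder d h 1 D := hDdef ▸ Submodule.add_mem (coder d h 1) hh.diff_coder hD'
  have e : ∀ {i} {w : W} (_ : w ∈ c.gr i) x,
      μ (w ⊗ₜ D x) = ksign k i • (c.diff (μ (w ⊗ₜ x)) - μ (c.diff w ⊗ₜ x)) := by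
    intro i w hw x
    have e1 := LinearMap.congr_fun e' (w ⊗ₜ x)
    simp only [comp_apply, map_tmul, c.sgn_apply 1 hw, one_mul,
      ← smul_tmul', map_smul, LinearMap.sub_apply, tensor_diff_tmul hw, map_add] at e1
    have e2 := congrArg (fun y => ksign k i • y) e1
    simp only [ksign_smul_smul] at e2
    rw [hDdef, LinearMap.add_apply, tmul_add, map_add, e2]
    simp only [smul_sub, smul_add, ksign_smul_smul]
    abel
  have hD2 : D ∘ₗ D = 0 := by
    obtain ⟨_, -, huniq⟩ := hq.existsUnique_coder hh hh' (n := 1 + 1) (.zero _)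
    refine (huniq _ ⟨hD.comp_self, DiffMod.tensor_hom_ext c.toDiffMod h.toDiffMod
      fun i j w x hw hx => ?_⟩).trans
      (huniq 0 ⟨Submodule.zero_mem (coder d h (1 + 1)), by simp⟩).symm
    have h0 : ∀ y, c.diff (c.diff y) = 0 := hc.isComplex
    simp only [comp_apply, map_tmul, c.sgn_apply _ hw,
      ← smul_tmul', map_smul, e hw, e (c.diff_mem hw), map_sub, h0,
      zero_tmul, map_zero, LinearMap.zero_apply, sub_zero, zero_sub, smul_neg]
    rw [← neg_add', ← add_smul, add_comm, ksign_add_eq_zero (by push_cast; grind)]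
    simp
  have hεD : h.counit ∘ₗ D = 0 :=
    (isCoderAlong_id.2 hD).counit hh hh (IsGradedHom.id h)
  have hD1 : D h.one = 0 := hcof.coder_one hh hh' hD (by
    have h1 := hh'.isCoaugmented hh
    have := hq.comp_ext (s := h) (n := 1) 
      (g := D ∘ₗ toSpanSingleton k H h.one ∘ₗ h.counit) (g' := 0) (homDeg_comp_zero hD.deg (h1.isGradedHom_trivial hh).deg) (Submodule.zero_mem _)
      (by rw [← comp_assoc, hεD]; simp) (fun w x => by
        induction w using c.induction with
        | hom i w hw => simp [e hw, hμ1]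
        | add w w' h1 h2 => simp only [add_tmul, map_add, h1, h2])
    have := LinearMap.congr_fun this h.one
    simpa [h1.counit_one] using this)
  have hμd : c.diff ∘ₗ μ = μ ∘ₗ (c.tensor d (h.withDiff D hD.deg)).diff := by
    refine DiffMod.tensor_hom_ext c.toDiffMod h.toDiffMod fun i j w x hw hx => ?_
    simp only [comp_apply, tensor_diff_tmul hw]
    change _ = μ (c.diff w ⊗ₜ[k] x + ksign k i • w ⊗ₜ[k] D x)
    rw [map_add, map_smul, e hw, ksign_smul_smul]
    abel
  refine ⟨H, inferInstance, inferInstance, h.withDiff D hD.deg, q, μ, ?_,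
    ⟨hcof.withDiff hD.deg, ⟨hμ.deg, hμ.comul, hμ.cobr, hμ.counit⟩, hμ1, hμp⟩⟩
  refine ⟨hh.withDiff hD hD2, hh'.withDiff hh hD hD2 hD1,
    ⟨⟨⟨hμ.deg, hμ.comul, hμ.cobr, hμ.counit⟩, hμd⟩, hμ1⟩, ?_⟩
  rintro S _ _ s hs hs' f ⟨hf, hf1⟩
  have hs1 := hs'.isCoaugmented hs
  obtain ⟨g, ⟨hg, hgf⟩, huniq⟩ := hq.existsUnique_gradedHom hs hs' hf.toIsGradedHom hf1
  have hgf' : ∀ w x, μ (w ⊗ₜ g x) = f (w ⊗ₜ x) := fun w x => LinearMap.congr_fun hgf (w ⊗ₜ x)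
  refine ⟨g, ⟨⟨⟨hg.deg, hg.comul, hg.cobr, hg.counit⟩, ?_⟩, hgf⟩, fun g' hg' => huniq g'
    ⟨⟨hg'.1.deg, hg'.1.comul, hg'.1.cobr, hg'.1.counit⟩, hg'.2⟩⟩
  change D ∘ₗ g = g ∘ₗ s.diff
  have c1 := hD.comp_hom hg
  have c2 := hg.comp_coder hs.diff_coder
  have hg1 : q (g s.one) = 0 := by
    have hz := hq.comp_ext (s := s) (n := 0)
      (g := g ∘ₗ toSpanSingleton k S s.one ∘ₗ s.counit)
      (g' := toSpanSingleton k H h.one ∘ₗ s.counit)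
      (homDeg_comp_zero hg.deg (hs1.isGradedHom_trivial hs).deg)
      ((hh'.isCoaugmented hh).isGradedHom_trivial hs).deg
      (by
        rw [← comp_assoc, hg.counit]
        ext x
        simp [(hh'.isCoaugmented hh).counit_one, hs1.counit_one]) (fun w x => by simp [hgf', hf1, hμ1])
    have := LinearMap.congr_fun hz s.one
    simpa [hs1.counit_one, hcof.one] using this
  obtain ⟨_, -, hu⟩ := hcof.existsUnique_coderAlong hh hs hs' hg hg1
    (zero_homDeg_comp hcof.deg c1.deg)
  refine (hu _ ⟨c1, rfl⟩).trans (hu _ ⟨c2, hq.comp_ext c2.deg c1.deg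
    ((c2.counit hs hh hg).trans (c1.counit hs hh hg).symm) fun w x => ?_⟩).symm
  induction w using c.induction with
  | hom i w hw =>
    have e1 := LinearMap.congr_fun hf.diff (w ⊗ₜ x)
    simp only [comp_apply, tensor_diff_tmul hw, map_add, map_smul] at e1
    simp only [comp_apply, e hw, hgf', e1]
    rw [add_sub_cancel_left, ksign_smul_smul]
  | add w w' h1 h2 => simp only [add_tmul, map_add, h1, h2]

end IsBar

section HomId
variable {k : Type u} [Field k] {d : ℤ} {W : Type u} [AddCommGroup W] [Module k W]
  {c : DCoalgData k W} {H : Type u} [AddCommGroup H] [Module k H] {h : DCoalgData k H}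
  {μ : W ⊗[k] H →ₗ[k] W}

theorem IsHomId.hom_ext (hμ : IsHomId d c h μ) {S : Type u} [AddCommGroup S] [Module k S]
    {s : DCoalgData k S} (hs : s.IsDCoalgebra d) (hs' : s.IsCoproartinian) {g g' : S →ₗ[k] H}
    (hg : IsHom s h g) (hg' : IsHom s h g') (h1 : g s.one = h.one)
    (e : ∀ w x, μ (w ⊗ₜ g x) = μ (w ⊗ₜ g' x)) : g = g' := by
  obtain ⟨_, -, huniq⟩ := hμ.universal S s hs hs' (μ ∘ₗ TensorProduct.map LinearMap.id g)
    ⟨hμ.mem.1.comp ((IsHom.id c).tensorMap hg), fun w => by simp [h1, hμ.mem.2]⟩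
  exact (huniq g ⟨hg, rfl⟩).trans (huniq g' ⟨hg', (ext' e).symm⟩).symm

theorem DCoalgData.IsGradedHom.map_one {S : Type u} [AddCommGroup S] [Module k S] {s : DCoalgData k S}
    {g : S →ₗ[k] H} (hg : IsGradedHom s h g) (hs : s.IsCoaugmented) (hh : h.IsDCoalgebra d)
    (hh' : h.IsCoproartinian) : g s.one = h.one := by
  obtain ⟨n, hn⟩ := hh'.exists_mem_corad hh (g s.one)
  refine (hh'.isCoaugmented hh).grouplike_eq_one hn ?_ ?_
  · rw [← comp_apply, hg.counit, hs.counit_one]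
  · rw [← comp_apply, hg.comul, comp_apply, hs.comul_one,
      map_tmul]

theorem IsHomId.isHomCofree [CharZero k] {V : Type u} [AddCommGroup V] [Module k V]
    {A : DAlgebra k d V} {p : W →ₗ[k] V} (hW : IsBar A c p) (hμ : IsHomId d c h μ) :
    ∃ q, hW.IsHomCofree h q μ := by
  obtain ⟨H', _, _, h', q, μ', hμ', hq⟩ := hW.exists_isHomId
  have hh := hμ.isDCoalgebra
  have hh' := hμ'.isDCoalgebra
  have hH := hμ.isCoproartinian
  have hH' := hμ'.isCoproartinian
  obtain ⟨φ, ⟨hφ, eφ⟩, -⟩ := hμ'.universal H h hh hH μ hμ.mem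
  obtain ⟨ψ, ⟨hψ, eψ⟩, -⟩ := hμ.universal H' h' hh' hH' μ' hμ'.mem
  have eφ' : ∀ w x, μ' (w ⊗ₜ φ x) = μ (w ⊗ₜ x) := fun w x => LinearMap.congr_fun eφ (w ⊗ₜ x)
  have eψ' : ∀ w x, μ (w ⊗ₜ ψ x) = μ' (w ⊗ₜ x) := fun w x => LinearMap.congr_fun eψ (w ⊗ₜ x)
  have φ1 := hφ.toIsGradedHom.map_one (hH.isCoaugmented hh) hh' hH'
  have ψ1 := hψ.toIsGradedHom.map_one (hH'.isCoaugmented hh') hh hH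
  have h1 : φ ∘ₗ ψ = LinearMap.id := hμ'.hom_ext hh' hH' (hφ.comp hψ) (IsHom.id _)
    (by rw [comp_apply, ψ1, φ1]) (fun w x => by simp [eφ', eψ'])
  have h2 : ψ ∘ₗ φ = LinearMap.id := hμ.hom_ext hh hH (hψ.comp hφ) (IsHom.id _)
    (by rw [comp_apply, φ1, ψ1]) (fun w x => by simp [eφ', eψ'])
  refine ⟨q ∘ₗ φ, ⟨homDeg_comp_zero hq.isCofree.deg hφ.deg, ?_, ?_⟩, hμ.mem.1.toIsGradedHom,
    hμ.mem.2, fun w x => ?_⟩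
  · rw [comp_apply, φ1, hq.isCofree.one]
  · intro S _ _ s hs hs' f hf hf1
    obtain ⟨g, ⟨hg, hgf⟩, huniq⟩ := hq.isCofree.universal S s hs hs' f hf hf1
    refine ⟨ψ ∘ₗ g, ⟨hψ.toIsGradedHom.comp hg, ?_⟩, fun g' hg' => ?_⟩
    · rw [comp_assoc, ← comp_assoc g ψ φ, h1, id_comp, hgf]
    · rw [← huniq (φ ∘ₗ g') ⟨hφ.toIsGradedHom.comp hg'.1, by rw [← comp_assoc, hg'.2]⟩,
        ← comp_assoc, h2, id_comp]
  · rw [← eφ', hq.comp, ← comp_apply, hφ.counit, comp_apply]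

/-- The existence and uniqueness of the composition product. -/
theorem IsHomId.existsUnique_composition (hμ : IsHomId d c h μ) (hc : c.IsDCoalgebra d) :
    ∃! m, IsComposition d h μ m := by
  have hh := hμ.isDCoalgebra
  have hH := hμ.isCoproartinian
  let f : W ⊗[k] (H ⊗[k] H) →ₗ[k] W :=
    (μ ∘ₗ TensorProduct.map μ LinearMap.id) ∘ₗ (assoc k W H H).symm.toLinearMap
  have hf : f ∈ FId d c (h.tensor d h) := by
    refine ⟨(hμ.mem.1.comp (hμ.mem.1.tensorMap (IsHom.id h))).comp (isHom_assoc_symm hc hh),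
      fun w => ?_⟩
    change f (w ⊗ₜ (h.one ⊗ₜ h.one)) = w
    simp [f, hμ.mem.2]
  have key : ∀ m, μ ∘ₗ TensorProduct.map LinearMap.id m = f ↔
      μ ∘ₗ TensorProduct.map LinearMap.id m ∘ₗ (assoc k W H H).toLinearMap =
        μ ∘ₗ TensorProduct.map μ LinearMap.id := fun m => by
    rw [← comp_assoc]
    constructor
    · intro e
      rw [e]
      ext; simp [f]
    · intro e
      simp only [f, ← e]
      ext; simp
  obtain ⟨m, ⟨hm, e⟩, huniq⟩ := hμ.universal _ _ (hh.tensor hh) (hH.tensor hh hh hH) f hf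
  exact ⟨m, ⟨hm, (key m).1 e⟩, fun m' hm' => huniq m' ⟨hm'.isHom, (key m').2 hm'.comp⟩⟩

end HomId

section leib
variable {k : Type u} [Field k] {V V' W W' : Type*} [AddCommGroup V] [Module k V]
  [AddCommGroup W] [Module k W] [AddCommGroup V'] [Module k V'] [AddCommGroup W'] [Module k W']

theorem DiffMod.leib_tmul (c : DiffMod k V) (n : ℤ) (D : V →ₗ[k] V) (D' : W →ₗ[k] W) {i : ℤ}
    {x : V} (hx : x ∈ c.gr i) (y : W) :
    c.leib n D D' (x ⊗ₜ y) = D x ⊗ₜ y + ksign k (n * i) • (x ⊗ₜ D' y) := by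
  simp [leib, c.sgn_apply n hx, smul_tmul']

theorem DiffMod.map_comp_leib {a : DiffMod k V} {b : DiffMod k W} {f : V →ₗ[k] W}
    {g : V' →ₗ[k] W'} (hf : f ∈ homDeg a b 0) (n : ℤ) {D : V →ₗ[k] V} {E : W →ₗ[k] W}
    {D' : V' →ₗ[k] V'} {E' : W' →ₗ[k] W'} (h : f ∘ₗ D = E ∘ₗ f) (h' : g ∘ₗ D' = E' ∘ₗ g) :
    TensorProduct.map f g ∘ₗ a.leib n D D' = b.leib n E E' ∘ₗ TensorProduct.map f g := by
  rw [leib, leib, comp_add, add_comp]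
  simp only [← map_comp, h, h', sgn_comp hf, comp_id, id_comp]

theorem DiffMod.twist_comp_leib {a : DiffMod k V} {b : DiffMod k W} {n : ℤ} {D : V →ₗ[k] V}
    {E : W →ₗ[k] W} (hD : D ∈ homDeg a a n) (hE : E ∈ homDeg b b n) :
    a.twist b ∘ₗ a.leib n D E = b.leib n E D ∘ₗ a.twist b := by
  refine tensor_hom_ext a b fun i j x y hx hy => ?_
  simp only [comp_apply, leib_tmul _ _ _ _ hx, twist_apply _ _ hx hy, map_add, map_smul,
    twist_apply _ _ (hD i x hx) hy, twist_apply _ _ hx (hE j y hy), leib_tmul _ _ _ _ hy,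
    smul_add, smul_smul, ← ksign_add]
  rw [add_comm]
  congr 2 <;> exact ksign_congr (by push_cast; grind)

theorem DiffMod.assoc_comp_leib (a : DiffMod k V) (b : DiffMod k W) (n : ℤ) (D : V →ₗ[k] V)
    (E : W →ₗ[k] W) (F : V' →ₗ[k] V') :
    (assoc k V W V').toLinearMap ∘ₗ (a.tensor b).leib n (a.leib n D E) F =
      a.leib n D (b.leib n E F) ∘ₗ (assoc k V W V').toLinearMap := by
  refine TensorProduct.ext (tensor_hom_ext a b fun i j x y hx hy => LinearMap.ext fun z => ?_)
  have h : x ⊗ₜ y ∈ (a.tensor b).gr (i + j) := tmul_mem_tensorGr a b hx hy rfl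
  change assoc k V W V' ((a.tensor b).leib n (a.leib n D E) F ((x ⊗ₜ y) ⊗ₜ z)) =
    a.leib n D (b.leib n E F) (x ⊗ₜ (y ⊗ₜ z))
  simp only [leib_tmul _ _ _ _ h, leib_tmul _ _ _ _ hx, leib_tmul _ _ _ _ hy, add_tmul,
    ← smul_tmul', map_add, map_smul, assoc_tmul,
    tmul_add, tmul_smul, smul_add, smul_smul, ← ksign_add, mul_add]
  abel

end leib

namespace GLie
variable {k : Type u} [Field k] {g : Type v} [AddCommGroup g] [Module k g] (L : GLie k g)

theorem env_induction {P : Env L → Prop} (z : Env L) (one : P 1)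
    (cons : ∀ i n x z, x ∈ L.gr i → z ∈ envGr L n → P z → P (ι L x * z))
    (smul : ∀ (r : k) z, P z → P (r • z)) (add : ∀ y z, P y → P z → P (y + z)) : P z := by
  induction z using L.envBialg.induction with
  | add y z h1 h2 => exact add y z h1 h2
  | hom n z hz =>
    induction hz using Submodule.span_induction with
    | mem z hz =>
      have : z ∈ envGr L n ∧ P z := by
        induction hz with
        | one => exact ⟨Submodule.subset_span .one, one⟩
        | cons hx hz ih => exact ⟨Submodule.subset_span (.cons hx hz), cons _ _ _ _ hx ih.1 ih.2⟩
      exact this.2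
    | zero => simpa using smul 0 1 one
    | add y z _ _ h1 h2 => exact add y z h1 h2
    | smul r z _ h => exact smul r z h

variable {L}

theorem env_linear_ext {M : Type*} [AddCommMonoid M] [Module k M] {f f' : Env L →ₗ[k] M}
    (one : f 1 = f' 1) (cons : ∀ i n x z, x ∈ L.gr i → z ∈ envGr L n → f z = f' z →
      f (ι L x * z) = f' (ι L x * z)) : f = f' := by
  refine LinearMap.ext fun z => ?_
  induction z using env_induction with
  | one => exact one
  | cons i n x z hx hz h => exact cons i n x z hx hz h
  | smul r z h => rw [map_smul, map_smul, h]
  | add y z h1 h2 => rw [map_add, map_add, h1, h2]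

theorem env_mul_mem {i j : ℤ} {y z : Env L} (hy : y ∈ envGr L i) (hz : z ∈ envGr L j) :
    y * z ∈ envGr L (i + j) := SetLike.GradedMonoid.toGradedMul.mul_mem hy hz

theorem env_one_mem : (1 : Env L) ∈ envGr L 0 := SetLike.GradedOne.one_mem

theorem envDiff_apply (z : Env L) : envDiff L z = diffMat L z 0 1 := rfl

theorem envDiff_ι_mul {i : ℤ} {x : g} (hx : x ∈ L.gr i) (z : Env L) :
    envDiff L (ι L x * z) = ι L (L.diff x) * z + ksign k i • (ι L x * envDiff L z) := by
  have h : diffMat L z 1 1 = z := by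
    induction z using env_induction with
    | one => simp
    | cons j n y z hy hz h =>
      simp [diffMat, lift_ι, Matrix.mul_apply, diffMatι]
      exact congrArg _ h
    | smul r z h => simp [h]
    | add y z h1 h2 => simp [h1, h2]
  rw [envDiff_apply, envDiff_apply, map_mul, show diffMat L (ι L x) = diffMatι L x from lift_ι _ _ _ _]
  simp only [Matrix.mul_apply, Fin.sum_univ_two, diffMatι]
  simp [h, L.sgn_apply _ hx]
  abel

theorem envDiff_one : envDiff L 1 = 0 := by simp [envDiff_apply]

theorem envDiff_ι (x : g) : envDiff L (ι L x) = ι L (L.diff x) := by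
  induction x using L.induction with
  | hom i x hx => simpa [envDiff_one] using envDiff_ι_mul hx 1
  | add x y h1 h2 => simp only [map_add, h1, h2]

/-- Left multiplication by a generator. -/
def lmul (x : g) : Env L →ₗ[k] Env L := LinearMap.mulLeft k (ι L x)

theorem lmul_apply (x : g) (z : Env L) : lmul x z = ι L x * z := rfl

theorem lmul_mem {i : ℤ} {x : g} (hx : x ∈ L.gr i) :
    lmul x ∈ homDeg L.envBialg.toDiffMod L.envBialg.toDiffMod i := fun j z hz => by
  rw [add_comm]; exact env_mul_mem (ι_mem L hx) hz

theorem envComul_one : L.envBialg.comul 1 = 1 ⊗ₜ 1 := by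
  simp only [envBialg, comp_apply, AlgHom.toLinearMap_apply, map_one]
  rfl

theorem envComul_ι_mul {i : ℤ} {x : g} (hx : x ∈ L.gr i) (z : Env L) :
    L.envBialg.comul (ι L x * z) = L.envBialg.leib i (lmul x) (lmul x) (L.envBialg.comul z) := by
  have h : ∀ t : GradedTensorProduct k (envGr L) (envGr L),
      (GradedTensorProduct.of k (envGr L) (envGr L)).symm (comulι L x * t) =
        L.envBialg.leib i (lmul x) (lmul x)
          ((GradedTensorProduct.of k (envGr L) (envGr L)).symm t) := by
    intro t
    obtain ⟨t, rfl⟩ := (GradedTensorProduct.of k (envGr L) (envGr L)).surjective t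
    rw [LinearEquiv.symm_apply_apply]
    induction t using L.envBialg.tensor_induction L.envBialg.toDiffMod with
    | add s t h1 h2 => simp only [map_add, mul_add, h1, h2]
    | tmul a b y z hy hz =>
      rw [leib_tmul _ _ _ _ hy]
      simp only [comulι, comp_apply, LinearMap.add_apply, AlgHom.toLinearMap_apply,
        add_mul, map_add]
      congr 1
      · have := GradedTensorProduct.tmul_one_mul_coe_tmul (R := k) (envGr L) (envGr L)
          (ι L x) (⟨y, hy⟩ : envGr L a) z
        exact congrArg (GradedTensorProduct.of k (envGr L) (envGr L)).symm this
      · have := GradedTensorProduct.tmul_coe_mul_coe_tmul (R := k) (envGr L) (envGr L)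
          1 (⟨ι L x, ι_mem L hx⟩ : envGr L i) (⟨y, hy⟩ : envGr L a) z
        refine (congrArg (GradedTensorProduct.of k (envGr L) (envGr L)).symm this).trans ?_
        rw [one_mul]
        exact (Int.cast_smul_eq_zsmul k ((i * a).negOnePow : ℤ)
          (y ⊗ₜ[k] (ι L x * z))).symm
  have h2 : envComul L (ι L x) = comulι L x := lift_ι _ _ _ _
  simp only [envBialg, comp_apply, AlgHom.toLinearMap_apply, map_mul, h2]
  exact h _

theorem envCounit_one : L.envBialg.counit 1 = 1 := map_one (lift L _ _)

theorem envCounit_ι_mul (x : g) (z : Env L) : L.envBialg.counit (ι L x * z) = 0 := by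
  change lift L _ _ (ι L x * z) = 0
  rw [map_mul, lift_ι]
  simp

end GLie

namespace GLie
variable {k : Type u} [Field k] {g : Type v} [AddCommGroup g] [Module k g] {L : GLie k g}
  {M : Type w} [AddCommGroup M] [Module k M] {b : DiffMod k M}

variable (L b) in
/-- Graded representations of a graded Lie algebra. -/
structure IsRep (ρ : g →ₗ[k] M →ₗ[k] M) : Prop where
  deg : ∀ {i x}, x ∈ L.gr i → ρ x ∈ homDeg b b i
  brk : ∀ {i j x y}, x ∈ L.gr i → y ∈ L.gr j → ρ (L.brk x y) = gcomm i j (ρ x) (ρ y)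

/-- The right action of the enveloping algebra which corresponds to a representation. -/
theorem IsRep.exists_action {ρ : g →ₗ[k] M →ₗ[k] M} (hρ : IsRep L b ρ) :
    ∃ R : M ⊗[k] Env L →ₗ[k] M, R ∈ homDeg (b.tensor L.envBialg.toDiffMod) b 0 ∧
      (∀ m, R (m ⊗ₜ 1) = m) ∧ (∀ m y z, R (m ⊗ₜ (y * z)) = R (R (m ⊗ₜ y) ⊗ₜ z)) ∧
      ∀ {i x}, x ∈ L.gr i → ∀ m, R (m ⊗ₜ ι L x) = ksign k 1 • ρ x (b.sgn i m) := by
  let r : g →ₗ[k] (Module.End k M)ᵐᵒᵖ := L.glue fun i =>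
    (MulOpposite.opLinearEquiv k).toLinearMap ∘ₗ
      (ksign k 1 • LinearMap.lcomp k M (b.sgn i)) ∘ₗ ρ ∘ₗ (L.gr i).subtype
  have hr : ∀ {i x}, x ∈ L.gr i → r x = MulOpposite.op (ksign k 1 • (ρ x ∘ₗ b.sgn i)) := fun hx =>
    L.glue_apply _ hx
  let a : Env L →ₐ[k] (Module.End k M)ᵐᵒᵖ := lift L r (by
    intro i j x y hx hy
    rw [hr hx, hr hy, hr (L.brk_mem hx hy), ← MulOpposite.op_mul, ← MulOpposite.op_mul,
      ← MulOpposite.op_smul, ← MulOpposite.op_add, hρ.brk hx hy]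
    congr 1
    refine b.hom_ext fun n m hm => ?_
    simp only [Module.End.mul_apply, LinearMap.smul_apply, comp_apply,
      b.sgn_apply _ hm, map_smul, b.sgn_apply _ (hρ.deg hx _ _ hm), b.sgn_apply _
      (hρ.deg hy _ _ hm), LinearMap.add_apply, gcomm_apply, smul_sub, smul_smul, ← ksign_add]
    have e1 : ksign k (1 + i * n + (1 + j * (n + i))) + ksign k (1 + ((i + j) * n + i * j)) = 0 :=
      ksign_add_eq_zero (by push_cast; grind)
    have e2 : ksign k (i * j + (1 + j * n + (1 + i * (n + j)))) + ksign k (1 + (i + j) * n) = 0 :=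
      ksign_add_eq_zero (by push_cast; grind)
    rw [eq_neg_of_add_eq_zero_left e1, eq_neg_of_add_eq_zero_left e2]
    module)
  let R : M ⊗[k] Env L →ₗ[k] M := TensorProduct.lift (LinearMap.flip
    ((MulOpposite.opLinearEquiv k).symm.toLinearMap ∘ₗ a.toLinearMap))
  have hR : ∀ m z, R (m ⊗ₜ z) = MulOpposite.unop (a z) m := fun m z => rfl
  have h1 : ∀ m, R (m ⊗ₜ 1) = m := fun m => by rw [hR, map_one]; rfl
  have h2 : ∀ m y z, R (m ⊗ₜ (y * z)) = R (R (m ⊗ₜ y) ⊗ₜ z) := fun m y z => by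
    rw [hR, hR, hR, map_mul]; rfl
  have h3 : ∀ {i x}, x ∈ L.gr i → ∀ m, R (m ⊗ₜ ι L x) = ksign k 1 • ρ x (b.sgn i m) := by
    intro i x hx m
    have h : a (ι L x) = r x := lift_ι _ _ _ _
    rw [hR, h, hr hx]
    rfl
  refine ⟨R, fun n t ht => ?_, h1, h2, h3⟩
  refine tensorGr_induction (P := fun z => R z ∈ b.gr (n + 0)) _ _ t ht ?_
    (by rw [map_zero]; exact Submodule.zero_mem _)
    (fun x y h1 h2 => by rw [map_add]; exact Submodule.add_mem _ h1 h2)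
  clear ht
  rintro i j m z hm hz rfl
  rw [add_zero]
  change z ∈ envGr L j at hz
  induction hz using Submodule.span_induction with
  | mem z hz =>
    induction hz generalizing i m with
    | one => rwa [h1, add_zero]
    | @cons l n x z hx hz ih =>
      rw [h2, h3 hx, ← add_assoc]
      exact ih (i + l) _ (Submodule.smul_mem _ _ (hρ.deg hx _ _ (b.sgn_mem _ hm)))
  | zero => rw [tmul_zero, map_zero]; exact Submodule.zero_mem _
  | add y z _ _ h1 h2 => rw [tmul_add, map_add]; exact Submodule.add_mem _ h1 h2
  | smul r z _ h => rw [tmul_smul, map_smul]; exact Submodule.smul_mem _ _ h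

theorem isRep_lmul : IsRep L L.envBialg.toDiffMod (LinearMap.mul k (Env L) ∘ₗ ι L) where
  deg hx := lmul_mem hx
  brk hx hy := LinearMap.ext fun z => by
    have := ι_mul_ι L hx hy
    simp only [comp_apply, LinearMap.mul_apply', gcomm_apply, ← mul_assoc]
    refine eq_sub_of_add_eq' ?_
    rw [this, add_mul, smul_mul_assoc]

theorem envBialg_comul_homDeg : L.envBialg.comul ∈ homDeg L.envBialg.toDiffMod
    (L.envBialg.toDiffMod.tensor L.envBialg.toDiffMod) 0 := by
  intro n z hz
  change z ∈ envGr L n at hz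
  rw [add_zero]
  induction hz using Submodule.span_induction with
  | mem z hz =>
    induction hz with
    | one =>
      rw [envComul_one]
      exact tmul_mem_tensorGr _ _ env_one_mem env_one_mem (add_zero 0)
    | @cons i n x z hx hz ih =>
      rw [envComul_ι_mul hx]
      have h1 := map_homDeg (lmul_mem hx) (id_homDeg L.envBialg.toDiffMod) _ _ ih
      have h2 := map_homDeg (sgn_homDeg L.envBialg.toDiffMod i) (lmul_mem hx) _ _ ih
      rw [show n + (i + 0) = i + n by ring] at h1
      rw [show n + (0 + i) = i + n by ring] at h2
      exact Submodule.add_mem _ h1 h2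
  | zero => rw [map_zero]; exact Submodule.zero_mem _
  | add y z _ _ h1 h2 => rw [map_add]; exact Submodule.add_mem _ h1 h2
  | smul r z _ h => rw [map_smul]; exact Submodule.smul_mem _ _ h

theorem envCounit_deg {i : ℤ} {z : Env L} (hz : z ∈ envGr L i) (hi : i ≠ 0) :
    L.envBialg.counit z = 0 := by
  induction hz using Submodule.span_induction with
  | mem z hz =>
    cases hz with
    | one => exact absurd rfl hi
    | cons hx hz => exact envCounit_ι_mul _ _
  | zero => exact map_zero _
  | add y z _ _ h1 h2 => rw [map_add, h1, h2, add_zero]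
  | smul r z _ h => rw [map_smul, h, smul_zero]

theorem env_gcomm_diff {i : ℤ} {x : g} (hx : x ∈ L.gr i) :
    gcomm 1 i (envDiff L) (lmul x) = lmul (L.diff x) := by
  refine LinearMap.ext fun z => ?_
  rw [gcomm_apply, lmul_apply, envDiff_ι_mul hx, one_mul, lmul_apply, lmul_apply]
  abel

theorem env_comul_mul : L.envBialg.comul ∘ₗ L.envBialg.mul =
    TensorProduct.map L.envBialg.mul L.envBialg.mul ∘ₗ
      mid L.envBialg.toDiffMod L.envBialg.toDiffMod ∘ₗ
        TensorProduct.map L.envBialg.comul L.envBialg.comul := by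
  have h : ∀ {i x}, x ∈ L.gr i → ∀ s t, TensorProduct.map L.envBialg.mul L.envBialg.mul
      (mid L.envBialg.toDiffMod L.envBialg.toDiffMod
        (L.envBialg.leib i (lmul x) (lmul x) s ⊗ₜ t)) = L.envBialg.leib i (lmul x) (lmul x)
      (TensorProduct.map L.envBialg.mul L.envBialg.mul
        (mid L.envBialg.toDiffMod L.envBialg.toDiffMod (s ⊗ₜ t))) := by
    intro i x hx s t
    induction s using L.envBialg.tensor_induction L.envBialg.toDiffMod with
    | add s s' h1 h2 => simp only [map_add, add_tmul, h1, h2]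
    | tmul a b y z hy hz =>
      induction t using L.envBialg.tensor_induction L.envBialg.toDiffMod with
      | add t t' h1 h2 => simp only [map_add, tmul_add, h1, h2]
      | tmul a' b' y' z' hy' hz' =>
        have hm : L.envBialg.mul (y ⊗ₜ y') ∈ L.envBialg.gr (a + a') := env_mul_mem hy hy'
        simp only [leib_tmul _ _ _ _ hy, add_tmul, ← smul_tmul',
          map_add, map_smul, mid_tmul _ _ y z' hz hy', mid_tmul _ _ _ z' hz hy',
          mid_tmul _ _ y z' (lmul_mem hx _ _ hz) hy', map_tmul,
          leib_tmul _ _ _ _ hm, smul_add, smul_smul, ← ksign_add]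
        simp only [envBialg, LinearMap.mul'_apply, lmul_apply, mul_assoc]
        congr 2
        exact ksign_congr (by push_cast; grind)
  refine TensorProduct.ext ?_
  refine env_linear_ext ?_ fun i n x z hx hz ih => ?_
  · refine LinearMap.ext fun w => ?_
    change L.envBialg.comul (1 * w) = TensorProduct.map L.envBialg.mul L.envBialg.mul
      (mid L.envBialg.toDiffMod L.envBialg.toDiffMod (L.envBialg.comul 1 ⊗ₜ L.envBialg.comul w))
    rw [envComul_one, one_mul]
    generalize L.envBialg.comul w = t
    induction t using induction_on with
    | zero => simp
    | tmul y z =>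
      rw [mid_one_right _ _ env_one_mem]
      simp [envBialg]
    | add t t' h1 h2 => rw [tmul_add, map_add, map_add, ← h1, ← h2]
  · refine LinearMap.ext fun w => ?_
    have ih' := LinearMap.congr_fun ih w
    change L.envBialg.comul (z * w) = TensorProduct.map L.envBialg.mul L.envBialg.mul
      (mid L.envBialg.toDiffMod L.envBialg.toDiffMod
        (L.envBialg.comul z ⊗ₜ L.envBialg.comul w)) at ih'
    change L.envBialg.comul (ι L x * z * w) = TensorProduct.map L.envBialg.mul L.envBialg.mul
      (mid L.envBialg.toDiffMod L.envBialg.toDiffMod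
        (L.envBialg.comul (ι L x * z) ⊗ₜ L.envBialg.comul w))
    rw [mul_assoc, envComul_ι_mul hx, envComul_ι_mul hx, h hx, ih']

theorem env_diff_mul {i : ℤ} {y : Env L} (hy : y ∈ envGr L i) (z : Env L) :
    envDiff L (y * z) = envDiff L y * z + ksign k i • (y * envDiff L z) := by
  induction hy using Submodule.span_induction with
  | mem y hy =>
    induction hy with
    | one => simp [envDiff_one]
    | cons hx hy ih =>
      rw [mul_assoc, envDiff_ι_mul hx, ih, envDiff_ι_mul hx, mul_add, add_mul, mul_assoc,
        smul_mul_assoc, mul_assoc, mul_smul_comm, mul_assoc, smul_add, smul_smul, ksign_add,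
        add_assoc]
  | zero => simp
  | add y y' _ _ h1 h2 => simp only [add_mul, map_add, h1, h2, smul_add]; abel
  | smul r y _ h => simp only [smul_mul_assoc, map_smul, h, smul_add, smul_comm r]

theorem env_antipode : ∃ S ∈ homDeg L.envBialg.toDiffMod L.envBialg.toDiffMod 0,
    (∀ x, L.envBialg.mul (TensorProduct.map S LinearMap.id (L.envBialg.comul x)) =
      L.envBialg.counit x • 1) ∧
    (∀ x, L.envBialg.mul (TensorProduct.map LinearMap.id S (L.envBialg.comul x)) =
      L.envBialg.counit x • 1) := by
  obtain ⟨R, hR, R1, R2, R3⟩ := (isRep_lmul (L := L)).exists_action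
  let S : Env L →ₗ[k] Env L := R ∘ₗ TensorProduct.mk k (Env L) (Env L) 1
  have hS : S ∈ homDeg L.envBialg.toDiffMod L.envBialg.toDiffMod 0 := fun i z hz => by
    have := hR _ _ (tmul_mem_tensorGr L.envBialg.toDiffMod L.envBialg.toDiffMod env_one_mem hz
      (zero_add i))
    exact this
  have hmul : ∀ {i x}, x ∈ L.gr i → ∀ {n z}, z ∈ envGr L n → ∀ {j a}, a ∈ envGr L j →
      R ((a * ι L x) ⊗ₜ z) = ksign k (i * n) • (R (a ⊗ₜ z) * ι L x) := by
    intro i x hx n z hz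
    induction hz using Submodule.span_induction with
    | mem z hz =>
      induction hz with
      | one => intros; simp [R1]
      | @cons l n y z hy hz ih =>
        intro j a ha
        have hya : L.ι y * a ∈ envGr L (l + j) := env_mul_mem (ι_mem L hy) ha
        have ha' : a ∈ L.envBialg.gr j := ha
        have hax : a * ι L x ∈ L.envBialg.gr (j + i) := env_mul_mem ha (ι_mem L hx)
        rw [R2, R2, R3 hy, R3 hy, sgn_apply _ _ ha', sgn_apply _ _ hax]
        simp only [map_smul, comp_apply, LinearMap.mul_apply', ← mul_assoc,
          ← smul_tmul', ih hya, smul_mul_assoc, smul_smul, ← ksign_add]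
        congr 1
        exact ksign_congr (by push_cast; grind)
    | zero => intros; simp
    | add y z _ _ h1 h2 =>
      intro j a ha
      rw [tmul_add, tmul_add, map_add, map_add, h1 ha, h2 ha, add_mul,
        smul_add]
    | smul r z _ h =>
      intro j a ha
      rw [tmul_smul, tmul_smul, map_smul, map_smul, h ha,
        smul_mul_assoc, smul_comm]
  have hS1 : S 1 = 1 := R1 1
  have hSι : ∀ {i x}, x ∈ L.gr i → ∀ {n z}, z ∈ envGr L n →
      S (ι L x * z) = ksign k (i * n + 1) • (S z * ι L x) := by
    intro i x hx n z hz
    change R (1 ⊗ₜ (ι L x * z)) = _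
    have h1 : (1 : Env L) ∈ L.envBialg.gr 0 := env_one_mem
    have := hmul hx hz env_one_mem
    rw [one_mul] at this
    rw [R2, R3 hx, sgn_apply _ _ h1, mul_zero, ksign_zero, one_smul, comp_apply,
      LinearMap.mul_apply', mul_one, ← smul_tmul', map_smul, this, smul_smul,
      ← ksign_add, add_comm]
    rfl
  refine ⟨S, hS, fun z => ?_, fun z => ?_⟩
  · refine LinearMap.congr_fun (f := L.envBialg.mul ∘ₗ TensorProduct.map S LinearMap.id ∘ₗ
      L.envBialg.comul) (g := toSpanSingleton k _ 1 ∘ₗ L.envBialg.counit)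
      (env_linear_ext ?_ fun i n x z hx hz _ => ?_) z
    · simp only [comp_apply, envComul_one, map_tmul, hS1, envCounit_one]
      simp [envBialg]
    · simp only [comp_apply, envComul_ι_mul hx, envCounit_ι_mul, map_zero]
      generalize L.envBialg.comul z = t
      induction t using L.envBialg.tensor_induction L.envBialg.toDiffMod with
      | add s s' h1 h2 => simp only [map_add, h1, h2, add_zero]
      | tmul a b y z hy hz =>
        simp only [leib_tmul _ _ _ _ hy, map_add, map_smul, map_tmul, lmul_apply,
          hSι hx hy, ← smul_tmul']
        simp only [envBialg, LinearMap.mul'_apply, id_apply, mul_assoc]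
        rw [← add_smul, add_comm, ksign_add_eq_zero (by push_cast; grind), zero_smul]
  · refine LinearMap.congr_fun (f := L.envBialg.mul ∘ₗ TensorProduct.map LinearMap.id S ∘ₗ
      L.envBialg.comul) (g := toSpanSingleton k _ 1 ∘ₗ L.envBialg.counit)
      (env_linear_ext ?_ fun i n x z hx hz ih => ?_) z
    · simp only [comp_apply, envComul_one, map_tmul, hS1, envCounit_one]
      simp [envBialg]
    · have key : ∀ t ∈ (L.envBialg.tensor L.envBialg.toDiffMod).gr n,
          L.envBialg.mul (TensorProduct.map LinearMap.id S
            (L.envBialg.leib i (lmul x) (lmul x) t)) =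
          ι L x * L.envBialg.mul (TensorProduct.map LinearMap.id S t) + ksign k (i * n + 1) •
            (L.envBialg.mul (TensorProduct.map LinearMap.id S t) * ι L x) := by
        intro t ht
        refine tensorGr_induction (P := fun t => L.envBialg.mul (TensorProduct.map LinearMap.id S
            (L.envBialg.leib i (lmul x) (lmul x) t)) =
          ι L x * L.envBialg.mul (TensorProduct.map LinearMap.id S t) + ksign k (i * n + 1) •
            (L.envBialg.mul (TensorProduct.map LinearMap.id S t) * ι L x)) _ _ t ht ?_ (by simp)
          fun s s' h1 h2 => ?_
        · rintro a b y w hy hw rfl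
          simp only [leib_tmul _ _ _ _ hy, map_add, map_smul, map_tmul, lmul_apply,
            hSι hx hw, id_apply, tmul_smul, smul_smul, ← ksign_add]
          simp only [envBialg, LinearMap.mul'_apply, mul_assoc, mul_add, add_assoc]
        · simp only [map_add, h1, h2, mul_add, add_mul, smul_add]; abel
      have hz' := envBialg_comul_homDeg _ _ hz
      rw [add_zero] at hz'
      simp only [comp_apply, LinearMap.toSpanSingleton_apply] at ih
      simp only [comp_apply, envComul_ι_mul hx, envCounit_ι_mul, map_zero, key _ hz', ih]
      by_cases hn : n = 0
      · rw [hn, mul_smul_comm, smul_mul_assoc, mul_one, one_mul, mul_zero, zero_add, ksign_one]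
        module
      · simp [envCounit_deg hz hn]

theorem isCocommHopf_envBialg (hL : L.IsComplex) : L.envBialg.IsCocommHopf := by
  have hm := envBialg_comul_homDeg (L := L)
  have one := env_one_mem (L := L)
  have c1 : L.envBialg.comul 1 = 1 ⊗ₜ 1 := envComul_one
  have hd : ∀ {i : ℤ} {x : g}, x ∈ L.gr i → ∀ z, L.envBialg.diff (ι L x * z) =
    ι L (L.diff x) * z + ksign k i • (ι L x * L.envBialg.diff z) := fun hx z => envDiff_ι_mul hx z
  have d1 : L.envBialg.diff 1 = 0 := envDiff_one
  refine {
    mul_mem := fun hx hy => env_mul_mem hx hy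
    mul_assoc := fun x y z => mul_assoc (G := Env L) x y z
    one_mem := env_one_mem
    one_mul := fun x => one_mul (M := Env L) x
    mul_one := fun x => mul_one (M := Env L) x
    counit_deg := fun hx hi => envCounit_deg hx hi
    comul_mul := env_comul_mul
    comul_one := envComul_one
    counit_mul := fun x y => map_mul (lift L _ _) x y
    counit_one := envCounit_one
    antipode := env_antipode
    comul_mem := fun {i x} hx => by have := hm i x hx; rwa [add_zero] at this
    isComplex := ?_
    diff_mul := ?_
    coassoc := ?_
    cocomm := ?_
    counit_comul := ?_
    comul_diff := ?_
    counit_diff := ?_ }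
  · refine fun z => LinearMap.congr_fun (f := L.envBialg.diff ∘ₗ L.envBialg.diff) (g := 0)
      (env_linear_ext ?_ fun i n x z hx hz ih => ?_) z
    · rw [comp_apply, d1, map_zero, LinearMap.zero_apply]
    · have hL' : L.diff (L.diff x) = 0 := hL x
      rw [comp_apply, LinearMap.zero_apply] at *
      rw [hd hx, map_add, map_smul, hd hx, hd (L.diff_mem hx), ih, hL', map_zero, zero_mul,
        mul_zero, smul_zero, add_zero, zero_add, ← add_smul, add_comm,
        ksign_add_eq_zero (by push_cast; grind), zero_smul]
  · refine tensor_hom_ext L.envBialg.toDiffMod L.envBialg.toDiffMod fun i j x y hx hy => ?_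
    rw [comp_apply, comp_apply, leib_tmul _ _ _ _ hx, map_add, map_smul,
      one_mul]
    exact env_diff_mul hx y
  · refine env_linear_ext ?_ fun i n x z hx hz ih => ?_
    · simp only [comp_apply, c1, map_tmul, id_apply,
        LinearEquiv.coe_coe, assoc_tmul]
    · have hc : L.envBialg.comul ∘ₗ lmul x = L.envBialg.leib i (lmul x) (lmul x) ∘ₗ L.envBialg.comul :=
        LinearMap.ext fun z => envComul_ι_mul hx z
      have e1 := fun t => LinearMap.congr_fun (map_comp_leib hm i (g := LinearMap.id) hc
        (D' := lmul (L := L) x) (E' := lmul (L := L) x) rfl) t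
      have e2 := fun t => LinearMap.congr_fun (map_comp_leib (id_homDeg L.envBialg.toDiffMod) i
        (D := lmul (L := L) x) (E := lmul (L := L) x) rfl hc) t
      have e3 := fun t => LinearMap.congr_fun (assoc_comp_leib L.envBialg.toDiffMod
        L.envBialg.toDiffMod i (lmul x) (lmul x) (lmul (L := L) x)) t
      simp only [comp_apply] at e1 e2 e3 ih ⊢
      rw [envComul_ι_mul hx, e1, e2, e3, ih]
  · refine env_linear_ext ?_ fun i n x z hx hz ih => ?_
    · rw [comp_apply, c1, twist_apply L.envBialg.toDiffMod L.envBialg.toDiffMod one one,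
        mul_zero, ksign_zero, one_smul]
    · have e := LinearMap.congr_fun (twist_comp_leib (lmul_mem hx) (lmul_mem hx))
        (L.envBialg.comul z)
      simp only [comp_apply] at e ih ⊢
      rw [envComul_ι_mul hx, e, ih]
  · refine env_linear_ext ?_ fun i n x z hx hz ih => ?_
    · simp only [comp_apply, c1, map_tmul, id_apply,
        LinearEquiv.coe_coe, TensorProduct.lid_tmul, envCounit_one, one_smul]
    · simp only [comp_apply, envComul_ι_mul hx, id_apply] at ih ⊢
      conv_rhs => rw [← ih]
      generalize L.envBialg.comul z = t
      induction t using L.envBialg.tensor_induction L.envBialg.toDiffMod with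
      | add s s' h1 h2 => simp only [map_add, h1, h2, mul_add]
      | tmul a b y z hy hz =>
        simp only [leib_tmul _ _ _ _ hy, map_add, map_smul, map_tmul, lmul_apply,
          envCounit_ι_mul, id_apply, LinearEquiv.coe_coe, TensorProduct.lid_tmul,
          zero_smul, zero_add, mul_smul_comm]
        by_cases ha : a = 0
        · rw [ha, mul_zero, ksign_zero, one_smul]
        · rw [envCounit_deg hy ha, zero_smul]; simp
  · refine env_linear_ext ?_ fun i n x z hx hz ih => ?_
    · rw [comp_apply, comp_apply, d1, map_zero, c1]
      have h1 : (1 : Env L) ∈ L.envBialg.gr 0 := one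
      rw [leib_tmul _ _ _ _ h1, d1]
      simp
    · have e := LinearMap.congr_fun (leib_gcomm L.envBialg.toDiffMod (n := 1)
        (D := L.envBialg.diff) (fun i x hx => L.envBialg.diff_mem hx) (lmul_mem hx))
        (L.envBialg.comul z)
      have h1 : gcomm 1 i L.envBialg.diff (lmul x) = lmul (L.diff x) := env_gcomm_diff hx
      rw [h1, gcomm_apply, add_comm 1 i] at e
      simp only [comp_apply] at ih ⊢
      rw [hd hx, map_add, map_smul, envComul_ι_mul (L.diff_mem hx), ← e, envComul_ι_mul hx,
        envComul_ι_mul hx, ih, one_mul, sub_add_cancel]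
  · refine env_linear_ext ?_ fun i n x z hx hz ih => ?_
    · rw [comp_apply, d1, map_zero, LinearMap.zero_apply]
    · rw [comp_apply, hd hx, map_add, map_smul, envCounit_ι_mul, envCounit_ι_mul,
        smul_zero, add_zero, LinearMap.zero_apply]

end GLie

section toDCoalg
variable {k : Type u} [Field k] {A : Type v} [AddCommGroup A] [Module k A] {a : BialgData k A}

/-- A bialgebra as a coalgebra with zero cobracket. -/
def BialgData.toDCoalg (a : BialgData k A) : DCoalgData k A where
  toDiffMod := a.toDiffMod
  comul := a.comul
  cobr := 0
  counit := a.counit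
  one := a.one

theorem BialgData.IsCocommHopf.isDCoalgebra (ha : a.IsCocommHopf) (d : ℤ) :
    a.toDCoalg.IsDCoalgebra d where
  isComplex := ha.isComplex
  comul_mem := ha.comul_mem
  coassoc := ha.coassoc
  cocomm := ha.cocomm
  counit_deg := ha.counit_deg
  counit_comul := ha.counit_comul
  cobr_mem _ := Submodule.zero_mem _
  cobr_symm := by simp [toDCoalg]
  cojacobi _ := by simp [toDCoalg]
  coleibniz := by simp [toDCoalg]
  counit_cobr := by simp [toDCoalg]
  diff_coder := by
    refine ⟨fun i x hx => a.diff_mem hx, ha.comul_diff, ?_⟩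
    simp [toDCoalg]

end toDCoalg

namespace GLie
variable {k : Type u} [Field k] {g : Type v} [AddCommGroup g] [Module k g] {L : GLie k g}

/-- The enveloping algebra as a coalgebra with zero cobracket. -/
abbrev envCoalg (L : GLie k g) : DCoalgData k (Env L) := L.envBialg.toDCoalg

theorem isCoaugmented_envCoalg : L.envCoalg.IsCoaugmented where
  one_mem := env_one_mem
  counit_one := envCounit_one
  comul_one := envComul_one
  cobr_one := rfl
  diff_one := envDiff_one

theorem env_red_ι_mul {i : ℤ} {x : g} (hx : x ∈ L.gr i) (z : Env L) :
    L.envCoalg.red (ι L x * z) = L.envBialg.leib i (lmul x) (lmul x) (L.envCoalg.red z) +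
      ι L x ⊗ₜ z + L.envBialg.sgn i z ⊗ₜ ι L x := by
  have h1 : (1 : Env L) ∈ L.envBialg.gr 0 := env_one_mem
  have e : L.envBialg.comul z = L.envCoalg.red z + 1 ⊗ₜ z + z ⊗ₜ 1 :=
    comul_eq L.envCoalg z
  rw [red_apply]
  change L.envBialg.comul (ι L x * z) - 1 ⊗ₜ (ι L x * z) - (ι L x * z) ⊗ₜ 1 = _
  rw [envComul_ι_mul hx, e, map_add, map_add, leib_tmul _ _ _ _ h1, mul_zero, ksign_zero, one_smul]
  simp only [DiffMod.leib, LinearMap.add_apply, map_tmul, lmul_apply, mul_one,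
    id_apply]
  abel

theorem ι_mul_mem_corad (hL : L.IsComplex) {i : ℤ} {x : g} (hx : x ∈ L.gr i) {n : ℕ} :
    ∀ {z : Env L}, z ∈ L.envCoalg.corad n → ι L x * z ∈ L.envCoalg.corad (n + 1) := by
  have h1 := isCoaugmented_envCoalg (L := L)
  have hc := (isCocommHopf_envBialg hL).isDCoalgebra 0
  have hι : ι L x ∈ L.envCoalg.corad 1 := by
    refine mem_corad_succ.2 ⟨?_, Submodule.zero_mem _⟩
    have h1' : (1 : Env L) ∈ L.envBialg.gr 0 := env_one_mem
    have e : L.envBialg.comul (ι L x) = ι L x ⊗ₜ 1 + 1 ⊗ₜ ι L x := by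
      have e := envComul_ι_mul hx 1
      rwa [envComul_one, leib_tmul _ _ _ _ h1', mul_zero, ksign_zero, one_smul, lmul_apply,
        mul_one] at e
    rw [red_apply]
    change L.envBialg.comul (ι L x) - 1 ⊗ₜ ι L x - ι L x ⊗ₜ 1 ∈ _
    have h0 : ∀ a b : Env L ⊗[k] Env L, a + b - b - a = 0 := fun a b => by abel
    rw [e, h0]
    exact Submodule.zero_mem _
  induction n with
  | zero =>
    intro z hz
    obtain ⟨r, rfl⟩ := Submodule.mem_span_singleton.1 hz
    change ι L x * (r • 1) ∈ _
    rw [mul_smul_comm, mul_one]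
    exact Submodule.smul_mem _ _ hι
  | succ n ih =>
    intro z hz
    refine mem_corad_succ.2 ⟨?_, Submodule.zero_mem _⟩
    have hm := h1.corad_mono (Nat.le_succ n)
    have hH := h1.isHomog_corad hc
    have hι' := h1.corad_mono (show 1 ≤ n + 1 by omega) hι
    have hr := (mem_corad_succ.1 hz).1
    rw [env_red_ι_mul hx]
    refine Submodule.add_mem _ (Submodule.add_mem _ (Submodule.add_mem _ ?_ ?_) ?_) ?_
    · exact map_mem_tensorSub (fun y hy => ih hy) (fun y hy => hm hy) hr
    · exact map_mem_tensorSub (fun y hy => hm ((hH n).sgn_mem _ hy)) (fun y hy => ih hy) hr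
    · exact tmul_mem_tensorSub hι' hz
    · exact tmul_mem_tensorSub ((hH (n + 1)).sgn_mem _ hz) hι'

theorem isCoproartinian_envCoalg (hL : L.IsComplex) : L.envCoalg.IsCoproartinian := by
  have h1 := isCoaugmented_envCoalg (L := L)
  have hc := (isCocommHopf_envBialg hL).isDCoalgebra 0
  have key : ∀ z : Env L, ∃ n, z ∈ L.envCoalg.corad n := fun z => by
    induction z using env_induction with
    | one => exact ⟨0, h1.one_mem_corad 0⟩
    | cons i n x z hx hz ih => exact ih.elim fun n hn => ⟨n + 1, ι_mul_mem_corad hL hx hn⟩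
    | smul r z ih => exact ih.elim fun n hn => ⟨n, Submodule.smul_mem _ r hn⟩
    | add y z h2 h3 =>
      obtain ⟨⟨n, hn⟩, ⟨m, hm⟩⟩ := And.intro h2 h3
      exact ⟨max n m, Submodule.add_mem _ (h1.corad_mono (le_max_left _ _) hn)
        (h1.corad_mono (le_max_right _ _) hm)⟩
  refine h1.isCoproartinian hc (eq_top_iff.2 fun z _ => ?_)
  obtain ⟨n, hn⟩ := key z
  exact Submodule.mem_iSup_of_mem n hn

end GLie

namespace GLie
section action
variable {k : Type u} [Field k] {g : Type v} [AddCommGroup g] [Module k g]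
  {L : GLie k g} {W : Type w} [AddCommGroup W] [Module k W] {c : DCoalgData k W} {d : ℤ}

/-- A representation by coderivations gives an action of the enveloping algebra which is a morphism
of coalgebras. -/
theorem isHom_action (hc : c.IsDCoalgebra d) {ρ : g →ₗ[k] W →ₗ[k] W}
    (hρ : ∀ {i x}, x ∈ L.gr i → IsCoder d c i (ρ x))
    (hd : ∀ {i x}, x ∈ L.gr i → ρ (L.diff x) = gcomm 1 i c.diff (ρ x))
    {R : W ⊗[k] Env L →ₗ[k] W}
    (hR : R ∈ homDeg (c.toDiffMod.tensor L.envBialg.toDiffMod) c.toDiffMod 0)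
    (R1 : ∀ m, R (m ⊗ₜ 1) = m) (R2 : ∀ m y z, R (m ⊗ₜ (y * z)) = R (R (m ⊗ₜ y) ⊗ₜ z))
    (R3 : ∀ {i x}, x ∈ L.gr i → ∀ m, R (m ⊗ₜ ι L x) = ksign k 1 • ρ x (c.sgn i m)) :
    IsHom (c.tensor d L.envCoalg) c R := by
  have one := env_one_mem (L := L)
  have h2 : ∀ t, TensorProduct.map R R (mid c.toDiffMod L.envBialg.toDiffMod
      (t ⊗ₜ (1 ⊗ₜ 1))) = t := by
    intro t
    induction t using induction_on with
    | zero => simp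
    | tmul a b => rw [mid_one_left _ L.envBialg.toDiffMod one]; simp [R1]
    | add s t h1 h2 => rw [add_tmul, map_add, map_add, h1, h2]
  have key : ∀ {i x}, x ∈ L.gr i → ∀ t s, TensorProduct.map R R
      (mid c.toDiffMod L.envBialg.toDiffMod (t ⊗ₜ L.envBialg.leib i (lmul x) (lmul x) s)) =
      TensorProduct.map R R (mid c.toDiffMod L.envBialg.toDiffMod
        ((ksign k 1 • c.leib i (ρ x) (ρ x) ((c.toDiffMod.tensor c.toDiffMod).sgn i t)) ⊗ₜ s)) := by
    intro i x hx t s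
    induction t using c.tensor_induction c.toDiffMod with
    | add t t' h1 h2 => simp only [map_add, smul_add, add_tmul, h1, h2]
    | tmul α β a b ha hb =>
      induction s using L.envBialg.tensor_induction L.envBialg.toDiffMod with
      | add s s' h1 h2 => simp only [map_add, tmul_add, h1, h2]
      | tmul γ ζ y z hy hz =>
        have hab : a ⊗ₜ b ∈ (c.toDiffMod.tensor c.toDiffMod).gr (α + β) :=
          tmul_mem_tensorGr _ _ ha hb rfl
        have hy' := lmul_mem hx _ _ hy
        have hDb := (hρ hx).deg _ _ hb
        rw [leib_tmul _ _ _ _ hy, sgn_apply _ _ hab, map_smul, leib_tmul _ _ _ _ ha]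
        simp only [tmul_add, tmul_smul, add_tmul,
          ← smul_tmul', map_add, map_smul, smul_add,
          mid_tmul _ _ a z hb hy', mid_tmul _ _ a (lmul x z) hb hy, smul_smul,
          mid_tmul _ _ (ρ x a) z hb hy, mid_tmul _ _ a z hDb hy, map_tmul, ← ksign_add]
        simp only [lmul_apply, R2, R3 hx, sgn_apply _ _ ha, sgn_apply _ _ hb, map_smul, smul_smul,
          ← smul_tmul', tmul_smul, ← ksign_add]
        congr 2 <;> exact ksign_congr (by push_cast; grind)
  have hR3 : ∀ {i x}, x ∈ L.gr i → ∀ w z, R (w ⊗ₜ (ι L x * z)) =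
      R ((ksign k 1 • ρ x (c.sgn i w)) ⊗ₜ z) := fun hx w z => by rw [R2, R3 hx]
  have hcm : ∀ {i x}, x ∈ L.gr i → ∀ w, c.comul (ksign k 1 • ρ x (c.sgn i w)) =
      ksign k 1 • c.leib i (ρ x) (ρ x) ((c.toDiffMod.tensor c.toDiffMod).sgn i (c.comul w)) := by
    intro i x hx w
    have e1 := LinearMap.congr_fun (hρ hx).comul (c.sgn i w)
    have e2 := LinearMap.congr_fun (sgn_comp hc.comul_homDeg i) w
    simp only [comp_apply] at e1 e2
    rw [map_smul, e1, e2]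
  have hcb : ∀ {i x}, x ∈ L.gr i → ∀ w, c.cobr (ksign k 1 • ρ x (c.sgn i w)) =
      ksign k 1 • c.leib i (ρ x) (ρ x) ((c.toDiffMod.tensor c.toDiffMod).sgn i (c.cobr w)) := by
    intro i x hx w
    have e1 := LinearMap.congr_fun (hρ hx).cobr (c.sgn i w)
    have e2 := LinearMap.congr_fun (sgn_comp_homDeg hc.cobr_homDeg i) w
    simp only [comp_apply, LinearMap.smul_apply] at e1 e2
    rw [map_smul, e1, e2]
    simp only [map_smul]
  have hε : ∀ {i x}, x ∈ L.gr i → ∀ w, c.counit (ρ x w) = 0 := fun hx w =>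
    LinearMap.congr_fun ((isCoderAlong_id.2 (hρ hx)).counit hc hc (IsGradedHom.id c)) w
  refine ⟨⟨hR, ?_, ?_, ?_⟩, ?_⟩
  · refine ext' fun w z => ?_
    change c.comul (R (w ⊗ₜ z)) = TensorProduct.map R R (mid c.toDiffMod L.envBialg.toDiffMod
      (c.comul w ⊗ₜ L.envBialg.comul z))
    induction z using env_induction generalizing w with
    | one => rw [R1, envComul_one, h2]
    | cons i n x z hx hz ih => rw [hR3 hx, ih, envComul_ι_mul hx, key hx, hcm hx]
    | smul r z ih => simp only [map_smul, tmul_smul, ih]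
    | add y z h1 h2 => simp only [map_add, tmul_add, h1, h2]
  · refine ext' fun w z => ?_
    rw [comp_apply, comp_apply, tensor_cobr_tmul]
    change c.cobr (R (w ⊗ₜ z)) = TensorProduct.map R R (mid c.toDiffMod L.envBialg.toDiffMod
      (c.cobr w ⊗ₜ L.envBialg.comul z) + mid c.toDiffMod L.envBialg.toDiffMod
        (c.comul (c.sgn (d - 1) w) ⊗ₜ 0))
    rw [tmul_zero, map_zero, add_zero]
    induction z using env_induction generalizing w with
    | one => rw [R1, envComul_one, h2]
    | cons i n x z hx hz ih => rw [hR3 hx, ih, envComul_ι_mul hx, key hx, hcb hx]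
    | smul r z ih => simp only [map_smul, tmul_smul, ih]
    | add y z h1 h2 => simp only [map_add, tmul_add, h1, h2]
  · refine ext' fun w z => ?_
    rw [comp_apply, tensor_counit_tmul]
    change _ = c.counit w * L.envBialg.counit z
    induction z using env_induction generalizing w with
    | one => rw [R1, envCounit_one, mul_one]
    | cons i n x z hx hz ih =>
      rw [hR3 hx, ih, envCounit_ι_mul, map_smul, hε hx, smul_zero, zero_mul, mul_zero]
    | smul r z ih => simp only [map_smul, tmul_smul, ih, smul_eq_mul]; ring
    | add y z h1 h2 => simp only [map_add, tmul_add, h1, h2, mul_add]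
  · refine ext' fun w z => ?_
    induction z using env_induction generalizing w with
    | one =>
      induction w using c.induction with
      | add w w' h1 h2 => simp only [add_tmul, map_add, h1, h2]
      | hom j w hw =>
        rw [comp_apply, comp_apply, tensor_diff_tmul hw, R1]
        change _ = R (_ + _ • _ ⊗ₜ envDiff L 1)
        rw [envDiff_one, tmul_zero, smul_zero, add_zero, R1]
    | cons i n x z hx hz ih =>
      induction w using c.induction with
      | add w w' h1 h2 => simp only [add_tmul, map_add, h1, h2]
      | hom j w hw =>
        have e := ih (ksign k 1 • ρ x (c.sgn i w))
        have h1 : ksign k 1 • ρ x (c.sgn i w) ∈ c.gr (j + i) :=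
          Submodule.smul_mem _ _ ((hρ hx).deg _ _ (c.sgn_mem _ hw))
        have hdw := c.diff_mem hw
        simp only [comp_apply, tensor_diff_tmul hw, tensor_diff_tmul h1] at e ⊢
        rw [hR3 hx, e]
        change R (_ + _ • _ ⊗ₜ envDiff L z) = R (_ + _ • _ ⊗ₜ envDiff L (ι L x * z))
        rw [envDiff_ι_mul hx]
        simp only [map_add, tmul_add, tmul_smul, hR3 hx, smul_add,
          hR3 (L.diff_mem hx), hd hx, sgn_apply _ _ hw, sgn_apply _ _ hdw, map_smul,
          ← smul_tmul', smul_smul, ← ksign_add, gcomm_apply, TensorProduct.sub_tmul,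
          map_sub, smul_sub]
        have e1 : ksign k (1 + i * (j + 1)) = ksign k (j + (1 + ((i + 1) * j + 1 * i))) :=
          ksign_congr (by push_cast; grind)
        have e2 : ksign k (1 + i * j) = ksign k (j + (1 + ((i + 1) * j))) :=
          ksign_congr (by push_cast; grind)
        have e3 : ksign k (j + i + (1 + i * j)) = ksign k (j + (i + (1 + i * j))) :=
          ksign_congr (by push_cast; grind)
        rw [e1, e2, e3]
        abel
    | smul r z ih => simp only [map_smul, tmul_smul, ih]
    | add y z h1 h2 => simp only [map_add, tmul_add, h1, h2]

end action
end GLie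

section
variable {k : Type u} [Field k] [CharZero k] {d : ℤ} {W : Type v} [AddCommGroup W] [Module k W]
  {c : DCoalgData k W}

/-- The right action of `U(def)` by coderivations. -/
theorem exists_envAction (hc : c.IsDCoalgebra d) : ∃ R : W ⊗[k] (defLie hc).Env →ₗ[k] W,
    IsHom (c.tensor d (defLie hc).envCoalg) c R ∧ (∀ w, R (w ⊗ₜ 1) = w) ∧
    (∀ w y z, R (w ⊗ₜ (y * z)) = R (R (w ⊗ₜ y) ⊗ₜ z)) ∧
    ∀ (n i : ℤ) (D : W →ₗ[k] W) (hD : D ∈ coder d c n), ∀ w ∈ c.gr i,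
      R (w ⊗ₜ (defLie hc).ι (coderEl n hD)) = -(ksign k (n * i) • D w) := by
  let ρ : CoderSpace d c →ₗ[k] W →ₗ[k] W :=
    DirectSum.toModule k ℤ _ fun n => (coder d c n).subtype
  have hρ : ∀ {n} {D : W →ₗ[k] W} (hD : D ∈ coder d c n), ρ (coderEl n hD) = D := fun hD =>
    DirectSum.toModule_lof _ _ _
  have hmem : ∀ {n : ℤ} {D : W →ₗ[k] W} (hD : D ∈ coder d c n),
      coderEl n hD ∈ (defLie hc).gr n := fun hD => ⟨⟨_, hD⟩, rfl⟩
  have hrep : GLie.IsRep (defLie hc) c.toDiffMod ρ := by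
    constructor
    · rintro i _ ⟨⟨D, hD⟩, rfl⟩
      exact (hρ hD).symm ▸ hD.deg
    · rintro i j _ _ ⟨⟨D, hD⟩, rfl⟩ ⟨⟨E, hE⟩, rfl⟩
      change ρ (coderBracket d c (coderEl i hD) (coderEl j hE)) =
        gcomm i j (ρ (coderEl i hD)) (ρ (coderEl j hE))
      rw [coderBracket_el, hρ, hρ, hρ]
  obtain ⟨R, hR, R1, R2, R3⟩ := hrep.exists_action
  refine ⟨R, GLie.isHom_action hc (ρ := ρ) ?_ ?_ hR R1 R2 R3, R1, R2, fun n i D hD w hw => ?_⟩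
  · rintro i _ ⟨⟨D, hD⟩, rfl⟩
    exact (hρ hD).symm ▸ hD
  · rintro i _ ⟨⟨D, hD⟩, rfl⟩
    change ρ ((DiffMod.ofFamily (fun n => coder d c n) (coderDiff hc)).diff (coderEl i hD)) =
      gcomm 1 i c.diff (ρ (coderEl i hD))
    rw [coderDiff_el, hρ, hρ]
  · rw [R3 (hmem hD), hρ, sgn_apply _ _ hw, map_smul, ksign_one, neg_one_smul]

end

namespace GLie
variable {k : Type u} [Field k] {g : Type v} [AddCommGroup g] [Module k g] {L : GLie k g}

theorem isHom_envMul (hL : L.IsComplex) (d : ℤ) :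
    IsHom (L.envCoalg.tensor d L.envCoalg) L.envCoalg L.envBialg.mul := by
  have hU := isCocommHopf_envBialg hL
  refine ⟨⟨fun n t ht => ?_, hU.comul_mul, ?_, ?_⟩, hU.diff_mul⟩
  · refine tensorGr_induction (P := fun t => L.envBialg.mul t ∈ L.envBialg.gr (n + 0)) _ _ t ht
      ?_ (by rw [map_zero]; exact Submodule.zero_mem _)
      (fun x y h1 h2 => by rw [map_add]; exact Submodule.add_mem _ h1 h2)
    rintro i j x y hx hy rfl
    rw [add_zero]
    exact hU.mul_mem hx hy
  · simp [DCoalgData.tensor, BialgData.toDCoalg]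
  · refine ext' fun y z => ?_
    rw [comp_apply, tensor_counit_tmul]
    exact hU.counit_mul y z

end GLie

section
variable {k : Type u} [Field k] [CharZero k] {d : ℤ} {V : Type u} [AddCommGroup V] [Module k V]
  {A : DAlgebra k d V} {W : Type u} [AddCommGroup W] [Module k W] {c : DCoalgData k W}
  {p : W →ₗ[k] V} {H : Type u} [AddCommGroup H] [Module k H] {h : DCoalgData k H}
  {μ : W ⊗[k] H →ₗ[k] W} {m : H ⊗[k] H →ₗ[k] H}

/-- The classifying map of the action of `U(def(V))`. -/
theorem IsHomId.exists_envHom (hW : IsBar A c p) (hμ : IsHomId d c h μ)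
    (hm : IsComposition d h μ m) : ∃ Ψ : hW.lie.Env →ₗ[k] H, IsHom hW.lie.envCoalg h Ψ ∧
      Ψ ∘ₗ hW.lie.envBialg.mul = m ∘ₗ TensorProduct.map Ψ Ψ ∧
      ∀ (n i : ℤ) (D : W →ₗ[k] W) (hD : D ∈ coder d c n), ∀ w ∈ c.gr i,
        μ (w ⊗ₜ Ψ (hW.lie.ι (coderEl n hD))) = -(ksign k (n * i) • D w) := by
  obtain ⟨R, hR, R1, R2, R3⟩ := exists_envAction hW.isDCoalgebra
  have hL := hW.lie_isComplex
  have hU := (GLie.isCocommHopf_envBialg hL).isDCoalgebra d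
  have hU' := GLie.isCoproartinian_envCoalg hL
  obtain ⟨Ψ, ⟨hΨ, e⟩, -⟩ := hμ.universal _ hW.lie.envCoalg hU hU' R ⟨hR, R1⟩
  have e' : ∀ w z, μ (w ⊗ₜ Ψ z) = R (w ⊗ₜ z) := fun w z => LinearMap.congr_fun e (w ⊗ₜ z)
  refine ⟨Ψ, hΨ, ?_, fun n i D hD w hw => (e' _ _).trans (R3 n i D hD w hw)⟩
  have h1 := hm.isHom.comp (hΨ.tensorMap (d := d) hΨ)
  have hUU := GLie.isCoaugmented_envCoalg (L := hW.lie)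
  refine (hμ.hom_ext (hU.tensor hU) (hU'.tensor hU hU hU') h1 (hΨ.comp (GLie.isHom_envMul hL d))
    (h1.toIsGradedHom.map_one (hUU.tensor (d := d) hUU) hμ.isDCoalgebra hμ.isCoproartinian)
    fun w t => ?_).symm
  induction t using induction_on with
  | zero => simp
  | tmul y z =>
    have e2 := LinearMap.congr_fun hm.comp ((w ⊗ₜ Ψ y) ⊗ₜ Ψ z)
    simp only [comp_apply, map_tmul, LinearEquiv.coe_coe,
      assoc_tmul, id_apply, e'] at e2
    rw [comp_apply, map_tmul, e2, comp_apply, e']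
    exact (R2 w y z).symm
  | add s t h1 h2 => simp only [map_add, tmul_add, h1, h2]

end

section
variable {k : Type u} [Field k] {d : ℤ} {S : Type v} [AddCommGroup S] [Module k S]
  {s : DCoalgData k S} {H : Type w} [AddCommGroup H] [Module k H] {h : DCoalgData k H}

theorem isSubcoalgebra_coreC : IsSubcoalgebra h (coreC h) :=
  isSubcoalgebra_largestSub (K := LinearMap.ker h.cobr)

theorem cobr_of_mem_coreC {x : H} (hx : x ∈ coreC h) : h.cobr x = 0 :=
  largestSub_le (K := LinearMap.ker h.cobr) hx

/-- The image of a cocommutative coalgebra lies in the core. -/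
theorem DCoalgData.IsGradedHom.mem_coreC {g : S →ₗ[k] H} (hg : IsGradedHom s h g)
    (hh : h.IsDCoalgebra d) (hs : s.cobr = 0) (x : S) :
    g x ∈ coreC h := by
  let T : Submodule k H := LinearMap.range g ⊔ (LinearMap.range g).map h.diff
  have hg1 : ∀ x, g x ∈ T := fun x => Submodule.mem_sup_left ⟨x, rfl⟩
  have hg2 : ∀ x, h.diff (g x) ∈ T := fun x =>
    Submodule.mem_sup_right (Submodule.mem_map_of_mem ⟨x, rfl⟩)
  have hle : ∀ {U : Submodule k H}, (∀ i, ∀ x ∈ s.gr i, g x ∈ U) →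
      (∀ i, ∀ x ∈ s.gr i, h.diff (g x) ∈ U) → T ≤ U := by
    intro U h1 h2
    refine sup_le ?_ ?_
    · rintro _ ⟨x, rfl⟩
      induction x using s.induction with
      | hom i x hx => exact h1 i x hx
      | add x y hx hy => rw [map_add]; exact Submodule.add_mem _ hx hy
    · rintro _ ⟨_, ⟨x, rfl⟩, rfl⟩
      induction x using s.induction with
      | hom i x hx => exact h2 i x hx
      | add x y hx hy => rw [map_add, map_add]; exact Submodule.add_mem _ hx hy
  have hdeg : ∀ i, ∀ x ∈ s.gr i, g x ∈ h.gr i := fun i x hx => by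
    have := hg.deg i x hx; rwa [add_zero] at this
  have hΔ : ∀ x, h.comul (g x) = TensorProduct.map g g (s.comul x) := LinearMap.congr_fun hg.comul
  have hδ : ∀ x, h.cobr (g x) = 0 := fun x => by
    have := LinearMap.congr_fun hg.cobr x
    rwa [comp_apply, comp_apply, hs, LinearMap.zero_apply, map_zero] at this
  have hdδ : ∀ x, h.cobr (h.diff (g x)) = 0 := fun x => by
    have := LinearMap.congr_fun hh.diff_coder.cobr (g x)
    rwa [LinearMap.smul_apply, comp_apply, comp_apply, hδ, map_zero,
      smul_zero] at this
  have hker : T ≤ LinearMap.ker h.cobr := hle (fun i x _ => hδ x) fun i x _ => hdδ x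
  suffices hT : IsSubcoalgebra h T from
    (le_sSup (show T ∈ {S | IsSubcoalgebra h S ∧ S ≤ LinearMap.ker h.cobr} from ⟨hT, hker⟩) :
      T ≤ coreC h) (hg1 x)
  refine ⟨?_, ?_, ?_, ?_⟩
  · exact hle (fun i x hx => Submodule.mem_iSup_of_mem i ⟨hg1 x, hdeg i x hx⟩)
      fun i x hx => Submodule.mem_iSup_of_mem (i + 1) ⟨hg2 x, h.diff_mem (hdeg i x hx)⟩
  · refine fun y hy => hle (U := T.comap h.diff) (fun i x _ => hg2 x) (fun i x _ => ?_) hy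
    have h0 : h.diff (h.diff (g x)) = 0 := hh.isComplex _
    rw [Submodule.mem_comap, h0]
    exact Submodule.zero_mem _
  · refine fun y hy => hle (U := (tensorSub T T).comap h.comul) (fun i x _ => ?_)
      (fun i x hx => ?_) hy
    · rw [Submodule.mem_comap, hΔ]
      generalize s.comul x = t
      induction t using induction_on with
      | zero => rw [map_zero]; exact Submodule.zero_mem _
      | tmul y z => exact tmul_mem_tensorSub (hg1 y) (hg1 z)
      | add t t' h1 h2 => rw [map_add]; exact Submodule.add_mem _ h1 h2
    · have := LinearMap.congr_fun hh.diff_coder.comul (g x)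
      rw [comp_apply, comp_apply, hΔ] at this
      rw [Submodule.mem_comap, this]
      generalize s.comul x = t
      induction t using s.tensor_induction s.toDiffMod with
      | tmul a b y z hy hz =>
        rw [map_tmul, leib_tmul _ _ _ _ (hdeg a y hy)]
        exact Submodule.add_mem _ (tmul_mem_tensorSub (hg2 y) (hg1 z))
          (Submodule.smul_mem _ _ (tmul_mem_tensorSub (hg1 y) (hg2 z)))
      | add t t' h1 h2 => rw [map_add, map_add]; exact Submodule.add_mem _ h1 h2
  · intro y hy
    rw [LinearMap.mem_ker.1 (hker hy)]
    exact Submodule.zero_mem _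

end

namespace GLie
section conv
variable {k : Type u} [Field k] {g : Type v} [AddCommGroup g] [Module k g] {L : GLie k g}
  {S : Type w} [AddCommGroup S] [Module k S] {a : DCoalgData k S} {φ : S →ₗ[k] g}

/-- The summands of the convolution exponential of `φ`, with values in the enveloping algebra. -/
def convExp (L : GLie k g) (a : DCoalgData k S) (φ : S →ₗ[k] g) : ℕ → S →ₗ[k] Env L
  | 0 => toSpanSingleton k (Env L) 1 ∘ₗ a.counit
  | n + 1 => ((n + 1 : ℕ) : k)⁻¹ •
      (L.envBialg.mul ∘ₗ TensorProduct.map (ι L ∘ₗ φ) (convExp L a φ n) ∘ₗ a.comul)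

theorem convExp_zero_apply (x : S) : convExp L a φ 0 x = a.counit x • 1 := rfl

theorem convExp_succ_apply (n : ℕ) (x : S) : convExp L a φ (n + 1) x = ((n + 1 : ℕ) : k)⁻¹ •
    L.envBialg.mul (TensorProduct.map (ι L ∘ₗ φ) (convExp L a φ n) (a.comul x)) := rfl

theorem mul_convExp [CharZero k] (n : ℕ) :
    L.envBialg.mul ∘ₗ TensorProduct.map (ι L ∘ₗ φ) (convExp L a φ n) ∘ₗ a.comul =
      ((n + 1 : ℕ) : k) • convExp L a φ (n + 1) := by
  rw [convExp, smul_smul, mul_inv_cancel₀ (Nat.cast_ne_zero.2 n.succ_ne_zero), one_smul]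

theorem convExp_comp {T : Type*} [AddCommGroup T] [Module k T] {b : DCoalgData k T}
    {f : T →ₗ[k] S} (hf : IsGradedHom b a f) (n : ℕ) :
    convExp L b (φ ∘ₗ f) n = convExp L a φ n ∘ₗ f := by
  induction n with
  | zero => rw [convExp, convExp, comp_assoc, hf.counit]
  | succ n ih =>
    rw [convExp, ih, convExp, smul_comp, comp_assoc, comp_assoc,
      hf.comul, ← comp_assoc (g := TensorProduct.map f f), ← map_comp]
    rfl

theorem convExp_homDeg {d : ℤ} (ha : a.IsDCoalgebra d)
    (hφ : φ ∈ homDeg a.toDiffMod L.toDiffMod 0) (n : ℕ) :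
    convExp L a φ n ∈ homDeg a.toDiffMod L.envBialg.toDiffMod 0 := by
  have hι : ι L ∈ homDeg L.toDiffMod L.envBialg.toDiffMod 0 := fun i x hx => by
    rw [add_zero]; exact ι_mem L hx
  induction n with
  | zero => exact (isCoaugmented_envCoalg.isGradedHom_trivial ha).deg
  | succ n ih =>
    refine Submodule.smul_mem _ _ fun i x hx => ?_
    have h := map_mem_tensorGr (homDeg_comp_zero hι hφ) ih (ha.comul_mem hx)
    refine tensorGr_induction (P := fun t => L.envBialg.mul t ∈ L.envBialg.gr _) _ _ _ h
      ?_ (by rw [map_zero]; exact Submodule.zero_mem _)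
      (fun x y h1 h2 => by rw [map_add]; exact Submodule.add_mem _ h1 h2)
    rintro p q y z hy hz h
    rw [show i + 0 = p + q by omega]
    exact env_mul_mem hy hz

theorem convExp_diff {d : ℤ} (ha : a.IsDCoalgebra d)
    (hφ : φ ∈ homDeg a.toDiffMod L.toDiffMod 0) (hd : L.diff ∘ₗ φ = φ ∘ₗ a.diff) (n : ℕ) :
    L.envBialg.diff ∘ₗ convExp L a φ n = convExp L a φ n ∘ₗ a.diff := by
  have hι : ι L ∈ homDeg L.toDiffMod L.envBialg.toDiffMod 0 := fun i x hx => by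
    rw [add_zero]; exact ι_mem L hx
  have hdι : (ι L ∘ₗ φ) ∘ₗ a.diff = L.envBialg.diff ∘ₗ ι L ∘ₗ φ := by
    rw [comp_assoc, ← hd]
    exact LinearMap.ext fun x => (envDiff_ι _).symm
  have hd1 : L.envBialg.diff 1 = 0 := envDiff_one
  induction n with
  | zero =>
    refine LinearMap.ext fun x => ?_
    have h0 := LinearMap.congr_fun
      ((isCoderAlong_id.2 ha.diff_coder).counit ha ha (IsGradedHom.id a)) x
    simp only [comp_apply, LinearMap.zero_apply, convExp_zero_apply] at h0 ⊢
    rw [map_smul, hd1, h0, zero_smul, smul_zero]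
  | succ n ih =>
    have e1 := fun t => LinearMap.congr_fun
      (map_comp_leib (homDeg_comp_zero hι hφ) 1 hdι ih.symm) t
    have e2 := LinearMap.congr_fun ha.diff_coder.comul
    have e3 : ∀ t, L.envBialg.diff (L.envBialg.mul t) = _ := fun t => LinearMap.congr_fun
      (DiffMod.tensor_hom_ext L.envBialg.toDiffMod L.envBialg.toDiffMod
        (f := L.envBialg.diff ∘ₗ L.envBialg.mul)
        (g := L.envBialg.mul ∘ₗ L.envBialg.leib 1 L.envBialg.diff L.envBialg.diff)
        fun i j x y hx hy => by
          rw [comp_apply, comp_apply, leib_tmul _ _ _ _ hx, map_add, map_smul,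
            one_mul]
          exact env_diff_mul hx y) t
    refine LinearMap.ext fun x => ?_
    simp only [comp_apply] at e1 e2 e3 ⊢
    rw [convExp_succ_apply, convExp_succ_apply, map_smul, e3, e2, e1]

theorem convExp_comul [CharZero k] {d : ℤ} (ha : a.IsDCoalgebra d)
    (hφ : φ ∈ homDeg a.toDiffMod L.toDiffMod 0) (n : ℕ) :
    L.envBialg.comul ∘ₗ convExp L a φ n = ∑ q ∈ Finset.HasAntidiagonal.antidiagonal n,
      TensorProduct.map (convExp L a φ q.1) (convExp L a φ q.2) ∘ₗ a.comul := by
  have hι : ι L ∈ homDeg L.toDiffMod L.envBialg.toDiffMod 0 := fun i x hx => by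
    rw [add_zero]; exact ι_mem L hx
  have hψ := homDeg_comp_zero hι hφ
  let e := assoc k (Env L) (Env L) (Env L)
  let e' := assoc k S S S
  let tw : Env L ⊗[k] Env L →ₗ[k] Env L ⊗[k] Env L := L.envBialg.twist L.envBialg.toDiffMod
  have act : ∀ y u, L.envBialg.comul (L.envBialg.mul (ι L y ⊗ₜ u)) =
      TensorProduct.map L.envBialg.mul LinearMap.id (e.symm (ι L y ⊗ₜ L.envBialg.comul u)) +
      TensorProduct.map LinearMap.id L.envBialg.mul (e (TensorProduct.map tw LinearMap.id
        (e.symm (ι L y ⊗ₜ L.envBialg.comul u)))) := by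
    intro y u
    change L.envBialg.comul (ι L y * u) = _
    induction y using L.toDiffMod.induction with
    | add y y' h1 h2 =>
      simp only [map_add, add_tmul, add_mul, h1, h2]; abel
    | hom i y hy =>
      rw [envComul_ι_mul hy]
      generalize L.envBialg.comul u = t
      induction t using L.envBialg.tensor_induction L.envBialg.toDiffMod with
      | add t t' h1 h2 => simp only [map_add, tmul_add, h1, h2]; abel
      | tmul α β r s hr hs =>
        have hy' : ι L y ∈ L.envBialg.gr i := ι_mem L hy
        simp only [e, tw, TensorProduct.assoc_symm_tmul, map_tmul,
          twist_apply _ _ hy' hr, ← smul_tmul', map_smul, assoc_tmul,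
          id_apply, leib_tmul _ _ _ _ hr]
        rfl
  induction n with
  | zero =>
    rw [Finset.Nat.antidiagonal_zero, Finset.sum_singleton]
    exact (isCoaugmented_envCoalg.isGradedHom_trivial ha).comul
  | succ n ih =>
    have key : ∀ i j x,
        TensorProduct.map L.envBialg.mul LinearMap.id (e.symm (TensorProduct.map (ι L ∘ₗ φ)
          (TensorProduct.map (convExp L a φ i) (convExp L a φ j) ∘ₗ a.comul) (a.comul x))) =
        ((i + 1 : ℕ) : k) • TensorProduct.map (convExp L a φ (i + 1)) (convExp L a φ j)
          (a.comul x) ∧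
        TensorProduct.map LinearMap.id L.envBialg.mul (e (TensorProduct.map tw LinearMap.id
          (e.symm (TensorProduct.map (ι L ∘ₗ φ)
          (TensorProduct.map (convExp L a φ i) (convExp L a φ j) ∘ₗ a.comul) (a.comul x))))) =
        ((j + 1 : ℕ) : k) • TensorProduct.map (convExp L a φ i) (convExp L a φ (j + 1))
          (a.comul x) := by
      intro i j x
      have c1 := LinearMap.congr_fun ha.coassoc x
      have c2 : e'.symm (TensorProduct.map LinearMap.id a.comul (a.comul x)) =
          TensorProduct.map a.comul LinearMap.id (a.comul x) := by
        rw [LinearEquiv.symm_apply_eq]; exact c1.symm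
      have c3 : e.symm (TensorProduct.map (ι L ∘ₗ φ)
          (TensorProduct.map (convExp L a φ i) (convExp L a φ j) ∘ₗ a.comul) (a.comul x)) =
          TensorProduct.map (TensorProduct.map (ι L ∘ₗ φ) (convExp L a φ i)) (convExp L a φ j)
            (TensorProduct.map a.comul LinearMap.id (a.comul x)) := by
        rw [← c2]
        generalize a.comul x = t
        induction t using induction_on with
        | zero => simp
        | add t t' h1 h2 => simp only [map_add, h1, h2]
        | tmul y z =>
          simp only [map_tmul, comp_apply, id_apply]
          generalize a.comul z = t
          induction t using induction_on with
          | zero => simp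
          | add t t' h1 h2 => simp only [map_add, tmul_add, h1, h2]
          | tmul u v => rfl
      constructor
      · rw [c3, ← LinearMap.smul_apply, ← TensorProduct.map_smul_left, ← mul_convExp]
        simp only [map_map, comp_id, id_comp]
      · have c4 : TensorProduct.map tw LinearMap.id (TensorProduct.map
            (TensorProduct.map (ι L ∘ₗ φ) (convExp L a φ i)) (convExp L a φ j)
            (TensorProduct.map a.comul LinearMap.id (a.comul x))) =
            TensorProduct.map (TensorProduct.map (convExp L a φ i) (ι L ∘ₗ φ)) (convExp L a φ j)
            (TensorProduct.map a.comul LinearMap.id (a.comul x)) := by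
          simp only [map_map, comp_id, id_comp]
          rw [← comp_assoc, twist_comp_map hψ (convExp_homDeg ha hφ i),
            comp_assoc, ha.cocomm]
        rw [c3, c4, ← LinearMap.smul_apply, ← TensorProduct.map_smul_right, ← mul_convExp]
        have c5 : e (TensorProduct.map (TensorProduct.map (convExp L a φ i) (ι L ∘ₗ φ))
            (convExp L a φ j) (TensorProduct.map a.comul LinearMap.id (a.comul x))) =
            TensorProduct.map (convExp L a φ i) (TensorProduct.map (ι L ∘ₗ φ) (convExp L a φ j))
              (TensorProduct.map LinearMap.id a.comul (a.comul x)) := by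
          rw [← c2]
          generalize TensorProduct.map LinearMap.id a.comul (a.comul x) = t
          obtain ⟨t, rfl⟩ := e'.surjective t
          rw [LinearEquiv.symm_apply_apply]
          exact LinearMap.congr_fun (f := e.toLinearMap ∘ₗ TensorProduct.map (TensorProduct.map
            (convExp L a φ i) (ι L ∘ₗ φ)) (convExp L a φ j)) (g := TensorProduct.map
            (convExp L a φ i) (TensorProduct.map (ι L ∘ₗ φ) (convExp L a φ j)) ∘ₗ e'.toLinearMap)
            (TensorProduct.ext_threefold fun u v w => rfl) t
        rw [c5]
        simp only [map_map, comp_id, id_comp]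
    refine LinearMap.ext fun x => ?_
    let f : ℕ × ℕ → Env L ⊗[k] Env L := fun q =>
      TensorProduct.map (convExp L a φ q.1) (convExp L a φ q.2) (a.comul x)
    have hn : ((n + 1 : ℕ) : k) ≠ 0 := Nat.cast_ne_zero.2 n.succ_ne_zero
    have hact : ∀ t, L.envBialg.comul (L.envBialg.mul
        (TensorProduct.map (ι L ∘ₗ φ) (convExp L a φ n) t)) =
        TensorProduct.map L.envBialg.mul LinearMap.id (e.symm (TensorProduct.map (ι L ∘ₗ φ)
          (L.envBialg.comul ∘ₗ convExp L a φ n) t)) +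
        TensorProduct.map LinearMap.id L.envBialg.mul (e (TensorProduct.map tw LinearMap.id
          (e.symm (TensorProduct.map (ι L ∘ₗ φ) (L.envBialg.comul ∘ₗ convExp L a φ n) t)))) := by
      intro t
      induction t using induction_on with
      | zero => simp
      | add t t' h1 h2 => simp only [map_add, h1, h2]; abel
      | tmul y z => exact act _ _
    have hsum : ∀ t, TensorProduct.map (ι L ∘ₗ φ) (L.envBialg.comul ∘ₗ convExp L a φ n) t =
        ∑ q ∈ Finset.HasAntidiagonal.antidiagonal n, TensorProduct.map (ι L ∘ₗ φ)
          (TensorProduct.map (convExp L a φ q.1) (convExp L a φ q.2) ∘ₗ a.comul) t := by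
      intro t
      rw [ih]
      induction t using induction_on with
      | zero => simp
      | add t t' h1 h2 => simp only [map_add, h1, h2, Finset.sum_add_distrib]
      | tmul y z =>
        simp only [map_tmul, LinearMap.sum_apply, TensorProduct.tmul_sum]
    have e1 : ((n + 1 : ℕ) : k) • L.envBialg.comul (convExp L a φ (n + 1) x) =
        ∑ q ∈ Finset.HasAntidiagonal.antidiagonal n, (((q.1 + 1 : ℕ) : k) • f (q.1 + 1, q.2) +
          ((q.2 + 1 : ℕ) : k) • f (q.1, q.2 + 1)) := by
      rw [convExp_succ_apply, map_smul, smul_smul, mul_inv_cancel₀ hn, one_smul, hact, hsum]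
      simp only [map_sum, (key _ _ _).1, (key _ _ _).2, Finset.sum_add_distrib]
      rfl
    have e2 : ((n + 1 : ℕ) : k) • ∑ q ∈ Finset.HasAntidiagonal.antidiagonal (n + 1), f q =
        ∑ q ∈ Finset.HasAntidiagonal.antidiagonal n, (((q.1 + 1 : ℕ) : k) • f (q.1 + 1, q.2) +
          ((q.2 + 1 : ℕ) : k) • f (q.1, q.2 + 1)) := by
      have s1 := Finset.Nat.sum_antidiagonal_succ (n := n) (f := fun q => (q.1 : k) • f q)
      have s2 := Finset.Nat.sum_antidiagonal_succ' (n := n) (f := fun q => (q.2 : k) • f q)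
      simp only [Nat.cast_zero, zero_smul, zero_add] at s1 s2
      rw [Finset.sum_add_distrib, ← s1]
      refine Eq.trans ?_ (congrArg (_ + ·) s2)
      rw [Finset.smul_sum, ← Finset.sum_add_distrib]
      refine Finset.sum_congr rfl fun q hq => ?_
      rw [← add_smul, ← Nat.cast_add, Finset.HasAntidiagonal.mem_antidiagonal.1 hq]
    rw [LinearMap.sum_apply]
    exact smul_right_injective _ hn (e1.trans e2.symm)

end conv
end GLie

namespace GLie
section conv
variable {k : Type u} [Field k] {g : Type v} [AddCommGroup g] [Module k g] {L : GLie k g}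
  {S : Type w} [AddCommGroup S] [Module k S] {a : DCoalgData k S} {φ : S →ₗ[k] g}

theorem convExp_succ_one (ha : a.IsCoaugmented) (h1 : φ a.one = 0) (n : ℕ) :
    convExp L a φ (n + 1) a.one = 0 := by
  rw [convExp_succ_apply, ha.comul_one, map_tmul, comp_apply, h1, map_zero,
    zero_tmul, map_zero, smul_zero]

theorem convExp_eq_zero (ha : a.IsCoaugmented) (h1 : φ a.one = 0) {m : ℕ} :
    ∀ {n : ℕ} {x : S}, x ∈ a.corad m → m < n → convExp L a φ n x = 0 := by
  induction m with
  | zero =>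
    intro n x hx hn
    obtain ⟨n, rfl⟩ := Nat.exists_eq_succ_of_ne_zero hn.ne'
    obtain ⟨r, rfl⟩ := Submodule.mem_span_singleton.1 hx
    rw [map_smul, convExp_succ_one ha h1, smul_zero]
  | succ m ih =>
    intro n x hx hn
    obtain ⟨n, rfl⟩ := Nat.exists_eq_succ_of_ne_zero (Nat.ne_zero_of_lt hn)
    obtain ⟨n, rfl⟩ := Nat.exists_eq_succ_of_ne_zero (show n ≠ 0 by omega)
    have h0 := map_congr_tensorSub (f := ι L ∘ₗ φ) (f' := ι L ∘ₗ φ) (g := convExp L a φ (n + 1))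
      (g' := 0) (fun _ _ => rfl) (fun y hy => ih hy (by omega)) (mem_corad_succ.1 hx).1
    rw [convExp_succ_apply, comul_eq, map_add, map_add, map_add, map_tmul,
      map_tmul, convExp_succ_one ha h1, comp_apply, h1, h0]
    simp

/-- `E` is the convolution exponential of `φ`. -/
def IsConvExp (L : GLie k g) (a : DCoalgData k S) (φ : S →ₗ[k] g) (E : S →ₗ[k] Env L) : Prop :=
  ∀ x, ∃ n, ∀ m, n ≤ m → E x = ∑ i ∈ Finset.range m, convExp L a φ i x

theorem IsConvExp.unique {E E' : S →ₗ[k] Env L} (h : IsConvExp L a φ E)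
    (h' : IsConvExp L a φ E') : E = E' := LinearMap.ext fun x => by
  obtain ⟨⟨n, hn⟩, ⟨m, hm⟩⟩ := And.intro (h x) (h' x)
  rw [hn _ (le_max_left n m), hm _ (le_max_right n m)]

theorem IsConvExp.comp {T : Type*} [AddCommGroup T] [Module k T] {b : DCoalgData k T}
    {f : T →ₗ[k] S} (hf : IsGradedHom b a f) {E : S →ₗ[k] Env L} (h : IsConvExp L a φ E) :
    IsConvExp L b (φ ∘ₗ f) (E ∘ₗ f) := fun x => by
  obtain ⟨n, hn⟩ := h (f x)
  exact ⟨n, fun m hm => (hn m hm).trans (Finset.sum_congr rfl fun i _ =>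
    (LinearMap.congr_fun (convExp_comp hf i) x).symm)⟩

theorem sum_convExp (ha : a.IsCoaugmented) (h1 : φ a.one = 0) {n m l : ℕ} {x : S}
    (hx : x ∈ a.corad n) (hm : n < m) (hml : m ≤ l) : ∑ i ∈ Finset.range l, convExp L a φ i x =
      ∑ i ∈ Finset.range m, convExp L a φ i x := by
  refine (Finset.sum_subset (Finset.range_mono hml) fun i _ hi => ?_).symm
  rw [Finset.mem_range, not_lt] at hi
  exact convExp_eq_zero ha h1 hx (by omega)

theorem IsConvExp.eq (ha : a.IsCoaugmented) (h1 : φ a.one = 0) {E : S →ₗ[k] Env L}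
    (h : IsConvExp L a φ E) {n m : ℕ} {x : S} (hx : x ∈ a.corad n) (hm : n < m) :
    E x = ∑ i ∈ Finset.range m, convExp L a φ i x := by
  obtain ⟨l, hl⟩ := h x
  rw [hl _ (le_max_left l m), sum_convExp ha h1 hx hm (le_max_right l m)]

theorem exists_isConvExp {d : ℤ} (ha : a.IsDCoalgebra d) (ha' : a.IsCoproartinian)
    (h1 : φ a.one = 0) : ∃ E, IsConvExp L a φ E := by
  have hc := ha'.isCoaugmented ha
  obtain ⟨E, hE⟩ := exists_limit hc.corad_mono (ha'.exists_mem_corad ha)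
    (fun m => ∑ i ∈ Finset.range (m + 1), convExp L a φ i) fun n m x hx hnm => by
      rw [LinearMap.sum_apply, LinearMap.sum_apply, sum_convExp hc h1 hx (Nat.lt_succ_of_le hnm) (Nat.le_succ (m + 1))]
  refine ⟨E, fun x => ?_⟩
  obtain ⟨n, hn⟩ := ha'.exists_mem_corad ha x
  refine ⟨n + 1, fun m hm => ?_⟩
  obtain ⟨m, rfl⟩ := Nat.exists_eq_add_of_le' (show 1 ≤ m by omega)
  rw [hE n m x hn (by omega), LinearMap.sum_apply]

theorem IsConvExp.diff {d : ℤ} {E : S →ₗ[k] Env L} (h : IsConvExp L a φ E) (ha : a.IsDCoalgebra d)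
    (hφ : φ ∈ homDeg a.toDiffMod L.toDiffMod 0) (hd : L.diff ∘ₗ φ = φ ∘ₗ a.diff) :
    L.envBialg.diff ∘ₗ E = E ∘ₗ a.diff := LinearMap.ext fun x => by
  obtain ⟨⟨n, hn⟩, ⟨m, hm⟩⟩ := And.intro (h x) (h (a.diff x))
  rw [comp_apply, comp_apply, hn _ (le_max_left n m), hm _ (le_max_right n m),
    map_sum]
  exact Finset.sum_congr rfl fun i _ => LinearMap.congr_fun (convExp_diff ha hφ hd i) x

theorem counit_convExp_succ (n : ℕ) (x : S) :
    L.envBialg.counit (convExp L a φ (n + 1) x) = 0 := by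
  rw [convExp_succ_apply, map_smul]
  generalize a.comul x = t
  induction t using induction_on with
  | zero => simp
  | tmul y z =>
    refine (congrArg _ (envCounit_ι_mul (L := L) (φ y) (convExp L a φ n z))).trans ?_
    rw [smul_zero]
  | add t t' h1 h2 => rw [map_add, map_add, map_add, smul_add, h1, h2, add_zero]

theorem IsConvExp.isGradedHom [CharZero k] {d : ℤ} {E : S →ₗ[k] Env L} (h : IsConvExp L a φ E)
    (ha : a.IsDCoalgebra d) (ha' : a.IsCoproartinian) (h0 : a.cobr = 0)
    (hφ : φ ∈ homDeg a.toDiffMod L.toDiffMod 0) (h1 : φ a.one = 0) :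
    IsGradedHom a L.envCoalg E := by
  have hc := ha'.isCoaugmented ha
  refine ⟨fun i x hx => ?_, LinearMap.ext fun x => ?_, ?_, LinearMap.ext fun x => ?_⟩
  · obtain ⟨n, hn⟩ := h x
    rw [hn n le_rfl]
    exact Submodule.sum_mem _ fun j _ => convExp_homDeg ha hφ j i x hx
  · obtain ⟨m, hm⟩ := ha'.exists_mem_corad ha x
    let N := 2 * m + 1
    let f : ℕ × ℕ → Env L ⊗[k] Env L := fun q =>
      TensorProduct.map (convExp L a φ q.1) (convExp L a φ q.2) (a.comul x)
    have hΔ := hc.comul_mem_corad hm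
    have hf : ∀ q : ℕ × ℕ, ¬q.1 + q.2 < N → f q = 0 := by
      intro q hq
      rcases Nat.lt_or_ge m q.1 with h2 | h2
      · exact (map_congr_tensorSub (f' := 0) (g' := convExp L a φ q.2)
          (fun y hy => convExp_eq_zero hc h1 hy h2) (fun _ _ => rfl) hΔ).trans (by simp)
      · exact (map_congr_tensorSub (f' := convExp L a φ q.1) (g' := 0) (fun _ _ => rfl)
          (fun y hy => convExp_eq_zero hc h1 hy (show m < q.2 by omega)) hΔ).trans (by simp)
    have e1 : L.envBialg.comul (E x) =
        ∑ n ∈ Finset.range N, ∑ q ∈ Finset.HasAntidiagonal.antidiagonal n, f q := by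
      rw [h.eq hc h1 hm (show m < N by omega), map_sum]
      refine Finset.sum_congr rfl fun n _ => ?_
      have := LinearMap.congr_fun (convExp_comul ha hφ n) x
      rwa [LinearMap.sum_apply] at this
    have e2 : TensorProduct.map E E (a.comul x) =
        ∑ q ∈ Finset.range N ×ˢ Finset.range N, f q := by
      have hE : ∀ y ∈ a.corad m, E y = (∑ i ∈ Finset.range N, convExp L a φ i) y := fun y hy => by
        rw [h.eq hc h1 hy (show m < N by omega), LinearMap.sum_apply]
      rw [map_congr_tensorSub hE hE hΔ, Finset.sum_product]
      simp only [f, ← LinearMap.sum_apply]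
      refine LinearMap.congr_fun (ext' fun y z => ?_) (a.comul x)
      simp only [map_tmul, LinearMap.sum_apply, TensorProduct.sum_tmul,
        TensorProduct.tmul_sum]
      exact Finset.sum_comm
    refine e1.trans (Eq.trans ?_ e2.symm)
    rw [← Finset.sum_filter_of_ne (p := fun q : ℕ × ℕ => q.1 + q.2 < N)
      (fun q _ hq => by_contra fun h2 => hq (hf q h2)),
      ← Finset.sum_fiberwise_of_maps_to (g := fun q : ℕ × ℕ => q.1 + q.2) (t := Finset.range N)
        (fun q hq => Finset.mem_range.2 (Finset.mem_filter.1 hq).2)]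
    refine Finset.sum_congr rfl fun n hn => Finset.sum_congr ?_ fun _ _ => rfl
    ext q
    simp only [Finset.HasAntidiagonal.mem_antidiagonal, Finset.mem_filter, Finset.mem_product,
      Finset.mem_range] at hn ⊢
    omega
  · rw [h0, comp_zero]
    exact LinearMap.zero_comp _
  · obtain ⟨n, hn⟩ := h x
    rw [comp_apply, hn _ (Nat.le_succ n), map_sum, Finset.sum_range_succ']
    have h2 : ∀ i, L.envCoalg.counit (convExp L a φ (i + 1) x) = 0 := fun i => counit_convExp_succ i x
    have h3 : L.envCoalg.counit 1 = 1 := envCounit_one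
    simp only [h2, Finset.sum_const_zero, zero_add, convExp_zero_apply, map_smul, h3, smul_eq_mul,
      mul_one]

end conv
end GLie

namespace GLie
section words
variable {k : Type u} [Field k] {g : Type v} [AddCommGroup g] [Module k g] {L : GLie k g}

variable (L) in
/-- The span of the products of `n` generators. -/
def words (n : ℕ) : Submodule k (Env L) := Submodule.span k (Set.range (mono L (n := n)))

theorem mono_zero (x : Fin 0 → g) : mono L x = 1 := by simp [mono]

theorem mono_succ {n : ℕ} (x : Fin (n + 1) → g) :
    mono L x = ι L (x 0) * mono L fun i => x i.succ := by
  simp [mono, List.ofFn_succ]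

theorem mono_mem_words {n : ℕ} (x : Fin n → g) : mono L x ∈ words L n :=
  Submodule.subset_span ⟨x, rfl⟩

theorem words_le_filtLT {m n : ℕ} (h : m < n) : words L m ≤ filtLT L n := by
  refine Submodule.span_le.2 ?_
  rintro _ ⟨x, rfl⟩
  exact Submodule.subset_span ⟨m, h, x, rfl⟩

theorem filtLT_le {n : ℕ} {U : Submodule k (Env L)} (h : ∀ m < n, words L m ≤ U) :
    filtLT L n ≤ U := by
  refine Submodule.span_le.2 ?_
  rintro _ ⟨m, hm, x, rfl⟩
  exact h m hm (mono_mem_words x)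

theorem filtLT_mono : Monotone (filtLT L) := fun _ _ h =>
  filtLT_le fun _ hm => words_le_filtLT (hm.trans_le h)

theorem ι_mul_mem_words {n : ℕ} (y : g) {z : Env L} (hz : z ∈ words L n) :
    ι L y * z ∈ words L (n + 1) := by
  have : words L n ≤ (words L (n + 1)).comap (lmul y) := by
    refine Submodule.span_le.2 ?_
    rintro _ ⟨x, rfl⟩
    have := mono_mem_words (L := L) (Fin.cons y x : Fin (n + 1) → g)
    rwa [mono_succ] at this
  exact this hz

theorem ι_mul_mem_filtLT {n : ℕ} (y : g) {z : Env L} (hz : z ∈ filtLT L n) :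
    ι L y * z ∈ filtLT L (n + 1) :=
  filtLT_le (U := (filtLT L (n + 1)).comap (lmul y)) (fun _ hm _ hz =>
    words_le_filtLT (by omega) (ι_mul_mem_words y hz)) hz

theorem words_le {n : ℕ} {U : Submodule k (Env L)}
    (h : ∀ i, ∀ x ∈ L.gr i, ∀ z ∈ words L n, ι L x * z ∈ U) : words L (n + 1) ≤ U := by
  refine Submodule.span_le.2 ?_
  rintro _ ⟨x, rfl⟩
  rw [mono_succ]
  generalize x 0 = y
  induction y using L.toDiffMod.induction with
  | hom i y hy => exact h i y hy _ (mono_mem_words _)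
  | add y y' h1 h2 => rw [map_add, add_mul]; exact Submodule.add_mem _ h1 h2

theorem words_zero_le {U : Submodule k (Env L)} (h : 1 ∈ U) : words L 0 ≤ U := by
  refine Submodule.span_le.2 ?_
  rintro _ ⟨x, rfl⟩
  rwa [mono_zero]

theorem sgn_mem_words (i : ℤ) : ∀ {n : ℕ} {z : Env L}, z ∈ words L n →
    L.envBialg.sgn i z ∈ words L n := by
  have h1 : (1 : Env L) ∈ L.envBialg.gr 0 := env_one_mem
  intro n
  induction n with
  | zero =>
    refine fun hz => words_zero_le (U := (words L 0).comap (L.envBialg.sgn i)) ?_ hz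
    rw [Submodule.mem_comap, sgn_apply _ _ h1]
    refine Submodule.smul_mem _ _ ?_
    have := mono_mem_words (L := L) (Fin.elim0 : Fin 0 → g)
    rwa [mono_zero] at this
  | succ n ih =>
    refine fun hz => words_le (U := (words L (n + 1)).comap (L.envBialg.sgn i))
      (fun j x hx z hz => ?_) hz
    have := LinearMap.congr_fun (sgn_comp_homDeg (lmul_mem hx) i) z
    rw [Submodule.mem_comap, ← lmul_apply]
    rw [comp_apply] at this
    rw [this]
    exact Submodule.smul_mem _ _ (ι_mul_mem_words x (ih hz))

theorem exists_mem_words (z : Env L) : ∃ n, z ∈ filtLT L n := by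
  induction z using env_induction with
  | one =>
    have := mono_mem_words (L := L) (Fin.elim0 : Fin 0 → g)
    rw [mono_zero] at this
    exact ⟨1, words_le_filtLT one_pos this⟩
  | cons i n x z hx hz ih => exact ih.elim fun n hn => ⟨n + 1, ι_mul_mem_filtLT x hn⟩
  | smul r z ih => exact ih.elim fun n hn => ⟨n, Submodule.smul_mem _ r hn⟩
  | add y z h2 h3 =>
    obtain ⟨⟨n, hn⟩, ⟨m, hm⟩⟩ := And.intro h2 h3
    exact ⟨max n m, Submodule.add_mem _ (filtLT_mono (le_max_left _ _) hn)
      (filtLT_mono (le_max_right _ _) hm)⟩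

/-- The coproduct is compatible with the lengths of words. -/
theorem comul_words_ext {M : Type*} [AddCommMonoid M] [Module k M] {n : ℕ} :
    ∀ {B B' : Env L ⊗[k] Env L →ₗ[k] M}, (∀ i j y z, i + j = n → y ∈ words L i → z ∈ words L j →
      B (y ⊗ₜ z) = B' (y ⊗ₜ z)) → ∀ w ∈ words L n, B (L.envBialg.comul w) = B' (L.envBialg.comul w) := by
  have one : (1 : Env L) ∈ words L 0 := by
    have := mono_mem_words (L := L) (Fin.elim0 : Fin 0 → g)
    rwa [mono_zero] at this
  induction n with
  | zero =>
    intro B B' h w hw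
    refine words_zero_le (U := LinearMap.eqLocus (B ∘ₗ L.envBialg.comul) (B' ∘ₗ L.envBialg.comul))
      ?_ hw
    rw [LinearMap.mem_eqLocus, comp_apply, comp_apply, envComul_one]
    exact h 0 0 _ _ rfl one one
  | succ n ih =>
    intro B B' h w hw
    refine words_le (U := LinearMap.eqLocus (B ∘ₗ L.envBialg.comul) (B' ∘ₗ L.envBialg.comul))
      (fun i x hx z hz => ?_) hw
    rw [LinearMap.mem_eqLocus, comp_apply, comp_apply, envComul_ι_mul hx]
    refine ih (B := B ∘ₗ L.envBialg.leib i (lmul x) (lmul x))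
      (B' := B' ∘ₗ L.envBialg.leib i (lmul x) (lmul x)) (fun p q y z hpq hy hz => ?_) z hz
    simp only [comp_apply, DiffMod.leib, LinearMap.add_apply, map_tmul,
      map_add, lmul_apply, id_apply]
    rw [h (p + 1) q _ _ (by omega) (ι_mul_mem_words x hy) hz,
      h p (q + 1) _ _ (by omega) (sgn_mem_words i hy) (ι_mul_mem_words x hz)]

end words

section exp
variable {k : Type u} [Field k] {g : Type v} [AddCommGroup g] [Module k g] {L : GLie k g}
  {g' : Type w} [AddCommGroup g'] [Module k g'] {L' : GLie k g'} {φ φ' : Env L →ₗ[k] g'}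

theorem convExp_mem_words {S : Type*} [AddCommGroup S] [Module k S] {a : DCoalgData k S}
    {φ : S →ₗ[k] g} (n : ℕ) (x : S) : convExp L a φ n x ∈ words L n := by
  induction n generalizing x with
  | zero =>
    have := mono_mem_words (L := L) (Fin.elim0 : Fin 0 → g)
    rw [mono_zero] at this
    exact Submodule.smul_mem _ _ this
  | succ n ih =>
    rw [convExp_succ_apply]
    refine Submodule.smul_mem _ _ ?_
    generalize a.comul x = t
    induction t using induction_on with
    | zero => rw [map_zero, map_zero]; exact Submodule.zero_mem _
    | tmul y z => exact ι_mul_mem_words _ (ih z)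
    | add t t' h1 h2 => rw [map_add, map_add]; exact Submodule.add_mem _ h1 h2

theorem eq_zero_of_mem_words_zero (h1 : φ 1 = 0) {y : Env L} (hy : y ∈ words L 0) : φ y = 0 :=
  words_zero_le (U := LinearMap.ker φ) h1 hy

theorem convExp_words_eq_zero (h1 : φ 1 = 0) {n : ℕ} : ∀ {m : ℕ} {z : Env L}, z ∈ words L m →
    m < n → convExp L' L.envCoalg φ n z = 0 := by
  induction n with
  | zero => intro m z _ h; omega
  | succ n ih =>
    intro m z hz hm
    rw [convExp_succ_apply]
    have := comul_words_ext (B := L'.envBialg.mul ∘ₗ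
      TensorProduct.map (ι L' ∘ₗ φ) (convExp L' L.envCoalg φ n)) (B' := 0)
      (fun i j y z hij hy hz => ?_) z hz
    · exact (congrArg _ this).trans (smul_zero _)
    · rw [comp_apply, map_tmul, LinearMap.zero_apply]
      rcases Nat.eq_zero_or_pos i with rfl | hi
      · rw [comp_apply, eq_zero_of_mem_words_zero h1 hy, map_zero,
          zero_tmul, map_zero]
      · rw [ih hz (by omega), tmul_zero, map_zero]

/-- On words of length `n`, the `n`-th term of the exponential depends only on the values on the
generators. -/
theorem convExp_words_congr (h1 : φ 1 = 0) (h1' : φ' 1 = 0) (h : ∀ x, φ (ι L x) = φ' (ι L x))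
    {n : ℕ} : ∀ {z : Env L}, z ∈ words L n →
    convExp L' L.envCoalg φ n z = convExp L' L.envCoalg φ' n z := by
  induction n with
  | zero => intro z _; rfl
  | succ n ih =>
    intro z hz
    rw [convExp_succ_apply, convExp_succ_apply]
    refine congrArg _ (comul_words_ext (B := L'.envBialg.mul ∘ₗ
      TensorProduct.map (ι L' ∘ₗ φ) (convExp L' L.envCoalg φ n)) (B' := L'.envBialg.mul ∘ₗ
      TensorProduct.map (ι L' ∘ₗ φ') (convExp L' L.envCoalg φ' n))
      (fun i j y w hij hy hw => ?_) z hz)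
    simp only [comp_apply, map_tmul]
    rcases i with _ | _ | i
    · rw [eq_zero_of_mem_words_zero h1 hy, eq_zero_of_mem_words_zero h1' hy, map_zero,
        zero_tmul, zero_tmul]
    · have hφ : φ y = φ' y := by
        refine words_le (U := LinearMap.eqLocus φ φ') (fun i x hx z hz => ?_) hy
        refine words_zero_le (U := (LinearMap.eqLocus φ φ').comap (lmul x)) ?_ hz
        rw [Submodule.mem_comap, lmul_apply, mul_one]
        exact h x
      obtain rfl : j = n := by omega
      rw [hφ, ih hw]
    · rw [convExp_words_eq_zero h1 hw (by omega), convExp_words_eq_zero h1' hw (by omega),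
        tmul_zero, tmul_zero]

end exp
end GLie

section sym
open GLie
variable {k : Type u} [Field k] {M : Type v} [AddCommGroup M] [Module k M] (X : DiffMod k M)

/-- The projection of the symmetric algebra to its generators. -/
def DiffMod.symProj : X.Sym →ₗ[k] M :=
  let f : M →ₗ[k] Module.End k (k × M) :=
    { toFun := fun x => LinearMap.inr k k M ∘ₗ toSpanSingleton k M x ∘ₗ
        LinearMap.fst k k M
      map_add' := fun x y => by ext <;> simp
      map_smul' := fun r x => by ext <;> simp }
  LinearMap.snd k k M ∘ₗ LinearMap.applyₗ (1, 0) ∘ₗ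
    (lift X.abelian f fun i j x y _ _ => by ext <;> simp [f, DiffMod.abelian]).toLinearMap

theorem DiffMod.symProj_one : X.symProj 1 = 0 := by simp [symProj]

theorem DiffMod.symProj_ι_mul (x : M) (z : X.Sym) :
    X.symProj (X.abelian.ι x * z) = X.symBialg.counit z • x := by
  let f : M →ₗ[k] Module.End k (k × M) :=
    { toFun := fun x => LinearMap.inr k k M ∘ₗ toSpanSingleton k M x ∘ₗ
        LinearMap.fst k k M
      map_add' := fun x y => by ext <;> simp
      map_smul' := fun r x => by ext <;> simp }
  let F : X.Sym →ₐ[k] Module.End k (k × M) :=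
    lift X.abelian f fun i j x y _ _ => by ext <;> simp [f, DiffMod.abelian]
  have hF : ∀ x, F (X.abelian.ι x) = f x := fun x => lift_ι _ _ _ _
  have h1 : (F z (1, 0)).1 = X.symBialg.counit z := by
    induction z using env_induction with
    | one => rw [map_one]; exact envCounit_one.symm
    | cons i n x z _ _ _ =>
      rw [map_mul, hF]
      exact (envCounit_ι_mul (L := X.abelian) x z).symm
    | smul r z h => simp [h]
    | add y z h1 h2 => simp [h1, h2]
  rw [← h1]
  change (F (X.abelian.ι x * z) (1, 0)).2 = _
  rw [map_mul, hF]
  rfl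

theorem DiffMod.symProj_ι (x : M) : X.symProj (X.abelian.ι x) = x := by
  have := X.symProj_ι_mul x 1
  rwa [mul_one, show X.symBialg.counit 1 = 1 from envCounit_one, one_smul] at this

theorem DiffMod.symProj_homDeg : X.symProj ∈ homDeg X.symBialg.toDiffMod X 0 := by
  intro n z hz
  rw [add_zero]
  change z ∈ envGr X.abelian n at hz
  induction hz using Submodule.span_induction with
  | mem z hz =>
    cases hz with
    | one => rw [symProj_one]; exact Submodule.zero_mem _
    | @cons i n x z hx hz =>
      rw [symProj_ι_mul]
      by_cases hn : n = 0
      · rw [hn, add_zero]; exact Submodule.smul_mem _ _ hx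
      · have := envCounit_deg (L := X.abelian) (Submodule.subset_span hz) hn
        rw [show X.symBialg.counit z = 0 from this, zero_smul]
        exact Submodule.zero_mem _
  | zero => rw [map_zero]; exact Submodule.zero_mem _
  | add y z _ _ h1 h2 => rw [map_add]; exact Submodule.add_mem _ h1 h2
  | smul r z _ h => rw [map_smul]; exact Submodule.smul_mem _ _ h

theorem DiffMod.symProj_diff (hX : X.IsComplex) :
    X.diff ∘ₗ X.symProj = X.symProj ∘ₗ X.symBialg.diff := by
  have h0 := (isCocommHopf_envBialg (L := X.abelian) hX).counit_diff
  refine env_linear_ext ?_ fun i n x z hx hz _ => ?_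
  · have h1 : X.symBialg.diff 1 = 0 := envDiff_one
    rw [comp_apply, comp_apply, h1, symProj_one, map_zero, map_zero]
  · have h1 : X.symBialg.diff (X.abelian.ι x * z) = X.abelian.ι (X.diff x) * z +
      ksign k i • (X.abelian.ι x * X.symBialg.diff z) := envDiff_ι_mul hx z
    have h2 : X.symBialg.counit (X.symBialg.diff z) = 0 := LinearMap.congr_fun h0 z
    rw [comp_apply, comp_apply, h1, map_add, map_smul, symProj_ι_mul,
      symProj_ι_mul, symProj_ι_mul, h2, zero_smul, smul_zero, add_zero, map_smul]

variable {g : Type w} [AddCommGroup g] [Module k g] {L : GLie k g}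

/-- The convolution of a linear map, extended by zero to words of length at least two, with a
map. -/
def convSym (L : GLie k g) (f : M →ₗ[k] g) (F : X.Sym →ₗ[k] Env L) : X.Sym →ₗ[k] Env L :=
  L.envBialg.mul ∘ₗ TensorProduct.map (ι L ∘ₗ f ∘ₗ X.symProj) F ∘ₗ X.symBialg.comul

theorem convSym_one (f : M →ₗ[k] g) (F : X.Sym →ₗ[k] Env L) : convSym X L f F 1 = 0 := by
  change L.envBialg.mul (TensorProduct.map _ F (X.abelian.envBialg.comul 1)) = 0
  rw [envComul_one, map_tmul, comp_apply, comp_apply,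
    symProj_one, map_zero, map_zero, zero_tmul, map_zero]

theorem convSym_ι_mul (f : M →ₗ[k] g) (F : X.Sym →ₗ[k] Env L) (hX : X.IsComplex) {i : ℤ} {x : M}
    (hx : x ∈ X.gr i) (z : X.Sym) : convSym X L f F (X.abelian.ι x * z) = ι L (f x) * F z +
      convSym X L (f ∘ₗ X.sgn i) (F ∘ₗ lmul (L := X.abelian) x) z := by
  have hU := (isCocommHopf_envBialg (L := X.abelian) hX).isDCoalgebra 0
  change L.envBialg.mul (TensorProduct.map _ F (X.abelian.envBialg.comul (X.abelian.ι x * z))) = _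
  rw [envComul_ι_mul hx, DiffMod.leib, LinearMap.add_apply, map_add, map_add,
    map_map, map_map, comp_id]
  congr 1
  · have h1 : (ι L ∘ₗ f ∘ₗ X.symProj) ∘ₗ lmul (L := X.abelian) x =
        toSpanSingleton k _ (ι L (f x)) ∘ₗ X.abelian.envCoalg.counit := by
      refine LinearMap.ext fun y => ?_
      simp only [comp_apply, lmul_apply, symProj_ι_mul, map_smul]
      rfl
    rw [h1]
    exact congrArg L.envBialg.mul (hU.map_counit_left F (ι L (f x)) z)
  · have h1 := sgn_comp X.symProj_homDeg i
    simp only [convSym, comp_assoc, ← h1]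
    rfl

/-- Convolution on a word picks out one letter. -/
theorem convSym_mono (hX : X.IsComplex) {n : ℕ} : ∀ (f : M →ₗ[k] g) (F : X.Sym →ₗ[k] Env L)
    (e : Fin (n + 1) → ℤ) (x : Fin (n + 1) → M), (∀ i, x i ∈ X.gr (e i)) →
    convSym X L f F (X.abelian.mono x) = ∑ j, (∏ l, if l < j then ksign k (e l * e j) else 1) •
      (ι L (f (x j)) * F (X.abelian.mono (x ∘ j.succAbove))) := by
  induction n with
  | zero =>
    intro f F e x hx
    rw [mono_succ, convSym_ι_mul X f F hX (hx 0), mono_zero, convSym_one, Fin.sum_univ_one,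
      mono_zero]
    simp
  | succ n ih =>
    intro f F e x hx
    rw [mono_succ, convSym_ι_mul X f F hX (hx 0),
      ih _ _ (fun i => e i.succ) (fun i => x i.succ) (fun i => hx i.succ)]
    refine Eq.trans ?_ (Fin.sum_univ_succ _).symm
    congr 1
    · simp
      rfl
    · refine Finset.sum_congr rfl fun j _ => ?_
      have hp : (∏ l, if l < j.succ then ksign k (e l * e j.succ) else 1) =
          ksign k (e 0 * e j.succ) *
            ∏ l : Fin (n + 1), if l < j then ksign k (e l.succ * e j.succ) else 1 := by
        rw [Fin.prod_univ_succ]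
        simp only [Fin.succ_lt_succ_iff, Fin.succ_pos, if_true]
      rw [hp]
      simp only [comp_apply, sgn_apply _ _ (hx j.succ), map_smul, smul_mul_assoc,
        smul_smul, lmul_apply]
      rw [mul_comm, mono_succ (x ∘ j.succ.succAbove)]
      simp only [Function.comp_def, Fin.succ_succAbove_zero, Fin.succ_succAbove_succ]

variable {X}

theorem convExp_succ_eq_convSym (f : M →ₗ[k] g) (n : ℕ) :
    convExp L X.abelian.envCoalg (f ∘ₗ X.symProj) (n + 1) = ((n + 1 : ℕ) : k)⁻¹ •
      convSym X L f (convExp L X.abelian.envCoalg (f ∘ₗ X.symProj) n) := rfl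

theorem convExp_symProj_succ [CharZero k] (hX : X.IsComplex) (m : ℕ) : ∀ {i : ℤ} {x : M},
    x ∈ X.gr i → ∀ z, convExp X.abelian X.abelian.envCoalg X.symProj (m + 1) (X.abelian.ι x * z) =
      X.abelian.ι x * convExp X.abelian X.abelian.envCoalg X.symProj m z := by
  have hs : ∀ {i : ℤ} {x : M}, x ∈ X.gr i → ∀ F z,
      convSym X X.abelian (X.sgn i) (lmul (L := X.abelian) x ∘ₗ F) z =
        X.abelian.ι x * convSym X X.abelian LinearMap.id F z := by
    intro i x hx F z
    change X.symBialg.mul (TensorProduct.map (X.abelian.ι ∘ₗ X.sgn i ∘ₗ X.symProj)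
        (lmul (L := X.abelian) x ∘ₗ F) (X.symBialg.comul z)) = X.abelian.ι x *
      X.symBialg.mul (TensorProduct.map (X.abelian.ι ∘ₗ LinearMap.id ∘ₗ X.symProj) F
        (X.symBialg.comul z))
    generalize X.symBialg.comul z = t
    induction t using induction_on with
    | zero => simp
    | add t t' h1 h2 => simp only [map_add, mul_add, h1, h2]
    | tmul y z =>
      change X.abelian.ι (X.sgn i (X.symProj y)) * (X.abelian.ι x * F z) =
        X.abelian.ι x * (X.abelian.ι (X.symProj y) * F z)
      rw [← mul_assoc, ← mul_assoc]
      congr 1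
      induction X.symProj y using X.induction with
      | hom j y hy =>
        have := ι_mul_ι X.abelian hx hy
        rw [show X.abelian.brk x y = 0 from rfl, map_zero, add_zero] at this
        rw [this, sgn_apply _ _ hy, map_smul, smul_mul_assoc]
      | add y y' h1 h2 => simp only [map_add, mul_add, add_mul, h1, h2]
  have h1 := convExp_succ_eq_convSym (X := X) (L := X.abelian) LinearMap.id
  rw [id_comp] at h1
  induction m with
  | zero =>
    intro i x hx z
    have h2 : convExp X.abelian X.abelian.envCoalg X.symProj 0 ∘ₗ lmul (L := X.abelian) x = 0 :=
      LinearMap.ext fun z => by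
        have : X.abelian.envCoalg.counit (X.abelian.ι x * z) = 0 := envCounit_ι_mul _ _
        rw [comp_apply, lmul_apply, convExp_zero_apply, this, zero_smul,
          LinearMap.zero_apply]
    rw [h1, LinearMap.smul_apply, convSym_ι_mul X _ _ hX hx, h2, convSym]
    simp
  | succ m ih =>
    intro i x hx z
    have h2 : convExp X.abelian X.abelian.envCoalg X.symProj (m + 1) ∘ₗ lmul (L := X.abelian) x =
        lmul (L := X.abelian) x ∘ₗ convExp X.abelian X.abelian.envCoalg X.symProj m :=
      LinearMap.ext fun z => ih hx z
    have h3 : convSym X X.abelian LinearMap.id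
        (convExp X.abelian X.abelian.envCoalg X.symProj m) z = ((m + 1 : ℕ) : k) •
        convExp X.abelian X.abelian.envCoalg X.symProj (m + 1) z := by
      rw [h1, LinearMap.smul_apply, smul_smul,
        mul_inv_cancel₀ (Nat.cast_ne_zero.2 m.succ_ne_zero), one_smul]
    rw [h1, LinearMap.smul_apply, convSym_ι_mul X _ _ hX hx, h2, id_comp, hs hx, h3,
      mul_smul_comm, id_apply]
    have h5 : ∀ (r : k) (y : X.Sym), y + r • y = (1 + r) • y := fun r y => by
      rw [add_smul, one_smul]
    rw [h5, smul_smul]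
    have h4 : (((m + 1 + 1 : ℕ) : k))⁻¹ * (1 + ((m + 1 : ℕ) : k)) = 1 := by
      rw [add_comm (1 : k), ← Nat.cast_add_one]
      exact inv_mul_cancel₀ (Nat.cast_ne_zero.2 (m + 1).succ_ne_zero)
    rw [h4, one_smul]

theorem isConvExp_id [CharZero k] (hX : X.IsComplex) :
    IsConvExp X.abelian X.abelian.envCoalg X.symProj LinearMap.id := by
  intro z
  induction z using env_induction with
  | one =>
    refine ⟨1, fun m hm => ?_⟩
    obtain ⟨m, rfl⟩ := Nat.exists_eq_add_of_le' hm
    have h1 : ∀ i, convExp X.abelian X.abelian.envCoalg X.symProj (i + 1) 1 = 0 :=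
      convExp_succ_one (L := X.abelian) isCoaugmented_envCoalg X.symProj_one
    rw [Finset.sum_range_succ', Finset.sum_eq_zero fun i _ => h1 i, zero_add, convExp_zero_apply,
      show X.abelian.envCoalg.counit 1 = 1 from envCounit_one, one_smul]
    rfl
  | cons i n x z hx hz ih =>
    obtain ⟨n, hn⟩ := ih
    refine ⟨n + 1, fun m hm => ?_⟩
    obtain ⟨m, rfl⟩ := Nat.exists_eq_add_of_le' (show 1 ≤ m by omega)
    have h0 : X.abelian.envCoalg.counit (X.abelian.ι x * z) = 0 := envCounit_ι_mul _ _
    have h1 := hn m (by omega)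
    rw [id_apply] at h1
    rw [Finset.sum_range_succ', convExp_zero_apply, h0, zero_smul, add_zero, id_apply,
      Finset.sum_congr rfl fun i _ => convExp_symProj_succ hX i hx z, ← Finset.mul_sum, ← h1]
  | smul r z ih =>
    obtain ⟨n, hn⟩ := ih
    refine ⟨n, fun m hm => ?_⟩
    rw [map_smul, hn m hm, Finset.smul_sum]
    simp only [map_smul]
  | add y z h1 h2 =>
    obtain ⟨⟨n, hn⟩, ⟨m, hm⟩⟩ := And.intro h1 h2
    refine ⟨max n m, fun l hl => ?_⟩
    rw [map_add, hn l (by omega), hm l (by omega), ← Finset.sum_add_distrib]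
    simp only [map_add]

/-- In the abelian case, the exponential of `φ` has corestriction `φ`. -/
theorem GLie.IsConvExp.symProj_comp {S : Type*} [AddCommGroup S] [Module k S] {a : DCoalgData k S} {d : ℤ}
    (ha : a.IsDCoalgebra d) {φ : S →ₗ[k] M} {E : S →ₗ[k] X.Sym}
    (h : IsConvExp X.abelian a φ E) : X.symProj ∘ₗ E = φ := by
  have h1 : ∀ n x, X.symProj (convExp X.abelian a φ (n + 1 + 1) x) = 0 := fun n x => by
    rw [convExp_succ_apply, map_smul]
    generalize a.comul x = t
    induction t using induction_on with
    | zero => simp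
    | add t t' h1 h2 => rw [map_add, map_add, map_add, smul_add, h1, h2, add_zero]
    | tmul y z =>
      have h2 := counit_convExp_succ (L := X.abelian) (a := a) (φ := φ) n z
      change _ • X.symProj (X.abelian.ι (φ y) * convExp X.abelian a φ (n + 1) z) = 0
      rw [symProj_ι_mul, show X.symBialg.counit (convExp X.abelian a φ (n + 1) z) = 0 from h2,
        zero_smul, smul_zero]
  have h2 : ∀ x, X.symProj (convExp X.abelian a φ 1 x) = φ x := fun x => by
    have e : ∀ t, X.symProj (X.symBialg.mul (TensorProduct.map (X.abelian.ι ∘ₗ φ)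
        (convExp X.abelian a φ 0) t)) =
        φ (rid k S (TensorProduct.map LinearMap.id a.counit t)) := fun t => by
      induction t using induction_on with
      | zero => simp
      | add t t' h1 h2 => simp only [map_add, h1, h2]
      | tmul y z =>
        change X.symProj (X.abelian.ι (φ y) * (a.counit z • 1)) = φ (a.counit z • y)
        rw [symProj_ι_mul, map_smul, map_smul, smul_eq_mul,
          show X.symBialg.counit 1 = 1 from envCounit_one, mul_one]
    rw [convExp_succ_apply, Nat.zero_add, Nat.cast_one, inv_one, one_smul]
    refine (e _).trans (congrArg φ ?_)
    rw [← sub_eq_zero]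
    refine separating_univ (k := k) _ fun ψ _ => ?_
    rw [map_sub, dual_counit_right]
    exact sub_eq_zero.2 (LinearMap.congr_fun (ha.dmul_counit ψ) x)
  refine LinearMap.ext fun x => ?_
  obtain ⟨n, hn⟩ := h x
  rw [comp_apply, hn (n + 2) (by omega), Finset.sum_range_succ', Finset.sum_range_succ',
    map_add, map_add, map_sum, Finset.sum_eq_zero fun i _ => h1 i x, zero_add, h2,
    convExp_zero_apply, map_smul, symProj_one, smul_zero, add_zero]

end sym

namespace GLie
section permSign
variable {k : Type u} [Field k]

/-- The permutation `0 ↦ j`, `i + 1 ↦ j.succAbove (τ i)`. -/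
def consPerm {n : ℕ} (q : Fin (n + 1) × Equiv.Perm (Fin n)) : Equiv.Perm (Fin (n + 1)) :=
  q.1.cycleRange.symm * Equiv.Perm.decomposeFin.symm (0, q.2)

theorem consPerm_zero {n : ℕ} (q : Fin (n + 1) × Equiv.Perm (Fin n)) : consPerm q 0 = q.1 := by
  simp [consPerm]

theorem consPerm_succ {n : ℕ} (q : Fin (n + 1) × Equiv.Perm (Fin n)) (i : Fin n) :
    consPerm q i.succ = q.1.succAbove (q.2 i) := by
  simp [consPerm]

theorem consPerm_bijective {n : ℕ} : Function.Bijective (consPerm (n := n)) := by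
  rw [Fintype.bijective_iff_injective_and_card]
  refine ⟨fun q q' h => ?_, ?_⟩
  · have h1 : q.1 = q'.1 := by rw [← consPerm_zero q, h, consPerm_zero]
    refine Prod.ext h1 (Equiv.ext fun i => ?_)
    have := consPerm_succ q i
    rw [h, consPerm_succ, h1] at this
    exact (Fin.succAbove_right_injective this).symm
  · simp [Fintype.card_perm, Nat.factorial_succ]

theorem permSign_consPerm {n : ℕ} (e : Fin (n + 1) → ℤ) (j : Fin (n + 1))
    (τ : Equiv.Perm (Fin n)) : permSign k e (consPerm (j, τ)) =
      (∏ l, if l < j then ksign k (e l * e j) else 1) * permSign k (e ∘ j.succAbove) τ := by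
  rw [permSign, permSign, Finset.prod_filter, Finset.prod_filter, Fintype.prod_prod_type,
    Fintype.prod_prod_type, Fin.prod_univ_succ, Fin.prod_univ_succ, Fin.prod_univ_succAbove _ j]
  simp only [Fin.prod_univ_succ (n := n), consPerm_zero, consPerm_succ, lt_self_iff_false,
    false_and, if_false, one_mul, Fin.succ_pos, true_and, Fin.not_lt_zero, Fin.succ_lt_succ_iff,
    (Fin.strictMono_succAbove j).lt_iff_lt, Function.comp_apply]
  congr 1
  rw [← Equiv.prod_comp τ fun i =>
    if j.succAbove i < j then ksign k (e (j.succAbove i) * e j) else 1]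
  exact Finset.prod_congr rfl fun i _ => by rw [mul_comm (e j)]

variable {g : Type v} [AddCommGroup g] [Module k g] {L : GLie k g}

theorem sum_perm_succ {n : ℕ} (e : Fin (n + 1) → ℤ) (y : Fin (n + 1) → g) :
    ∑ s : Equiv.Perm (Fin (n + 1)), permSign k e s • mono L (y ∘ s) =
      ∑ j, (∏ l, if l < j then ksign k (e l * e j) else 1) • (ι L (y j) *
        ∑ τ : Equiv.Perm (Fin n), permSign k (e ∘ j.succAbove) τ •
          mono L ((y ∘ j.succAbove) ∘ τ)) := by
  rw [← consPerm_bijective.sum_comp, Fintype.sum_prod_type]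
  refine Finset.sum_congr rfl fun j _ => ?_
  rw [Finset.mul_sum, Finset.smul_sum]
  refine Finset.sum_congr rfl fun τ _ => ?_
  rw [permSign_consPerm, mono_succ, mul_smul_comm, smul_smul]
  simp only [Function.comp_apply, consPerm_zero, consPerm_succ]
  rfl

theorem pbw_succ {n : ℕ} (e : Fin (n + 1) → ℤ) (y : Fin (n + 1) → g) [CharZero k] :
    pbw L e y = ((n + 1 : ℕ) : k)⁻¹ • ∑ j, (∏ l, if l < j then ksign k (e l * e j) else 1) •
      (ι L (y j) * pbw L (e ∘ j.succAbove) (y ∘ j.succAbove)) := by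
  simp only [pbw, mul_smul_comm]
  rw [sum_perm_succ, Nat.factorial_succ, Nat.cast_mul, mul_inv, mul_smul, Finset.smul_sum]
  congr 1
  exact Finset.sum_congr rfl fun j _ => smul_comm _ _ _

theorem pbw_zero (e : Fin 0 → ℤ) (y : Fin 0 → g) : pbw L e y = 1 := by
  simp [pbw, permSign, mono_zero]

/-- Left multiplication by a generator on the quotients of the filtration by length. -/
theorem mkQ_ι_mul {n : ℕ} (y : g) {A B : Env L} (h : (filtLT L n).mkQ A = (filtLT L n).mkQ B) :
    (filtLT L (n + 1)).mkQ (ι L y * A) = (filtLT L (n + 1)).mkQ (ι L y * B) :=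
  congrArg (Submodule.mapQ _ (filtLT L (n + 1)) (lmul y) fun _ hz => ι_mul_mem_filtLT y hz) h

theorem mkQ_mono_swap {n : ℕ} : ∀ {e : Fin (n + 1) → ℤ} {y : Fin (n + 1) → g},
    (∀ i, y i ∈ L.gr (e i)) → ∀ j, (filtLT L (n + 1)).mkQ (mono L y) =
      (filtLT L (n + 1)).mkQ ((∏ l, if l < j then ksign k (e l * e j) else 1) •
        (ι L (y j) * mono L (y ∘ j.succAbove))) := by
  induction n with
  | zero =>
    intro e y hy j
    obtain rfl : j = 0 := Fin.eq_zero j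
    rw [mono_succ]
    simp
    rfl
  | succ n ih =>
    intro e y hy j
    induction j using Fin.cases with
    | zero =>
      rw [mono_succ]
      simp
      rfl
    | succ j =>
      have h1 := mkQ_ι_mul (y 0) (ih (e := fun i => e i.succ) (y := fun i => y i.succ)
        (fun i => hy i.succ) j)
      have h2 : ι L (L.brk (y 0) (y j.succ)) * mono L ((fun i => y i.succ) ∘ j.succAbove) ∈
        filtLT L (n + 1 + 1) := words_le_filtLT (by omega) (ι_mul_mem_words _ (mono_mem_words _))
      have h3 := (Submodule.Quotient.mk_eq_zero _).2 h2
      have hp : (∏ l, if l < j.succ then ksign k (e l * e j.succ) else 1) =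
          ksign k (e 0 * e j.succ) *
            ∏ l : Fin (n + 1), if l < j then ksign k (e l.succ * e j.succ) else 1 := by
        rw [Fin.prod_univ_succ]
        simp only [Fin.succ_lt_succ_iff, Fin.succ_pos, if_true]
      rw [mono_succ, h1, hp, mul_smul_comm, ← mul_assoc, ι_mul_ι L (hy 0) (hy j.succ), add_mul,
        smul_add, map_add, map_smul _ _ (ι L (L.brk (y 0) (y j.succ)) * _),
        show (filtLT L (n + 1 + 1)).mkQ _ = _ from h3, smul_zero, add_zero, smul_mul_assoc, smul_smul, mul_comm (ksign k _), mul_assoc,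
        mono_succ (y ∘ j.succ.succAbove)]
      simp only [Function.comp_def, Fin.succ_succAbove_zero, Fin.succ_succAbove_succ]

/-- The symmetrization of a word has that word as its leading term. -/
theorem mkQ_pbw [CharZero k] {n : ℕ} : ∀ {e : Fin n → ℤ} {y : Fin n → g},
    (∀ i, y i ∈ L.gr (e i)) → (filtLT L n).mkQ (pbw L e y) = (filtLT L n).mkQ (mono L y) := by
  induction n with
  | zero => intro e y _; rw [pbw_zero, mono_zero]
  | succ n ih =>
    intro e y hy
    have h1 : ∀ j, (filtLT L (n + 1)).mkQ ((∏ l, if l < j then ksign k (e l * e j) else 1) •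
        (ι L (y j) * pbw L (e ∘ j.succAbove) (y ∘ j.succAbove))) =
        (filtLT L (n + 1)).mkQ (mono L y) := fun j => by
      rw [mkQ_mono_swap hy j, map_smul, map_smul,
        mkQ_ι_mul (y j) (ih (e := e ∘ j.succAbove) (y := y ∘ j.succAbove) fun i => hy _)]
    rw [pbw_succ, map_smul, map_sum, Finset.sum_congr rfl fun j _ => h1 j, Finset.sum_const,
      Finset.card_univ, Fintype.card_fin, ← Nat.cast_smul_eq_nsmul k, smul_smul,
      inv_mul_cancel₀ (Nat.cast_ne_zero.2 n.succ_ne_zero), one_smul]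

end permSign

section sym
variable {k : Type u} [Field k] {M : Type v} [AddCommGroup M] [Module k M] {X : DiffMod k M}
  {g : Type w} [AddCommGroup g] [Module k g] {L : GLie k g}

theorem convExp_mono [CharZero k] (hX : X.IsComplex) (f : M →ₗ[k] g) {n : ℕ} :
    ∀ (m : ℕ) {e : Fin n → ℤ} {x : Fin n → M}, (∀ i, x i ∈ X.gr (e i)) →
    convExp L X.abelian.envCoalg (f ∘ₗ X.symProj) m (X.abelian.mono x) =
      if m = n then pbw L e (f ∘ x) else 0 := by
  have h0 : ∀ m, convExp L X.abelian.envCoalg (f ∘ₗ X.symProj) (m + 1) 1 = 0 :=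
    convExp_succ_one isCoaugmented_envCoalg (by
      rw [comp_apply]
      exact (congrArg f X.symProj_one).trans (map_zero f))
  induction n with
  | zero =>
    intro m e x hx
    rw [mono_zero]
    rcases m with _ | m
    · rw [convExp_zero_apply, if_pos rfl, pbw_zero,
        show X.abelian.envCoalg.counit 1 = 1 from envCounit_one, one_smul]
    · rw [h0, if_neg (Nat.succ_ne_zero m)]
  | succ n ih =>
    intro m e x hx
    rcases m with _ | m
    · have : X.abelian.envCoalg.counit (X.abelian.mono x) = 0 := by
        rw [mono_succ]; exact envCounit_ι_mul _ _
      rw [convExp_zero_apply, this, zero_smul, if_neg (Nat.succ_ne_zero n).symm]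
    · rw [convExp_succ_eq_convSym, LinearMap.smul_apply, convSym_mono X hX f _ e x hx]
      simp only [ih m (e := _ ∘ Fin.succAbove _) (x := _ ∘ Fin.succAbove _) fun i => hx _,
        Nat.succ_inj]
      split_ifs with h
      · rw [pbw_succ, h]
        rfl
      · simp

theorem IsConvExp.mono [CharZero k] (hX : X.IsComplex) {f : M →ₗ[k] g} {E : X.Sym →ₗ[k] Env L}
    (h : IsConvExp L X.abelian.envCoalg (f ∘ₗ X.symProj) E) {n : ℕ} {e : Fin n → ℤ}
    {x : Fin n → M} (hx : ∀ i, x i ∈ X.gr (e i)) : E (X.abelian.mono x) = pbw L e (f ∘ x) := by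
  obtain ⟨m, hm⟩ := h (X.abelian.mono x)
  rw [hm _ (le_max_left m (n + 1)),
    Finset.sum_congr rfl fun i _ => convExp_mono hX f i hx, Finset.sum_ite_eq', if_pos]
  exact Finset.mem_range.2 (lt_max_of_lt_right (Nat.lt_succ_self n))

variable (X) in
/-- Relations between the values of `mono` in two enveloping algebras can be tested on
homogeneous elements. -/
theorem mono_pair_mem (f : M →ₗ[k] g) {n : ℕ} : ∀ (U : Submodule k (X.Sym × Env L)),
    (∀ (e : Fin n → ℤ) x, (∀ i, x i ∈ X.gr (e i)) → (X.abelian.mono x, mono L (f ∘ x)) ∈ U) →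
    ∀ x : Fin n → M, (X.abelian.mono x, mono L (f ∘ x)) ∈ U := by
  induction n with
  | zero => exact fun U h x => h Fin.elim0 x fun i => i.elim0
  | succ n ih =>
    intro U h x
    rw [mono_succ, mono_succ]
    change (X.abelian.ι (x 0) * _, ι L (f (x 0)) * _) ∈ U
    generalize x 0 = y
    induction y using X.induction with
    | hom i y hy =>
      refine ih (U.comap ((lmul (L := X.abelian) y).prodMap (lmul (L := L) (f y))))
        (fun e x hx => ?_) fun i => x i.succ
      have := h (Fin.cons i e) (Fin.cons y x) fun j => by
        induction j using Fin.cases with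
        | zero => exact hy
        | succ j => exact hx j
      rw [mono_succ, mono_succ] at this
      exact this
    | add y y' h1 h2 =>
      have := U.add_mem h1 h2
      rw [Prod.mk_add_mk] at this
      rwa [map_add, map_add, map_add, add_mul, add_mul]

theorem IsConvExp.mkQ_mono [CharZero k] (hX : X.IsComplex) {f : M →ₗ[k] g}
    (hf : f ∈ homDeg X L.toDiffMod 0) {E : X.Sym →ₗ[k] Env L}
    (h : IsConvExp L X.abelian.envCoalg (f ∘ₗ X.symProj) E) {n : ℕ} (x : Fin n → M) :
    (filtLT L n).mkQ (E (X.abelian.mono x)) = (filtLT L n).mkQ (GLie.mono L (f ∘ x)) := by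
  refine mono_pair_mem X f (LinearMap.eqLocus ((filtLT L n).mkQ ∘ₗ E ∘ₗ LinearMap.fst k _ _)
    ((filtLT L n).mkQ ∘ₗ LinearMap.snd k _ _)) (fun e x hx => ?_) x
  rw [LinearMap.mem_eqLocus]
  refine (congrArg _ (h.mono hX hx)).trans (mkQ_pbw fun i => ?_)
  have := hf (e i) (x i) (hx i)
  rwa [add_zero] at this

/-- The leading term of a convolution exponential. -/
theorem IsConvExp.mkQ_words {g' : Type*} [AddCommGroup g'] [Module k g'] {L' : GLie k g'}
    {φ : Env L →ₗ[k] g'} (h1 : φ 1 = 0) {E : Env L →ₗ[k] Env L'}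
    (h : IsConvExp L' L.envCoalg φ E) {n : ℕ} {z : Env L} (hz : z ∈ words L n) :
    (filtLT L' n).mkQ (E z) = (filtLT L' n).mkQ (convExp L' L.envCoalg φ n z) := by
  obtain ⟨m, hm⟩ := h z
  rw [hm _ (le_max_left m (n + 1)), map_sum, Finset.sum_eq_single n]
  · intro i _ hi
    rcases Nat.lt_or_gt_of_ne hi with hi | hi
    · exact (Submodule.Quotient.mk_eq_zero _).2 (words_le_filtLT hi (convExp_mem_words i z))
    · rw [convExp_words_eq_zero h1 hz hi, map_zero]
  · intro h
    exact absurd (Finset.mem_range.2 (lt_max_of_lt_right (Nat.lt_succ_self n))) h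

end sym
end GLie

section filtration
variable {k : Type u} [Field k] {M : Type v} [AddCommGroup M] [Module k M]
  {N : Type w} [AddCommGroup N] [Module k N] {F : ℕ → Submodule k N}

theorem surjective_of_mkQ (h0 : F 0 = ⊥) (hF : ∀ z, ∃ n, z ∈ F n) (f : M →ₗ[k] N)
    (h : ∀ n, ∀ z ∈ F (n + 1), ∃ y, (F n).mkQ (f y) = (F n).mkQ z) : Function.Surjective f := by
  intro z
  obtain ⟨n, hn⟩ := hF z
  induction n generalizing z with
  | zero =>
    rw [h0, Submodule.mem_bot] at hn
    exact ⟨0, by rw [map_zero, hn]⟩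
  | succ n ih =>
    obtain ⟨y, hy⟩ := h n z hn
    obtain ⟨y', hy'⟩ := ih (f y - z) ((Submodule.Quotient.eq _).1 hy)
    exact ⟨y - y', by rw [map_sub, hy', sub_sub_cancel]⟩

/-- A unipotent endomorphism is bijective, and its inverse is unipotent. -/
theorem bijective_of_mkQ (h0 : F 0 = ⊥) (hm : Monotone F) (hF : ∀ z, ∃ n, z ∈ F n) (f : N →ₗ[k] N)
    (h : ∀ n, ∀ z ∈ F (n + 1), (F n).mkQ (f z) = (F n).mkQ z) : Function.Bijective f ∧
      ∀ n z, f z ∈ F (n + 1) → (F n).mkQ (f z) = (F n).mkQ z := by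
  have h2 : ∀ n z, f z ∈ F n → z ∈ F n := by
    have key : ∀ m z n, z ∈ F (n + m) → f z ∈ F n → z ∈ F n := by
      intro m
      induction m with
      | zero => exact fun z n hz _ => hz
      | succ m ih =>
        intro z n hz hn
        refine ih z n ?_ hn
        have := (Submodule.Quotient.eq _).1 (h (n + m) z hz)
        rw [← neg_mem_iff, neg_sub] at this
        rw [← sub_add_cancel z (f z)]
        exact Submodule.add_mem _ this (hm (Nat.le_add_right n m) hn)
    intro n z hn
    obtain ⟨m, hz⟩ := hF z
    exact key m z n (hm (Nat.le_add_left m n) hz) hn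
  refine ⟨⟨(injective_iff_map_eq_zero f).2 fun z hz => ?_,
    surjective_of_mkQ h0 hF f fun n z hz => ⟨z, h n z hz⟩⟩, fun n z hz => h n z (h2 _ z hz)⟩
  have := h2 0 z (by rw [hz]; exact Submodule.zero_mem _)
  rwa [h0, Submodule.mem_bot] at this

end filtration

section transport
variable {k : Type u} [Field k] {A : Type v} [AddCommGroup A] [Module k A] {B : Type w}
  [AddCommGroup B] [Module k B] {a : DCoalgData k A} {b : DCoalgData k B}

theorem DCoalgData.IsHom.symm {e : A ≃ₗ[k] B} (he : IsHom a b e.toLinearMap) :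
    IsHom b a e.symm.toLinearMap := by
  have h1 : ∀ x, e.symm.toLinearMap (e x) = x := e.symm_apply_apply
  have key : ∀ {f : A →ₗ[k] A ⊗[k] A} {g : B →ₗ[k] B ⊗[k] B}, g ∘ₗ e.toLinearMap =
      TensorProduct.map e.toLinearMap e.toLinearMap ∘ₗ f →
      f ∘ₗ e.symm.toLinearMap =
        TensorProduct.map e.symm.toLinearMap e.symm.toLinearMap ∘ₗ g := fun {f g} h =>
    LinearMap.ext fun y => by
      obtain ⟨x, rfl⟩ := e.surjective y
      have := LinearMap.congr_fun h x
      rw [comp_apply, LinearEquiv.coe_coe] at this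
      rw [comp_apply, comp_apply, h1, this, comp_apply,
        map_map, LinearEquiv.symm_comp, map_id, id_apply]
  refine ⟨⟨fun i y hy => ?_, key he.comul, key he.cobr, LinearMap.ext fun y => ?_⟩,
    LinearMap.ext fun y => e.injective ?_⟩
  · rw [add_zero]
    refine mem_of_map_mem he.deg e.injective ?_
    rwa [LinearEquiv.coe_coe, LinearEquiv.coe_coe, e.apply_symm_apply]
  · have := LinearMap.congr_fun he.counit (e.symm y)
    simpa using this.symm
  · have := LinearMap.congr_fun he.diff (e.symm y)
    simpa using this.symm

/-- The product of a bialgebra, transported to an isomorphic coalgebra. -/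
def DCoalgData.bialg (b : DCoalgData k B) (a : BialgData k A) (e : A ≃ₗ[k] B) : BialgData k B where
  toDiffMod := b.toDiffMod
  mul := e.toLinearMap ∘ₗ a.mul ∘ₗ TensorProduct.map e.symm.toLinearMap e.symm.toLinearMap
  one := b.one
  comul := b.comul
  counit := b.counit

theorem GLie.isCocommHopf_bialg {g : Type v} [AddCommGroup g] [Module k g] {L : GLie k g}
    (hL : L.IsComplex) {d : ℤ} (hb : b.IsDCoalgebra d) (h1 : b.IsCoaugmented)
    {e : L.Env ≃ₗ[k] B} (he : IsHom L.envCoalg b e.toLinearMap) (e1 : e 1 = b.one) :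
    (b.bialg L.envBialg e).IsCocommHopf ∧
      (b.bialg L.envBialg e).IsBialgHom L.envBialg e.symm.toLinearMap := by
  have hU := isCocommHopf_envBialg hL
  have hm : IsHom (b.tensor d b) b (b.bialg L.envBialg e).mul :=
    he.comp ((isHom_envMul hL d).comp (he.symm.tensorMap he.symm))
  have hmul : ∀ x y, (b.bialg L.envBialg e).mul (x ⊗ₜ y) =
    e (L.envBialg.mul (e.symm x ⊗ₜ e.symm y)) := fun x y => rfl
  have e1' : e.symm b.one = 1 := by rw [← e1, e.symm_apply_apply]
  have hs := he.symm
  refine ⟨{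
    isComplex := hb.isComplex
    mul_mem := fun {i j x y} hx hy => by
      have := hm.deg (i + j) _ (tmul_mem_tensorGr _ _ hx hy rfl)
      rwa [add_zero] at this
    mul_assoc := fun x y z => by
      rw [hmul, hmul, hmul, hmul, e.symm_apply_apply, e.symm_apply_apply, hU.mul_assoc]
    one_mem := h1.one_mem
    one_mul := fun x => by
      rw [hmul]
      change e (L.envBialg.mul (e.symm b.one ⊗ₜ _)) = x
      rw [e1']
      exact (congrArg e (hU.one_mul _)).trans (e.apply_symm_apply x)
    mul_one := fun x => by
      rw [hmul]
      change e (L.envBialg.mul (_ ⊗ₜ e.symm b.one)) = x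
      rw [e1']
      exact (congrArg e (hU.mul_one _)).trans (e.apply_symm_apply x)
    diff_mul := hm.diff
    comul_mem := hb.comul_mem
    coassoc := hb.coassoc
    cocomm := hb.cocomm
    counit_deg := hb.counit_deg
    counit_comul := hb.counit_comul
    comul_diff := hb.diff_coder.comul
    counit_diff := LinearMap.ext fun y => ?_
    comul_mul := hm.comul
    comul_one := h1.comul_one
    counit_mul := fun x y => LinearMap.congr_fun hm.counit (x ⊗ₜ y)
    counit_one := h1.counit_one
    antipode := ?_ }, ⟨⟨⟨hs.deg, hs.comul, hs.counit, e1'⟩, hs.diff⟩, ?_⟩⟩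
  · have h2 := LinearMap.congr_fun he.counit (L.envBialg.diff (e.symm y))
    have h3 := LinearMap.congr_fun he.diff (e.symm y)
    have h4 := LinearMap.congr_fun hU.counit_diff (e.symm y)
    rw [comp_apply, comp_apply, LinearEquiv.coe_coe, e.apply_symm_apply] at h3
    rw [comp_apply]
    exact (congrArg b.counit h3).trans (h2.trans h4)
  · obtain ⟨S, hS, S1, S2⟩ := hU.antipode
    have hc : ∀ x, b.comul x = TensorProduct.map e.toLinearMap e.toLinearMap
        (L.envBialg.comul (e.symm x)) := fun x => by
      have := LinearMap.congr_fun he.comul (e.symm x)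
      rw [comp_apply, LinearEquiv.coe_coe, e.apply_symm_apply] at this
      exact this
    have hr : ∀ x, e (L.envBialg.counit (e.symm x) • L.envBialg.one) = b.counit x • b.one :=
      fun x => by
        rw [map_smul, show e L.envBialg.one = b.one from e1]
        exact congrArg (· • b.one) (LinearMap.congr_fun hs.counit x)
    have key : ∀ {P Q P' Q'}, P' ∘ₗ e.toLinearMap = e.toLinearMap ∘ₗ P →
        Q' ∘ₗ e.toLinearMap = e.toLinearMap ∘ₗ Q → ∀ x, (b.bialg L.envBialg e).mul
          (TensorProduct.map P' Q' (b.comul x)) =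
        e (L.envBialg.mul (TensorProduct.map P Q (L.envBialg.comul (e.symm x)))) :=
      fun {P Q P' Q'} hP hQ x => by
        change e (L.envBialg.mul (TensorProduct.map e.symm.toLinearMap e.symm.toLinearMap
          (TensorProduct.map P' Q' (b.comul x)))) = _
        rw [hc, map_map, map_map, comp_assoc,
          comp_assoc, hP, hQ, ← comp_assoc, ← comp_assoc,
          LinearEquiv.symm_comp, id_comp, id_comp]
    have hS' : (e.toLinearMap ∘ₗ S ∘ₗ e.symm.toLinearMap) ∘ₗ e.toLinearMap =
        e.toLinearMap ∘ₗ S := by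
      rw [comp_assoc, comp_assoc, LinearEquiv.symm_comp, comp_id]
    exact ⟨_, zero_homDeg_comp he.deg (homDeg_comp_zero hS hs.deg),
      fun x => (key hS' rfl x).trans ((congrArg e (S1 (e.symm x))).trans (hr x)),
      fun x => (key rfl hS' x).trans ((congrArg e (S2 (e.symm x))).trans (hr x))⟩
  · exact LinearMap.ext fun z => e.symm_apply_apply _

end transport

namespace GLie
section sym
variable {k : Type u} [Field k] [CharZero k] {M : Type v} [AddCommGroup M] [Module k M]
  {X : DiffMod k M} {g : Type w} [AddCommGroup g] [Module k g] {L : GLie k g} {f : M →ₗ[k] g}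
  {E : X.Sym →ₗ[k] Env L}

theorem IsConvExp.apply_ι (hX : X.IsComplex) (h : IsConvExp L X.abelian.envCoalg (f ∘ₗ X.symProj) E)
    (x : M) : E (X.abelian.ι x) = ι L (f x) := by
  induction x using X.induction with
  | hom i x hx =>
    have := h.mono hX (e := fun _ : Fin 1 => i) (x := fun _ => x) fun _ => hx
    rw [mono_succ, mono_zero, mul_one] at this
    rw [this, pbw_succ, Fin.sum_univ_one, pbw_zero, mul_one]
    simp
  | add x y h1 h2 => simp only [map_add, h1, h2]

omit [CharZero k] in
theorem filtLT_zero : filtLT L 0 = ⊥ := by simp [filtLT]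

theorem IsConvExp.mem_filtLT (hX : X.IsComplex) (hf : f ∈ homDeg X L.toDiffMod 0)
    (h : IsConvExp L X.abelian.envCoalg (f ∘ₗ X.symProj) E) {n : ℕ} :
    filtLT X.abelian n ≤ (filtLT L n).comap E := by
  refine filtLT_le fun m hm => Submodule.span_le.2 ?_
  rintro _ ⟨x, rfl⟩
  have h1 := (Submodule.Quotient.eq _).1 (h.mkQ_mono hX hf x)
  have h2 := Submodule.add_mem _ (filtLT_mono hm.le h1)
    (words_le_filtLT hm (mono_mem_words (L := L) (f ∘ x)))
  rwa [sub_add_cancel] at h2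

/-- If `f` is surjective then so is the induced map from the symmetric algebra. -/
theorem IsConvExp.surjective (hX : X.IsComplex) (hf : f ∈ homDeg X L.toDiffMod 0)
    (h : IsConvExp L X.abelian.envCoalg (f ∘ₗ X.symProj) E) (hs : Function.Surjective f) :
    Function.Surjective E := by
  refine surjective_of_mkQ filtLT_zero exists_mem_words E fun n z hz => ?_
  have : filtLT L (n + 1) ≤ (LinearMap.range ((filtLT L n).mkQ ∘ₗ E)).comap (filtLT L n).mkQ := by
    refine filtLT_le fun m hm => Submodule.span_le.2 ?_
    rintro _ ⟨y, rfl⟩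
    obtain ⟨x, rfl⟩ := hs.comp_left y
    rcases Nat.lt_succ_iff_lt_or_eq.1 hm with hm | rfl
    · refine ⟨0, (map_zero _).trans ((Submodule.Quotient.mk_eq_zero _).2 ?_).symm⟩
      exact words_le_filtLT hm (mono_mem_words _)
    · exact ⟨_, h.mkQ_mono hX hf x⟩
  exact this hz

/-- A morphism of symmetric coalgebras which fixes the generators is unipotent. -/
theorem IsConvExp.unipotent (hX : X.IsComplex) {T : X.Sym →ₗ[k] X.Sym} {φ : X.Sym →ₗ[k] M}
    (h : IsConvExp X.abelian X.abelian.envCoalg φ T) (h1 : φ 1 = 0)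
    (hφ : ∀ x, φ (X.abelian.ι x) = x) : (∀ x, T (X.abelian.ι x) = X.abelian.ι x) ∧
      Function.Bijective T ∧ ∀ n z, T z ∈ filtLT X.abelian (n + 1) →
        (filtLT X.abelian n).mkQ (T z) = (filtLT X.abelian n).mkQ z := by
  have hid := isConvExp_id hX
  have hφ' : ∀ x, φ (X.abelian.ι x) = X.symProj (X.abelian.ι x) := fun x => by
    rw [hφ, symProj_ι]
  refine ⟨fun x => ?_, bijective_of_mkQ filtLT_zero filtLT_mono exists_mem_words T
    fun n z hz => ?_⟩
  · have hx : X.abelian.ι x ∈ words X.abelian 1 := by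
      have := mono_mem_words (L := X.abelian) fun _ : Fin 1 => x
      rwa [mono_succ, mono_zero, mul_one] at this
    obtain ⟨⟨m, hm⟩, ⟨n, hn⟩⟩ := And.intro (h (X.abelian.ι x)) (hid (X.abelian.ι x))
    rw [hm _ (le_max_left m n)]
    refine (Finset.sum_congr rfl fun i _ => ?_).trans (hn _ (le_max_right m n)).symm
    rcases i with _ | _ | i
    · rfl
    · exact convExp_words_congr h1 X.symProj_one hφ' hx
    · rw [convExp_words_eq_zero h1 hx (by omega), convExp_words_eq_zero X.symProj_one hx (by omega)]
  · have : filtLT X.abelian (n + 1) ≤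
        LinearMap.eqLocus ((filtLT X.abelian n).mkQ ∘ₗ T) (filtLT X.abelian n).mkQ := by
      refine filtLT_le fun m hm z hz => ?_
      have e : (filtLT X.abelian m).mkQ (T z) = (filtLT X.abelian m).mkQ z :=
        (h.mkQ_words h1 hz).trans (((congrArg _ (convExp_words_congr h1 X.symProj_one hφ' hz))).trans
          (hid.mkQ_words X.symProj_one hz).symm)
      exact (Submodule.Quotient.eq _).2 (filtLT_mono (Nat.lt_succ_iff.1 hm)
        ((Submodule.Quotient.eq _).1 e))
    exact this hz

end sym
end GLie

section
variable {k : Type u} [Field k] {d : ℤ} {V : Type u} [AddCommGroup V] [Module k V]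
  {A : DAlgebra k d V} {W : Type u} [AddCommGroup W] [Module k W] {c : DCoalgData k W}
  {p : W →ₗ[k] V} {H : Type u} [AddCommGroup H] [Module k H] {h : DCoalgData k H}
  {μ : W ⊗[k] H →ₗ[k] W} {m : H ⊗[k] H →ₗ[k] H} {q : H →ₗ[k] HomSpace A c} {hW : IsBar A c p}

theorem IsBar.IsHomCofree.corestrict_envHom (hq : hW.IsHomCofree h q μ)
    {Ψ : hW.lie.Env →ₗ[k] H} (hΨ : IsHom hW.lie.envCoalg h Ψ)
    (hΨμ : ∀ (n i : ℤ) (D : W →ₗ[k] W) (hD : D ∈ coder d c n), ∀ w ∈ c.gr i,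
        μ (w ⊗ₜ Ψ (hW.lie.ι (coderEl n hD))) = -(ksign k (n * i) • D w)) (x : HomSpace A c) :
    q (Ψ (hW.lie.ι (hW.theta x))) = x := by
  have hι : hW.lie.ι ∈ homDeg hW.lie.toDiffMod hW.lie.envBialg.toDiffMod 0 := fun i x hx => by
    rw [add_zero]; exact GLie.ι_mem _ hx
  refine LinearMap.congr_fun (hW.homEv_ext (s := hW.twisted) (n := 0)
    (g := q ∘ₗ Ψ ∘ₗ hW.lie.ι ∘ₗ hW.theta.toLinearMap) (g' := LinearMap.id)
    (homDeg_comp_zero hq.isCofree.deg (homDeg_comp_zero hΨ.deg (homDeg_comp_zero hι hW.theta_mem)))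
    (fun i x hx => by rwa [add_zero]) fun x => ?_) x
  induction x using homSpace_induction with
  | el n f hf =>
    obtain ⟨D, hD, hθ, hpD⟩ := hW.theta_homEl hf
    refine c.hom_ext fun i w hw => ?_
    have h0 : h.counit (Ψ (hW.lie.ι (coderEl n hD))) = 0 := by
      have := LinearMap.congr_fun hΨ.counit (hW.lie.ι (coderEl n hD))
      have h2 := GLie.envCounit_ι_mul (L := hW.lie) (coderEl n hD) 1
      rw [mul_one] at h2
      exact this.trans h2
    have h1 := LinearMap.congr_fun hpD w
    rw [comp_apply] at h1
    simp only [comp_apply, LinearEquiv.coe_coe, id_apply]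
    rw [hθ, hq.homEv_eq, h0, hΨμ n i D hD w hw, map_neg, map_smul, h1, homEv_homEl,
      comp_apply, c.sgn_apply _ hw, map_smul]
    simp
  | add x y h1 h2 => simp only [map_add, h1, h2]

end

section core
variable {k : Type u} [Field k] [CharZero k] {d : ℤ} {V : Type u} [AddCommGroup V] [Module k V]
  {A : DAlgebra k d V} {W : Type u} [AddCommGroup W] [Module k W] {c : DCoalgData k W}
  {p : W →ₗ[k] V} {H : Type u} [AddCommGroup H] [Module k H] {h : DCoalgData k H}
  {μ : W ⊗[k] H →ₗ[k] W} {m : H ⊗[k] H →ₗ[k] H} {q : H →ₗ[k] HomSpace A c} {hW : IsBar A c p}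

omit [CharZero k] in
theorem IsCoproartinian.restrict_coreC (hh : h.IsDCoalgebra d) (hH : h.IsCoproartinian)
    (h1 : h.one ∈ coreC h) : (h.restrict isSubcoalgebra_coreC h1).IsCoproartinian ∧
      (h.restrict isSubcoalgebra_coreC h1).cobr = 0 := by
  have hsub := h.isHom_subtype isSubcoalgebra_coreC h1
  refine ⟨(hH.isCoaugmented hh).isCoproartinian_of_injective (eq_top_iff.2 fun x _ =>
    (hH.exists_mem_corad hh x).elim fun n hn => Submodule.mem_iSup_of_mem n hn) hsub rfl
    (coreC h).subtype_injective (hh.restrict _ h1), LinearMap.ext fun x =>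
    map_injective (coreC h).subtype_injective (coreC h).subtype_injective ?_⟩
  have := LinearMap.congr_fun hsub.cobr x
  rw [LinearMap.zero_apply, map_zero, ← comp_apply, ← this]
  exact cobr_of_mem_coreC x.2

/-- The core of the coalgebra `Hom^Id` is the cofree cocommutative coalgebra. -/
theorem IsBar.IsHomCofree.exists_symEquiv (hq : hW.IsHomCofree h q μ) (hh : h.IsDCoalgebra d)
    (hH : h.IsCoproartinian) (h1 : h.one ∈ coreC h) : ∃ κ : hW.twisted.Sym ≃ₗ[k] coreC h,
      IsGradedHom hW.twisted.abelian.envCoalg (h.restrict isSubcoalgebra_coreC h1)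
        κ.toLinearMap ∧ (∀ z, q (κ z) = hW.twisted.symProj z) ∧
      GLie.IsConvExp hW.twisted.abelian (h.restrict isSubcoalgebra_coreC h1)
        (q ∘ₗ (coreC h).subtype) κ.symm.toLinearMap := by
  have hX := hW.twisted_isComplex
  have hS := (GLie.isCocommHopf_envBialg (L := hW.twisted.abelian) hX).isDCoalgebra d
  have hS' := GLie.isCoproartinian_envCoalg (L := hW.twisted.abelian) hX
  have hsub := h.isHom_subtype isSubcoalgebra_coreC h1
  have hC := hh.restrict isSubcoalgebra_coreC h1
  obtain ⟨hC', hC0⟩ := IsCoproartinian.restrict_coreC hh hH h1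
  have hqC := homDeg_comp_zero hq.isCofree.deg hsub.deg
  have q1 : (q ∘ₗ (coreC h).subtype) (h.restrict isSubcoalgebra_coreC h1).one = 0 :=
    hq.isCofree.one
  obtain ⟨g, ⟨hg, eg⟩, -⟩ := hq.isCofree.universal _ _ hS hS' _ hW.twisted.symProj_homDeg
    hW.twisted.symProj_one
  have hgC := hg.mem_coreC hh rfl
  let g' := g.codRestrict (coreC h) hgC
  have hg' : IsGradedHom _ _ g' := hg.codRestrict isSubcoalgebra_coreC h1 hgC
  obtain ⟨l, hl⟩ := GLie.exists_isConvExp (L := hW.twisted.abelian) hC hC' q1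
  have hl' := hl.isGradedHom hC hC' hC0 hqC q1
  have e1 : l ∘ₗ g' = LinearMap.id := by
    refine (hl.comp hg').unique ?_
    have : (q ∘ₗ (coreC h).subtype) ∘ₗ g' = hW.twisted.symProj := eg
    rw [this]
    exact isConvExp_id hX
  have e2 : g' ∘ₗ l = LinearMap.id := by
    obtain ⟨_, -, huniq⟩ := hq.isCofree.universal _ _ hC hC' _ hqC q1
    have := (huniq (g ∘ₗ l) ⟨hg.comp hl', ?_⟩).trans (huniq _ ⟨hsub.toIsGradedHom, rfl⟩).symm
    · exact LinearMap.ext fun x => Subtype.ext (LinearMap.congr_fun this x)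
    · rw [← comp_assoc, eg]
      exact hl.symProj_comp hC
  exact ⟨LinearEquiv.ofLinearMap g' l e2 e1, hg', LinearMap.congr_fun eg, hl⟩

omit [CharZero k] in
theorem IsBar.IsHomCofree.apply_ι (hq : hW.IsHomCofree h q μ)
    {κ : hW.twisted.Sym →ₗ[k] H} (hε : ∀ z, h.counit (κ z) = hW.twisted.symBialg.counit z)
    (hqκ : ∀ z, q (κ z) = hW.twisted.symProj z) {n i : ℤ} {f : W →ₗ[k] V}
    (hf : f ∈ homDeg c.toDiffMod (A.shift d) n) {w : W} (hw : w ∈ c.gr i) :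
    p (μ (w ⊗ₜ κ (hW.twisted.abelian.ι (homEl n hf)))) = ksign k (n * i) • f w := by
  have h3 := GLie.envCounit_ι_mul (L := hW.twisted.abelian) (homEl n hf) 1
  rw [mul_one] at h3
  rw [hq.comp, hε, h3, zero_smul, zero_add, hqκ,
    DiffMod.symProj_ι, homEv_homEl, comp_apply, c.sgn_apply _ hw, map_smul]

omit [CharZero k] in
theorem IsBar.IsHomCofree.apply_ι_mul_ι_mul (hq : hW.IsHomCofree h q μ)
    {κ : hW.twisted.Sym →ₗ[k] H} (hε : ∀ z, h.counit (κ z) = hW.twisted.symBialg.counit z)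
    (hqκ : ∀ z, q (κ z) = hW.twisted.symProj z) (x y : HomSpace A c) (z : hW.twisted.Sym)
    (w : W) : p (μ (w ⊗ₜ κ (hW.twisted.abelian.ι x * (hW.twisted.abelian.ι y * z)))) = 0 := by
  have h3 : ∀ y z, hW.twisted.symBialg.counit (hW.twisted.abelian.ι y * z) = 0 :=
    GLie.envCounit_ι_mul
  rw [hq.comp, hε, h3, hqκ, DiffMod.symProj_ι_mul, h3,
    zero_smul, zero_smul, map_zero, LinearMap.zero_apply, add_zero]

/-- The symmetrization map of `a'[d]`, followed by the identification with `def(V)`. -/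
theorem IsBar.exists_symmetrization (hW : IsBar A c p) : ∃ E : hW.twisted.Sym →ₗ[k] hW.lie.Env,
    GLie.IsConvExp hW.lie hW.twisted.abelian.envCoalg (hW.theta.toLinearMap ∘ₗ hW.twisted.symProj)
      E ∧ IsHom hW.twisted.abelian.envCoalg hW.lie.envCoalg E := by
  have hX := hW.twisted_isComplex
  have hS := (GLie.isCocommHopf_envBialg (L := hW.twisted.abelian) hX).isDCoalgebra d
  have hS' := GLie.isCoproartinian_envCoalg (L := hW.twisted.abelian) hX
  have φ1 : (hW.theta.toLinearMap ∘ₗ hW.twisted.symProj) 1 = 0 := by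
    rw [comp_apply, DiffMod.symProj_one, map_zero]
  have φ0 := homDeg_comp_zero hW.theta_mem hW.twisted.symProj_homDeg
  obtain ⟨E, hE⟩ := GLie.exists_isConvExp (L := hW.lie) hS hS' φ1
  refine ⟨E, hE, hE.isGradedHom hS hS' rfl φ0 φ1, hE.diff hS φ0 ?_⟩
  have h3 : hW.lie.diff ∘ₗ hW.theta.toLinearMap = hW.theta.toLinearMap ∘ₗ hW.twisted.diff :=
    LinearMap.ext fun x => (hW.theta_diff x).symm
  rw [← comp_assoc, h3, comp_assoc, DiffMod.symProj_diff _ hX,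
    comp_assoc]
  rfl

theorem IsBar.bijective_envHom {h1 : h.one ∈ coreC h}
    (hC : (h.restrict isSubcoalgebra_coreC h1).IsDCoalgebra d)
    (hC' : (h.restrict isSubcoalgebra_coreC h1).IsCoproartinian)
    {κ : hW.twisted.Sym ≃ₗ[k] coreC h} (hl : GLie.IsConvExp hW.twisted.abelian
      (h.restrict isSubcoalgebra_coreC h1) (q ∘ₗ (coreC h).subtype) κ.symm.toLinearMap)
    (q1 : q h.one = 0) {Ψ : hW.lie.Env →ₗ[k] coreC h}
    (hΨ : IsGradedHom hW.lie.envCoalg (h.restrict isSubcoalgebra_coreC h1) Ψ)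
    (hΨq : ∀ x, q (Ψ (hW.lie.ι (hW.theta x))) = x) {E : hW.twisted.Sym →ₗ[k] hW.lie.Env}
    (hE : GLie.IsConvExp hW.lie hW.twisted.abelian.envCoalg
      (hW.theta.toLinearMap ∘ₗ hW.twisted.symProj) E)
    (hE' : IsGradedHom hW.twisted.abelian.envCoalg hW.lie.envCoalg E) :
    (Function.Bijective Ψ ∧ Function.Bijective E) ∧
      (∀ x, Ψ (hW.lie.ι (hW.theta x)) = κ (hW.twisted.abelian.ι x)) ∧
      ∀ (n : ℕ) (x : Fin n → HomSpace A c), ∃ z, Ψ z = κ (hW.twisted.abelian.mono x) ∧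
        (hW.lie.filtLT n).mkQ z = (hW.lie.filtLT n).mkQ (hW.lie.mono (hW.theta ∘ x)) := by
  have hX := hW.twisted_isComplex
  have hΨE := hΨ.comp hE'
  have hEι := hE.apply_ι hX
  obtain ⟨Tι, Tb, Tu⟩ := (hl.comp hΨE).unipotent hX
    (by
      have := hΨE.map_one (GLie.isCoaugmented_envCoalg (L := hW.twisted.abelian)) hC hC'
      rw [comp_apply]
      exact (congrArg _ this).trans q1) (fun x => (congrArg (fun z => q (Ψ z)) (hEι x)).trans (hΨq x))
  have Es := hE.surjective hX hW.theta_mem hW.theta.surjective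
  have Eb : Function.Bijective E :=
    ⟨fun y z hyz => Tb.1 (congrArg (fun t => κ.symm (Ψ t)) hyz), Es⟩
  have ΨE : Function.Bijective (Ψ ∘ E) := (Function.Bijective.of_comp_iff' κ.symm.bijective _).1 Tb
  refine ⟨⟨(Function.Bijective.of_comp_iff Ψ Eb).1 ΨE, Eb⟩, fun x => ?_, fun n x => ?_⟩
  · have := κ.symm_apply_eq.1 (Tι x)
    rw [← this]
    exact (congrArg Ψ (hEι x)).symm
  · obtain ⟨y, hy⟩ := Tb.2 (hW.twisted.abelian.mono x)
    have h2 := Tu n y (hy ▸ GLie.words_le_filtLT n.lt_succ_self (GLie.mono_mem_words x))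
    rw [hy] at h2
    exact ⟨E y, κ.symm_apply_eq.1 hy, (congrArg (Submodule.mapQ _ _ E
      (hE.mem_filtLT hX hW.theta_mem)) h2).symm.trans (hE.mkQ_mono hX hW.theta_mem x)⟩

end core

end DefHopf

end

theorem mainTheorem4 {k : Type u} [Field k] [CharZero k] {d : ℤ} {V : Type u} [AddCommGroup V]
    [Module k V] (A : DAlgebra k d V) :
    -- the coalgebra `V^∨` exists
    (∃ (W : Type u) (_ : AddCommGroup W) (_ : Module k W) (c : DCoalgData k W) (p : W →ₗ[k] V),
      IsBar A c p) ∧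
    ∀ (W : Type u) [AddCommGroup W] [Module k W] (c : DCoalgData k W) (p : W →ₗ[k] V)
      (hW : IsBar A c p),
    -- the coalgebra `Hom^Id(V, V)` exists
    (∃ (H : Type u) (_ : AddCommGroup H) (_ : Module k H) (h : DCoalgData k H)
      (μ : W ⊗[k] H →ₗ[k] W), IsHomId d c h μ) ∧
    ∀ (H : Type u) [AddCommGroup H] [Module k H] (h : DCoalgData k H) (μ : W ⊗[k] H →ₗ[k] W),
      IsHomId d c h μ →
    -- the composition product on it
    ∃ m : H ⊗[k] H →ₗ[k] H, IsComposition d h μ m ∧ (∀ m', IsComposition d h μ m' → m' = m) ∧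
    -- `C(Hom^Id(V, V))` is a cocommutative Hopf algebra
    ∃ C : BialgData k (coreC h), C.IsRestriction h m (coreC h) ∧ C.IsCocommHopf ∧
    -- it is canonically isomorphic to `U(def(V))`
    hW.lie.IsComplex ∧ hW.lie.envBialg.IsCocommHopf ∧
    ∃ Φ : coreC h ≃ₗ[k] hW.lie.Env,
      C.IsBialgHom hW.lie.envBialg Φ.toLinearMap ∧
      (∀ (n i : ℤ) (D : W →ₗ[k] W) (hD : D ∈ coder d c n), ∀ w ∈ c.gr i,
        μ (w ⊗ₜ (Φ.symm (hW.lie.ι (coderEl n hD)) : H)) =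
          -(ksign k (n * i) • D w)) ∧
    -- `a'[d]` is isomorphic to `def(V)` as a complex
    hW.twisted.IsComplex ∧
    ∃ θ : (HomSpace A c) ≃ₗ[k] CoderSpace d c,
      (∀ x, θ (hW.twisted.diff x) =
        hW.lie.diff (θ x)) ∧
      (∀ (n : ℤ) (f : W →ₗ[k] V) (hf : f ∈ DiffMod.homDeg c.toDiffMod (A.shift d) n),
        ∃ (D : W →ₗ[k] W) (hD : D ∈ coder d c n), θ (homEl n hf) = coderEl n hD ∧ p ∘ₗ D = -f) ∧
    -- the isomorphism of graded coalgebras `S(a'[d]) → C(Hom^Id(V, V))` given by cofreeness, whose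
    -- composite with `Φ` agrees with the PBW isomorphism up to products of fewer factors
    (∃ κ : hW.twisted.Sym ≃ₗ[k] coreC h,
      hW.twisted.symBialg.IsGradedCoalgHom C κ.toLinearMap ∧
      (∀ (n i : ℤ) (f : W →ₗ[k] V) (hf : f ∈ DiffMod.homDeg c.toDiffMod (A.shift d) n),
        ∀ w ∈ c.gr i, p (μ (w ⊗ₜ (κ (hW.twisted.abelian.ι
          (homEl n hf)) : H))) = ksign k (n * i) • f w) ∧
      (∀ (n : ℕ), 2 ≤ n → ∀ (x : Fin n → HomSpace A c) (w : W),
        p (μ (w ⊗ₜ (κ (hW.twisted.abelian.mono x) : H))) =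
          0) ∧
      (∀ x, Φ (κ (hW.twisted.abelian.ι x)) =
        hW.lie.ι (θ x)) ∧
      (∀ (n : ℕ) (x : Fin n → HomSpace A c),
        Φ (κ (hW.twisted.abelian.mono x)) -
          hW.lie.mono (θ ∘ x) ∈ hW.lie.filtLT n)) ∧
    -- an isomorphism of dg coalgebras `S(a'[d]) → C(Hom^Id(V, V))` whose composite with `Φ` is
    -- exactly the PBW isomorphism
    (∃ σ : hW.twisted.Sym ≃ₗ[k] coreC h,
      hW.twisted.symBialg.IsCoalgHom C σ.toLinearMap ∧
      (∀ (n : ℕ) (e : Fin n → ℤ)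
        (x : Fin n → HomSpace A c),
        (∀ i, x i ∈ hW.twisted.gr (e i)) →
        Φ (σ (hW.twisted.abelian.mono x)) =
          hW.lie.pbw e (θ ∘ x))) := by
  refine ⟨exists_isBar A, fun W _ _ c p hW => ⟨?_, fun H _ _ h μ hμ => ?_⟩⟩
  · obtain ⟨H, i1, i2, h, q, μ, hμ, -⟩ := hW.exists_isHomId
    exact ⟨H, i1, i2, h, μ, hμ⟩
  obtain ⟨m, hm, hm'⟩ := hμ.existsUnique_composition hW.isDCoalgebra
  obtain ⟨q, hq⟩ := hμ.isHomCofree hW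
  obtain ⟨Ψ, hΨ, hΨm, hΨμ⟩ := hμ.exists_envHom hW hm
  obtain ⟨E, hE, hE'⟩ := hW.exists_symmetrization
  have hh := hμ.isDCoalgebra
  have hH := hμ.isCoproartinian
  have hL := hW.lie_isComplex
  have hX := hW.twisted_isComplex
  have ha := hH.isCoaugmented hh
  have h1 : h.one ∈ coreC h := ha.one_mem_largestSub (K := LinearMap.ker h.cobr) ha.cobr_one
  have hsub := h.isHom_subtype isSubcoalgebra_coreC h1
  have hC := hh.restrict isSubcoalgebra_coreC h1
  obtain ⟨hC', -⟩ := IsCoproartinian.restrict_coreC hh hH h1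
  have hS1 := GLie.isCoaugmented_envCoalg (L := hW.twisted.abelian)
  obtain ⟨κ, hκ, hqκ, hl⟩ := hq.exists_symEquiv hh hH h1
  have hΨC := hΨ.toIsGradedHom.mem_coreC hh rfl
  have hΨ' : hW.lie.envCoalg.IsHom (h.restrict isSubcoalgebra_coreC h1)
      (Ψ.codRestrict (coreC h) hΨC) :=
    ⟨hΨ.toIsGradedHom.codRestrict isSubcoalgebra_coreC h1 hΨC,
      LinearMap.ext fun z => Subtype.ext (LinearMap.congr_fun hΨ.diff z)⟩
  obtain ⟨⟨Ψb, Eb⟩, hι, hmono⟩ := hW.bijective_envHom hC hC' hl hq.isCofree.one hΨ'.toIsGradedHom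
    (hq.corestrict_envHom hΨ hΨμ) hE hE'.toIsGradedHom
  let e : hW.lie.Env ≃ₗ[k] coreC h := LinearEquiv.ofBijective _ Ψb
  obtain ⟨hHopf, hΦ⟩ := GLie.isCocommHopf_bialg (e := e) hL hC (hC'.isCoaugmented hC) hΨ'
    (hΨ'.toIsGradedHom.map_one GLie.isCoaugmented_envCoalg hC hC')
  have hσ := hΨ'.comp hE'
  refine ⟨m, hm, hm', (h.restrict isSubcoalgebra_coreC h1).bialg hW.lie.envBialg e,
    ⟨fun _ => rfl, hsub.diff.symm, TensorProduct.ext' fun y z => ?_, rfl, hsub.comul.symm, rfl⟩,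
    hHopf, hL, GLie.isCocommHopf_envBialg hL, e.symm, hΦ,
    fun n i D hD w hw => hΨμ n i D hD w hw, hX, hW.theta, hW.theta_diff,
    fun n f hf => hW.theta_homEl hf,
    ⟨κ, ⟨hκ.deg, hκ.comul, hκ.counit, hκ.map_one hS1 hC hC'⟩,
      fun n i f hf w hw => hq.apply_ι (κ := (coreC h).subtype ∘ₗ κ.toLinearMap)
        (LinearMap.congr_fun hκ.counit) hqκ hf hw,
      fun n hn x w => ?_, fun x => e.symm_apply_eq.2 (hι x).symm, fun n x => ?_⟩,
    LinearEquiv.ofBijective E Eb ≪≫ₗ e,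
    ⟨⟨hσ.deg, hσ.comul, hσ.counit, hσ.toIsGradedHom.map_one hS1 hC hC'⟩, hσ.diff⟩,
    fun n s x hx => (e.symm_apply_apply _).trans (hE.mono hX hx)⟩
  · refine (LinearMap.congr_fun hΨm (e.symm y ⊗ₜ e.symm z)).trans ?_
    have h2 : ∀ y : coreC h, Ψ (e.symm y) = y := fun y =>
      congrArg Subtype.val (e.apply_symm_apply y)
    simp only [LinearMap.comp_apply, TensorProduct.map_tmul, h2, Submodule.subtype_apply]
  · obtain ⟨n, rfl⟩ := Nat.exists_eq_add_of_le' hn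
    rw [GLie.mono_succ, GLie.mono_succ]
    exact hq.apply_ι_mul_ι_mul (κ := (coreC h).subtype ∘ₗ κ.toLinearMap)
      (LinearMap.congr_fun hκ.counit) hqκ _ _ _ w
  · obtain ⟨z, hz, hz'⟩ := hmono n x
    rw [e.symm_apply_eq.2 hz.symm]
    exact (Submodule.Quotient.eq _).1 hz'
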